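/- **Fractalization.** A *divide & conquer problem* is given, for each $n$, by a set of valid instances $x$ (bit strings of length $\mathrm{poly}(n)$) and, for each instance, a function $f=f_x$ on the subsets of $[n]$ with values of $\mathrm{poly}(n)$ bits such that for all $S\subseteq[n]$ and all $1\le k<|S|$ $$f(S)=\min_{X\subset S,\ |X|=k} g\bigl(f(S\setminus X),f(X)\bigr);$$ the task is to compute $f(S)$ for a given $x$ and $S\subseteq[n]$, the size of the task being $m=|S|$ (for $S=[n]$ this solves the instance). A *permutation problem* is given in the same way by a function $f(L,M,R)=\min_{\pi}\mathrm{cost}(L,\pi,R)$ on the partitions $L\cup M\cup R=[n]$, the minimum being over the orderings $\pi$ of $M$, such that for all $1\le k<|M|$ $$f(L,M,R)=\min_{X\cup Y=M,\ X\cap Y=\varnothing,\ |X|=k} g\bigl(f(L,X,Y\cup R),f(L\cup X,Y,R)\bigr);$$ the task is to compute $f(L,M,R)$ for a given $x$ and partition, of size $m=|M|$ (for $M=[n]$ this solves the instance). In both cases $g$ may also depend on $x$ and on the parts, and it is computable in polynomial time, in the sense of uniform Boolean circuits of size $\mathrm{poly}(n)$; the polynomial bounds on the lengths of instances and values are computable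 functions of $n$. Algorithms are uniform families (computable from $(n,m)$) of quantum circuits over the gates $X,H,T,T^\dagger,\mathrm{CNOT}$, Toffoli, with a QRAM whose data items consist of $\mathrm{poly}(n)$ qubits and can be read and swapped with a work register in superposition; each gate and each QRAM operation takes unit time, space is the total number of qubits, and the output must be correct with probability at least $2/3$ on every valid input. For real $\mathcal T,\mathcal S\ge 1$, a problem has a *quantum $(\mathcal T,\mathcal S)$ time-space tradeoff* if such a family solves its tasks of size $m$, $1\le m\le n$, in time $\mathrm{poly}(n)\cdot\mathcal T^m$ and space $\mathrm{poly}(n)\cdot\mathcal S^m$. Let $\mathcal T,\mathcal S\ge1$ and suppose that a divide & conquer or permutation problem has a quantum $(\mathcal T,\mathcal S)$ tradeoff. Then: 1. it has a quantum $(\sqrt{2\mathcal T},\sqrt{\mathcal S})$ tradeoff, and hence, with $(\mathcal T_0,\mathcal S_0)=(\mathcal T,\mathcal S)$ and $(\mathcal T_{k+1},\mathcal S_{k+1})=(\sqrt{2\mathcal T_k},\sqrt{\mathcal S_k})$, a quantum $(\mathcal T_k,\mathcal S_k)$ tradeoff for every $k\ge0$; 2. if $\mathcal S>1$, or if $\mathcal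 S=1$ and $\mathcal T=2$, there is a real $c$ such that $\mathcal T_k=2/\mathcal S_k^{\,c}$ for all $k\ge0$. -/

import Mathlib

noncomputable section

namespace Fract

/-! Bit strings. -/

/-- The `w` low-order bits of `a`, least significant bit first. -/
def natBits (w a : ℕ) : List Bool := List.ofFn fun i : Fin w => a.testBit i

/-- The number with the given binary digits, least significant bit first. -/
def bitsVal (l : List Bool) : ℕ := Nat.ofDigits 2 (l.map Bool.toNat)

/-- The characteristic vector of a subset of the ground set `{0, …, n-1}`. -/
def setBits {n : ℕ} (S : Finset (Fin n)) : List Bool := List.ofFn fun i => decide (i ∈ S)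

/-- `p(n) = O(poly n)`. -/
def PolyBounded (p : ℕ → ℕ) : Prop := ∃ c : ℕ, ∀ n, p n ≤ c * (n + 1) ^ c

/-! Classical Boolean circuits, used for the polynomial-time computable functions. -/

/-- A Boolean circuit as a straight-line program of NAND gates. The wires are the input bits
followed by the gate outputs in order; a gate is the pair of wires it reads (a wire that does not
exist carries `false`), and `outs` lists the output wires. -/
structure BoolCircuit where
  gates : List (ℕ × ℕ)
  outs : List ℕ

def BoolCircuit.size (B : BoolCircuit) : ℕ := B.gates.length + B.outs.length

def BoolCircuit.code (B : BoolCircuit) : List (ℕ × ℕ) × List ℕ := (B.gates, B.outs)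

def BoolCircuit.wires (B : BoolCircuit) (input : List Bool) : List Bool :=
  B.gates.foldl (fun ws p => ws ++ [!(ws.getD p.1 false && ws.getD p.2 false)]) input

def BoolCircuit.eval (B : BoolCircuit) (input : List Bool) : List Bool :=
  B.outs.map fun i => (B.wires input).getD i false

/-- A uniform family of Boolean circuits of polynomial size. -/
def UniformPolySize (B : ℕ → BoolCircuit) : Prop :=
  Computable (fun n => (B n).code) ∧ PolyBounded (fun n => (B n).size)

/-! Quantum circuits with QRAM. -/

/-- The qubits: the work qubits, and the `j`-th qubit of the `i`-th data item of the QRAM. -/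
inductive Qubit where
  | work (q : ℕ)
  | cell (i j : ℕ)
  deriving DecidableEq

/-- Computational basis states. -/
abbrev BasisState := Qubit → Bool

/-- Finite superpositions of basis states. A circuit only touches finitely many qubits, the others
stay in the state `0`. -/
abbrev QState := BasisState →₀ ℂ

/-- Elementary operations. `not`, `had`, `phase`, `phaseInv`, `cnot`, `toffoli` are the gates
`X`, `H`, `T`, `T†`, `CNOT` and `CCNOT` on work qubits. `qread addr tgt` is the read-only QRAM
operation and `qswap addr tgt` the read-write one, with address register `addr` (least significant
qubit first) and target register `tgt`. -/
inductive Gate where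
  | not (q : ℕ)
  | had (q : ℕ)
  | phase (q : ℕ)
  | phaseInv (q : ℕ)
  | cnot (c t : ℕ)
  | toffoli (c₁ c₂ t : ℕ)
  | qread (addr tgt : List ℕ)
  | qswap (addr tgt : List ℕ)

/-- The index of the data item that the address register holds in the basis state `b`. -/
def address (b : BasisState) (addr : List ℕ) : ℕ := bitsVal (addr.map fun q => b (.work q))

/-- `|i⟩|y⟩|D⟩ ↦ |i⟩|y ⊕ D_i⟩|D⟩`. -/
def readBasis (addr tgt : List ℕ) (b : BasisState) : BasisState
  | .work q =>
      if q ∈ tgt then xor (b (.work q)) (b (.cell (address b addr) (tgt.idxOf q)))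
      else b (.work q)
  | .cell i j => b (.cell i j)

/-- `|i⟩|y⟩|D⟩ ↦ |i⟩|D_i⟩|D_1, …, D_{i-1}, y, D_{i+1}, …⟩`. -/
def swapBasis (addr tgt : List ℕ) (b : BasisState) : BasisState
  | .work q =>
      if q ∈ tgt then b (.cell (address b addr) (tgt.idxOf q)) else b (.work q)
  | .cell i j =>
      if i = address b addr ∧ j < tgt.length then b (.work (tgt.getD j 0)) else b (.cell i j)

/-- The image of a basis state under an elementary operation. -/
def Gate.onBasis : Gate → BasisState → QState
  | .not q, b => Finsupp.single (Function.update b (.work q) (!b (.work q))) 1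
  | .had q, b =>
      Finsupp.single (Function.update b (.work q) false) ((1 / Real.sqrt 2 : ℝ) : ℂ) +
      Finsupp.single (Function.update b (.work q) true)
        (if b (.work q) then -((1 / Real.sqrt 2 : ℝ) : ℂ) else ((1 / Real.sqrt 2 : ℝ) : ℂ))
  | .phase q, b =>
      Finsupp.single b (if b (.work q) then Complex.exp (Complex.I * (Real.pi / 4)) else 1)
  | .phaseInv q, b =>
      Finsupp.single b (if b (.work q) then Complex.exp (-(Complex.I * (Real.pi / 4))) else 1)
  | .cnot c t, b =>
      Finsupp.single (Function.update b (.work t) (xor (b (.work t)) (b (.work c)))) 1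
  | .toffoli c₁ c₂ t, b =>
      Finsupp.single
        (Function.update b (.work t) (xor (b (.work t)) (b (.work c₁) && b (.work c₂)))) 1
  | .qread addr tgt, b => Finsupp.single (readBasis addr tgt b) 1
  | .qswap addr tgt, b => Finsupp.single (swapBasis addr tgt b) 1

/-- The linear operator of an elementary operation. -/
def Gate.op (G : Gate) : QState →ₗ[ℂ] QState := Finsupp.linearCombination ℂ G.onBasis

/-- A description of an elementary operation by numbers. -/
def Gate.code : Gate → ℕ × List ℕ × List ℕ
  | .not q => (0, [q], [])
  | .had q => (1, [q], [])
  | .phase q => (2, [q], [])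
  | .phaseInv q => (3, [q], [])
  | .cnot c t => (4, [c, t], [])
  | .toffoli c₁ c₂ t => (5, [c₁, c₂, t], [])
  | .qread addr tgt => (6, addr, tgt)
  | .qswap addr tgt => (7, addr, tgt)

theorem Gate.code_injective : Function.Injective Gate.code := by
  intro a b h
  cases a <;> cases b <;> simp_all [Gate.code]

/-- A quantum circuit with `work` work qubits and a QRAM of `2 ^ addrWidth` data items of
`wordSize` qubits each. The work qubits `outs` are measured at the end. -/
structure QCircuit where
  work : ℕ
  addrWidth : ℕ
  wordSize : ℕ
  outs : List ℕ
  gates : List Gate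

/-- The work qubits used by an operation. -/
def Gate.qubits : Gate → List ℕ
  | .not q => [q]
  | .had q => [q]
  | .phase q => [q]
  | .phaseInv q => [q]
  | .cnot c t => [c, t]
  | .toffoli c₁ c₂ t => [c₁, c₂, t]
  | .qread addr tgt => addr ++ tgt
  | .qswap addr tgt => addr ++ tgt

/-- QRAM operations use a full address register and a target register of one word. -/
def Gate.RegistersFit (addrWidth wordSize : ℕ) : Gate → Prop
  | .qread addr tgt => addr.length = addrWidth ∧ tgt.length = wordSize
  | .qswap addr tgt => addr.length = addrWidth ∧ tgt.length = wordSize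
  | _ => True

/-- Every operation acts on pairwise distinct work qubits of the circuit. -/
def QCircuit.WellFormed (C : QCircuit) : Prop :=
  (∀ q ∈ C.outs, q < C.work) ∧ C.outs.Nodup ∧
  ∀ G ∈ C.gates,
    (∀ q ∈ G.qubits, q < C.work) ∧ G.qubits.Nodup ∧ G.RegistersFit C.addrWidth C.wordSize

/-- Time: every elementary gate and every QRAM operation takes unit time. -/
def QCircuit.time (C : QCircuit) : ℕ := C.gates.length

/-- Space: the total number of qubits, in the workspace and in the QRAM. -/
def QCircuit.space (C : QCircuit) : ℕ := C.work + 2 ^ C.addrWidth * C.wordSize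

def QCircuit.code (C : QCircuit) :
    ℕ × ℕ × ℕ × List ℕ × List (ℕ × List ℕ × List ℕ) :=
  (C.work, C.addrWidth, C.wordSize, C.outs, C.gates.map Gate.code)

/-- The input is written on the first work qubits, all other qubits are `0`. -/
def initial (input : List Bool) : BasisState
  | .work q => input.getD q false
  | .cell _ _ => false

/-- The state before the final measurement. -/
def QCircuit.finalState (C : QCircuit) (input : List Bool) : QState :=
  C.gates.foldl (fun ψ G => G.op ψ) (Finsupp.single (initial input) 1)

open Classical in
/-- The probability that measuring the output qubits gives the number `y` in binary. -/
def QCircuit.prob (C : QCircuit) (input : List Bool) (y : ℕ) : ℝ :=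
  (C.finalState input).sum fun b z =>
    if bitsVal (C.outs.map fun q => b (.work q)) = y then ‖z‖ ^ 2 else 0

/-- The circuit computes `y` on the given input with bounded error. -/
def QCircuit.Computes (C : QCircuit) (input : List Bool) (y : ℕ) : Prop :=
  input.length ≤ C.work ∧ 2 / 3 ≤ C.prob input y

/-- A computational task. `R n m input y` says that `input` encodes a subproblem of size `m` of an
instance of size `n`, and that `y` is its answer. -/
abbrev Task := ℕ → ℕ → List Bool → ℕ → Prop

/-- The task has a quantum `(T, S)` time-space tradeoff: a uniform family of quantum circuits with
QRAM solves subproblems of size `m` of instances of size `n` with bounded error in time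
`poly(n) * T ^ m` and space `poly(n) * S ^ m`, on data items of `poly(n)` qubits. -/
def HasTradeoff (R : Task) (T S : ℝ) : Prop :=
  ∃ C : ℕ → ℕ → QCircuit, Computable₂ (fun n m => (C n m).code) ∧
    ∃ c : ℕ, ∀ n m : ℕ, 1 ≤ m → m ≤ n →
      (C n m).WellFormed ∧
      (C n m).wordSize ≤ c * (n + 1) ^ c ∧
      ((C n m).time : ℝ) ≤ c * ((n : ℝ) + 1) ^ c * T ^ m ∧
      ((C n m).space : ℝ) ≤ c * ((n : ℝ) + 1) ^ c * S ^ m ∧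
      ∀ input y, R n m input y → (C n m).Computes input y

/-- A divide & conquer problem. An instance of size `n` is a bit string `x` of polynomial length
that satisfies `valid n`; `f n x S` is the value of the set `S`. The function `g`, which may also
look at the instance and at the two parts, is computed by uniform circuits of polynomial size. -/
structure DivideConquerProblem where
  inputLen : ℕ → ℕ
  width : ℕ → ℕ
  valid : ℕ → List Bool → Prop
  f : (n : ℕ) → List Bool → Finset (Fin n) → ℕ
  g : (n : ℕ) → List Bool → Finset (Fin n) → Finset (Fin n) → ℕ → ℕ → ℕ
  inputLen_computable : Computable inputLen
  inputLen_poly : PolyBounded inputLen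
  width_computable : Computable width
  width_poly : PolyBounded width
  length_eq : ∀ n x, valid n x → x.length = inputLen n
  f_lt : ∀ n x S, valid n x → f n x S < 2 ^ width n
  recurrence : ∀ n x (S : Finset (Fin n)) (k : ℕ), valid n x → 1 ≤ k → k < S.card →
    IsLeast {v | ∃ X ⊆ S, X.card = k ∧ v = g n x (S \ X) X (f n x (S \ X)) (f n x X)} (f n x S)
  g_poly : ∃ B : ℕ → BoolCircuit, UniformPolySize B ∧
    ∀ n x (Y X : Finset (Fin n)) (a b : ℕ), valid n x → Disjoint Y X →
      a < 2 ^ width n → b < 2 ^ width n →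
      bitsVal ((B n).eval
        (x ++ setBits Y ++ setBits X ++ natBits (width n) a ++ natBits (width n) b)) =
        g n x Y X a b

/-- Compute `f(S)` for a given set `S` of size `m`; for `S = [n]` this is the answer to the
instance. -/
def DivideConquerProblem.task (D : DivideConquerProblem) : Task := fun n m input y =>
  ∃ (x : List Bool) (S : Finset (Fin n)), D.valid n x ∧ S.card = m ∧
    input = x ++ setBits S ∧ y = D.f n x S

/-- `(L, M, R)` is a partition of the ground set (with possibly empty parts). -/
def IsPartition {n : ℕ} (L M R : Finset (Fin n)) : Prop :=
  Disjoint L M ∧ Disjoint L R ∧ Disjoint M R ∧ L ∪ M ∪ R = Finset.univ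

/-- A permutation problem. `f n x L M R` is the least value of `cost n x L π R` over the orderings
`π` of `M`, and it decomposes over the ways to split `M` into a first part `X` of a fixed size and
a second part `M \ X`. The function `g`, which may also look at the instance and at the parts, is
computed by uniform circuits of polynomial size. -/
structure PermutationProblem where
  inputLen : ℕ → ℕ
  width : ℕ → ℕ
  valid : ℕ → List Bool → Prop
  cost : (n : ℕ) → List Bool → Finset (Fin n) → List (Fin n) → Finset (Fin n) → ℕ
  f : (n : ℕ) → List Bool → Finset (Fin n) → Finset (Fin n) → Finset (Fin n) → ℕ
  g : (n : ℕ) → List Bool → Finset (Fin n) → Finset (Fin n) → Finset (Fin n) →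
    Finset (Fin n) → ℕ → ℕ → ℕ
  inputLen_computable : Computable inputLen
  inputLen_poly : PolyBounded inputLen
  width_computable : Computable width
  width_poly : PolyBounded width
  length_eq : ∀ n x, valid n x → x.length = inputLen n
  f_eq : ∀ n x (L M R : Finset (Fin n)), valid n x → IsPartition L M R →
    IsLeast {v | ∃ π : List (Fin n), π.Nodup ∧ π.toFinset = M ∧ v = cost n x L π R} (f n x L M R)
  f_lt : ∀ n x (L M R : Finset (Fin n)), valid n x → IsPartition L M R →
    f n x L M R < 2 ^ width n
  recurrence : ∀ n x (L M R : Finset (Fin n)) (k : ℕ), valid n x → IsPartition L M R →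
    1 ≤ k → k < M.card →
    IsLeast {v | ∃ X ⊆ M, X.card = k ∧
      v = g n x L X (M \ X) R (f n x L X (M \ X ∪ R)) (f n x (L ∪ X) (M \ X) R)} (f n x L M R)
  g_poly : ∃ B : ℕ → BoolCircuit, UniformPolySize B ∧
    ∀ n x (L X Y R : Finset (Fin n)) (a b : ℕ), valid n x → Disjoint X Y →
      IsPartition L (X ∪ Y) R → a < 2 ^ width n → b < 2 ^ width n →
      bitsVal ((B n).eval
        (x ++ setBits L ++ setBits X ++ setBits Y ++ setBits R ++
          natBits (width n) a ++ natBits (width n) b)) =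
        g n x L X Y R a b

/-- Compute `f(L, M, R)` for a given partition with `|M| = m`; for `M = [n]` this is the answer to
the instance. -/
def PermutationProblem.task (P : PermutationProblem) : Task := fun n m input y =>
  ∃ (x : List Bool) (L M R : Finset (Fin n)), P.valid n x ∧ IsPartition L M R ∧ M.card = m ∧
    input = x ++ setBits L ++ setBits M ++ setBits R ∧ y = P.f n x L M R

/-- One fractalization step on tradeoff parameters `(T, S)`. -/
def fractalize (p : ℝ × ℝ) : ℝ × ℝ := (Real.sqrt (2 * p.1), Real.sqrt p.2)

end Fract

end

/-!
The faster algorithm is a quantum search over the splittings of a set of size `m` into two parts of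
sizes `m - m / 2` and `m / 2`, in which the given algorithm computes the values of both parts.
There are at most `2 ^ m` splittings, so that about `2 ^ (m / 2)` iterations suffice, each of which
takes time about `T ^ (m / 2)`. This gives the time `√(2 * T) ^ m` and the space `√S ^ m`, up to
polynomial factors (`Fract.Halving.pow_half_le`). Both kinds of problems enter only through the
structure `Fract.Halving`, which both provide (`exists_halving`), and the step is
`Fract.Halving.hasTradeoff_step`.

*The search.* The register of the search holds an arbitrary subset `X` of the ground set of `n`
elements, which selects the part `X ∩ M` of the set `M` to be split. No enumeration of the subsets
of a given size is needed: a subset is good if it selects a part of size `m / 2` for which the value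
has the desired property, and since only the intersection with `M` matters, a fraction of at least
`2 ^ (-m)` of all subsets is good as soon as one is (`Fract.two_pow_le_card_pick`). The number of
good subsets is unknown, so that `0, 1, 2, 4, …, 2 ^ h` iterations are tried; one of these numbers
succeeds with probability at least `1 / 4` (`Fract.exists_iterCount`). The minimum is found bit by
bit from the highest one: the bit at place `i` is zero if and only if some value agrees with the
minimum above the place `i` and has a zero there, and this is decided by a sequence of searches
(`Fract.Lay.norm_bit_sub_le`).

*Errors.* The subroutines err with probability up to `1 / 3`. The oracle runs polynomially many
copies of them, each on its own work qubits and its own part of the QRAM, and takes the majority of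
each bit, which is wrong with exponentially small probability (`Fract.Lay.mass_not_maj`, an
exponential moment bound that rests on `Fract.wt_prod_le`). Everything but the result is then
uncomputed, so that the oracle is close to the ideal one in norm
(`Fract.Lay.norm_oracle_sub_le`). Since an estimate on basis states does not by itself carry over to
superpositions, the operators are required to change only certain qubits (`Fract.Local`) and the
basis states to be distinguished by the other ones (`Fract.Transversal`); then no interference
occurs (`Fract.norm_map_le`). As gates are isometries, the errors of successive calls add up, and
the final state is close to a basis state with the correct output (`Fract.Lay.circuit_computes`).

*Uniformity and size.* All classical computation inside the circuit is a list of assignments of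
quadratic expressions over the field with two elements to fresh qubits (`Fract.progGates`), which
makes the circuit an explicit primitive recursive function of the circuits of the parts
(`Fract.Lay.primrec_circuit`). Its size is estimated in `Fract.Lay.time_circuit_le` and
`Fract.Lay.space_circuit_le`.

The iterated statement follows by induction, and the curve `T = 2 / S ^ c` is invariant under the
map that sends `(T, S)` to `(√(2 * T), √S)` (`Fract.fractalize_curve`).
-/

noncomputable section

namespace Fract

/-! ### The Hilbert space of superpositions -/

open Classical in
/-- The inner product of superpositions for which the basis states are orthonormal. -/
@[reducible]
def qstateCore : InnerProductSpace.Core ℂ QState where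
  inner φ ψ := φ.sum fun b z => (starRingEnd ℂ) z * ψ b
  conj_inner_symm φ ψ := by
    have h1 : φ.sum (fun b z => (starRingEnd ℂ) z * ψ b)
        = ∑ b ∈ φ.support ∪ ψ.support, (starRingEnd ℂ) (φ b) * ψ b :=
      Finsupp.sum_of_support_subset _ Finset.subset_union_left _ (by simp)
    have h2 : ψ.sum (fun b z => (starRingEnd ℂ) z * φ b)
        = ∑ b ∈ φ.support ∪ ψ.support, (starRingEnd ℂ) (ψ b) * φ b :=
      Finsupp.sum_of_support_subset _ Finset.subset_union_right _ (by simp)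
    change (starRingEnd ℂ) (ψ.sum fun b z => (starRingEnd ℂ) z * φ b) = _
    rw [h1, h2, map_sum]
    exact Finset.sum_congr rfl fun b _ => by simp [mul_comm]
  re_inner_nonneg φ := by
    rw [Finsupp.sum, map_sum]
    refine Finset.sum_nonneg fun b _ => ?_
    rw [← Complex.normSq_eq_conj_mul_self]
    simpa using Complex.normSq_nonneg _
  add_left φ ψ χ := Finsupp.sum_add_index' (by simp) (by intros; simp [add_mul])
  smul_left φ ψ r := by
    change (r • φ).sum (fun b z => (starRingEnd ℂ) z * ψ b) = _
    rw [Finsupp.sum_smul_index' (by simp)]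
    change _ = (starRingEnd ℂ) r * φ.sum _
    rw [Finsupp.mul_sum]
    exact Finsupp.sum_congr fun b _ => by simp [mul_assoc]
  definite φ h := by
    have h' : φ.sum (fun b z => (starRingEnd ℂ) z * φ b) = 0 := h
    rw [Finsupp.sum] at h'
    have h2 : ∑ b ∈ φ.support, Complex.normSq (φ b) = 0 := by
      have : ((∑ b ∈ φ.support, Complex.normSq (φ b) : ℝ) : ℂ) = 0 := by
        rw [← h']; push_cast
        exact Finset.sum_congr rfl fun b _ => Complex.normSq_eq_conj_mul_self
      exact_mod_cast this
    rw [Finset.sum_eq_zero_iff_of_nonneg (fun _ _ => Complex.normSq_nonneg _)] at h2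
    ext b
    by_cases hb : b ∈ φ.support
    · simpa using h2 b hb
    · simpa using hb

instance : NormedAddCommGroup QState :=
  @InnerProductSpace.Core.toNormedAddCommGroup ℂ QState _ _ _ qstateCore

instance : InnerProductSpace ℂ QState := InnerProductSpace.ofCore qstateCore.toCore

theorem inner_def (φ ψ : QState) :
    inner ℂ φ ψ = φ.sum fun b z => (starRingEnd ℂ) z * ψ b := rfl

theorem inner_single_left (b : BasisState) (z : ℂ) (ψ : QState) :
    inner ℂ (Finsupp.single b z) ψ = (starRingEnd ℂ) z * ψ b := by
  rw [inner_def, Finsupp.sum_single_index (by simp)]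

/-- The total weight of a superposition, where the basis state `b` is weighted by `F b`. -/
def wt (F : BasisState → ℝ) (ψ : QState) : ℝ := ψ.sum fun b z => F b * ‖z‖ ^ 2

theorem wt_eq_sum (F : BasisState → ℝ) (ψ : QState) {T : Finset BasisState} (h : ψ.support ⊆ T) :
    wt F ψ = ∑ b ∈ T, F b * ‖ψ b‖ ^ 2 :=
  Finsupp.sum_of_support_subset _ h _ (by simp)

theorem norm_sq_eq_wt (ψ : QState) : ‖ψ‖ ^ 2 = wt (fun _ => 1) ψ := by
  have h := @inner_self_eq_norm_sq ℂ QState _ _ _ ψ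
  rw [← h, inner_def, Finsupp.sum, map_sum, wt, Finsupp.sum]
  refine Finset.sum_congr rfl fun b _ => ?_
  rw [← Complex.normSq_eq_conj_mul_self, ← Complex.normSq_eq_norm_sq]
  simp

theorem wt_single (F : BasisState → ℝ) (b : BasisState) (z : ℂ) :
    wt F (Finsupp.single b z) = F b * ‖z‖ ^ 2 := by
  rw [wt, Finsupp.sum_single_index (by simp)]

theorem norm_single (b : BasisState) (z : ℂ) : ‖(Finsupp.single b z : QState)‖ = ‖z‖ := by
  have := norm_sq_eq_wt (Finsupp.single b z)
  rw [wt_single, one_mul] at this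
  exact (sq_eq_sq₀ (norm_nonneg _) (norm_nonneg _)).1 this

theorem wt_mono {F G : BasisState → ℝ} {ψ : QState} (h : ∀ b, ψ b ≠ 0 → F b ≤ G b) :
    wt F ψ ≤ wt G ψ :=
  Finset.sum_le_sum fun b hb =>
    mul_le_mul_of_nonneg_right (h b (Finsupp.mem_support_iff.1 hb)) (by positivity)

theorem wt_congr {F G : BasisState → ℝ} {ψ : QState} (h : ∀ b, ψ b ≠ 0 → F b = G b) :
    wt F ψ = wt G ψ :=
  Finset.sum_congr rfl fun b hb => by
    change F b * _ = G b * _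
    rw [h b (Finsupp.mem_support_iff.1 hb)]

theorem wt_add (F G : BasisState → ℝ) (ψ : QState) :
    wt (fun b => F b + G b) ψ = wt F ψ + wt G ψ := by
  simp only [wt, Finsupp.sum, add_mul, Finset.sum_add_distrib]

theorem wt_const_mul (c : ℝ) (F : BasisState → ℝ) (ψ : QState) :
    wt (fun b => c * F b) ψ = c * wt F ψ := by
  simp only [wt, Finsupp.sum, Finset.mul_sum, mul_assoc]

open Classical in
/-- The probability of measuring a basis state in `A`. -/
def mass (A : Set BasisState) (ψ : QState) : ℝ := wt (fun b => if b ∈ A then 1 else 0) ψ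

theorem mass_eq_norm_filter (A : Set BasisState) [DecidablePred (· ∈ A)] (ψ : QState) :
    mass A ψ = ‖(ψ.filter (· ∈ A) : QState)‖ ^ 2 := by
  rw [norm_sq_eq_wt, mass, wt_eq_sum _ ψ (Finset.Subset.refl _),
    wt_eq_sum _ _ (T := ψ.support) (by simp [Finsupp.support_filter])]
  refine Finset.sum_congr rfl fun b _ => ?_
  by_cases hb : b ∈ A <;> simp [hb]

open Classical in
theorem sqrt_mass_le (A : Set BasisState) (φ ψ : QState) :
    √(mass A φ) ≤ √(mass A ψ) + ‖φ - ψ‖ := by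
  have hle : mass A (φ - ψ) ≤ ‖φ - ψ‖ ^ 2 := by
    rw [norm_sq_eq_wt]
    exact wt_mono fun b _ => by split_ifs <;> norm_num
  have e (χ : QState) : √(mass A χ) = ‖(χ.filter (· ∈ A) : QState)‖ := by
    rw [mass_eq_norm_filter, Real.sqrt_sq (norm_nonneg _)]
  have h1 : ‖((φ - ψ).filter (· ∈ A) : QState)‖ ≤ ‖φ - ψ‖ := by
    rw [← e]; exact Real.sqrt_le_iff.2 ⟨norm_nonneg _, hle⟩
  rw [e, e]
  have h2 : (φ.filter (· ∈ A) : QState) = ψ.filter (· ∈ A) + (φ - ψ).filter (· ∈ A) := by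
    rw [← Finsupp.filter_add]; congr 1; abel
  rw [h2]
  exact (norm_add_le _ _).trans (by gcongr)

theorem mass_union_le (A B : Set BasisState) (ψ : QState) :
    mass (A ∪ B) ψ ≤ mass A ψ + mass B ψ := by
  rw [mass, mass, mass, ← wt_add]
  refine wt_mono fun b _ => ?_
  by_cases hA : b ∈ A <;> by_cases hB : b ∈ B <;> simp [hA, hB]

theorem mass_compl (A : Set BasisState) (ψ : QState) : mass Aᶜ ψ = ‖ψ‖ ^ 2 - mass A ψ := by
  rw [eq_sub_iff_add_eq, norm_sq_eq_wt, mass, mass, ← wt_add]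
  exact wt_congr fun b _ => by by_cases hA : b ∈ A <;> simp [hA]

/-- The superposition `ψ` contains only basis states in `A`. -/
def Supp (A : Set BasisState) (ψ : QState) : Prop := ∀ b, ψ b ≠ 0 → b ∈ A

theorem Supp.mono {A B : Set BasisState} {ψ : QState} (h : Supp A ψ) (hAB : A ⊆ B) : Supp B ψ :=
  fun b hb => hAB (h b hb)

theorem supp_single {A : Set BasisState} {b : BasisState} (hb : b ∈ A) (z : ℂ) :
    Supp A (Finsupp.single b z) := by
  classical
  intro c hc
  rw [Finsupp.single_apply] at hc
  split_ifs at hc with h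
  · exact h ▸ hb
  · exact absurd rfl hc

theorem Supp.smul {A : Set BasisState} {φ : QState} (h₁ : Supp A φ) (z : ℂ) : Supp A (z • φ) := by
  intro b hb
  refine h₁ b fun h => hb ?_
  simp [h]

theorem supp_sum {ι : Type*} {A : Set BasisState} {s : Finset ι} {φ : ι → QState}
    (h : ∀ i ∈ s, Supp A (φ i)) : Supp A (∑ i ∈ s, φ i) := by
  intro b hb
  rw [Finsupp.finsetSum_apply] at hb
  obtain ⟨i, hi, hne⟩ := Finset.exists_ne_zero_of_sum_ne_zero hb
  exact h i hi b hne

theorem map_eq_sum (L : QState →ₗ[ℂ] QState) (ψ : QState) :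
    L ψ = ∑ b ∈ ψ.support, ψ b • L (Finsupp.single b 1) := by
  conv_lhs => rw [← Finsupp.sum_single ψ, Finsupp.sum, map_sum]
  refine Finset.sum_congr rfl fun b _ => ?_
  rw [← map_smul, Finsupp.smul_single, smul_eq_mul, mul_one]

/-- On a superposition whose basis states have images with pairwise disjoint supports, weights
behave like classical probabilities. -/
theorem wt_map_of_disjoint {L : QState →ₗ[ℂ] QState} {ψ : QState}
    (h : ∀ b₁ b₂ b', ψ b₁ ≠ 0 → ψ b₂ ≠ 0 → L (Finsupp.single b₁ 1) b' ≠ 0 →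
      L (Finsupp.single b₂ 1) b' ≠ 0 → b₁ = b₂) (F : BasisState → ℝ) :
    wt F (L ψ) = wt (fun b => wt F (L (Finsupp.single b 1))) ψ := by
  classical
  set T := (L ψ).support ∪ ψ.support.biUnion fun b => (L (Finsupp.single b 1)).support with hT
  have key : ∀ b', ‖L ψ b'‖ ^ 2
      = ∑ b ∈ ψ.support, ‖ψ b‖ ^ 2 * ‖L (Finsupp.single b 1) b'‖ ^ 2 := by
    intro b'
    rw [map_eq_sum L ψ, Finsupp.finsetSum_apply]
    by_cases hex : ∃ b ∈ ψ.support, L (Finsupp.single b 1) b' ≠ 0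
    · obtain ⟨b, hb, hne⟩ := hex
      have hz : ∀ c ∈ ψ.support, c ≠ b → L (Finsupp.single c 1) b' = 0 := by
        intro c hc hcb
        by_contra hc'
        exact hcb (h c b b' (Finsupp.mem_support_iff.1 hc) (Finsupp.mem_support_iff.1 hb) hc' hne)
      rw [Finset.sum_eq_single_of_mem b hb (fun c hc hcb => by simp [hz c hc hcb]),
        Finset.sum_eq_single_of_mem b hb (fun c hc hcb => by simp [hz c hc hcb])]
      simp [mul_pow]
    · push Not at hex
      rw [Finset.sum_eq_zero fun c hc => by simp [hex c hc],
        Finset.sum_eq_zero fun c hc => by simp [hex c hc]]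
      simp
  rw [wt_eq_sum F _ (T := T) Finset.subset_union_left]
  simp_rw [key, Finset.mul_sum]
  rw [Finset.sum_comm, wt, Finsupp.sum]
  refine Finset.sum_congr rfl fun b hb => ?_
  rw [wt_eq_sum F (L (Finsupp.single b 1)) (T := T)
    ((Finset.subset_biUnion_of_mem (fun b => (L (Finsupp.single b 1)).support) hb).trans
      Finset.subset_union_right), Finset.sum_mul]
  exact Finset.sum_congr rfl fun b' _ => by ring

/-- The operator `L` changes only the qubits in `W`. -/
def Local (W : Set Qubit) (L : QState →ₗ[ℂ] QState) : Prop :=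
  ∀ b b', L (Finsupp.single b 1) b' ≠ 0 → ∀ q ∉ W, b' q = b q

/-- A basis state in `A` is determined by its qubits outside `W`. -/
def Transversal (W : Set Qubit) (A : Set BasisState) : Prop :=
  ∀ b₁ ∈ A, ∀ b₂ ∈ A, (∀ q ∉ W, b₁ q = b₂ q) → b₁ = b₂

theorem Local.mono {W W' : Set Qubit} {L : QState →ₗ[ℂ] QState} (h : Local W L) (hW : W ⊆ W') :
    Local W' L := fun b b' hb q hq => h b b' hb q fun h' => hq (hW h')

theorem Local.sub {W : Set Qubit} {L L' : QState →ₗ[ℂ] QState} (h : Local W L) (h' : Local W L') :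
    Local W (L - L') := by
  intro b b' hb
  by_cases h1 : L (Finsupp.single b 1) b' = 0
  · refine h' b b' fun h2 => hb ?_
    simp [h1, h2]
  · exact h b b' h1

theorem local_id (W : Set Qubit) : Local W LinearMap.id := by
  classical
  intro b b' hb q _
  rw [LinearMap.id_apply, Finsupp.single_apply] at hb
  split_ifs at hb with h
  · rw [h]
  · exact absurd rfl hb

/-- The image of a superposition under an operator that only changes `W` consists of basis states
that agree outside of `W` with basis states of that superposition. -/
theorem Local.supp {W : Set Qubit} {L : QState →ₗ[ℂ] QState} (h : Local W L) (ψ : QState)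
    {b' : BasisState} (hb' : L ψ b' ≠ 0) : ∃ b, ψ b ≠ 0 ∧ ∀ q ∉ W, b' q = b q := by
  rw [map_eq_sum, Finsupp.finsetSum_apply] at hb'
  obtain ⟨b, hb, hne⟩ := Finset.exists_ne_zero_of_sum_ne_zero hb'
  refine ⟨b, Finsupp.mem_support_iff.1 hb, h b b' fun h0 => hne ?_⟩
  simp [h0]

theorem Local.comp {W : Set Qubit} {L L' : QState →ₗ[ℂ] QState} (h : Local W L) (h' : Local W L') :
    Local W (L ∘ₗ L') := by
  intro b b' hb q hq
  obtain ⟨c, hc, hcq⟩ := h.supp _ hb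
  rw [hcq q hq, h' b c hc q hq]

/-- If the basis states of a superposition can be told apart outside of `W`, then an operator that
only changes `W` maps them to superpositions without common basis states, so that no interference
occurs. -/
theorem wt_map {W : Set Qubit} {A : Set BasisState} {L : QState →ₗ[ℂ] QState} {ψ : QState}
    (hL : Local W L) (hA : Transversal W A) (hψ : Supp A ψ) (F : BasisState → ℝ) :
    wt F (L ψ) = wt (fun b => wt F (L (Finsupp.single b 1))) ψ :=
  wt_map_of_disjoint (fun b₁ b₂ b' h₁ h₂ h₁' h₂' => hA b₁ (hψ _ h₁) b₂ (hψ _ h₂) fun q hq => by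
    rw [← hL b₁ b' h₁' q hq, hL b₂ b' h₂' q hq]) F

/-- A bound for the images of basis states carries over to superpositions of basis states that can
be told apart by the qubits that the operator does not change. -/
theorem norm_map_le {W : Set Qubit} {A : Set BasisState} {L : QState →ₗ[ℂ] QState} {ψ : QState}
    (hL : Local W L) (hA : Transversal W A) (hψ : Supp A ψ) {ε : ℝ} (hε : 0 ≤ ε)
    (h : ∀ b ∈ A, ‖L (Finsupp.single b 1)‖ ≤ ε) : ‖L ψ‖ ≤ ε * ‖ψ‖ := by
  refine le_of_sq_le_sq ?_ (by positivity)
  rw [norm_sq_eq_wt, wt_map hL hA hψ, mul_pow, norm_sq_eq_wt ψ, ← wt_const_mul]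
  refine wt_mono fun b hb => ?_
  rw [← norm_sq_eq_wt, mul_one]
  exact pow_le_pow_left₀ (norm_nonneg _) (h b (hψ b hb)) 2

theorem norm_map_eq {W : Set Qubit} {A : Set BasisState} {L : QState →ₗ[ℂ] QState} {ψ : QState}
    (hL : Local W L) (hA : Transversal W A) (hψ : Supp A ψ)
    (h : ∀ b ∈ A, ‖L (Finsupp.single b 1)‖ = 1) : ‖L ψ‖ = ‖ψ‖ := by
  refine (sq_eq_sq₀ (norm_nonneg _) (norm_nonneg _)).1 ?_
  rw [norm_sq_eq_wt, wt_map hL hA hψ, norm_sq_eq_wt ψ]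
  refine wt_congr fun b hb => ?_
  rw [← norm_sq_eq_wt, h b (hψ b hb), one_pow]

/-! ### Gates as unitary operators -/

/-- The linear extension of a map of basis states. -/
def basisMap (τ : BasisState → BasisState) : QState →ₗ[ℂ] QState := Finsupp.lmapDomain ℂ ℂ τ

@[simp] theorem basisMap_single (τ : BasisState → BasisState) (b : BasisState) (z : ℂ) :
    basisMap τ (Finsupp.single b z) = Finsupp.single (τ b) z := by
  simp [basisMap, Finsupp.mapDomain_single]

theorem Gate.op_single (G : Gate) (b : BasisState) :
    G.op (Finsupp.single b 1) = G.onBasis b := by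
  simp [Gate.op]

theorem linearMap_ext {L L' : QState →ₗ[ℂ] QState}
    (h : ∀ b, L (Finsupp.single b 1) = L' (Finsupp.single b 1)) : L = L' := by
  refine Finsupp.lhom_ext fun b z => ?_
  have e : (Finsupp.single b z : QState) = z • Finsupp.single b 1 := by simp
  rw [e, map_smul, map_smul, h]

/-- The qubit `q` is negated. -/
def flipAt (q : ℕ) (b : BasisState) : BasisState := Function.update b (.work q) (!b (.work q))

/-- The inverse of an elementary operation. -/
def Gate.inv : Gate → Gate
  | .phase q => .phaseInv q
  | .phaseInv q => .phase q
  | G => G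

@[simp] theorem Gate.inv_inv (G : Gate) : G.inv.inv = G := by cases G <;> rfl

@[simp] theorem Gate.qubits_inv (G : Gate) : G.inv.qubits = G.qubits := by cases G <;> rfl

/-- The qubits that an elementary operation may change. -/
def Gate.writes : Gate → Set Qubit
  | .not q => {.work q}
  | .had q => {.work q}
  | .phase _ => ∅
  | .phaseInv _ => ∅
  | .cnot _ t => {.work t}
  | .toffoli _ _ t => {.work t}
  | .qread _ tgt => {x | ∃ q ∈ tgt, x = .work q}
  | .qswap addr tgt =>
      {x | (∃ q ∈ tgt, x = .work q) ∨
        ∃ i j, i < 2 ^ addr.length ∧ j < tgt.length ∧ x = .cell i j}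

theorem Gate.writes_inv (G : Gate) : G.inv.writes = G.writes := by cases G <;> rfl

theorem address_congr {b b' : BasisState} {addr : List ℕ}
    (h : ∀ q ∈ addr, b (.work q) = b' (.work q)) : address b addr = address b' addr := by
  unfold address
  congr 1
  exact List.map_congr_left h

theorem bitsVal_lt (l : List Bool) : bitsVal l < 2 ^ l.length := by
  have := Nat.ofDigits_lt_base_pow_length (b := 2) (l := l.map Bool.toNat) (by norm_num) (by
    intro x hx
    obtain ⟨v, _, rfl⟩ := List.mem_map.1 hx
    exact Bool.toNat_lt v)
  simpa [bitsVal] using this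

theorem address_lt (b : BasisState) (addr : List ℕ) : address b addr < 2 ^ addr.length := by
  simpa [address] using bitsVal_lt (addr.map fun q => b (.work q))

theorem address_readBasis {addr tgt : List ℕ} (h : (addr ++ tgt).Nodup) (b : BasisState) :
    address (readBasis addr tgt b) addr = address b addr :=
  address_congr fun q hq => by
    have : q ∉ tgt := fun ht => (List.nodup_append.1 h).2.2 q hq q ht rfl
    simp [readBasis, this]

theorem address_swapBasis {addr tgt : List ℕ} (h : (addr ++ tgt).Nodup) (b : BasisState) :
    address (swapBasis addr tgt b) addr = address b addr :=
  address_congr fun q hq => by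
    have : q ∉ tgt := fun ht => (List.nodup_append.1 h).2.2 q hq q ht rfl
    simp [swapBasis, this]

theorem readBasis_readBasis {addr tgt : List ℕ} (h : (addr ++ tgt).Nodup) (b : BasisState) :
    readBasis addr tgt (readBasis addr tgt b) = b := by
  funext q
  cases q with
  | cell i j => rfl
  | work q =>
    have ha := address_readBasis h b
    by_cases hq : q ∈ tgt
    · rw [readBasis, if_pos hq, ha]
      change xor (readBasis addr tgt b (.work q)) (b _) = _
      rw [readBasis, if_pos hq]
      simp
    · rw [readBasis, if_neg hq, readBasis, if_neg hq]

theorem swapBasis_swapBasis {addr tgt : List ℕ} (h : (addr ++ tgt).Nodup) (b : BasisState) :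
    swapBasis addr tgt (swapBasis addr tgt b) = b := by
  have ha := address_swapBasis h b
  have hn : tgt.Nodup := (List.nodup_append.1 h).2.1
  funext q
  cases q with
  | cell i j =>
    rw [swapBasis, ha]
    split_ifs with hij
    · have hm : tgt.getD j 0 ∈ tgt := by
        rw [List.getD_eq_getElem _ _ hij.2]; exact List.getElem_mem _
      rw [swapBasis, if_pos hm, List.getD_eq_getElem _ _ hij.2, hn.idxOf_getElem, hij.1]
    · rw [swapBasis, if_neg hij]
  | work q =>
    by_cases hq : q ∈ tgt
    · rw [swapBasis, if_pos hq, ha, swapBasis, if_pos ⟨rfl, List.idxOf_lt_length_of_mem hq⟩,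
        List.getD_eq_getElem _ _ (List.idxOf_lt_length_of_mem hq), List.getElem_idxOf]
    · rw [swapBasis, if_neg hq, swapBasis, if_neg hq]

theorem sqrt_two_inv_sq : ((1 / √2 : ℝ) : ℂ) * ((1 / √2 : ℝ) : ℂ) = 1 / 2 := by
  rw [← Complex.ofReal_mul]
  have : (1 / √2) * (1 / √2) = (1 / 2 : ℝ) := by
    rw [div_mul_div_comm, Real.mul_self_sqrt (by norm_num), one_mul]
  rw [this]; norm_num

/-- The operations are invertible since their registers consist of distinct qubits: otherwise the
address of a QRAM operation could be overwritten by the operation. -/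
theorem Gate.inv_op_op {G : Gate} (h : G.qubits.Nodup) (ψ : QState) :
    G.inv.op (G.op ψ) = ψ := by
  suffices hh : G.inv.op ∘ₗ G.op = LinearMap.id from LinearMap.congr_fun hh ψ
  refine linearMap_ext fun b => ?_
  simp only [LinearMap.comp_apply, LinearMap.id_apply, Gate.op_single]
  have hs (G' : Gate) (c : BasisState) (z : ℂ) :
      G'.op (Finsupp.single c z) = z • G'.onBasis c := by simp [Gate.op]
  cases G with
  | not q => simp [Gate.inv, Gate.onBasis, hs]
  | had q =>
    simp only [Gate.inv, Gate.onBasis, map_add, hs]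
    simp only [Function.update_self, Function.update_idem, smul_add, Finsupp.smul_single,
      smul_eq_mul]
    generalize hr : ((1 / √2 : ℝ) : ℂ) = r
    have hr2 : r * r = 1 / 2 := by rw [← hr]; exact sqrt_two_inv_sq
    have e : Function.update b (.work q) (b (.work q)) = b := Function.update_eq_self _ _
    cases hq : b (.work q) <;> rw [hq] at e <;>
      simp only [if_true, if_false, Bool.false_eq_true, mul_neg, neg_mul, hr2, e, neg_neg,
        Finsupp.single_neg] <;> rw [add_add_add_comm, ← Finsupp.single_add] <;> norm_num
  | phase q =>
    simp only [Gate.inv, Gate.onBasis, hs, Finsupp.smul_single, smul_eq_mul]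
    split_ifs <;> simp [← Complex.exp_add]
  | phaseInv q =>
    simp only [Gate.inv, Gate.onBasis, hs, Finsupp.smul_single, smul_eq_mul]
    split_ifs <;> simp [← Complex.exp_add]
  | cnot c t =>
    have hct : c ≠ t := by simpa [Gate.qubits] using h
    simp [Gate.inv, Gate.onBasis, hs, hct]
  | toffoli c₁ c₂ t =>
    have hct : c₁ ≠ t ∧ c₂ ≠ t := by
      simp [Gate.qubits] at h; tauto
    simp [Gate.inv, Gate.onBasis, hs, hct.1, hct.2]
  | qread addr tgt => simp [Gate.inv, Gate.onBasis, hs, readBasis_readBasis h]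
  | qswap addr tgt => simp [Gate.inv, Gate.onBasis, hs, swapBasis_swapBasis h]

/-- A linear map that preserves the inner products of basis states is an isometry. -/
theorem norm_map_of_inner_basis {L : QState →ₗ[ℂ] QState}
    (h : ∀ b b', inner ℂ (L (Finsupp.single b 1)) (L (Finsupp.single b' 1))
      = inner ℂ (Finsupp.single b (1 : ℂ) : QState) (Finsupp.single b' (1 : ℂ) : QState))
    (ψ : QState) : ‖L ψ‖ = ‖ψ‖ := by
  have key : inner ℂ (L ψ) (L ψ) = inner ℂ ψ ψ := by
    have e : ψ = ∑ b ∈ ψ.support, ψ b • Finsupp.single b (1 : ℂ) := by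
      conv_lhs => rw [← Finsupp.sum_single ψ]
      exact Finset.sum_congr rfl fun b _ => by simp
    rw [map_eq_sum L ψ]
    conv_rhs => rw [e]
    simp only [sum_inner, inner_sum, inner_smul_left, inner_smul_right, h]
  rw [@norm_eq_sqrt_re_inner ℂ, @norm_eq_sqrt_re_inner ℂ _ _ _ _ ψ, key]

/-- If the `single`-valued part of a gate is undone by an injective map, it is unitary. -/
theorem inner_single_of_injective {τ : BasisState → BasisState} (hτ : Function.Injective τ)
    (b b' : BasisState) {z z' : ℂ} (h : b = b' → (starRingEnd ℂ) z * z' = 1) :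
    inner ℂ (Finsupp.single (τ b) z : QState) (Finsupp.single (τ b') z' : QState)
      = inner ℂ (Finsupp.single b (1 : ℂ) : QState) (Finsupp.single b' (1 : ℂ) : QState) := by
  classical
  rw [inner_single_left, inner_single_left, Finsupp.single_apply, Finsupp.single_apply]
  by_cases hb : b = b'
  · subst hb; simp [h rfl]
  · have : τ b' ≠ τ b := fun h' => hb (hτ h').symm
    rw [if_neg this, if_neg (Ne.symm hb)]; simp

theorem injective_of_inv_op_op {G : Gate} (h : G.qubits.Nodup) {τ : BasisState → BasisState}
    (hτ : ∀ b, G.onBasis b = Finsupp.single (τ b) 1) : Function.Injective τ := by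
  intro b b' hbb
  have e : G.op (Finsupp.single b 1) = G.op (Finsupp.single b' 1) := by
    rw [Gate.op_single, Gate.op_single, hτ, hτ, hbb]
  have e2 := congrArg G.inv.op e
  rw [Gate.inv_op_op h, Gate.inv_op_op h] at e2
  exact Finsupp.single_left_injective one_ne_zero e2

theorem inner_had (q : ℕ) (b b' : BasisState) :
    inner ℂ ((Gate.had q).onBasis b) ((Gate.had q).onBasis b')
      = inner ℂ (Finsupp.single b (1 : ℂ) : QState) (Finsupp.single b' (1 : ℂ) : QState) := by
  classical
  have e1 : ∀ v v', Function.update b' (.work q) v' = Function.update b (.work q) v ↔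
      (v' = v ∧ ∀ x ≠ Qubit.work q, b' x = b x) := by
    intro v v'
    constructor
    · intro h
      refine ⟨by simpa using congrFun h (.work q), fun x hx => ?_⟩
      simpa [hx] using congrFun h x
    · rintro ⟨rfl, h⟩
      funext x
      by_cases hx : x = .work q
      · subst hx; simp
      · simp [hx, h x hx]
  have e2 : b' = b ↔ (b' (.work q) = b (.work q) ∧ ∀ x ≠ Qubit.work q, b' x = b x) := by
    constructor
    · rintro rfl; simp
    · rintro ⟨h, h'⟩
      funext x
      by_cases hx : x = .work q
      · rw [hx, h]
      · exact h' x hx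
  simp only [Gate.onBasis, inner_add_left, inner_add_right, inner_single_left,
    Finsupp.single_apply, e1]
  rw [if_congr e2 rfl rfl]
  generalize hr : ((1 / √2 : ℝ) : ℂ) = r
  have hr2 : r * r = 1 / 2 := by rw [← hr]; exact sqrt_two_inv_sq
  have hc : (starRingEnd ℂ) r = r := by rw [← hr]; exact Complex.conj_ofReal _
  by_cases hx : ∀ x ≠ Qubit.work q, b' x = b x
  · simp only [eq_true hx, and_true]
    cases b (.work q) <;> cases b' (.work q) <;> simp [hc, hr2] <;> norm_num
  · simp [hx]

theorem Gate.norm_op {G : Gate} (h : G.qubits.Nodup) (ψ : QState) : ‖G.op ψ‖ = ‖ψ‖ := by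
  refine norm_map_of_inner_basis (fun b b' => ?_) ψ
  rw [Gate.op_single, Gate.op_single]
  have hp (z : ℝ) : (starRingEnd ℂ) (Complex.exp (Complex.I * z)) * Complex.exp (Complex.I * z)
      = 1 := by
    rw [← Complex.exp_conj, ← Complex.exp_add]; simp
  have hp1 := hp (Real.pi / 4)
  have hp2 := hp (-(Real.pi / 4))
  push_cast at hp1 hp2
  rw [mul_neg] at hp2
  have ge (G : Gate) (h : G.qubits.Nodup) (τ : BasisState → BasisState)
      (hτ : ∀ b, G.onBasis b = Finsupp.single (τ b) 1) :
      inner ℂ (G.onBasis b) (G.onBasis b') =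
        inner ℂ (Finsupp.single b (1 : ℂ) : QState) (Finsupp.single b' (1 : ℂ) : QState) := by
    rw [hτ, hτ]
    exact inner_single_of_injective (injective_of_inv_op_op h hτ) b b' (by simp)
  cases G with
  | had q => exact inner_had q b b'
  | phase q =>
    refine inner_single_of_injective (τ := id) Function.injective_id b b' ?_
    rintro rfl
    split_ifs
    · exact hp1
    · simp
  | phaseInv q =>
    refine inner_single_of_injective (τ := id) Function.injective_id b b' ?_
    rintro rfl
    split_ifs
    · exact hp2
    · simp
  | not q => exact ge _ h _ fun _ => rfl
  | cnot c t => exact ge _ h _ fun _ => rfl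
  | toffoli c₁ c₂ t => exact ge _ h _ fun _ => rfl
  | qread addr tgt => exact ge _ h _ fun _ => rfl
  | qswap addr tgt => exact ge _ h _ fun _ => rfl

theorem Gate.local_op (G : Gate) : Local G.writes G.op := by
  have key (τ : BasisState → BasisState) (z : ℂ) (b b' : BasisState) (W : Set Qubit)
      (hτ : ∀ q ∉ W, τ b q = b q) (h : (Finsupp.single (τ b) z : QState) b' ≠ 0) :
      ∀ q ∉ W, b' q = b q := by
    classical
    rw [Finsupp.single_apply] at h
    split_ifs at h with hb
    · rw [← hb]; exact hτ
    · exact absurd rfl h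
  have upd (b : BasisState) (t : ℕ) (v : Bool) :
      ∀ q ∉ ({.work t} : Set Qubit), Function.update b (.work t) v q = b q := by
    intro q hq
    rw [Function.update_of_ne hq]
  intro b b' hb
  rw [Gate.op_single] at hb
  cases G with
  | not q => exact key (fun b => Function.update b _ _) _ _ _ _ (upd _ _ _) hb
  | cnot c t => exact key (fun b => Function.update b _ _) _ _ _ _ (upd _ _ _) hb
  | toffoli c₁ c₂ t => exact key (fun b => Function.update b _ _) _ _ _ _ (upd _ _ _) hb
  | phase q => exact key id _ _ _ _ (fun _ _ => rfl) hb
  | phaseInv q => exact key id _ _ _ _ (fun _ _ => rfl) hb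
  | had q =>
    simp only [Gate.onBasis] at hb
    rw [Finsupp.add_apply] at hb
    by_cases h0 : (Finsupp.single (Function.update b (.work q) false)
        ((1 / √2 : ℝ) : ℂ) : QState) b' = 0
    · rw [h0, zero_add] at hb
      exact key (fun b => Function.update b _ _) _ _ _ _ (upd _ _ _) hb
    · exact key (fun b => Function.update b _ _) _ _ _ _ (upd _ _ _) h0
  | qread addr tgt =>
    refine key (readBasis addr tgt) _ _ _ _ (fun x hx => ?_) hb
    cases x with
    | cell i j => rfl
    | work q =>
      have : q ∉ tgt := fun h => hx ⟨q, h, rfl⟩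
      simp [readBasis, this]
  | qswap addr tgt =>
    refine key (swapBasis addr tgt) _ _ _ _ (fun x hx => ?_) hb
    cases x with
    | cell i j =>
      rw [swapBasis, if_neg]
      rintro ⟨h1, h2⟩
      exact hx (Or.inr ⟨i, j, h1 ▸ address_lt b addr, h2, rfl⟩)
    | work q =>
      have : q ∉ tgt := fun h => hx (Or.inl ⟨q, h, rfl⟩)
      simp [swapBasis, this]

theorem address_flipAt {b : BasisState} {addr : List ℕ} {q : ℕ} (h : q ∉ addr) :
    address (flipAt q b) addr = address b addr :=
  address_congr fun q' hq' => by
    have : q' ≠ q := fun e => h (e ▸ hq')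
    simp [flipAt, this]

/-- An operation that does not involve the qubit `q` commutes with the negation of `q`. -/
theorem Gate.op_flipAt {G : Gate} {q : ℕ} (h : q ∉ G.qubits) (ψ : QState) :
    G.op (basisMap (flipAt q) ψ) = basisMap (flipAt q) (G.op ψ) := by
  suffices hh : G.op ∘ₗ basisMap (flipAt q) = basisMap (flipAt q) ∘ₗ G.op from
    LinearMap.congr_fun hh ψ
  refine linearMap_ext fun b => ?_
  simp only [LinearMap.comp_apply, basisMap_single, Gate.op_single]
  have hw (q' : ℕ) (hq : q' ≠ q) : flipAt q b (.work q') = b (.work q') := by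
    simp [flipAt, hq]
  have hc (q' : ℕ) (hq : q' ≠ q) (v : Bool) : Function.update (flipAt q b) (.work q') v
      = flipAt q (Function.update b (.work q') v) := by
    have : Qubit.work q ≠ .work q' := fun e => hq (Qubit.work.inj e).symm
    simp only [flipAt]
    rw [Function.update_of_ne this, Function.update_comm this]
  cases G with
  | not q' =>
    have h1 : q' ≠ q := by simp [Gate.qubits] at h; tauto
    simp [Gate.onBasis, hw _ h1, hc _ h1]
  | had q' =>
    have h1 : q' ≠ q := by simp [Gate.qubits] at h; tauto
    simp [Gate.onBasis, hw _ h1, hc _ h1]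
  | phase q' =>
    have h1 : q' ≠ q := by simp [Gate.qubits] at h; tauto
    simp [Gate.onBasis, hw _ h1]
  | phaseInv q' =>
    have h1 : q' ≠ q := by simp [Gate.qubits] at h; tauto
    simp [Gate.onBasis, hw _ h1]
  | cnot c t =>
    have h1 : c ≠ q ∧ t ≠ q := by simp [Gate.qubits] at h; tauto
    simp [Gate.onBasis, hw _ h1.1, hw _ h1.2, hc _ h1.2]
  | toffoli c₁ c₂ t =>
    have h1 : c₁ ≠ q ∧ c₂ ≠ q ∧ t ≠ q := by simp [Gate.qubits] at h; tauto
    simp [Gate.onBasis, hw _ h1.1, hw _ h1.2.1, hw _ h1.2.2, hc _ h1.2.2]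
  | qread addr tgt =>
    have h1 : q ∉ addr ∧ q ∉ tgt := by simpa [Gate.qubits] using h
    simp only [Gate.onBasis, basisMap_single]
    congr 1
    funext x
    cases x with
    | cell i j => simp [readBasis, flipAt]
    | work q' =>
      by_cases hq : q' = q
      · subst hq; simp [readBasis, flipAt, h1.2]
      · have : flipAt q (readBasis addr tgt b) (.work q') = readBasis addr tgt b (.work q') := by
          simp [flipAt, hq]
        rw [this]
        simp only [readBasis, address_flipAt h1.1, hw _ hq]
        simp [flipAt]
  | qswap addr tgt =>
    have h1 : q ∉ addr ∧ q ∉ tgt := by simpa [Gate.qubits] using h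
    simp only [Gate.onBasis, basisMap_single]
    congr 1
    funext x
    cases x with
    | cell i j =>
      have : flipAt q (swapBasis addr tgt b) (.cell i j) = swapBasis addr tgt b (.cell i j) := by
        simp [flipAt]
      rw [this]
      simp only [swapBasis, address_flipAt h1.1]
      split_ifs with hij
      · refine hw _ fun e => h1.2 ?_
        rw [← e, List.getD_eq_getElem _ _ hij.2]; exact List.getElem_mem _
      · simp [flipAt]
    | work q' =>
      by_cases hq : q' = q
      · subst hq; simp [swapBasis, flipAt, h1.2]
      · have : flipAt q (swapBasis addr tgt b) (.work q') = swapBasis addr tgt b (.work q') := by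
          simp [flipAt, hq]
        rw [this]
        simp only [swapBasis, address_flipAt h1.1, hw _ hq]
        simp [flipAt]

/-! ### Gate sequences -/

/-- The operator of a sequence of operations, the first one in the list being applied first. -/
def run : List Gate → QState →ₗ[ℂ] QState
  | [] => LinearMap.id
  | G :: gs => run gs ∘ₗ G.op

@[simp] theorem run_nil : run [] = LinearMap.id := rfl

theorem run_cons (G : Gate) (gs : List Gate) (ψ : QState) : run (G :: gs) ψ = run gs (G.op ψ) := rfl

theorem foldl_op_eq_run (gs : List Gate) (ψ : QState) :
    gs.foldl (fun ψ G => G.op ψ) ψ = run gs ψ := by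
  induction gs generalizing ψ with
  | nil => rfl
  | cons G gs ih => exact ih _

theorem run_append (gs hs : List Gate) (ψ : QState) : run (gs ++ hs) ψ = run hs (run gs ψ) := by
  induction gs generalizing ψ with
  | nil => rfl
  | cons G gs ih => exact ih _

theorem run_singleton (G : Gate) (ψ : QState) : run [G] ψ = G.op ψ := rfl

/-- Every operation of the sequence acts on pairwise distinct qubits. -/
def Distinct (gs : List Gate) : Prop := ∀ G ∈ gs, G.qubits.Nodup

/-- The inverse of a sequence of operations. -/
def invGates (gs : List Gate) : List Gate := (gs.map Gate.inv).reverse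

theorem mem_invGates {gs : List Gate} {G : Gate} : G ∈ invGates gs ↔ G.inv ∈ gs := by
  simp only [invGates, List.mem_reverse, List.mem_map]
  constructor
  · rintro ⟨G', h, rfl⟩; simpa using h
  · intro h; exact ⟨_, h, by simp⟩

theorem Distinct.append {gs hs : List Gate} (h₁ : Distinct gs) (h₂ : Distinct hs) :
    Distinct (gs ++ hs) := fun G hG => (List.mem_append.1 hG).elim (h₁ G) (h₂ G)

theorem Distinct.inv {gs : List Gate} (h : Distinct gs) : Distinct (invGates gs) := fun G hG => by
  have := h _ (mem_invGates.1 hG); simpa using this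

theorem norm_run {gs : List Gate} (h : Distinct gs) (ψ : QState) : ‖run gs ψ‖ = ‖ψ‖ := by
  induction gs generalizing ψ with
  | nil => rfl
  | cons G gs ih =>
    rw [run_cons, ih fun G' hG' => h G' (List.mem_cons_of_mem _ hG'), Gate.norm_op (h G (by simp))]

theorem run_invGates_run {gs : List Gate} (h : Distinct gs) (ψ : QState) :
    run (invGates gs) (run gs ψ) = ψ := by
  induction gs generalizing ψ with
  | nil => rfl
  | cons G gs ih =>
    have : invGates (G :: gs) = invGates gs ++ [G.inv] := by simp [invGates]
    rw [run_cons, this, run_append, ih fun G' hG' => h G' (List.mem_cons_of_mem _ hG'),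
      run_singleton, Gate.inv_op_op (h G (by simp))]

@[simp] theorem invGates_invGates (gs : List Gate) : invGates (invGates gs) = gs := by
  simp [invGates, List.map_reverse, Function.comp_def]

theorem run_run_invGates {gs : List Gate} (h : Distinct gs) (ψ : QState) :
    run gs (run (invGates gs) ψ) = ψ := by
  have := run_invGates_run h.inv ψ
  rwa [invGates_invGates] at this

theorem local_run {W : Set Qubit} {gs : List Gate} (h : ∀ G ∈ gs, G.writes ⊆ W) :
    Local W (run gs) := by
  induction gs with
  | nil => exact local_id W
  | cons G gs ih =>
    exact (ih fun G' hG' => h G' (List.mem_cons_of_mem _ hG')).comp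
      (G.local_op.mono (h G (by simp)))

/-- Gates commute with the negation of a qubit that they do not use. -/
theorem run_flipAt {gs : List Gate} {q : ℕ} (h : ∀ G ∈ gs, q ∉ G.qubits) (ψ : QState) :
    run gs (basisMap (flipAt q) ψ) = basisMap (flipAt q) (run gs ψ) := by
  induction gs generalizing ψ with
  | nil => rfl
  | cons G gs ih =>
    rw [run_cons, Gate.op_flipAt (h G (by simp)),
      ih fun G' hG' => h G' (List.mem_cons_of_mem _ hG'),
      run_cons]

/-! ### Computing, copying and uncomputing -/

/-- The qubit `q` is negated if `v` holds. -/
def xorAt (q : ℕ) (v : Bool) (b : BasisState) : BasisState :=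
  Function.update b (.work q) (xor (b (.work q)) v)

theorem basisMap_flipAt (q : ℕ) : basisMap (flipAt q) = (Gate.not q).op :=
  linearMap_ext fun b => by rw [basisMap_single, Gate.op_single]; rfl

theorem basisMap_id : basisMap (fun b => b) = LinearMap.id :=
  linearMap_ext fun b => by rw [basisMap_single]; rfl

theorem xorAt_true (q : ℕ) : xorAt q true = flipAt q := by
  funext b; simp [xorAt, flipAt]

theorem xorAt_false (q : ℕ) : xorAt q false = fun b => b := by
  funext b; simp [xorAt]

theorem norm_basisMap_xorAt (q : ℕ) (v : Bool) (ψ : QState) : ‖basisMap (xorAt q v) ψ‖ = ‖ψ‖ := by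
  cases v
  · rw [xorAt_false, basisMap_id, LinearMap.id_apply]
  · rw [xorAt_true, basisMap_flipAt, Gate.norm_op (by simp [Gate.qubits])]

theorem run_xorAt {gs : List Gate} {q : ℕ} (h : ∀ G ∈ gs, q ∉ G.qubits) (v : Bool) (ψ : QState) :
    run gs (basisMap (xorAt q v) ψ) = basisMap (xorAt q v) (run gs ψ) := by
  cases v
  · simp [xorAt_false, basisMap_id]
  · rw [xorAt_true, run_flipAt h]

/-- Compute with `gs`, copy the qubit `f` to `q`, and uncompute. -/
def copyOut (gs : List Gate) (f q : ℕ) : List Gate := gs ++ .cnot f q :: invGates gs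

theorem distinct_copyOut {gs : List Gate} (h : Distinct gs) {f q : ℕ} (hfq : f ≠ q) :
    Distinct (copyOut gs f q) := by
  refine h.append fun G hG => ?_
  rcases List.mem_cons.1 hG with rfl | hG
  · simpa [Gate.qubits] using hfq
  · exact h.inv G hG

/-- If `gs` writes `v` into the qubit `f` up to a small probability of failure, then computing,
copying and uncomputing is close to the classical operation that adds `v` to `q`. -/
theorem norm_copyOut_sub_le {gs : List Gate} (h : Distinct gs) {f q : ℕ} (hfq : f ≠ q)
    (hq : ∀ G ∈ gs, q ∉ G.qubits) (b : BasisState) (v : Bool) :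
    ‖run (copyOut gs f q) (Finsupp.single b 1) - Finsupp.single (xorAt q v b) 1‖
      ≤ 2 * √(mass {c | c (.work f) ≠ v} (run gs (Finsupp.single b 1))) := by
  classical
  set φ := run gs (Finsupp.single b 1) with hφ
  have e1 : (Finsupp.single (xorAt q v b) 1 : QState)
      = run (invGates gs) (basisMap (xorAt q v) φ) := by
    rw [hφ, ← run_xorAt hq, basisMap_single, run_invGates_run h]
  rw [copyOut, run_append, run_cons, e1, ← map_sub, norm_run h.inv, ← hφ]
  set Q : BasisState → Prop := (· ∈ {c : BasisState | c (.work f) ≠ v})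
  have hsplit : φ = φ.filter Q + φ.filter (fun b => ¬ Q b) :=
    (Finsupp.filter_add_filter_not φ Q).symm
  have hgood : (Gate.cnot f q).op (φ.filter (fun b => ¬ Q b))
      = basisMap (xorAt q v) (φ.filter (fun b => ¬ Q b)) := by
    rw [map_eq_sum, map_eq_sum (basisMap _)]
    refine Finset.sum_congr rfl fun c hc => ?_
    have hcv : c (.work f) = v := by
      have := (Finset.mem_filter.1 (Finsupp.support_filter (fun b => ¬ Q b) φ ▸ hc)).2
      simpa [Q] using this
    rw [Gate.op_single, basisMap_single]
    simp [Gate.onBasis, xorAt, hcv]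
  have hdiff : (Gate.cnot f q).op φ - basisMap (xorAt q v) φ
      = (Gate.cnot f q).op (φ.filter Q) - basisMap (xorAt q v) (φ.filter Q) := by
    conv_lhs => rw [hsplit, map_add, map_add, hgood]
    abel
  rw [hdiff, mass_eq_norm_filter, Real.sqrt_sq (norm_nonneg _), two_mul]
  refine (norm_sub_le _ _).trans ?_
  rw [norm_basisMap_xorAt, Gate.norm_op (by simpa [Gate.qubits] using hfq)]

/-! ### Approximating operators -/

/-- On superpositions of basis states in `A`, the operations `gs` agree with the norm-preserving
operator `I` up to a relative error `ε`, and the result is a superposition of basis states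
in `B`. -/
def Approx (gs : List Gate) (I : QState →ₗ[ℂ] QState) (A B : Set BasisState) (ε : ℝ) : Prop :=
  Distinct gs ∧ ∀ ψ, Supp A ψ → Supp B (I ψ) ∧ ‖I ψ‖ = ‖ψ‖ ∧ ‖run gs ψ - I ψ‖ ≤ ε * ‖ψ‖

theorem Approx.trans {g₁ g₂ : List Gate} {I₁ I₂ : QState →ₗ[ℂ] QState} {A B D : Set BasisState}
    {ε₁ ε₂ : ℝ} (h₁ : Approx g₁ I₁ A B ε₁) (h₂ : Approx g₂ I₂ B D ε₂) :
    Approx (g₁ ++ g₂) (I₂ ∘ₗ I₁) A D (ε₁ + ε₂) := by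
  refine ⟨h₁.1.append h₂.1, fun ψ hψ => ?_⟩
  obtain ⟨a1, a2, a3⟩ := h₁.2 ψ hψ
  obtain ⟨b1, b2, b3⟩ := h₂.2 _ a1
  refine ⟨b1, b2.trans a2, ?_⟩
  rw [run_append, LinearMap.comp_apply]
  have : run g₂ (run g₁ ψ) - I₂ (I₁ ψ)
      = run g₂ (run g₁ ψ - I₁ ψ) + (run g₂ (I₁ ψ) - I₂ (I₁ ψ)) := by
    rw [map_sub]; abel
  rw [this]
  refine (norm_add_le _ _).trans ?_
  rw [norm_run h₂.1, add_mul]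
  rw [a2] at b3
  exact add_le_add a3 b3

theorem Approx.mono {g : List Gate} {I : QState →ₗ[ℂ] QState} {A A' B B' : Set BasisState}
    {ε ε' : ℝ} (h : Approx g I A B ε) (hA : A' ⊆ A) (hB : B ⊆ B') (hε : ε ≤ ε') :
    Approx g I A' B' ε' := by
  refine ⟨h.1, fun ψ hψ => ?_⟩
  obtain ⟨a1, a2, a3⟩ := h.2 ψ (hψ.mono hA)
  exact ⟨a1.mono hB, a2, a3.trans (mul_le_mul_of_nonneg_right hε (norm_nonneg _))⟩

theorem Approx.exact {g : List Gate} (hd : Distinct g) {A B : Set BasisState}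
    (h : ∀ ψ, Supp A ψ → Supp B (run g ψ)) : Approx g (run g) A B 0 :=
  ⟨hd, fun ψ hψ => ⟨h ψ hψ, norm_run hd ψ, by simp⟩⟩

/-- The `j`-fold repetition of a sequence of operations. -/
def repGates (j : ℕ) (gs : List Gate) : List Gate := (List.range j).flatMap fun _ => gs

theorem repGates_succ (j : ℕ) (gs : List Gate) : repGates (j + 1) gs = repGates j gs ++ gs := by
  simp [repGates, List.range_succ]

/-- Errors of the steps add up, as the operators are isometries. -/
theorem Approx.rep {g : List Gate} {I : QState →ₗ[ℂ] QState} {A : Set BasisState} {ε : ℝ}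
    (h : Approx g I A A ε) (j : ℕ) : Approx (repGates j g) (I ^ j) A A (j * ε) := by
  induction j with
  | zero =>
    refine ⟨fun G hG => by simp [repGates] at hG, fun ψ hψ => ?_⟩
    simpa [repGates] using hψ
  | succ j ih =>
    rw [repGates_succ, pow_succ']
    have := ih.trans h
    push_cast
    rw [add_mul, one_mul]
    exact this

theorem local_basisMap {W : Set Qubit} {τ : BasisState → BasisState}
    (h : ∀ b, ∀ q ∉ W, τ b q = b q) : Local W (basisMap τ) := by
  classical
  intro b b' hb
  rw [basisMap_single, Finsupp.single_apply] at hb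
  split_ifs at hb with e
  · rw [← e]; exact h b
  · exact absurd rfl hb

/-- It suffices to know the accuracy of a classical computation on basis states, if these can be
told apart by the qubits that are not changed. -/
theorem approx_basisMap {g : List Gate} {τ : BasisState → BasisState} {W : Set Qubit}
    {A B : Set BasisState} {ε : ℝ} (hd : Distinct g) (hW : ∀ G ∈ g, G.writes ⊆ W)
    (hA : Transversal W A) (hτ : ∀ b, ∀ q ∉ W, τ b q = b q) (hAB : ∀ b ∈ A, τ b ∈ B) (hε : 0 ≤ ε)
    (h : ∀ b ∈ A, ‖run g (Finsupp.single b 1) - Finsupp.single (τ b) 1‖ ≤ ε) :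
    Approx g (basisMap τ) A B ε := by
  refine ⟨hd, fun ψ hψ => ⟨?_, ?_, ?_⟩⟩
  · rw [map_eq_sum]
    refine supp_sum fun b hb => ?_
    rw [basisMap_single]
    exact (supp_single (hAB b (hψ b (Finsupp.mem_support_iff.1 hb))) _).smul _
  · refine norm_map_eq (local_basisMap hτ) hA hψ fun b _ => ?_
    rw [basisMap_single, norm_single, norm_one]
  · rw [← LinearMap.sub_apply]
    refine norm_map_le ((local_run hW).sub (local_basisMap hτ)) hA hψ hε fun b hb => ?_
    rw [LinearMap.sub_apply, basisMap_single]
    exact h b hb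

/-- The diagonal operator that negates the amplitudes of the basis states that satisfy `Q`. -/
def phaseOp (Q : BasisState → Bool) : QState →ₗ[ℂ] QState :=
  Finsupp.linearCombination ℂ fun b => Finsupp.single b (if Q b then -1 else 1)

theorem phaseOp_single (Q : BasisState → Bool) (b : BasisState) (z : ℂ) :
    phaseOp Q (Finsupp.single b z) = Finsupp.single b ((if Q b then -1 else 1) * z) := by
  simp [phaseOp, mul_comm]

theorem phaseOp_apply (Q : BasisState → Bool) (ψ : QState) (b : BasisState) :
    phaseOp Q ψ b = (if Q b then -1 else 1) * ψ b := by
  classical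
  induction ψ using Finsupp.induction_linear with
  | zero => simp
  | add φ ψ h₁ h₂ => rw [map_add, Finsupp.add_apply, h₁, h₂, Finsupp.add_apply, mul_add]
  | single c z =>
    rw [phaseOp_single, Finsupp.single_apply, Finsupp.single_apply]
    split_ifs <;> simp_all

theorem phaseOp_supp {Q : BasisState → Bool} {A : Set BasisState} {ψ : QState} (h : Supp A ψ) :
    Supp A (phaseOp Q ψ) := fun b hb => h b fun h0 => hb (by simp [phaseOp_apply, h0])

theorem norm_phaseOp (Q : BasisState → Bool) (ψ : QState) : ‖phaseOp Q ψ‖ = ‖ψ‖ := by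
  refine norm_map_of_inner_basis (fun b b' => ?_) ψ
  rw [phaseOp_single, phaseOp_single]
  refine inner_single_of_injective (τ := id) Function.injective_id b b' ?_
  rintro rfl
  split_ifs <;> simp

theorem local_phaseOp (W : Set Qubit) (Q : BasisState → Bool) : Local W (phaseOp Q) := by
  classical
  intro b b' hb q _
  rw [phaseOp_single, Finsupp.single_apply] at hb
  split_ifs at hb with h <;> first | exact (congrFun h q).symm | exact absurd rfl hb

/-- The phase flip `Z = T⁴`. -/
def zGates (f : ℕ) : List Gate := [.phase f, .phase f, .phase f, .phase f]

/-- `T ^ 4 = Z`. -/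
theorem run_zGates (f : ℕ) : run (zGates f) = phaseOp fun b => b (.work f) := by
  refine linearMap_ext fun b => ?_
  have hs (z : ℂ) : (Gate.phase f).op (Finsupp.single b z)
      = Finsupp.single b
          (z * if b (.work f) then Complex.exp (Complex.I * (Real.pi / 4)) else 1) := by
    simp [Gate.op, Gate.onBasis]
  simp only [zGates, run_cons, run_nil, LinearMap.id_apply, hs, phaseOp_single]
  congr 1
  split_ifs
  · rw [one_mul, mul_one, ← Complex.exp_add, ← Complex.exp_add, ← Complex.exp_add,
      ← Complex.exp_pi_mul_I]
    congr 1; ring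
  · simp

/-- Compute with `gs`, negate the phase if the qubit `f` is set, and uncompute. -/
def phaseKick (gs : List Gate) (f : ℕ) : List Gate := gs ++ zGates f ++ invGates gs

/-- Computing a predicate, applying `Z` to the result, and uncomputing the predicate. -/
theorem Approx.phaseKick {g : List Gate} {τ : BasisState → BasisState} {A B : Set BasisState}
    {ε : ℝ} (h : Approx g (basisMap τ) A B ε) {f : ℕ} {Q : BasisState → Bool}
    (hQ : ∀ b ∈ A, τ b (.work f) = Q b) : Approx (phaseKick g f) (phaseOp Q) A A (2 * ε) := by
  have hz : Distinct (zGates f) := by simp [Distinct, zGates, Gate.qubits]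
  refine ⟨(h.1.append hz).append h.1.inv, fun ψ hψ => ⟨phaseOp_supp hψ, norm_phaseOp Q ψ, ?_⟩⟩
  have e : run (zGates f) (basisMap τ ψ) = basisMap τ (phaseOp Q ψ) := by
    rw [run_zGates, map_eq_sum (basisMap τ) ψ, map_eq_sum (phaseOp Q) ψ, map_sum, map_sum]
    refine Finset.sum_congr rfl fun b hb => ?_
    rw [map_smul, map_smul, basisMap_single, phaseOp_single, phaseOp_single, basisMap_single,
      hQ b (hψ b (Finsupp.mem_support_iff.1 hb))]
  rw [Fract.phaseKick, run_append, run_append]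
  have e2 : run (invGates g) (run (zGates f) (run g ψ)) - phaseOp Q ψ
      = run (invGates g) (run (zGates f) (run g ψ - basisMap τ ψ))
        - run (invGates g) (run g (phaseOp Q ψ) - basisMap τ (phaseOp Q ψ)) := by
    simp only [map_sub, e, run_invGates_run h.1]; abel
  rw [e2]
  refine (norm_sub_le _ _).trans ?_
  rw [norm_run h.1.inv, norm_run h.1.inv, norm_run hz]
  have h1 := (h.2 ψ hψ).2.2
  have h2 := (h.2 _ (phaseOp_supp (Q := Q) hψ)).2.2
  rw [norm_phaseOp] at h2
  linarith

/-! ### Independent repetitions -/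

/-- The composition of the operators `L 0, …, L (N - 1)`. -/
def seqOp (L : ℕ → QState →ₗ[ℂ] QState) : ℕ → QState →ₗ[ℂ] QState
  | 0 => LinearMap.id
  | N + 1 => L N ∘ₗ seqOp L N

/-- Operators that act on pairwise disjoint sets of qubits, and whose effect does not depend on the
sets of the earlier ones, behave like independent random experiments: the expectation of a product
of quantities read off from the single sets is the product of the expectations. -/
theorem wt_prod_le (L : ℕ → QState →ₗ[ℂ] QState) (W : ℕ → Set Qubit) (F : ℕ → BasisState → ℝ)
    (κ : ℕ → ℝ) (b₀ : BasisState) (A : ℕ → Set BasisState)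
    (hA : ∀ i, A i = {b | ∀ q, (∀ j < i, q ∉ W j) → b q = b₀ q}) (N : ℕ)
    (hdisj : ∀ i j, j < i → i < N → Disjoint (W j) (W i))
    (hFnn : ∀ i b, 0 ≤ F i b)
    (hF : ∀ i < N, ∀ b b', (∀ q ∈ W i, b q = b' q) → F i b = F i b')
    (hloc : ∀ i < N, ∀ b ∈ A i, ∀ b', L i (Finsupp.single b 1) b' ≠ 0 → ∀ q ∉ W i, b' q = b q)
    (hκ0 : ∀ i < N, 0 ≤ κ i)
    (hκ : ∀ i < N, ∀ b ∈ A i, wt (F i) (L i (Finsupp.single b 1)) ≤ κ i) :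
    Supp (A N) (seqOp L N (Finsupp.single b₀ 1)) ∧
      wt (fun b => ∏ i ∈ Finset.range N, F i b) (seqOp L N (Finsupp.single b₀ 1))
        ≤ ∏ i ∈ Finset.range N, κ i := by
  induction N with
  | zero =>
    refine ⟨supp_single (by simp [hA]) _, ?_⟩
    simp [seqOp, wt_single]
  | succ N ih =>
    obtain ⟨ihS, ihw⟩ := ih (fun i j hj hi => hdisj i j hj (by omega)) (fun i hi => hF i (by omega))
      (fun i hi => hloc i (by omega)) (fun i hi => hκ0 i (by omega)) (fun i hi => hκ i (by omega))
    set ψ := seqOp L N (Finsupp.single b₀ 1) with hψ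
    have hstep : seqOp L (N + 1) (Finsupp.single b₀ 1) = L N ψ := rfl
    have hWb (b : BasisState) (hb : b ∈ A N) : ∀ q ∈ W N, b q = b₀ q := by
      rw [hA] at hb
      exact fun q hq => hb q fun j hj hqj =>
        Set.disjoint_left.1 (hdisj N j hj (by omega)) hqj hq
    have hl := hloc N (by omega)
    rw [hstep]
    constructor
    · intro b' hb'
      rw [map_eq_sum, Finsupp.finsetSum_apply] at hb'
      obtain ⟨b, hb, hne⟩ := Finset.exists_ne_zero_of_sum_ne_zero hb'
      have hbA := ihS b (Finsupp.mem_support_iff.1 hb)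
      have hne' : L N (Finsupp.single b 1) b' ≠ 0 := fun h0 => hne (by simp [h0])
      have h1 := hl b hbA b' hne'
      rw [hA] at hbA ⊢
      intro q hq
      rw [h1 q (hq N (by omega)), hbA q fun j hj => hq j (by omega)]
    · rw [wt_map_of_disjoint (ψ := ψ)]
      · rw [Finset.prod_range_succ, mul_comm]
        refine le_trans ?_ (mul_le_mul_of_nonneg_left ihw (hκ0 N (by omega)))
        rw [← wt_const_mul]
        refine wt_mono fun b hb => ?_
        have hbA := ihS b hb
        have : wt (fun b => ∏ i ∈ Finset.range (N + 1), F i b) (L N (Finsupp.single b 1))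
            = (∏ i ∈ Finset.range N, F i b) * wt (F N) (L N (Finsupp.single b 1)) := by
          rw [← wt_const_mul]
          refine wt_congr fun b' hb' => ?_
          rw [Finset.prod_range_succ]
          congr 1
          refine Finset.prod_congr rfl fun i hi => ?_
          rw [Finset.mem_range] at hi
          refine hF i (by omega) b' b fun q hq => ?_
          exact hl b hbA b' hb' q fun hqN =>
            Set.disjoint_left.1 (hdisj N i hi (by omega)) hq hqN
        rw [this, mul_comm]
        exact mul_le_mul_of_nonneg_right (hκ N (by omega) b hbA)
          (Finset.prod_nonneg fun i _ => hFnn i b)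
      · intro b₁ b₂ b' h₁ h₂ h₁' h₂'
        have hb₁ := ihS b₁ h₁
        have hb₂ := ihS b₂ h₂
        funext q
        by_cases hq : q ∈ W N
        · rw [hWb b₁ hb₁ q hq, hWb b₂ hb₂ q hq]
        · rw [← hl b₁ hb₁ b' h₁' q hq, hl b₂ hb₂ b' h₂' q hq]

/-! ### Classical programs -/

/-- A quadratic Boolean expression over the field with two elements: the pair `(a, b)` stands for
the product of the qubits `a` and `b`, and a list for the sum of its entries. -/
abbrev Expr := List (ℕ × ℕ)

/-- The value of an expression under an assignment of the variables. -/
def exprVal (e : Expr) (v : ℕ → Bool) : Bool :=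
  e.foldr (fun t acc => xor (v t.1 && v t.2) acc) false

@[simp] theorem exprVal_nil (v : ℕ → Bool) : exprVal [] v = false := rfl

@[simp] theorem exprVal_cons (t : ℕ × ℕ) (e : Expr) (v : ℕ → Bool) :
    exprVal (t :: e) v = xor (v t.1 && v t.2) (exprVal e v) := rfl

@[simp] theorem exprVal_append (e e' : Expr) (v : ℕ → Bool) :
    exprVal (e ++ e') v = xor (exprVal e v) (exprVal e' v) := by
  induction e with
  | nil => simp
  | cons t e ih => simp [ih]

theorem exprVal_congr {e : Expr} {v v' : ℕ → Bool} (h : ∀ t ∈ e, v t.1 = v' t.1 ∧ v t.2 = v' t.2) :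
    exprVal e v = exprVal e v' := by
  induction e with
  | nil => rfl
  | cons t e ih =>
    rw [exprVal_cons, exprVal_cons, (h t (by simp)).1, (h t (by simp)).2,
      ih fun t ht => h t (List.mem_cons_of_mem _ ht)]

/-- The contents of the work qubits. -/
def workBits (b : BasisState) : ℕ → Bool := fun q => b (.work q)

/-- Add the value of an expression to the qubit `t`. -/
def assignGates (t : ℕ) (e : Expr) : List Gate :=
  e.map fun p => if p.1 = p.2 then .cnot p.1 t else .toffoli p.1 p.2 t

theorem run_assignGates {t : ℕ} {e : Expr} (h : ∀ p ∈ e, p.1 ≠ t ∧ p.2 ≠ t) (b : BasisState) :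
    run (assignGates t e) (Finsupp.single b 1)
      = Finsupp.single (xorAt t (exprVal e (workBits b)) b) 1 := by
  induction e generalizing b with
  | nil => simp [assignGates, xorAt]
  | cons p e ih =>
    have hp := h p (by simp)
    have hstep : (if p.1 = p.2 then Gate.cnot p.1 t else .toffoli p.1 p.2 t).op
        (Finsupp.single b 1) = Finsupp.single (xorAt t (workBits b p.1 && workBits b p.2) b) 1 := by
      rw [Gate.op_single]
      split_ifs with he
      · simp [Gate.onBasis, xorAt, workBits, he]
      · simp [Gate.onBasis, xorAt, workBits]
    have hc : assignGates t (p :: e)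
        = (if p.1 = p.2 then Gate.cnot p.1 t else .toffoli p.1 p.2 t) :: assignGates t e := rfl
    rw [hc, run_cons, hstep, ih fun p hp => h p (List.mem_cons_of_mem _ hp)]
    congr 1
    have : exprVal e (workBits (xorAt t (workBits b p.1 && workBits b p.2) b))
        = exprVal e (workBits b) := by
      refine exprVal_congr fun s hs => ?_
      have := h s (List.mem_cons_of_mem _ hs)
      simp [workBits, xorAt, this.1, this.2]
    rw [this, exprVal_cons]
    simp [xorAt]

/-- A program computes the values of its expressions, one after the other, in the consecutive
qubits `p, p + 1, …`. -/
def progGates (p : ℕ) : List Expr → List Gate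
  | [] => []
  | e :: es => assignGates p e ++ progGates (p + 1) es

/-- Each expression of the program refers to earlier qubits only. -/
def WFProg (p : ℕ) : List Expr → Prop
  | [] => True
  | e :: es => (∀ t ∈ e, t.1 < p ∧ t.2 < p) ∧ WFProg (p + 1) es

/-- The effect of a program on a basis state. -/
def execProg (p : ℕ) : List Expr → BasisState → BasisState
  | [], b => b
  | e :: es, b => execProg (p + 1) es (xorAt p (exprVal e (workBits b)) b)

/-- In the basis state `φ`, the qubits `p, p + 1, …` hold the values of the expressions. -/
def Sat (p : ℕ) : List Expr → BasisState → Prop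
  | [], _ => True
  | e :: es, φ => φ (.work p) = exprVal e (workBits φ) ∧ Sat (p + 1) es φ

theorem wfProg_append {p : ℕ} {es fs : List Expr} :
    WFProg p (es ++ fs) ↔ WFProg p es ∧ WFProg (p + es.length) fs := by
  induction es generalizing p with
  | nil => simp [WFProg]
  | cons e es ih =>
    simp only [List.cons_append, WFProg, ih, List.length_cons, and_assoc]
    rw [show p + 1 + es.length = p + (es.length + 1) by omega]

theorem sat_append {p : ℕ} {es fs : List Expr} {φ : BasisState} :
    Sat p (es ++ fs) φ ↔ Sat p es φ ∧ Sat (p + es.length) fs φ := by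
  induction es generalizing p with
  | nil => simp [Sat]
  | cons e es ih =>
    simp only [List.cons_append, Sat, ih, List.length_cons, and_assoc]
    rw [show p + 1 + es.length = p + (es.length + 1) by omega]

theorem wfProg_map_range {p N : ℕ} {e : ℕ → Expr} :
    WFProg p ((List.range N).map e) ↔ ∀ k < N, ∀ t ∈ e k, t.1 < p + k ∧ t.2 < p + k := by
  induction N with
  | zero => simp [WFProg]
  | succ N ih =>
    rw [List.range_succ, List.map_append, wfProg_append, ih]
    simp only [List.map_cons, List.map_nil, WFProg, and_true, List.length_map, List.length_range]
    constructor
    · rintro ⟨h1, h2⟩ k hk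
      rcases Nat.lt_succ_iff_lt_or_eq.1 hk with h | rfl
      · exact h1 k h
      · exact h2
    · exact fun h => ⟨fun k hk => h k (by omega), h N (by omega)⟩

theorem sat_map_range {p N : ℕ} {e : ℕ → Expr} {φ : BasisState} :
    Sat p ((List.range N).map e) φ ↔
      ∀ k < N, φ (.work (p + k)) = exprVal (e k) (workBits φ) := by
  induction N with
  | zero => simp [Sat]
  | succ N ih =>
    rw [List.range_succ, List.map_append, sat_append, ih]
    simp only [List.map_cons, List.map_nil, Sat, and_true, List.length_map, List.length_range]
    constructor
    · rintro ⟨h1, h2⟩ k hk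
      rcases Nat.lt_succ_iff_lt_or_eq.1 hk with h | rfl
      · exact h1 k h
      · exact h2
    · exact fun h => ⟨fun k hk => h k (by omega), h N (by omega)⟩

theorem length_flatMap_range {α : Type*} {N w : ℕ} {f : ℕ → List α}
    (hf : ∀ i < N, (f i).length = w) :
    ((List.range N).flatMap f).length = N * w := by
  induction N with
  | zero => simp
  | succ N ih =>
    rw [List.range_succ, List.flatMap_append, List.length_append, ih fun i hi => hf i (by omega)]
    simp [hf N (by omega), Nat.succ_mul]

theorem wfProg_flatMap_range {p N w : ℕ} {f : ℕ → List Expr} (hf : ∀ i < N, (f i).length = w) :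
    WFProg p ((List.range N).flatMap f) ↔ ∀ i < N, WFProg (p + i * w) (f i) := by
  induction N with
  | zero => simp [WFProg]
  | succ N ih =>
    have hf' : ∀ i < N, (f i).length = w := fun i hi => hf i (by omega)
    rw [List.range_succ, List.flatMap_append, wfProg_append, ih hf', length_flatMap_range hf']
    simp only [List.flatMap_cons, List.flatMap_nil, List.append_nil]
    constructor
    · rintro ⟨h1, h2⟩ k hk
      rcases Nat.lt_succ_iff_lt_or_eq.1 hk with h | rfl
      · exact h1 k h
      · exact h2
    · exact fun h => ⟨fun k hk => h k (by omega), h N (by omega)⟩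

theorem sat_flatMap_range {p N w : ℕ} {f : ℕ → List Expr} (hf : ∀ i < N, (f i).length = w)
    {φ : BasisState} :
    Sat p ((List.range N).flatMap f) φ ↔ ∀ i < N, Sat (p + i * w) (f i) φ := by
  induction N with
  | zero => simp [Sat]
  | succ N ih =>
    have hf' : ∀ i < N, (f i).length = w := fun i hi => hf i (by omega)
    rw [List.range_succ, List.flatMap_append, sat_append, ih hf', length_flatMap_range hf']
    simp only [List.flatMap_cons, List.flatMap_nil, List.append_nil]
    constructor
    · rintro ⟨h1, h2⟩ k hk
      rcases Nat.lt_succ_iff_lt_or_eq.1 hk with h | rfl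
      · exact h1 k h
      · exact h2
    · exact fun h => ⟨fun k hk => h k (by omega), h N (by omega)⟩

theorem run_progGates {p : ℕ} {es : List Expr} (h : WFProg p es) (b : BasisState) :
    run (progGates p es) (Finsupp.single b 1) = Finsupp.single (execProg p es b) 1 := by
  induction es generalizing p b with
  | nil => rfl
  | cons e es ih =>
    rw [progGates, run_append, run_assignGates fun t ht => ⟨(h.1 t ht).1.ne, (h.1 t ht).2.ne⟩,
      ih h.2, execProg]

theorem execProg_of_lt {p : ℕ} {es : List Expr} {b : BasisState} {x : Qubit}
    (h : ∀ q, p ≤ q → q < p + es.length → x ≠ .work q) : execProg p es b x = b x := by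
  induction es generalizing p b with
  | nil => rfl
  | cons e es ih =>
    rw [execProg, ih fun q hq hq' => h q (by omega) (by simp at hq' ⊢; omega)]
    have := h p le_rfl (by simp)
    simp [xorAt, this]

/-- The state after the execution of a program on fresh qubits satisfies all of its assignments.
As no qubit is assigned twice, this describes the result without reference to the intermediate
states. -/
theorem sat_execProg {p : ℕ} {es : List Expr} (h : WFProg p es) {b : BasisState}
    (hb : ∀ q, p ≤ q → q < p + es.length → b (.work q) = false) : Sat p es (execProg p es b) := by
  induction es generalizing p b with
  | nil => trivial
  | cons e es ih =>
    have hlt (q : ℕ) (hq : q ≤ p) : execProg p (e :: es) b (.work q)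
        = xorAt p (exprVal e (workBits b)) b (.work q) := by
      rw [execProg]
      refine execProg_of_lt fun q' hq' _ hqq => ?_
      have := Qubit.work.inj hqq; omega
    refine ⟨?_, ?_⟩
    · rw [hlt p le_rfl]
      have : exprVal e (workBits (execProg p (e :: es) b)) = exprVal e (workBits b) := by
        refine exprVal_congr fun t ht => ?_
        have ht' := h.1 t ht
        simp only [workBits]
        rw [hlt _ ht'.1.le, hlt _ ht'.2.le]
        simp [xorAt, ht'.1.ne, ht'.2.ne]
      rw [this]
      simp [xorAt, hb p le_rfl (by simp)]
    · refine ih h.2 fun q hq hq' => ?_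
      have := hb q (by omega) (by simp; omega)
      simp only [xorAt]
      rw [Function.update_of_ne (by simp; omega), this]

theorem mem_assignGates {t : ℕ} {e : Expr} {G : Gate} (h : G ∈ assignGates t e) :
    ∃ p ∈ e, G = if p.1 = p.2 then .cnot p.1 t else .toffoli p.1 p.2 t := by
  simpa [assignGates, eq_comm] using h

theorem distinct_progGates {p : ℕ} {es : List Expr} (h : WFProg p es) :
    Distinct (progGates p es) := by
  induction es generalizing p with
  | nil => intro G hG; simp [progGates] at hG
  | cons e es ih =>
    refine Distinct.append (fun G hG => ?_) (ih h.2)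
    obtain ⟨t, ht, rfl⟩ := mem_assignGates hG
    have := h.1 t ht
    split_ifs with he
    · simp [Gate.qubits]; omega
    · simp [Gate.qubits]; omega

theorem qubits_progGates {p : ℕ} {es : List Expr} {P : ℕ → Prop}
    (h : ∀ e ∈ es, ∀ t ∈ e, P t.1 ∧ P t.2) (hp : ∀ q, p ≤ q → q < p + es.length → P q) :
    ∀ G ∈ progGates p es, ∀ q ∈ G.qubits, P q := by
  induction es generalizing p with
  | nil => intro G hG; simp [progGates] at hG
  | cons e es ih =>
    intro G hG
    rcases List.mem_append.1 hG with hG | hG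
    · obtain ⟨t, ht, rfl⟩ := mem_assignGates hG
      have h1 := h e (by simp) t ht
      have h2 := hp p le_rfl (by simp)
      intro q hq
      split_ifs at hq with he
      · simp [Gate.qubits] at hq
        rcases hq with rfl | rfl
        · exact h1.1
        · exact h2
      · simp [Gate.qubits] at hq
        rcases hq with rfl | rfl | rfl
        · exact h1.1
        · exact h1.2
        · exact h2
    · exact ih (fun e he => h e (List.mem_cons_of_mem _ he))
        (fun q hq hq' => hp q (by omega) (by simp at hq' ⊢; omega)) G hG

theorem writes_progGates {p : ℕ} {es : List Expr} :
    ∀ G ∈ progGates p es, G.writes ⊆ {x | ∃ q, p ≤ q ∧ q < p + es.length ∧ x = .work q} := by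
  induction es generalizing p with
  | nil => intro G hG; simp [progGates] at hG
  | cons e es ih =>
    intro G hG
    rcases List.mem_append.1 hG with hG | hG
    · obtain ⟨t, ht, rfl⟩ := mem_assignGates hG
      intro x hx
      refine ⟨p, le_rfl, by simp, ?_⟩
      split_ifs at hx <;> simpa [Gate.writes] using hx
    · refine (ih G hG).trans ?_
      rintro x ⟨q, h1, h2, rfl⟩
      exact ⟨q, by omega, by simp; omega, rfl⟩

/-- Program operations use no QRAM. -/
theorem registersFit_progGates {p : ℕ} {es : List Expr} (a w : ℕ) :
    ∀ G ∈ progGates p es, G.RegistersFit a w := by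
  induction es generalizing p with
  | nil => intro G hG; simp [progGates] at hG
  | cons e es ih =>
    intro G hG
    rcases List.mem_append.1 hG with hG | hG
    · obtain ⟨t, ht, rfl⟩ := mem_assignGates hG
      split_ifs <;> trivial
    · exact ih G hG

/-- The number of products in a program. -/
def progCost (es : List Expr) : ℕ := (es.map List.length).sum

theorem length_progGates (p : ℕ) (es : List Expr) : (progGates p es).length = progCost es := by
  induction es generalizing p with
  | nil => rfl
  | cons e es ih => simp [progGates, assignGates, progCost, ih]

theorem progCost_le {es : List Expr} {B : ℕ} (h : ∀ e ∈ es, e.length ≤ B) :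
    progCost es ≤ es.length * B := by
  induction es with
  | nil => simp [progCost]
  | cons e es ih =>
    have h1 := h e (by simp)
    have h2 := ih fun e he => h e (List.mem_cons_of_mem _ he)
    simp only [progCost, List.map_cons, List.sum_cons, List.length_cons, Nat.succ_mul] at *
    omega

theorem progCost_append (es fs : List Expr) : progCost (es ++ fs) = progCost es + progCost fs := by
  simp [progCost]

/-! ### Binary numbers -/

theorem bitsVal_nil : bitsVal [] = 0 := rfl

theorem bitsVal_cons (v : Bool) (l : List Bool) : bitsVal (v :: l) = v.toNat + 2 * bitsVal l := by
  simp [bitsVal, Nat.ofDigits_cons]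

theorem bitsVal_append (l l' : List Bool) :
    bitsVal (l ++ l') = bitsVal l + 2 ^ l.length * bitsVal l' := by
  simp [bitsVal, Nat.ofDigits_append]

theorem testBit_bitsVal (l : List Bool) (i : ℕ) : (bitsVal l).testBit i = l.getD i false := by
  induction l generalizing i with
  | nil => simp [bitsVal_nil]
  | cons v l ih =>
    rw [bitsVal_cons]
    cases i with
    | zero => cases v <;> simp [Nat.testBit_zero, Nat.add_mul_mod_self_left]
    | succ i =>
      have : (v.toNat + 2 * bitsVal l) / 2 = bitsVal l := by
        have := Bool.toNat_lt v; omega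
      rw [Nat.testBit_succ, this, ih]; simp

theorem bitsVal_eq_of_testBit {l : List Bool} {x : ℕ} (hx : x < 2 ^ l.length)
    (h : ∀ i (hi : i < l.length), l[i] = x.testBit i) : bitsVal l = x := by
  refine Nat.eq_of_testBit_eq fun i => ?_
  rw [testBit_bitsVal]
  by_cases hi : i < l.length
  · rw [List.getD_eq_getElem _ _ hi, h i hi]
  · rw [List.getD_eq_default _ _ (by omega), Nat.testBit_lt_two_pow]
    exact hx.trans_le (Nat.pow_le_pow_right (by norm_num) (by omega))

/-! ### Running a circuit on a part of the qubits -/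

/-- The address register of a copy of a circuit: the one of the circuit, filled up with zero qubits
to width `A`, followed by `s` qubits that hold the number of the copy. -/
def padAddr (base wm s A : ℕ) (addr : List ℕ) : List ℕ :=
  addr.map (base + ·) ++ (List.range (A - addr.length)).map (base + wm + s + ·) ++
    (List.range s).map (base + wm + ·)

/-- The target register of a copy of a circuit, filled up with zero qubits to width `w`. -/
def padTgt (base wm s A w : ℕ) (tgt : List ℕ) : List ℕ :=
  tgt.map (base + ·) ++ (List.range (w - tgt.length)).map (base + wm + s + A + ·)

/-- The operation of a copy of a circuit. The copy has its own work qubits `base, …, base + wm - 1`,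
and the part of the QRAM whose addresses end with the number of the copy. Operations on empty data
items do nothing and are dropped. -/
def placeGate (base wm s A w : ℕ) : Gate → List Gate
  | .not q => [.not (base + q)]
  | .had q => [.had (base + q)]
  | .phase q => [.phase (base + q)]
  | .phaseInv q => [.phaseInv (base + q)]
  | .cnot c t => [.cnot (base + c) (base + t)]
  | .toffoli c₁ c₂ t => [.toffoli (base + c₁) (base + c₂) (base + t)]
  | .qread addr tgt =>
      if tgt.length = 0 then [] else [.qread (padAddr base wm s A addr) (padTgt base wm s A w tgt)]
  | .qswap addr tgt =>
      if tgt.length = 0 then [] else [.qswap (padAddr base wm s A addr) (padTgt base wm s A w tgt)]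

/-- A circuit whose qubits are moved to `base, …`, and which uses the part of the QRAM with number
`c`. -/
def placeGates (base wm s A w : ℕ) (gs : List Gate) : List Gate :=
  gs.flatMap (placeGate base wm s A w)

/-- The basis state of the whole machine in which the copy of a circuit is in the state `φ`, and
everything else is as in `b`. -/
def embed (base wm A c a wd : ℕ) (b φ : BasisState) : BasisState
  | .work q => if base ≤ q ∧ q < base + wm then φ (.work (q - base)) else b (.work q)
  | .cell i j =>
      if i / 2 ^ A = c ∧ i % 2 ^ A < 2 ^ a ∧ j < wd then φ (.cell (i % 2 ^ A) j) else b (.cell i j)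

/-- The auxiliary registers of the copy number `c` are set up. -/
structure CopyReady (base wm s A w c : ℕ) (b : BasisState) : Prop where
  num : ∀ l < s, b (.work (base + wm + l)) = c.testBit l
  zeros : ∀ l < A, b (.work (base + wm + s + l)) = false
  pads : ∀ l < w, b (.work (base + wm + s + A + l)) = false
  cells : ∀ i j, i / 2 ^ A = c → b (.cell i j) = false

/-- The operation fits into a circuit with `wm` work qubits and the given QRAM parameters. -/
def GateOK (work a w : ℕ) (G : Gate) : Prop :=
  (∀ q ∈ G.qubits, q < work) ∧ G.qubits.Nodup ∧ G.RegistersFit a w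

theorem GateOK.mono {work work' a w : ℕ} {G : Gate} (h : GateOK work a w G) (hw : work ≤ work') :
    GateOK work' a w G := ⟨fun q hq => (h.1 q hq).trans_le hw, h.2⟩

section Embedding

variable {base wm s A w c a wd : ℕ} {b : BasisState}

theorem embed_work (φ : BasisState) {q : ℕ} (hq : q < wm) :
    embed base wm A c a wd b φ (.work (base + q)) = φ (.work q) := by
  simp [embed, hq]

theorem embed_work_of_le (φ : BasisState) {q : ℕ} (hq : base + wm ≤ q) :
    embed base wm A c a wd b φ (.work q) = b (.work q) := by
  have : ¬ (base ≤ q ∧ q < base + wm) := by omega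
  simp [embed, this]

theorem embed_update (φ : BasisState) {q : ℕ} (hq : q < wm) (v : Bool) :
    embed base wm A c a wd b (Function.update φ (.work q) v)
      = Function.update (embed base wm A c a wd b φ) (.work (base + q)) v := by
  funext x
  cases x with
  | cell i j => simp [embed]
  | work x =>
    by_cases hx : x = base + q
    · subst hx; simp [embed, hq]
    · rw [Function.update_of_ne (by simpa using hx)]
      simp only [embed]
      split_ifs with h
      · rw [Function.update_of_ne (by simp; omega)]
      · rfl

theorem address_embed (hb : CopyReady base wm s A w c b) (hc : c < 2 ^ s) {φ : BasisState}
    {addr : List ℕ} (ha : addr.length ≤ A) (hlt : ∀ q ∈ addr, q < wm) :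
    address (embed base wm A c a wd b φ) (padAddr base wm s A addr)
      = address φ addr + 2 ^ A * c := by
  have e1 : (addr.map (base + ·)).map (fun q => embed base wm A c a wd b φ (.work q))
      = addr.map fun q => φ (.work q) := by
    rw [List.map_map]
    exact List.map_congr_left fun q hq => by
      simpa using
        embed_work (base := base) (A := A) (c := c) (a := a) (wd := wd) (b := b) φ (hlt q hq)
  have e2 : bitsVal (((List.range (A - addr.length)).map (base + wm + s + ·)).map
      (fun q => embed base wm A c a wd b φ (.work q))) = 0 := by
    refine bitsVal_eq_of_testBit (by positivity) fun i hi => ?_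
    have hi' : i < A - addr.length := by simpa using hi
    simp only [List.getElem_map, List.getElem_range, Nat.zero_testBit]
    rw [embed_work_of_le _ (by omega), hb.zeros i (by omega)]
  have e3 : bitsVal (((List.range s).map (base + wm + ·)).map
      (fun q => embed base wm A c a wd b φ (.work q))) = c := by
    refine bitsVal_eq_of_testBit (by simpa using hc) fun i hi => ?_
    have hi' : i < s := by simpa using hi
    simp only [List.getElem_map, List.getElem_range]
    rw [embed_work_of_le _ (by omega), hb.num i hi']
  rw [address, padAddr, List.map_append, List.map_append, bitsVal_append, bitsVal_append, e1, e2,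
    e3]
  simp only [List.length_append, List.length_map, List.length_range, mul_zero, add_zero]
  rw [Nat.add_sub_cancel' ha]
  rfl

theorem getD_padTgt_of_lt {tgt : List ℕ} {j : ℕ} (hj : j < tgt.length) :
    (padTgt base wm s A w tgt).getD j 0 = base + tgt.getD j 0 := by
  rw [padTgt, List.getD_append _ _ _ _ (by simpa using hj), List.getD_eq_getElem _ _
      (by simpa using hj),
    List.getD_eq_getElem _ _ hj]
  simp

theorem getD_padTgt_of_ge {tgt : List ℕ} {j : ℕ} (hj : tgt.length ≤ j) (hw : j < w) :
    (padTgt base wm s A w tgt).getD j 0 = base + wm + s + A + (j - tgt.length) := by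
  rw [padTgt, List.getD_append_right _ _ _ _ (by simpa using hj),
    List.getD_eq_getElem _ _ (by simp; omega)]
  simp

theorem length_padTgt {tgt : List ℕ} (h : tgt.length ≤ w) :
    (padTgt base wm s A w tgt).length = w := by
  simp [padTgt]; omega

theorem length_padAddr {addr : List ℕ} (h : addr.length ≤ A) :
    (padAddr base wm s A addr).length = A + s := by
  simp [padAddr]; omega

theorem nodup_padTgt {tgt : List ℕ} (h : tgt.Nodup) (hlt : ∀ q ∈ tgt, q < wm) :
    (padTgt base wm s A w tgt).Nodup := by
  refine List.nodup_append.2 ⟨h.map (add_right_injective _),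
    List.nodup_range.map (add_right_injective _), ?_⟩
  simp only [List.mem_map, List.mem_range]
  rintro _ ⟨q, hq, rfl⟩ _ ⟨l, hl, rfl⟩
  have := hlt q hq; omega

theorem mem_padTgt {tgt : List ℕ} {q : ℕ} : q ∈ padTgt base wm s A w tgt ↔
    (∃ t ∈ tgt, q = base + t) ∨ ∃ l < w - tgt.length, q = base + wm + s + A + l := by
  simp [padTgt, eq_comm]

theorem mem_padAddr {addr : List ℕ} {q : ℕ} : q ∈ padAddr base wm s A addr ↔
    (∃ t ∈ addr, q = base + t) ∨ (∃ l < A - addr.length, q = base + wm + s + l) ∨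
      ∃ l < s, q = base + wm + l := by
  simp [padAddr, eq_comm]

theorem nodup_pad {addr tgt : List ℕ} (h : (addr ++ tgt).Nodup) (hlt : ∀ q ∈ addr ++ tgt, q < wm) :
    (padAddr base wm s A addr ++ padTgt base wm s A w tgt).Nodup := by
  have h' := List.nodup_append.1 h
  refine List.nodup_append.2 ⟨?_, nodup_padTgt h'.2.1 fun q hq => hlt q (by simp [hq]), ?_⟩
  · refine List.nodup_append.2 ⟨List.nodup_append.2 ⟨h'.1.map (add_right_injective _),
      List.nodup_range.map (add_right_injective _), ?_⟩,
      List.nodup_range.map (add_right_injective _), ?_⟩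
    · simp only [List.mem_map, List.mem_range]
      rintro _ ⟨q, hq, rfl⟩ _ ⟨l, hl, rfl⟩
      have := hlt q (by simp [hq]); omega
    · simp only [List.mem_append, List.mem_map, List.mem_range]
      rintro _ (⟨q, hq, rfl⟩ | ⟨l', hl', rfl⟩) _ ⟨l, hl, rfl⟩
      · have := hlt q (by simp [hq]); omega
      · omega
  · intro x hx y hy hxy
    subst hxy
    rw [mem_padAddr] at hx
    rw [mem_padTgt] at hy
    rcases hx with ⟨t, ht, rfl⟩ | ⟨l, hl, rfl⟩ | ⟨l, hl, rfl⟩ <;>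
      rcases hy with ⟨t', ht', he⟩ | ⟨l', hl', he⟩
    · have : t = t' := by omega
      subst this
      exact h'.2.2 t ht t ht' rfl
    · have := hlt t (by simp [ht]); omega
    · have := hlt t' (by simp [ht']); omega
    · omega
    · have := hlt t' (by simp [ht']); omega
    · omega

/-- Reading from the part of the QRAM that belongs to the copy. The target register is padded with
zero qubits, which stay zero as the words of this part have zeros in these places. -/
theorem embed_readBasis (hb : CopyReady base wm s A w c b) (hc : c < 2 ^ s) (φ : BasisState)
    {addr tgt : List ℕ} (ha : addr.length = a) (haA : a ≤ A) (ht : tgt.length = wd) (hw : wd ≤ w)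
    (hnd : (addr ++ tgt).Nodup) (hlt : ∀ q ∈ addr ++ tgt, q < wm) :
    readBasis (padAddr base wm s A addr) (padTgt base wm s A w tgt) (embed base wm A c a wd b φ)
      = embed base wm A c a wd b (readBasis addr tgt φ) := by
  have had := address_embed (a := a) (wd := wd) (φ := φ) hb hc (ha.trans_le haA)
    fun q hq => hlt q (by simp [hq])
  have hal : address φ addr < 2 ^ a := ha ▸ address_lt φ addr
  have hAa : 2 ^ a ≤ 2 ^ A := Nat.pow_le_pow_right (by norm_num) haA
  have hdiv : (address φ addr + 2 ^ A * c) / 2 ^ A = c := by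
    rw [Nat.add_mul_div_left _ _ (by positivity), Nat.div_eq_of_lt (hal.trans_le hAa), zero_add]
  have hmod : (address φ addr + 2 ^ A * c) % 2 ^ A = address φ addr := by
    rw [Nat.add_mul_mod_self_left, Nat.mod_eq_of_lt (hal.trans_le hAa)]
  have hnt := nodup_padTgt (base := base) (s := s) (A := A) (w := w)
    (List.nodup_append.1 hnd).2.1 fun q hq => hlt q (by simp [hq])
  funext x
  cases x with
  | cell i j =>
    simp only [readBasis, embed]
  | work q =>
    by_cases hq : q ∈ padTgt base wm s A w tgt
    · have hidx := List.idxOf_lt_length_of_mem hq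
      have hget := List.getElem_idxOf hidx
      rw [readBasis, if_pos hq, had]
      set j := (padTgt base wm s A w tgt).idxOf q
      rw [length_padTgt (by omega)] at hidx
      rw [← List.getD_eq_getElem _ 0] at hget
      by_cases hj : j < tgt.length
      · rw [getD_padTgt_of_lt hj] at hget
        have hmem : tgt.getD j 0 ∈ tgt := by
          rw [List.getD_eq_getElem _ _ hj]; exact List.getElem_mem _
        have hlt' : tgt.getD j 0 < wm := hlt _ (by simp only [List.mem_append, hmem, or_true])
        rw [← hget, embed_work _ hlt', embed_work _ hlt', readBasis, if_pos hmem]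
        simp only [embed]
        rw [if_pos ⟨hdiv, by rw [hmod]; exact hal, by omega⟩, hmod]
        have : tgt.idxOf (tgt.getD j 0) = j := by
          rw [List.getD_eq_getElem _ _ hj]; exact (List.nodup_append.1 hnd).2.1.idxOf_getElem _ hj
        rw [this]
      · rw [getD_padTgt_of_ge (by omega) hidx] at hget
        have h0 : embed base wm A c a wd b φ (.cell (address φ addr + 2 ^ A * c) j) = false := by
          simp only [embed]
          rw [if_neg (by omega), hb.cells _ _ hdiv]
        rw [h0, ← hget, embed_work_of_le _ (by omega), embed_work_of_le _ (by omega),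
            Bool.xor_false]
    · rw [readBasis, if_neg hq]
      simp only [embed]
      split_ifs with hr
      · have : q - base ∉ tgt := fun h => hq (mem_padTgt.2 (Or.inl ⟨_, h, by omega⟩))
        rw [readBasis, if_neg this]
      · rfl

theorem embed_swapBasis (hb : CopyReady base wm s A w c b) (hc : c < 2 ^ s) (φ : BasisState)
    {addr tgt : List ℕ} (ha : addr.length = a) (haA : a ≤ A) (ht : tgt.length = wd) (hw : wd ≤ w)
    (hnd : (addr ++ tgt).Nodup) (hlt : ∀ q ∈ addr ++ tgt, q < wm) :
    swapBasis (padAddr base wm s A addr) (padTgt base wm s A w tgt) (embed base wm A c a wd b φ)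
      = embed base wm A c a wd b (swapBasis addr tgt φ) := by
  have had := address_embed (a := a) (wd := wd) (φ := φ) hb hc (ha.trans_le haA)
    fun q hq => hlt q (by simp [hq])
  have hal : address φ addr < 2 ^ a := ha ▸ address_lt φ addr
  have hAa : 2 ^ a ≤ 2 ^ A := Nat.pow_le_pow_right (by norm_num) haA
  have hdiv : (address φ addr + 2 ^ A * c) / 2 ^ A = c := by
    rw [Nat.add_mul_div_left _ _ (by positivity), Nat.div_eq_of_lt (hal.trans_le hAa), zero_add]
  have hmod : (address φ addr + 2 ^ A * c) % 2 ^ A = address φ addr := by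
    rw [Nat.add_mul_mod_self_left, Nat.mod_eq_of_lt (hal.trans_le hAa)]
  funext x
  cases x with
  | cell i j =>
    rw [swapBasis, had, length_padTgt (by omega)]
    by_cases hij : i = address φ addr + 2 ^ A * c ∧ j < w
    · obtain ⟨rfl, hj⟩ := hij
      rw [if_pos ⟨rfl, hj⟩]
      by_cases hjt : j < tgt.length
      · have hmem : tgt.getD j 0 ∈ tgt := by
          rw [List.getD_eq_getElem _ _ hjt]; exact List.getElem_mem _
        have hlt' : tgt.getD j 0 < wm := hlt _ (by simp only [List.mem_append, hmem, or_true])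
        rw [getD_padTgt_of_lt hjt, embed_work _ hlt']
        simp only [embed]
        rw [if_pos ⟨hdiv, by rw [hmod]; exact hal, by omega⟩, hmod, swapBasis,
          if_pos ⟨rfl, hjt⟩]
      · rw [getD_padTgt_of_ge (by omega) hj, embed_work_of_le _ (by omega), hb.pads _ (by omega)]
        simp only [embed]
        rw [if_neg (by omega), hb.cells _ _ hdiv]
    · rw [if_neg hij]
      simp only [embed]
      split_ifs with hr
      · rw [swapBasis, if_neg]
        rintro ⟨h1, h2⟩
        refine hij ⟨?_, by omega⟩
        rw [← h1, ← hr.1]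
        exact (Nat.mod_add_div i _).symm
      · rfl
  | work q =>
    by_cases hq : q ∈ padTgt base wm s A w tgt
    · have hidx := List.idxOf_lt_length_of_mem hq
      have hget := List.getElem_idxOf hidx
      rw [swapBasis, if_pos hq, had]
      set j := (padTgt base wm s A w tgt).idxOf q
      rw [length_padTgt (by omega)] at hidx
      rw [← List.getD_eq_getElem _ 0] at hget
      by_cases hj : j < tgt.length
      · rw [getD_padTgt_of_lt hj] at hget
        have hmem : tgt.getD j 0 ∈ tgt := by
          rw [List.getD_eq_getElem _ _ hj]; exact List.getElem_mem _
        have hlt' : tgt.getD j 0 < wm := hlt _ (by simp only [List.mem_append, hmem, or_true])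
        rw [← hget, embed_work _ hlt', swapBasis, if_pos hmem]
        simp only [embed]
        rw [if_pos ⟨hdiv, by rw [hmod]; exact hal, by omega⟩, hmod]
        have : tgt.idxOf (tgt.getD j 0) = j := by
          rw [List.getD_eq_getElem _ _ hj]; exact (List.nodup_append.1 hnd).2.1.idxOf_getElem _ hj
        rw [this]
      · rw [getD_padTgt_of_ge (by omega) hidx] at hget
        have h0 : embed base wm A c a wd b φ (.cell (address φ addr + 2 ^ A * c) j) = false := by
          simp only [embed]
          rw [if_neg (by omega), hb.cells _ _ hdiv]
        rw [h0, ← hget, embed_work_of_le _ (by omega), hb.pads _ (by omega)]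
    · rw [swapBasis, if_neg hq]
      simp only [embed]
      split_ifs with hr
      · have : q - base ∉ tgt := fun h => hq (mem_padTgt.2 (Or.inl ⟨_, h, by omega⟩))
        rw [swapBasis, if_neg this]
      · rfl

theorem readBasis_nil (addr : List ℕ) (b : BasisState) : readBasis addr [] b = b := by
  funext x; cases x <;> simp [readBasis]

theorem swapBasis_nil (addr : List ℕ) (b : BasisState) : swapBasis addr [] b = b := by
  funext x; cases x <;> simp [swapBasis]

/-- Running an operation on a copy simulates the operation. -/
theorem run_placeGate (hb : CopyReady base wm s A w c b) (hc : c < 2 ^ s) (hw : wd ≤ w)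
    (haA : 0 < wd → a ≤ A) {G : Gate} (hG : GateOK wm a wd G) (ψ : QState) :
    run (placeGate base wm s A w G) (basisMap (embed base wm A c a wd b) ψ)
      = basisMap (embed base wm A c a wd b) (G.op ψ) := by
  suffices hh : run (placeGate base wm s A w G) ∘ₗ basisMap (embed base wm A c a wd b)
      = basisMap (embed base wm A c a wd b) ∘ₗ G.op from LinearMap.congr_fun hh ψ
  refine linearMap_ext fun φ => ?_
  obtain ⟨hlt, hnd, hfit⟩ := hG
  simp only [LinearMap.comp_apply, basisMap_single, Gate.op_single]
  cases G with
  | not q =>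
    have h1 : q < wm := hlt q (by simp [Gate.qubits])
    simp [placeGate, run_cons, Gate.op_single, Gate.onBasis, embed_work _ h1, embed_update _ h1]
  | had q =>
    have h1 : q < wm := hlt q (by simp [Gate.qubits])
    simp [placeGate, run_cons, Gate.op_single, Gate.onBasis, embed_work _ h1, embed_update _ h1]
  | phase q =>
    have h1 : q < wm := hlt q (by simp [Gate.qubits])
    simp [placeGate, run_cons, Gate.op_single, Gate.onBasis, embed_work _ h1]
  | phaseInv q =>
    have h1 : q < wm := hlt q (by simp [Gate.qubits])
    simp [placeGate, run_cons, Gate.op_single, Gate.onBasis, embed_work _ h1]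
  | cnot c t =>
    have h1 : c < wm := hlt c (by simp [Gate.qubits])
    have h2 : t < wm := hlt t (by simp [Gate.qubits])
    simp [placeGate, run_cons, Gate.op_single, Gate.onBasis, embed_work _ h1, embed_work _ h2,
      embed_update _ h2]
  | toffoli c₁ c₂ t =>
    have h1 : c₁ < wm := hlt c₁ (by simp [Gate.qubits])
    have h2 : c₂ < wm := hlt c₂ (by simp [Gate.qubits])
    have h3 : t < wm := hlt t (by simp [Gate.qubits])
    simp [placeGate, run_cons, Gate.op_single, Gate.onBasis, embed_work _ h1, embed_work _ h2,
      embed_work _ h3, embed_update _ h3]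
  | qread addr tgt =>
    simp only [Gate.RegistersFit] at hfit
    by_cases h0 : tgt.length = 0
    · have : tgt = [] := List.eq_nil_of_length_eq_zero h0
      subst this
      simp [placeGate, Gate.onBasis, readBasis_nil]
    · simp only [placeGate, if_neg h0, run_singleton, Gate.op_single, Gate.onBasis, basisMap_single]
      rw [embed_readBasis hb hc φ hfit.1 (haA (by omega)) hfit.2 hw hnd hlt]
  | qswap addr tgt =>
    simp only [Gate.RegistersFit] at hfit
    by_cases h0 : tgt.length = 0
    · have : tgt = [] := List.eq_nil_of_length_eq_zero h0
      subst this
      simp [placeGate, Gate.onBasis, swapBasis_nil]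
    · simp only [placeGate, if_neg h0, run_singleton, Gate.op_single, Gate.onBasis, basisMap_single]
      rw [embed_swapBasis hb hc φ hfit.1 (haA (by omega)) hfit.2 hw hnd hlt]

/-- A copy of a circuit acts on its own qubits as the circuit does. -/
theorem run_placeGates (hb : CopyReady base wm s A w c b) (hc : c < 2 ^ s) (hw : wd ≤ w)
    (haA : 0 < wd → a ≤ A) {gs : List Gate} (hG : ∀ G ∈ gs, GateOK wm a wd G) (ψ : QState) :
    run (placeGates base wm s A w gs) (basisMap (embed base wm A c a wd b) ψ)
      = basisMap (embed base wm A c a wd b) (run gs ψ) := by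
  induction gs generalizing ψ with
  | nil => rfl
  | cons G gs ih =>
    have : placeGates base wm s A w (G :: gs)
        = placeGate base wm s A w G ++ placeGates base wm s A w gs := rfl
    rw [this, run_append, run_placeGate hb hc hw haA (hG G (by simp)),
      ih fun G hG' => hG G (List.mem_cons_of_mem _ hG'), run_cons]

end Embedding

/-- The qubits that the copy number `c` of a circuit changes. -/
def copyQubits (base wm A c : ℕ) : Set Qubit :=
  {x | (∃ q, base ≤ q ∧ q < base + wm ∧ x = .work q) ∨ ∃ i j, i / 2 ^ A = c ∧ x = .cell i j}

/-- The `l`-th output bit of a copy of a circuit. -/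
def outBit (base : ℕ) (outs : List ℕ) (l : ℕ) (b : BasisState) : Bool :=
  if l < outs.length then b (.work (base + outs.getD l 0)) else false

/-- The low-order bits of the output of a copy of a circuit are those of `y`. -/
def OutCorrect (base : ℕ) (outs : List ℕ) (wv y : ℕ) (b : BasisState) : Prop :=
  ∀ l < wv, outBit base outs l b = y.testBit l

/-- The qubits of a circuit. -/
def domainQubits (work a wd : ℕ) : Set Qubit :=
  {x | (∃ q < work, x = .work q) ∨ ∃ i j, i < 2 ^ a ∧ j < wd ∧ x = .cell i j}

theorem writes_subset_domain {work a wd : ℕ} {G : Gate} (h : GateOK work a wd G) :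
    G.writes ⊆ domainQubits work a wd := by
  obtain ⟨h1, -, h3⟩ := h
  intro x hx
  cases G with
  | phase q => exact absurd hx (by simp [Gate.writes])
  | phaseInv q => exact absurd hx (by simp [Gate.writes])
  | qread addr tgt =>
    obtain ⟨q, hq, rfl⟩ := hx
    exact Or.inl ⟨q, h1 q (by simp [Gate.qubits, hq]), rfl⟩
  | qswap addr tgt =>
    rcases hx with ⟨q, hq, rfl⟩ | ⟨i, j, hi, hj, rfl⟩
    · exact Or.inl ⟨q, h1 q (by simp [Gate.qubits, hq]), rfl⟩
    · exact Or.inr ⟨i, j, h3.1 ▸ hi, h3.2 ▸ hj, rfl⟩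
  | _ => exact Or.inl ⟨_, h1 _ (by simp [Gate.qubits]), hx⟩

open Classical in
/-- A copy of a bounded-error circuit that is started on its input changes only its own qubits and
produces the correct answer with probability at least `2 / 3`; in the form used for independent
repetitions, the expectation of `2 ^ [the answer is wrong]` is at most `4 / 3`. -/
theorem wt_copy {C : QCircuit} (hC : C.WellFormed) {input : List Bool} {y : ℕ}
    (hcomp : C.Computes input y) {base wm s A w c : ℕ} {b : BasisState}
    (hb : CopyReady base wm s A w c b) (hc : c < 2 ^ s) (hwm : C.work ≤ wm) (hw : C.wordSize ≤ w)
    (haA : 0 < C.wordSize → C.addrWidth ≤ A)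
    (hin : ∀ q < wm, b (.work (base + q)) = input.getD q false) (wv : ℕ) :
    (∀ b', run (placeGates base wm s A w C.gates) (Finsupp.single b 1) b' ≠ 0 →
      ∀ q ∉ copyQubits base wm A c, b' q = b q) ∧
    wt (fun b' => if OutCorrect base C.outs wv y b' then 1 else 2)
      (run (placeGates base wm s A w C.gates) (Finsupp.single b 1)) ≤ 4 / 3 := by
  obtain ⟨hout, -, hgates⟩ := hC
  have hOK : ∀ G ∈ C.gates, GateOK C.work C.addrWidth C.wordSize G := hgates
  have hOK' : ∀ G ∈ C.gates, GateOK wm C.addrWidth C.wordSize G := fun G hG => (hOK G hG).mono hwm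
  set em := embed base wm A c C.addrWidth C.wordSize b with hem
  have hinit : em (initial input) = b := by
    funext x
    cases x with
    | work q =>
      simp only [hem, embed]
      split_ifs with h
      · rw [initial, ← hin (q - base) (by omega)]; congr 2; omega
      · rfl
    | cell i j =>
      simp only [hem, embed]
      split_ifs with h
      · rw [initial, hb.cells i j h.1]
      · rfl
  set ψ := C.finalState input with hψ
  have hψr : ψ = run C.gates (Finsupp.single (initial input) 1) := by
    rw [hψ, QCircuit.finalState, foldl_op_eq_run]
  have hrun : run (placeGates base wm s A w C.gates) (Finsupp.single b 1) = basisMap em ψ := by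
    conv_lhs => rw [← hinit, ← basisMap_single em]
    rw [run_placeGates hb hc hw haA hOK', ← hψr]
  have hdist : Distinct C.gates := fun G hG => (hOK G hG).2.1
  have hnorm : ‖ψ‖ = 1 := by rw [hψr, norm_run hdist, norm_single, norm_one]
  have hloc : ∀ φ, ψ φ ≠ 0 → ∀ q ∉ domainQubits C.work C.addrWidth C.wordSize,
      φ q = initial input q := by
    intro φ hφ
    rw [hψr] at hφ
    exact local_run (fun G hG => writes_subset_domain (hOK G hG)) _ _ hφ
  rw [hrun]
  refine ⟨fun b' hb' q hq => ?_, ?_⟩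
  · rw [map_eq_sum, Finsupp.finsetSum_apply] at hb'
    obtain ⟨φ, -, hne⟩ := Finset.exists_ne_zero_of_sum_ne_zero hb'
    have : b' = em φ := by
      by_contra h
      refine hne ?_
      rw [basisMap_single, Finsupp.smul_apply, Finsupp.single_eq_of_ne h, smul_zero]
    rw [this]
    cases q with
    | work q =>
      simp only [hem, embed]
      rw [if_neg fun h => hq (Or.inl ⟨q, h.1, h.2, rfl⟩)]
    | cell i j =>
      simp only [hem, embed]
      rw [if_neg fun h => hq (Or.inr ⟨i, j, h.1, rfl⟩)]
  · have hinj : ∀ φ₁ φ₂, ψ φ₁ ≠ 0 → ψ φ₂ ≠ 0 → em φ₁ = em φ₂ → φ₁ = φ₂ := by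
      intro φ₁ φ₂ h₁ h₂ he
      funext x
      by_cases hx : x ∈ domainQubits C.work C.addrWidth C.wordSize
      · rcases hx with ⟨q, hq, rfl⟩ | ⟨i, j, hi, hj, rfl⟩
        · have := congrFun he (.work (base + q))
          rwa [hem, embed_work _ (by omega), embed_work _ (by omega)] at this
        · have := congrFun he (.cell (i + 2 ^ A * c) j)
          have hAa : 2 ^ C.addrWidth ≤ 2 ^ A :=
            Nat.pow_le_pow_right (by norm_num) (haA (by omega))
          have hdiv : (i + 2 ^ A * c) / 2 ^ A = c := by
            rw [Nat.add_mul_div_left _ _ (by positivity), Nat.div_eq_of_lt (hi.trans_le hAa),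
              zero_add]
          have hmod : (i + 2 ^ A * c) % 2 ^ A = i := by
            rw [Nat.add_mul_mod_self_left, Nat.mod_eq_of_lt (hi.trans_le hAa)]
          simpa only [hem, embed, hdiv, hmod, hi, hj, and_self, if_true] using this
      · rw [hloc φ₁ h₁ x hx, hloc φ₂ h₂ x hx]
    rw [wt_map_of_disjoint]
    · simp only [basisMap_single, wt_single, norm_one, one_pow, mul_one]
      have hright : ∀ φ, bitsVal (C.outs.map fun q => φ (.work q)) = y →
          OutCorrect base C.outs wv y (em φ) := by
        intro φ hφ l _
        rw [← hφ, testBit_bitsVal, outBit]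
        split_ifs with hl
        · have hmem : C.outs.getD l 0 ∈ C.outs := by
            rw [List.getD_eq_getElem _ _ hl]; exact List.getElem_mem _
          rw [hem, embed_work _ ((hout _ hmem).trans_le hwm), List.getD_eq_getElem _ _ hl,
            List.getD_eq_getElem _ _ (by simpa using hl)]
          simp
        · rw [List.getD_eq_default _ _ (by simpa using hl)]
      have hprob : C.prob input y
          = mass {φ | bitsVal (C.outs.map fun q => φ (.work q)) = y} ψ := by
        rw [QCircuit.prob, mass, wt]
        refine Finsupp.sum_congr fun φ _ => ?_
        by_cases h : bitsVal (C.outs.map fun q => φ (.work q)) = y <;> simp [h]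
      have hcompl := mass_compl {φ | bitsVal (C.outs.map fun q => φ (.work q)) = y} ψ
      have h23 := hcomp.2
      rw [hprob] at h23
      rw [hnorm] at hcompl
      calc wt (fun φ => if OutCorrect base C.outs wv y (em φ) then 1 else 2) ψ
          ≤ wt (fun φ => 1 + if φ ∈ {φ : BasisState |
              bitsVal (C.outs.map fun q => φ (.work q)) = y}ᶜ then 1 else 0) ψ := by
            refine wt_mono fun φ _ => ?_
            by_cases h : bitsVal (C.outs.map fun q => φ (.work q)) = y
            · simp [h, hright φ h]
            · simp only [Set.mem_compl_iff, Set.mem_ofPred_eq, h, not_false_eq_true, if_true]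
              split_ifs <;> norm_num
        _ = 1 + mass {φ | bitsVal (C.outs.map fun q => φ (.work q)) = y}ᶜ ψ := by
            rw [wt_add, ← norm_sq_eq_wt, hnorm, one_pow, mass]
            congr 1
            exact wt_congr fun φ _ => by congr
        _ ≤ 4 / 3 := by linarith
    · intro φ₁ φ₂ b' h₁ h₂ h₁' h₂'
      rw [basisMap_single] at h₁' h₂'
      have e₁ : b' = em φ₁ := by
        by_contra h; exact h₁' (Finsupp.single_eq_of_ne h)
      have e₂ : b' = em φ₂ := by
        by_contra h; exact h₂' (Finsupp.single_eq_of_ne h)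
      exact hinj φ₁ φ₂ h₁ h₂ (e₁.symm.trans e₂)

/-! ### Grover search -/

theorem inner_run {gs : List Gate} (h : Distinct gs) (φ ψ : QState) :
    inner ℂ (run gs φ) (run gs ψ) = inner ℂ φ ψ :=
  LinearIsometry.inner_map_map ⟨run gs, norm_run h⟩ φ ψ

/-- The subset of `{0, …, n - 1}` that the register `d, …, d + n - 1` holds. -/
def idxSet (d n : ℕ) (b : BasisState) : Finset ℕ :=
  (Finset.range n).filter fun i => b (.work (d + i)) = true

theorem mem_idxSet {d n i : ℕ} {b : BasisState} :
    i ∈ idxSet d n b ↔ i < n ∧ b (.work (d + i)) = true := by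
  rw [idxSet, Finset.mem_filter, Finset.mem_range]

/-- The basis state in which the set `X` is written to a register `d, d + 1, …` that was zero. -/
def setIdx (d : ℕ) (X : Finset ℕ) (b : BasisState) : BasisState
  | .work q => decide (d ≤ q ∧ q - d ∈ X) || b (.work q)
  | .cell i j => b (.cell i j)

/-- The qubits of the register `d, …, d + n - 1`. -/
def regQubits (d n : ℕ) : Set Qubit := {x | ∃ i < n, x = .work (d + i)}

section Register

variable {d n : ℕ} {b : BasisState} (hb : ∀ i < n, b (.work (d + i)) = false)

include hb in
theorem idxSet_setIdx {X : Finset ℕ} (hX : X ⊆ Finset.range n) : idxSet d n (setIdx d X b) = X := by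
  ext i
  rw [mem_idxSet]
  simp only [setIdx]
  constructor
  · rintro ⟨hi, h⟩
    simpa [hb i hi] using h
  · intro h
    have hi := Finset.mem_range.1 (hX h)
    exact ⟨hi, by simp [h]⟩

theorem setIdx_empty : setIdx d ∅ b = b := by
  funext x; cases x <;> simp [setIdx]

theorem setIdx_of_notMem {X : Finset ℕ} (hX : X ⊆ Finset.range n) {x : Qubit}
    (hx : x ∉ regQubits d n) : setIdx d X b x = b x := by
  cases x with
  | cell i j => rfl
  | work q =>
    have : ¬ (d ≤ q ∧ q - d ∈ X) := fun h =>
      hx ⟨q - d, Finset.mem_range.1 (hX h.2), by congr 1; omega⟩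
    simp [setIdx, this]

include hb in
theorem setIdx_idxSet {c : BasisState} (hc : ∀ x ∉ regQubits d n, c x = b x) :
    setIdx d (idxSet d n c) b = c := by
  funext x
  by_cases hx : x ∈ regQubits d n
  · obtain ⟨i, hi, rfl⟩ := hx
    simp [setIdx, mem_idxSet, hi, hb i hi]
  · rw [setIdx_of_notMem (n := n) (X := idxSet d n c) (Finset.filter_subset _ _) hx, hc x hx]

/-- Hadamard gates on a register. -/
def hadGates (d n : ℕ) : List Gate := (List.range n).map fun i => .had (d + i)

theorem distinct_hadGates (d n : ℕ) : Distinct (hadGates d n) := by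
  intro G hG
  obtain ⟨i, -, rfl⟩ := List.mem_map.1 hG
  simp [Gate.qubits]

theorem writes_hadGates (d n : ℕ) : ∀ G ∈ hadGates d n, G.writes ⊆ regQubits d n := by
  intro G hG x hx
  obtain ⟨i, hi, rfl⟩ := List.mem_map.1 hG
  exact ⟨i, List.mem_range.1 hi, hx⟩

theorem writes_invGates {W : Set Qubit} {gs : List Gate} (h : ∀ G ∈ gs, G.writes ⊆ W) :
    ∀ G ∈ invGates gs, G.writes ⊆ W := fun G hG => by
  have := h _ (mem_invGates.1 hG); rwa [Gate.writes_inv] at this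

/-- A superposition of the subsets of `{0, …, n - 1}`. -/
def vec (d n : ℕ) (b : BasisState) (c : Finset ℕ → ℂ) : QState :=
  ∑ X ∈ (Finset.range n).powerset, c X • Finsupp.single (setIdx d X b) 1

/-- Hadamard gates on a register that is zero produce the uniform superposition of all subsets. -/
theorem run_hadGates (d n : ℕ) (b : BasisState) (hb : ∀ i < n, b (.work (d + i)) = false) :
    run (hadGates d n) (Finsupp.single b 1)
      = vec d n b fun _ => (((1 / √2 : ℝ) ^ n : ℝ) : ℂ) := by
  induction n with
  | zero => simp [hadGates, vec, setIdx_empty]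
  | succ n ih =>
    have hsplit : hadGates d (n + 1) = hadGates d n ++ [.had (d + n)] := by
      simp [hadGates, List.range_succ]
    rw [hsplit, run_append, ih fun i hi => hb i (by omega), run_singleton, vec, vec, map_sum,
      Finset.range_add_one, Finset.sum_powerset_insert Finset.notMem_range_self,
      ← Finset.sum_add_distrib]
    refine Finset.sum_congr rfl fun X hX => ?_
    have hX' : n ∉ X := fun h => by
      have := Finset.mem_range.1 (Finset.mem_powerset.1 hX h); omega
    have h0 : setIdx d X b (.work (d + n)) = false := by simp [setIdx, hX', hb n (by omega)]
    have e0 : Function.update (setIdx d X b) (.work (d + n)) false = setIdx d X b := by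
      rw [← h0]; exact Function.update_eq_self _ _
    have e1 : Function.update (setIdx d X b) (.work (d + n)) true = setIdx d (insert n X) b := by
      funext x
      cases x with
      | cell i j => simp [setIdx]
      | work q =>
        by_cases hq : q = d + n
        · subst hq; simp [setIdx]
        · rw [Function.update_of_ne (by simpa using hq)]
          have : (d ≤ q ∧ q - d ∈ insert n X) ↔ (d ≤ q ∧ q - d ∈ X) := by
            simp only [Finset.mem_insert]
            constructor
            · rintro ⟨h, h' | h'⟩
              · omega
              · exact ⟨h, h'⟩
            · exact fun h => ⟨h.1, Or.inr h.2⟩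
          simp only [setIdx]
          congr 1
          exact decide_eq_decide.2 this.symm
    rw [map_smul, Gate.op_single]
    simp only [Gate.onBasis, h0, e0, e1, Bool.false_eq_true, if_false, smul_add,
      Finsupp.smul_single, smul_eq_mul, mul_one, ← Complex.ofReal_mul, pow_succ]

include hb in
theorem setIdx_injOn {X Y : Finset ℕ} (hX : X ∈ (Finset.range n).powerset)
    (hY : Y ∈ (Finset.range n).powerset) (h : setIdx d X b = setIdx d Y b) : X = Y := by
  rw [← idxSet_setIdx hb (Finset.mem_powerset.1 hX), h,
    idxSet_setIdx hb (Finset.mem_powerset.1 hY)]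

include hb in
theorem vec_apply (c : Finset ℕ → ℂ) {X : Finset ℕ} (hX : X ∈ (Finset.range n).powerset) :
    vec d n b c (setIdx d X b) = c X := by
  rw [vec, Finsupp.finsetSum_apply, Finset.sum_eq_single_of_mem X hX]
  · simp
  · intro Y hY hne
    rw [Finsupp.smul_apply, Finsupp.single_eq_of_ne fun h => hne (setIdx_injOn hb hX hY h).symm,
      smul_zero]

theorem vec_supp (c : Finset ℕ → ℂ) :
    Supp {x | ∃ X ∈ (Finset.range n).powerset, x = setIdx d X b} (vec d n b c) :=
  supp_sum fun X hX => Supp.smul (supp_single (Set.mem_ofPred_eq ▸ ⟨X, hX, rfl⟩) _) _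

include hb in
theorem inner_vec (r : ℝ) (c : Finset ℕ → ℂ) :
    inner ℂ (vec d n b fun _ => (r : ℂ)) (vec d n b c)
      = r * ∑ X ∈ (Finset.range n).powerset, c X := by
  conv_lhs => rw [vec, sum_inner]
  rw [Finset.mul_sum]
  refine Finset.sum_congr rfl fun X hX => ?_
  rw [inner_smul_left, inner_single_left, vec_apply hb c hX]
  simp

include hb in
theorem wt_basisMap_vec (τ : BasisState → BasisState) (c : Finset ℕ → ℂ) (F : BasisState → ℝ)
    (hτ : ∀ X ∈ (Finset.range n).powerset, idxSet d n (τ (setIdx d X b)) = X) :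
    wt F (basisMap τ (vec d n b c))
      = ∑ X ∈ (Finset.range n).powerset, F (τ (setIdx d X b)) * ‖c X‖ ^ 2 := by
  classical
  rw [wt_map_of_disjoint]
  · simp only [basisMap_single, wt_single, norm_one, one_pow, mul_one]
    rw [wt_eq_sum _ _ (T := (Finset.range n).powerset.image fun X => setIdx d X b),
      Finset.sum_image]
    · exact Finset.sum_congr rfl fun X hX => by rw [vec_apply hb c hX]
    · exact fun X hX Y hY h => setIdx_injOn hb hX hY h
    · intro x hx
      obtain ⟨X, hX, rfl⟩ := vec_supp c x (Finsupp.mem_support_iff.1 hx)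
      exact Finset.mem_image_of_mem _ hX
  · intro b₁ b₂ b' h₁ h₂ h₁' h₂'
    obtain ⟨X, hX, rfl⟩ := vec_supp c b₁ h₁
    obtain ⟨Y, hY, rfl⟩ := vec_supp c b₂ h₂
    rw [basisMap_single] at h₁' h₂'
    have e₁ : b' = τ (setIdx d X b) := by
      by_contra h; exact h₁' (Finsupp.single_eq_of_ne h)
    have e₂ : b' = τ (setIdx d Y b) := by
      by_contra h; exact h₂' (Finsupp.single_eq_of_ne h)
    rw [← hτ X hX, ← e₁, e₂, hτ Y hY]

theorem phaseOp_vec (Q : BasisState → Bool) (c : Finset ℕ → ℂ) :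
    phaseOp Q (vec d n b c)
      = vec d n b fun X => (if Q (setIdx d X b) then -1 else 1) * c X := by
  rw [vec, vec, map_sum]
  refine Finset.sum_congr rfl fun X _ => ?_
  rw [map_smul, phaseOp_single, mul_one, Finsupp.smul_single, Finsupp.smul_single, smul_eq_mul,
    smul_eq_mul, mul_one, mul_comm]

/-- The basis state holds the empty set in the register. -/
def idxZero (d n : ℕ) (b : BasisState) : Bool := decide (idxSet d n b = ∅)

/-- Reflection of the superpositions of subsets: the negative of the reflection about the uniform
superposition. -/
def diffOp (d n : ℕ) : QState →ₗ[ℂ] QState :=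
  run (hadGates d n) ∘ₗ phaseOp (idxZero d n) ∘ₗ run (invGates (hadGates d n))

include hb in
/-- `diffOp` maps the amplitudes `c` to `c - 2 * (mean of c)`. -/
theorem diffOp_vec (c : Finset ℕ → ℂ) :
    diffOp d n (vec d n b c)
      = vec d n b fun X => c X - 2 * (((1 / 2 : ℝ) ^ n : ℝ) : ℂ)
          * ∑ Y ∈ (Finset.range n).powerset, c Y := by
  set r : ℝ := (1 / √2) ^ n with hr
  have hr2 : r * r = (1 / 2) ^ n := by
    rw [hr, ← mul_pow, div_mul_div_comm, Real.mul_self_sqrt (by norm_num), one_mul]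
  have hd := distinct_hadGates d n
  set φ := run (invGates (hadGates d n)) (vec d n b c) with hφ
  have hs := run_hadGates d n b hb
  have hφb : φ b = r * ∑ Y ∈ (Finset.range n).powerset, c Y := by
    have h1 : inner ℂ (Finsupp.single b (1 : ℂ) : QState) φ = φ b := by
      rw [inner_single_left]; simp
    rw [← h1, ← inner_run hd, hφ, run_run_invGates hd, hs, inner_vec hb]
  have hph : phaseOp (idxZero d n) φ = φ - (2 * φ b) • Finsupp.single b 1 := by
    ext x
    rw [phaseOp_apply, Finsupp.sub_apply, Finsupp.smul_apply]
    by_cases hx : x = b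
    · have : idxZero d n b = true := by
        rw [idxZero, decide_eq_true_eq]
        ext i
        rw [mem_idxSet]
        simp +contextual [hb]
      subst hx
      rw [if_pos this]; simp; ring
    · rw [Finsupp.single_eq_of_ne hx, smul_zero, sub_zero]
      by_cases h0 : φ x = 0
      · rw [h0, mul_zero]
      · have hloc : ∀ q ∉ regQubits d n, x q = b q := by
          obtain ⟨y, hy, hxy⟩ :=
            (local_run (writes_invGates (writes_hadGates d n))).supp _ h0
          obtain ⟨X, hX, rfl⟩ := vec_supp c y hy
          intro q hq
          rw [hxy q hq, setIdx_of_notMem (Finset.mem_powerset.1 hX) hq]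
        have : idxZero d n x = false := by
          simp only [idxZero, decide_eq_false_iff_not]
          intro he
          have := setIdx_idxSet hb hloc
          rw [he, setIdx_empty] at this
          exact hx this.symm
        simp [this]
  rw [diffOp, LinearMap.comp_apply, LinearMap.comp_apply, ← hφ, hph, map_sub, map_smul, hs, hφb,
    hφ, run_run_invGates hd]
  have hrc : (r : ℂ) * r = (((1 / 2 : ℝ) ^ n : ℝ) : ℂ) := by rw [← hr2]; push_cast; rfl
  rw [vec, vec, vec, Finset.smul_sum, ← Finset.sum_sub_distrib]
  refine Finset.sum_congr rfl fun X _ => ?_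
  rw [smul_smul, ← sub_smul]
  congr 1
  rw [← hrc]; ring

end Register

/-- The amplitudes of the good and the bad sets after `j` Grover iterations, relative to the
initial amplitude and up to a global sign, when a fraction `a` of all sets is good. -/
def groverAmp (a : ℝ) : ℕ → ℝ × ℝ
  | 0 => (1, 1)
  | j + 1 =>
    ((groverAmp a j).1 + 2 * ((1 - a) * (groverAmp a j).2 - a * (groverAmp a j).1),
      -(groverAmp a j).2 + 2 * ((1 - a) * (groverAmp a j).2 - a * (groverAmp a j).1))

/-- If a fraction of `sin θ ^ 2` of the subsets is good, then the state after `j` iterations has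
the angle `(2 * j + 1) * θ` with the bad subsets. -/
theorem groverAmp_eq (θ : ℝ) (j : ℕ) :
    (groverAmp (Real.sin θ ^ 2) j).1 * Real.sin θ = Real.sin ((2 * j + 1) * θ) ∧
      (groverAmp (Real.sin θ ^ 2) j).2 * Real.cos θ = Real.cos ((2 * j + 1) * θ) := by
  induction j with
  | zero => simp [groverAmp]
  | succ j ih =>
    obtain ⟨h1, h2⟩ := ih
    have e : (2 * ((j + 1 : ℕ) : ℝ) + 1) * θ = (2 * j + 1) * θ + 2 * θ := by push_cast; ring
    rw [e, Real.sin_add, Real.cos_add, ← h1, ← h2, Real.cos_two_mul, Real.sin_two_mul]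
    have hsc := Real.sin_sq_add_cos_sq θ
    have hs : Real.sin θ ^ 2 = 1 - Real.cos θ ^ 2 := by linarith
    simp only [groverAmp, hs]
    constructor
    · ring
    · set u := (groverAmp (1 - Real.cos θ ^ 2) j).1
      set v := (groverAmp (1 - Real.cos θ ^ 2) j).2
      linear_combination (2 * Real.cos θ * u) * hs

/-- The search for a good subset with `j` iterations, followed by the computation of whether the
result is good into the qubit `flag`. -/
def searchOp (d n flag : ℕ) (Q : BasisState → Bool) (j : ℕ) : QState →ₗ[ℂ] QState :=
  basisMap (fun b => xorAt flag (Q b) b) ∘ₗ ((diffOp d n ∘ₗ phaseOp Q) ^ j) ∘ₗ run (hadGates d n)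

/-- The numbers of iterations that are tried: `0, 1, 2, 4, …`. -/
def iterCount (i : ℕ) : ℕ := if i = 0 then 0 else 2 ^ (i - 1)

section Search

variable {d n flag : ℕ} {b : BasisState} {Q : BasisState → Bool} {good : Finset ℕ → Bool}

/-- The amplitudes after `j` iterations only depend on whether a subset is good. The sign comes from
`diffOp`, which is the negative of the usual reflection. -/
theorem grover_iterate (hb : ∀ i < n, b (.work (d + i)) = false)
    (hQ : ∀ c, Q c = good (idxSet d n c)) {a : ℝ}
    (ha : a = ((Finset.range n).powerset.filter fun X => good X).card / 2 ^ n) (j : ℕ) :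
    ((diffOp d n ∘ₗ phaseOp Q) ^ j) (run (hadGates d n) (Finsupp.single b 1))
      = vec d n b fun X => (-1) ^ j * (((1 / √2 : ℝ) ^ n : ℝ) : ℂ)
          * ((if good X then (groverAmp a j).1 else (groverAmp a j).2 : ℝ) : ℂ) := by
  induction j with
  | zero =>
    rw [pow_zero, Module.End.one_apply, run_hadGates d n b hb]
    simp [groverAmp]
  | succ j ih =>
    rw [pow_succ', Module.End.mul_apply, ih, LinearMap.comp_apply, phaseOp_vec, diffOp_vec hb]
    set r : ℂ := (((1 / √2 : ℝ) ^ n : ℝ) : ℂ)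
    set u := (groverAmp a j).1 with hu
    set v := (groverAmp a j).2 with hv
    have hgood (X : Finset ℕ) (hX : X ∈ (Finset.range n).powerset) :
        Q (setIdx d X b) = good X := by
      rw [hQ, idxSet_setIdx hb (Finset.mem_powerset.1 hX)]
    have hN : (2 : ℝ) ^ n ≠ 0 := by positivity
    have hsum : (((1 / 2 : ℝ) ^ n : ℝ) : ℂ) * ∑ Y ∈ (Finset.range n).powerset,
        ((if Q (setIdx d Y b) then -1 else 1) *
          ((-1) ^ j * r * ((if good Y then u else v : ℝ) : ℂ)))
        = (-1) ^ j * r * (((1 - a) * v - a * u : ℝ) : ℂ) := by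
      have e1 : ∀ Y ∈ (Finset.range n).powerset,
          ((if Q (setIdx d Y b) then -1 else 1) *
              ((-1) ^ j * r * ((if good Y then u else v : ℝ) : ℂ)))
          = (-1) ^ j * r * ((if good Y then -u else v : ℝ) : ℂ) := by
        intro Y hY
        rw [hgood Y hY]
        cases good Y <;> simp
      rw [Finset.sum_congr rfl e1, ← Finset.mul_sum, ← Complex.ofReal_sum, Finset.sum_ite,
        Finset.sum_const, Finset.sum_const]
      have hcard := Finset.card_filter_add_card_filter_not (s := (Finset.range n).powerset)
        (fun X => good X = true)
      rw [Finset.card_powerset, Finset.card_range] at hcard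
      have hcard' : ((((Finset.range n).powerset.filter fun X => ¬ good X = true).card : ℕ) : ℝ)
          = 2 ^ n - ((Finset.range n).powerset.filter fun X => good X = true).card := by
        rw [eq_sub_iff_add_eq, add_comm]; exact_mod_cast hcard
      rw [nsmul_eq_mul, nsmul_eq_mul, hcard', mul_left_comm, ← Complex.ofReal_mul]
      congr 2
      rw [ha, one_div, inv_pow]
      field_simp
      ring
    have hstep : (groverAmp a (j + 1)) = (u + 2 * ((1 - a) * v - a * u),
        -v + 2 * ((1 - a) * v - a * u)) := rfl
    refine Finset.sum_congr rfl fun X hX => ?_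
    congr 1
    beta_reduce
    rw [mul_assoc 2, hsum, hgood X hX, hstep]
    cases good X <;> simp <;> ring

/-- The probability that a search with `j` iterations fails. -/
theorem wt_searchOp (hb : ∀ i < n, b (.work (d + i)) = false) (hflag : flag = d + n)
    (hbf : b (.work flag) = false)
    (hQ : ∀ c, Q c = good (idxSet d n c)) {a : ℝ}
    (ha : a = ((Finset.range n).powerset.filter fun X => good X).card / 2 ^ n) (j : ℕ) :
    wt (fun c => if c (.work flag) then 0 else 1) (searchOp d n flag Q j (Finsupp.single b 1))
      = (1 - a) * (groverAmp a j).2 ^ 2 := by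
  rw [searchOp, LinearMap.comp_apply, LinearMap.comp_apply, grover_iterate hb hQ ha j,
    wt_basisMap_vec hb]
  · have hr : ‖(((1 / √2 : ℝ) ^ n : ℝ) : ℂ)‖ ^ 2 = 1 / 2 ^ n := by
      rw [Complex.norm_real, Real.norm_eq_abs, sq_abs, ← pow_mul, mul_comm, pow_mul, div_pow,
        Real.sq_sqrt (by norm_num), one_pow, div_pow, one_pow]
    have hterm : ∀ X ∈ (Finset.range n).powerset,
        (if xorAt flag (Q (setIdx d X b)) (setIdx d X b) (.work flag) then 0 else 1) *
          ‖(-1) ^ j * (((1 / √2 : ℝ) ^ n : ℝ) : ℂ)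
            * ((if good X then (groverAmp a j).1 else (groverAmp a j).2 : ℝ) : ℂ)‖ ^ 2
        = if good X then 0 else 1 / 2 ^ n * (groverAmp a j).2 ^ 2 := by
      intro X hX
      have hX' := Finset.mem_powerset.1 hX
      have h0 : setIdx d X b (.work flag) = false := by
        rw [setIdx_of_notMem hX', hbf]
        rintro ⟨i, hi, h⟩
        have := Qubit.work.inj h; omega
      have h1 : xorAt flag (Q (setIdx d X b)) (setIdx d X b) (.work flag) = good X := by
        simp [xorAt, h0, hQ, idxSet_setIdx hb hX']
      rw [h1]
      cases good X
      · rw [norm_mul, norm_mul, mul_pow, mul_pow, hr]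
        simp
      · simp
    rw [Finset.sum_congr rfl hterm, Finset.sum_ite, Finset.sum_const_zero, zero_add,
      Finset.sum_const, nsmul_eq_mul]
    have hcard := Finset.card_filter_add_card_filter_not (s := (Finset.range n).powerset)
      (fun X => good X = true)
    rw [Finset.card_powerset, Finset.card_range] at hcard
    have hcard' : ((((Finset.range n).powerset.filter fun X => ¬ good X = true).card : ℕ) : ℝ)
        = 2 ^ n - ((Finset.range n).powerset.filter fun X => good X = true).card := by
      rw [eq_sub_iff_add_eq, add_comm]; exact_mod_cast hcard
    rw [hcard', ha]
    have hN : (2 : ℝ) ^ n ≠ 0 := by positivity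
    field_simp
  · intro X hX
    have hX' := Finset.mem_powerset.1 hX
    conv_rhs => rw [← idxSet_setIdx hb hX']
    ext i
    rw [mem_idxSet, mem_idxSet]
    refine and_congr_right fun hi => ?_
    rw [xorAt, Function.update_of_ne]
    intro h
    have := Qubit.work.inj h; omega

theorem local_searchOp : Local (regQubits d n ∪ {.work flag}) (searchOp d n flag Q iterations) := by
  have hh : Local (regQubits d n ∪ {.work flag}) (run (hadGates d n)) :=
    (local_run (writes_hadGates d n)).mono Set.subset_union_left
  have hi : Local (regQubits d n ∪ {.work flag}) (run (invGates (hadGates d n))) :=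
    (local_run (writes_invGates (writes_hadGates d n))).mono Set.subset_union_left
  have hit : Local (regQubits d n ∪ {.work flag}) (diffOp d n ∘ₗ phaseOp Q) :=
    (hh.comp ((local_phaseOp _ _).comp hi)).comp (local_phaseOp _ _)
  refine Local.comp (local_basisMap fun b q hq => ?_) (Local.comp ?_ hh)
  · rw [xorAt, Function.update_of_ne]
    rintro rfl
    exact hq (Or.inr rfl)
  · induction iterations with
    | zero => exact local_id _
    | succ j ih => rw [pow_succ']; exact hit.comp ih

end Search

/-- Among the tried numbers of iterations there is one for which the search fails with probability
at most `3 / 4`: the angle `(2 j + 1) θ` grows by a factor of at most `3` from one number to the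
next, so that it cannot jump over the interval from `π / 6` to `π / 2`. -/
theorem exists_iterCount {a : ℝ} {m h : ℕ} (ha : 1 ≤ a * 2 ^ m) (ha1 : a ≤ 1) (hm : m ≤ 2 * h) :
    ∃ i ≤ h + 1, (1 - a) * (groverAmp a (iterCount i)).2 ^ 2 ≤ 3 / 4 := by
  have ha0 : 0 < a := by
    by_contra hneg
    have : a * 2 ^ m ≤ 0 := mul_nonpos_of_nonpos_of_nonneg (not_lt.1 hneg) (by positivity)
    linarith
  set θ := Real.arcsin √a with hθ
  have hsin : Real.sin θ = √a := Real.sin_arcsin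
    (by linarith [Real.sqrt_nonneg a]) (Real.sqrt_le_one.2 ha1)
  have hsin2 : Real.sin θ ^ 2 = a := by rw [hsin, Real.sq_sqrt ha0.le]
  have hθ0 : 0 < θ := Real.arcsin_pos.2 (Real.sqrt_pos.2 ha0)
  have hθ1 : θ ≤ Real.pi / 2 := Real.arcsin_le_pi_div_two _
  have hθs : √a ≤ θ := hsin ▸ Real.sin_le hθ0.le
  have hval (j : ℕ) : (1 - a) * (groverAmp a j).2 ^ 2 = 1 - Real.sin ((2 * j + 1) * θ) ^ 2 := by
    have h1 := (groverAmp_eq θ j).2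
    rw [hsin2] at h1
    have h2 : 1 - a = Real.cos θ ^ 2 := by
      rw [← hsin2]; linarith [Real.sin_sq_add_cos_sq θ]
    rw [h2, ← mul_pow, mul_comm, h1]
    linarith [Real.sin_sq_add_cos_sq ((2 * (j : ℝ) + 1) * θ)]
  have hpi := Real.pi_gt_three
  have hpi4 := Real.pi_le_four
  -- `2 ^ h` iterations turn the state by a sufficient angle since `θ ≥ √a ≥ 2 ^ (-h)`
  have hex : ∃ i, i ≤ h + 1 ∧ Real.pi / 6 ≤ (2 * (iterCount i : ℝ) + 1) * θ := by
    refine ⟨h + 1, le_rfl, ?_⟩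
    have h1 : 1 ≤ 2 ^ h * √a := by
      have : √1 ≤ √(a * (2 ^ h) ^ 2) := by
        refine Real.sqrt_le_sqrt (ha.trans ?_)
        rw [← pow_mul, mul_comm h 2]
        exact mul_le_mul_of_nonneg_left (pow_le_pow_right₀ (by norm_num) hm) ha0.le
      rw [Real.sqrt_one, Real.sqrt_mul ha0.le, Real.sqrt_sq (by positivity)] at this
      linarith
    have h2 : (1 : ℝ) ≤ 2 ^ h * θ :=
      h1.trans (mul_le_mul_of_nonneg_left hθs (by positivity))
    have h3 : iterCount (h + 1) = 2 ^ h := by simp [iterCount]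
    rw [h3]
    push_cast
    nlinarith
  classical
  obtain ⟨hi, hlow⟩ := Nat.find_spec hex
  set i := Nat.find hex with hidef
  refine ⟨i, hi, ?_⟩
  have hup : (2 * (iterCount i : ℝ) + 1) * θ ≤ Real.pi / 2 := by
    rcases Nat.eq_zero_or_pos i with h0 | hpos
    · rw [h0]; simpa [iterCount] using hθ1
    · have hprev := Nat.find_min hex (m := i - 1) (by omega)
      have hprev' : (2 * (iterCount (i - 1) : ℝ) + 1) * θ < Real.pi / 6 := by
        by_contra hcon
        exact hprev ⟨by omega, not_lt.1 hcon⟩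
      have hgrow : 2 * (iterCount i : ℝ) + 1 ≤ 3 * (2 * (iterCount (i - 1) : ℝ) + 1) := by
        have : 2 * iterCount i + 1 ≤ 3 * (2 * iterCount (i - 1) + 1) := by
          obtain ⟨k, hk⟩ : ∃ k, i = k + 1 := ⟨i - 1, by omega⟩
          rw [hk]
          simp only [iterCount, Nat.add_sub_cancel]
          rcases Nat.eq_zero_or_pos k with rfl | hk'
          · simp
          · obtain ⟨l, rfl⟩ : ∃ l, k = l + 1 := ⟨k - 1, by omega⟩
            simp [pow_succ]; omega
        exact_mod_cast this
      nlinarith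
  rw [hval]
  have hs : 1 / 2 ≤ Real.sin ((2 * (iterCount i : ℝ) + 1) * θ) := by
    rw [← Real.sin_pi_div_six]
    exact Real.sin_le_sin_of_le_of_le_pi_div_two (by linarith) hup hlow
  nlinarith

/-! ### The layout of the circuit -/

/-- The parameters of the circuit for one fractalization step. -/
structure Lay where
  /-- the size of the ground set -/
  n : ℕ
  /-- the size of the second part -/
  k : ℕ
  /-- the length of the inputs -/
  N0 : ℕ
  /-- the number of bits of the values of the parts -/
  wv : ℕ
  /-- the number of repetitions of the subroutine for one part -/
  r : ℕ
  /-- the number of qubits that hold the number of a copy of a subroutine -/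
  s : ℕ
  /-- the number of work qubits of a copy of a subroutine -/
  wm : ℕ
  /-- the address width of a copy of a subroutine -/
  A : ℕ
  /-- the word size -/
  w : ℕ
  /-- the number of repetitions of the searches -/
  rep : ℕ
  /-- determines the largest number of Grover iterations -/
  h : ℕ
  /-- the inputs of the subroutines for the two parts -/
  sub1 : List Expr
  sub2 : List Expr
  /-- the elements of the second part -/
  sel : List Expr
  /-- the input of the circuit that combines the values of the parts, except for these values -/
  head : List Expr
  /-- the circuit that combines the values of the parts -/
  ga : List (ℕ × ℕ)
  go : List ℕ
  /-- the subroutines for the two parts, and their output qubits -/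
  g1 : List Gate
  g2 : List Gate
  o1 : List ℕ
  o2 : List ℕ

/-- In the expressions for the inputs of the subroutines, the variables from `N0` on stand for the
search register, which is at `d`. -/
def relocVar (N0 d v : ℕ) : ℕ := if v < N0 then v else d + (v - N0)

/-- The expression with the variables of the search register in place. -/
def relocE (N0 d : ℕ) (e : Expr) : Expr := e.map fun t => (relocVar N0 d t.1, relocVar N0 d t.2)

/-- A program for the conjunction of the negations of the qubits `start + t * step`, `t < N`. The
result is in the last of its `N + 1` qubits. -/
def allZero (one start step N p : ℕ) : List Expr :=
  [(one, one)] :: (List.range N).map fun t => [(p + t, p + t), (p + t, start + t * step)]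

/-- A program that counts the `N` qubits `start + t * step` that are set. It fills a square table;
the entry in row `i` and column `j` says that exactly `j` of the first `i` qubits are set. -/
def countRow (one start step N p i : ℕ) : List Expr :=
  (List.range (N + 1)).map fun j =>
    if i = 0 then (if j = 0 then [(one, one)] else [])
    else [(p + (i - 1) * (N + 1) + j, p + (i - 1) * (N + 1) + j),
        (start + (i - 1) * step, p + (i - 1) * (N + 1) + j)] ++
      if j = 0 then [] else [(start + (i - 1) * step, p + (i - 1) * (N + 1) + (j - 1))]

/-- The whole table, row by row. -/
def countProg (one start step N p : ℕ) : List Expr :=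
  (List.range (N + 1)).flatMap (countRow one start step N p)

namespace Lay

variable (L : Lay)

/-- The number of output qubits. -/
def Wo : ℕ := L.go.length

/-- A qubit that is always `1`. -/
def one : ℕ := L.N0 + L.Wo

/-- The registers of the searches start here. -/
def p0 : ℕ := L.N0 + L.Wo + 1

/-- The number of searches. -/
def Rn : ℕ := (L.h + 2) * L.rep

/-- The register of a search; it is followed by the flag of the search. -/
def reg (c : ℕ) : ℕ := L.p0 + c * (L.n + 1)

/-- The scratch qubits start here, with the copies of the subroutines. They are zero between the
calls of the oracle. -/
def p1 : ℕ := L.p0 + L.Rn * (L.n + 1)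

/-- The number of qubits for a copy of a subroutine. -/
def stride : ℕ := L.wm + L.s + L.A + L.w

/-- The first qubit of a copy of a subroutine. -/
def base (c : ℕ) : ℕ := L.p1 + c * L.stride

/-- The output bits of the copies of the subroutines start here. -/
def p2 : ℕ := L.p1 + 2 * L.r * L.stride

/-- The input of the copy number `c`: there are `r` copies of the subroutine for the first part,
followed by `r` copies of the one for the second part. -/
def subOf (c : ℕ) : List Expr := if c < L.r then L.sub1 else L.sub2

/-- The gates of the copy number `c`. -/
def gatesOf (c : ℕ) : List Gate := if c < L.r then L.g1 else L.g2

/-- The output qubits of the copy number `c`. -/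
def outsOf (c : ℕ) : List ℕ := if c < L.r then L.o1 else L.o2

/-- The binary digits of the number of a copy. -/
def numExprs (c : ℕ) : List Expr :=
  (List.range L.s).map fun l => if c / 2 ^ l % 2 = 1 then [(L.one, L.one)] else []

/-- `N` qubits that are left at zero. -/
def blanks (N : ℕ) : List Expr := (List.range N).map fun _ => []

/-- The initial state of the copy number `c`: its input, its work qubits, its number, which serves
as the upper part of all addresses, and zeros to pad addresses and words. -/
def preCopy (d c : ℕ) : List Expr :=
  (L.subOf c).map (relocE L.N0 d) ++ (blanks (L.wm - L.N0) ++
    (L.numExprs c ++ blanks (L.A + L.w)))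

/-- The program that prepares all copies of the subroutines. -/
def pre (d : ℕ) : List Expr := (List.range (2 * L.r)).flatMap (L.preCopy d)

/-- All copies of the subroutines. -/
def copies : List Gate :=
  (List.range (2 * L.r)).flatMap fun c =>
    placeGates (L.base c) L.wm L.s L.A L.w (L.gatesOf c)

/-- The output bits of a copy. -/
def outRow (c : ℕ) : List Expr :=
  (List.range L.wv).map fun l =>
    if l < (L.outsOf c).length then
      [(L.base c + (L.outsOf c).getD l 0, L.base c + (L.outsOf c).getD l 0)] else []

/-- The tables for the majority votes start here. -/
def p3 : ℕ := L.p2 + 2 * L.r * L.wv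

/-- The first of the copies of the output bit number `u` of both subroutines. -/
def voteStart (u : ℕ) : ℕ := L.p2 + (u / L.wv * L.r) * L.wv + u % L.wv

/-- The size of a table for the majority vote among `r` copies. -/
def tableSize : ℕ := (L.r + 1) * (L.r + 1)

/-- The indicators of the elements of the second part start here. -/
def p4 : ℕ := L.p3 + 2 * L.wv * L.tableSize

/-- The table that counts the elements of the second part starts here. -/
def p5 : ℕ := L.p4 + L.n

/-- The wires of the circuit that combines the values start here. -/
def p6 : ℕ := L.p5 + (L.n + 1) * (L.n + 1)

/-- The majority vote for the output bit number `u`. -/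
def voteExpr (u : ℕ) : Expr :=
  (List.range (L.r + 1)).flatMap fun j =>
    if L.r < 2 * j then
      [(L.p3 + u * L.tableSize + L.r * (L.r + 1) + j, L.p3 + u * L.tableSize + L.r * (L.r + 1) + j)]
    else []

/-- The number of inputs of the circuit that combines the values. -/
def nin : ℕ := L.head.length + 2 * L.wv

/-- The NAND gate number `t`, as `1 + a * b`. A wire that does not exist carries `false`, so that
the gate has the constant value `1`. -/
def gateExpr (t : ℕ) : Expr :=
  (L.one, L.one) ::
    if (L.ga.getD t (0, 0)).1 < L.nin + t ∧ (L.ga.getD t (0, 0)).2 < L.nin + t then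
      [(L.p6 + (L.ga.getD t (0, 0)).1, L.p6 + (L.ga.getD t (0, 0)).2)] else []

/-- The number of wires of the circuit that combines the values. -/
def ntot : ℕ := L.nin + L.ga.length

/-- The output bits of the circuit that combines the values start here. -/
def p7 : ℕ := L.p6 + L.ntot

/-- The output bit number `l` of the circuit that combines the values. -/
def goExpr (l : ℕ) : Expr :=
  if L.go.getD l 0 < L.ntot then [(L.p6 + L.go.getD l 0, L.p6 + L.go.getD l 0)] else []

/-- The comparison with the known bits of the minimum starts here. -/
def p8 : ℕ := L.p7 + L.Wo

/-- A chain of conjunctions. A link takes the conjunction with the test whether the bit number `l`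
of the value agrees with that of the minimum if `i < l`, and with the test whether it is `0` if
`i = l`. -/
def chainExpr (i l : ℕ) : Expr :=
  (L.p8 + l, L.p8 + l) :: ((if i ≤ l then [(L.p8 + l, L.p7 + l)] else []) ++
    if i < l then [(L.p8 + l, L.N0 + l)] else [])

/-- The program that evaluates the outcome of the subroutines: it takes the majority of the output
bits, checks the size of the second part, combines the values, and compares the result with the
known bits of the minimum, looking for a value with a zero in place `i`. -/
def post (d i : ℕ) : List Expr :=
  (List.range (2 * L.r)).flatMap L.outRow ++
  ((List.range (2 * L.wv)).flatMap (fun u =>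
    countProg L.one (L.voteStart u) L.wv L.r (L.p3 + u * L.tableSize)) ++
  (L.sel.map (relocE L.N0 d) ++
  (countProg L.one L.p4 1 L.n L.p5 ++
  (L.head.map (relocE L.N0 d) ++
  ((List.range (2 * L.wv)).map L.voteExpr ++
  ((List.range L.ga.length).map L.gateExpr ++
  ((List.range L.Wo).map L.goExpr ++
  ([(L.p5 + L.n * (L.n + 1) + L.k, L.p5 + L.n * (L.n + 1) + L.k)] ::
  (List.range L.Wo).map (L.chainExpr i)))))))))

/-- The computation of whether the set in the register at `d` is good, up to a small error. -/
def oracleU (d i : ℕ) : List Gate :=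
  progGates L.p1 (L.pre d) ++ (L.copies ++ progGates L.p2 (L.post d i))

/-- The qubit `fl` is flipped if the set in the register at `d` is good. -/
def oracle (d i fl : ℕ) : List Gate := copyOut (L.oracleU d i) (L.p8 + L.Wo) fl

/-- The reflection of the subsets in the register at `d`. -/
def diffusion (d : ℕ) : List Gate :=
  invGates (hadGates d L.n) ++
    (phaseKick (progGates L.p1 (allZero L.one d 1 L.n L.p1)) (L.p1 + L.n) ++ hadGates d L.n)

/-- The search number `c`. -/
def search (i c : ℕ) : List Gate :=
  hadGates (L.reg c) L.n ++
    (repGates (iterCount (c % (L.h + 2)))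
      (phaseKick (L.oracle (L.reg c) i (L.reg c + L.n)) (L.reg c + L.n) ++ L.diffusion (L.reg c)) ++
    L.oracle (L.reg c) i (L.reg c + L.n))

/-- All searches for a value that agrees with the minimum above the place `i` and has a zero
there. -/
def searches (i : ℕ) : List Gate := (List.range L.Rn).flatMap (L.search i)

/-- All searches, followed by the computation of whether none of them was successful. -/
def bitU (i : ℕ) : List Gate :=
  L.searches i ++ progGates L.p1 (allZero L.one (L.p0 + L.n) (L.n + 1) L.Rn L.p1)

/-- The computation of the `i`-th bit of the minimum from the higher ones. -/
def bit (i : ℕ) : List Gate := copyOut (L.bitU i) (L.p1 + L.Rn) (L.N0 + i)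

/-- The bits of the minimum are computed from the highest one on. -/
def gates : List Gate :=
  .not L.one :: (List.range L.Wo).flatMap fun t => L.bit (L.Wo - 1 - t)

/-- The number of work qubits, with room for the programs of `diffusion` and `bitU`, which start
at `p1`. -/
def work : ℕ := L.p8 + L.Wo + L.n + L.Rn + 2

/-- The circuit that computes the minimum. -/
def circuit : QCircuit where
  work := L.work
  addrWidth := L.A + L.s
  wordSize := L.w
  outs := (List.range L.Wo).map (L.N0 + ·)
  gates := L.gates

/-- The conditions on the parameters under which the circuit makes sense. -/
structure Good : Prop where
  len1 : L.sub1.length = L.N0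
  len2 : L.sub2.length = L.N0
  lenSel : L.sel.length = L.n
  vars : ∀ e, e ∈ L.sub1 ∨ e ∈ L.sub2 ∨ e ∈ L.sel ∨ e ∈ L.head →
    ∀ t ∈ e, t.1 < L.N0 + L.n ∧ t.2 < L.N0 + L.n
  N0_le : L.N0 ≤ L.wm
  k_le : L.k ≤ L.n
  two_r_le : 2 * L.r ≤ 2 ^ L.s
  o1_lt : ∀ q ∈ L.o1, q < L.wm
  o2_lt : ∀ q ∈ L.o2, q < L.wm
  g_ok : ∀ c, ∃ a wd, wd ≤ L.w ∧ (0 < wd → a ≤ L.A) ∧ ∀ G ∈ L.gatesOf c, GateOK L.wm a wd G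

end Lay

/-! ### Semantics of the programs -/

@[simp] theorem workBits_apply (b : BasisState) (q : ℕ) : workBits b q = b (.work q) := rfl

theorem length_allZero (one start step N p : ℕ) :
    (allZero one start step N p).length = N + 1 := by simp [allZero]

/-- The program `allZero` computes a conjunction of negations. -/
theorem allZero_spec {one start step N p : ℕ} {φ : BasisState}
    (h : Sat p (allZero one start step N p) φ) (h1 : φ (.work one) = true) :
    φ (.work (p + N)) = true ↔ ∀ t < N, φ (.work (start + t * step)) = false := by
  obtain ⟨h0, hs⟩ := h
  rw [sat_map_range] at hs
  have key : ∀ M ≤ N, (φ (.work (p + M)) = true ↔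
      ∀ t < M, φ (.work (start + t * step)) = false) := by
    intro M hM
    induction M with
    | zero => simp [h0, h1]
    | succ M ih =>
      have := hs M (by omega)
      rw [show p + 1 + M = p + (M + 1) by omega] at this
      have ih := ih (by omega)
      rw [this]
      simp only [exprVal_cons, exprVal_nil, workBits_apply, Bool.and_self, Bool.xor_false]
      constructor
      · intro hx t ht
        rcases Nat.lt_succ_iff_lt_or_eq.1 ht with ht | rfl
        · refine ih.1 ?_ t ht
          by_contra hc
          simp [hc] at hx
        · by_contra hc
          cases h : φ (.work (p + t)) <;> simp [hc, h] at hx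
      · intro hx
        have e1 := ih.2 fun t ht => hx t (by omega)
        simp [e1, hx M (by omega)]
  exact key N le_rfl

theorem wf_allZero {one start step N p : ℕ} (h1 : one < p) (h : ∀ t < N, start + t * step < p) :
    WFProg p (allZero one start step N p) := by
  refine ⟨by simpa using h1, wfProg_map_range.2 fun t ht => ?_⟩
  have := h t ht
  simp; omega

theorem length_countRow (one start step N p i : ℕ) :
    (countRow one start step N p i).length = N + 1 := by simp [countRow]

theorem length_countProg (one start step N p : ℕ) :
    (countProg one start step N p).length = (N + 1) * (N + 1) :=
  length_flatMap_range fun i _ => length_countRow one start step N p i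

/-- The entries of the table have the intended meaning: the `i`-th row is the unary representation
of the number of qubits that are set among the first `i` ones. -/
theorem countProg_spec {one start step N p : ℕ} {φ : BasisState}
    (h : Sat p (countProg one start step N p) φ) (h1 : φ (.work one) = true) {i j : ℕ} (hi : i ≤ N)
    (hj : j ≤ N) : φ (.work (p + i * (N + 1) + j)) =
      decide (((Finset.range i).filter fun t => φ (.work (start + t * step)) = true).card = j) := by
  rw [countProg, sat_flatMap_range fun i _ => length_countRow one start step N p i] at h
  induction i generalizing j with
  | zero =>
    have := h 0 (by omega)
    rw [countRow, sat_map_range] at this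
    rw [this j (by omega)]
    by_cases hj0 : j = 0
    · simp [hj0, h1]
    · simp [hj0, Ne.symm hj0]
  | succ i ih =>
    have hrow := h (i + 1) (by omega)
    rw [countRow, sat_map_range] at hrow
    rw [hrow j (by omega), Finset.range_add_one, Finset.filter_insert]
    simp only [Nat.add_eq_zero_iff, one_ne_zero, and_false, if_false, Nat.add_sub_cancel]
    set K := ((Finset.range i).filter fun t => φ (.work (start + t * step)) = true) with hK
    have e0 := ih (j := j) (by omega) hj
    have hnot : i ∉ K := by simp [hK]
    by_cases hv : φ (.work (start + i * step)) = true
    · rw [if_pos hv, Finset.card_insert_of_notMem hnot]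
      by_cases hj0 : j = 0
      · subst hj0; simp [hv]
      · have e1 := ih (j := j - 1) (by omega) (by omega)
        rw [if_neg hj0]
        simp only [List.cons_append, List.nil_append, exprVal_cons, exprVal_nil, workBits_apply, hv,
          e0, e1, Bool.and_self, Bool.true_and, Bool.xor_false]
        rw [← Bool.xor_assoc, Bool.xor_self, Bool.false_xor]
        exact decide_eq_decide.2 (by omega)
    · have hv' : φ (.work (start + i * step)) = false := by simpa using hv
      rw [if_neg hv]
      by_cases hj0 : j = 0
      · subst hj0; simpa [hv'] using e0
      · rw [if_neg hj0]
        simp [hv', e0]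

theorem wf_countProg {one start step N p : ℕ} (h1 : one < p) (h : ∀ t < N, start + t * step < p) :
    WFProg p (countProg one start step N p) := by
  rw [countProg, wfProg_flatMap_range fun i _ => length_countRow one start step N p i]
  intro i hi
  rw [countRow, wfProg_map_range]
  intro j hj t ht
  rcases Nat.eq_zero_or_pos i with rfl | hpos
  · by_cases hj0 : j = 0
    · subst hj0; simp at ht; subst ht; simp; omega
    · simp [hj0] at ht
  · have hs := h (i - 1) (by omega)
    obtain ⟨i, rfl⟩ : ∃ k, i = k + 1 := ⟨i - 1, by omega⟩
    simp only [Nat.add_sub_cancel, Nat.add_mul, one_mul] at *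
    by_cases hj0 : j = 0
    · subst hj0
      simp at ht
      rcases ht with rfl | rfl <;> exact ⟨by simp only; omega, by simp only; omega⟩
    · simp [hj0] at ht
      rcases ht with rfl | rfl | rfl <;> exact ⟨by simp only; omega, by simp only; omega⟩

theorem vars_allZero {one start step N p : ℕ} {P : ℕ → Prop} (h1 : P one)
    (hs : ∀ t < N, P (start + t * step)) (hp : ∀ q, p ≤ q → P q) :
    ∀ e ∈ allZero one start step N p, ∀ t ∈ e, P t.1 ∧ P t.2 := by
  intro e he t ht
  rcases List.mem_cons.1 he with rfl | he
  · simp at ht; subst ht; exact ⟨h1, h1⟩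
  · obtain ⟨l, hl, rfl⟩ := List.mem_map.1 he
    have h2 := hs l (List.mem_range.1 hl)
    have h3 := hp (p + l) (by omega)
    simp at ht
    rcases ht with rfl | rfl
    · exact ⟨h3, h3⟩
    · exact ⟨h3, h2⟩

theorem vars_countProg {one start step N p : ℕ} {P : ℕ → Prop} (h1 : P one)
    (hs : ∀ t < N, P (start + t * step)) (hp : ∀ q, p ≤ q → P q) :
    ∀ e ∈ countProg one start step N p, ∀ t ∈ e, P t.1 ∧ P t.2 := by
  intro e he t ht
  obtain ⟨i, hi, he⟩ := List.mem_flatMap.1 he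
  obtain ⟨j, hj, rfl⟩ := List.mem_map.1 he
  rw [List.mem_range] at hi hj
  by_cases hi0 : i = 0
  · by_cases hj0 : j = 0
    · simp [hi0, hj0] at ht; subst ht; exact ⟨h1, h1⟩
    · simp [hi0, hj0] at ht
  · have h2 := hs (i - 1) (by omega)
    have h3 := hp (p + (i - 1) * (N + 1) + j) (by omega)
    have h4 := hp (p + (i - 1) * (N + 1) + (j - 1)) (by omega)
    by_cases hj0 : j = 0
    · subst hj0
      simp [hi0] at ht
      rcases ht with rfl | rfl
      · exact ⟨h3, h3⟩
      · exact ⟨h2, h3⟩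
    · simp [hi0, hj0] at ht
      rcases ht with rfl | rfl | rfl
      · exact ⟨h3, h3⟩
      · exact ⟨h2, h3⟩
      · exact ⟨h2, h4⟩

theorem exprVal_flatMap_range {N c : ℕ} {P : ℕ → Prop} [DecidablePred P] {v : ℕ → Bool}
    {f : ℕ → Expr} (h : ∀ j < N, exprVal (f j) v = decide (P j ∧ c = j)) :
    exprVal ((List.range N).flatMap f) v = decide (P c ∧ c < N) := by
  induction N with
  | zero => simp
  | succ N ih =>
    rw [List.range_succ, List.flatMap_append, exprVal_append, ih fun j hj => h j (by omega)]
    simp only [List.flatMap_cons, List.flatMap_nil, List.append_nil]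
    rw [h N (by omega)]
    by_cases hc : c = N
    · subst hc; simp
    · have : c < N + 1 ↔ c < N := by omega
      simp [hc, this]

theorem exprVal_relocE {N0 d : ℕ} {e : Expr} {v : ℕ → Bool} :
    exprVal (relocE N0 d e) v = exprVal e fun x => v (relocVar N0 d x) := by
  induction e with
  | nil => rfl
  | cons t e ih => simpa [relocE] using ih

theorem sat_list {p : ℕ} {es : List Expr} {φ : BasisState} (h : Sat p es φ) {k : ℕ}
    (hk : k < es.length) : φ (.work (p + k)) = exprVal es[k] (workBits φ) := by
  induction es generalizing p k with
  | nil => simp at hk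
  | cons e es ih =>
    cases k with
    | zero => simpa using h.1
    | succ k =>
      have := ih h.2 (k := k) (by simpa using hk)
      rw [show p + 1 + k = p + (k + 1) by omega] at this
      simpa using this

theorem wfProg_of_forall {p : ℕ} {es : List Expr} (h : ∀ e ∈ es, ∀ t ∈ e, t.1 < p ∧ t.2 < p) :
    WFProg p es := by
  induction es generalizing p with
  | nil => trivial
  | cons e es ih =>
    refine ⟨h e (by simp), ih fun e he t ht => ?_⟩
    have := h e (List.mem_cons_of_mem _ he) t ht
    omega

/-- The value of an expression when the input and the subset `X` are given. -/
def evX (N0 : ℕ) (input : List Bool) (X : Finset ℕ) (e : Expr) : Bool :=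
  exprVal e fun v => if v < N0 then input.getD v false else decide (v - N0 ∈ X)

theorem length_foldl_wires (ga : List (ℕ × ℕ)) (ws : List Bool) :
    (ga.foldl (fun ws p => ws ++ [!(ws.getD p.1 false && ws.getD p.2 false)]) ws).length
      = ws.length + ga.length := by
  induction ga generalizing ws with
  | nil => rfl
  | cons g ga ih => rw [List.foldl_cons, ih]; simp; omega

theorem outRow_length (L : Lay) (c : ℕ) : (L.outRow c).length = L.wv := by simp [Lay.outRow]

namespace Lay

variable {L : Lay} {d i : ℕ} {φ : BasisState}

theorem p2_add_outs : L.p2 + ((List.range (2 * L.r)).flatMap L.outRow).length = L.p3 := by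
  rw [length_flatMap_range fun c _ => outRow_length L c]; rfl

theorem p3_add_tables : L.p3 + ((List.range (2 * L.wv)).flatMap (fun u =>
    countProg L.one (L.voteStart u) L.wv L.r (L.p3 + u * L.tableSize))).length = L.p4 := by
  rw [length_flatMap_range fun u _ => length_countProg _ _ _ _ _]; rfl

theorem sat_post (hL : L.Good) : Sat L.p2 (L.post d i) φ ↔
    Sat L.p2 ((List.range (2 * L.r)).flatMap L.outRow) φ ∧
    Sat L.p3 ((List.range (2 * L.wv)).flatMap (fun u =>
      countProg L.one (L.voteStart u) L.wv L.r (L.p3 + u * L.tableSize))) φ ∧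
    Sat L.p4 (L.sel.map (relocE L.N0 d)) φ ∧
    Sat L.p5 (countProg L.one L.p4 1 L.n L.p5) φ ∧
    Sat L.p6 (L.head.map (relocE L.N0 d)) φ ∧
    Sat (L.p6 + L.head.length) ((List.range (2 * L.wv)).map L.voteExpr) φ ∧
    Sat (L.p6 + L.nin) ((List.range L.ga.length).map L.gateExpr) φ ∧
    Sat L.p7 ((List.range L.Wo).map L.goExpr) φ ∧
    Sat L.p8 ([(L.p5 + L.n * (L.n + 1) + L.k, L.p5 + L.n * (L.n + 1) + L.k)] ::
      (List.range L.Wo).map (L.chainExpr i)) φ := by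
  rw [post, sat_append, p2_add_outs, sat_append, p3_add_tables, sat_append, sat_append, sat_append,
    sat_append, sat_append, sat_append]
  simp only [List.length_map, List.length_range, length_countProg, hL.lenSel]
  have e1 : L.p4 + L.n = L.p5 := rfl
  have e2 : L.p5 + (L.n + 1) * (L.n + 1) = L.p6 := rfl
  have e3 : L.p6 + L.head.length + 2 * L.wv = L.p6 + L.nin := by rw [nin]; omega
  have e4 : L.p6 + L.nin + L.ga.length = L.p7 := by rw [p7, ntot]; omega
  have e5 : L.p7 + L.Wo = L.p8 := rfl
  rw [e1, e2, e3, e4, e5]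

theorem wf_post_iff (hL : L.Good) : WFProg L.p2 (L.post d i) ↔
    WFProg L.p2 ((List.range (2 * L.r)).flatMap L.outRow) ∧
    WFProg L.p3 ((List.range (2 * L.wv)).flatMap (fun u =>
      countProg L.one (L.voteStart u) L.wv L.r (L.p3 + u * L.tableSize))) ∧
    WFProg L.p4 (L.sel.map (relocE L.N0 d)) ∧
    WFProg L.p5 (countProg L.one L.p4 1 L.n L.p5) ∧
    WFProg L.p6 (L.head.map (relocE L.N0 d)) ∧
    WFProg (L.p6 + L.head.length) ((List.range (2 * L.wv)).map L.voteExpr) ∧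
    WFProg (L.p6 + L.nin) ((List.range L.ga.length).map L.gateExpr) ∧
    WFProg L.p7 ((List.range L.Wo).map L.goExpr) ∧
    WFProg L.p8 ([(L.p5 + L.n * (L.n + 1) + L.k, L.p5 + L.n * (L.n + 1) + L.k)] ::
      (List.range L.Wo).map (L.chainExpr i)) := by
  rw [post, wfProg_append, p2_add_outs, wfProg_append, p3_add_tables, wfProg_append, wfProg_append,
    wfProg_append, wfProg_append, wfProg_append, wfProg_append]
  simp only [List.length_map, List.length_range, length_countProg, hL.lenSel]
  have e1 : L.p4 + L.n = L.p5 := rfl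
  have e2 : L.p5 + (L.n + 1) * (L.n + 1) = L.p6 := rfl
  have e3 : L.p6 + L.head.length + 2 * L.wv = L.p6 + L.nin := by rw [nin]; omega
  have e4 : L.p6 + L.nin + L.ga.length = L.p7 := by rw [p7, ntot]; omega
  have e5 : L.p7 + L.Wo = L.p8 := rfl
  rw [e1, e2, e3, e4, e5]

theorem length_post (hL : L.Good) : L.p2 + (L.post d i).length = L.p8 + L.Wo + 1 := by
  rw [post, List.length_append, ← add_assoc, p2_add_outs, List.length_append, ← add_assoc,
    p3_add_tables]
  simp only [List.length_map, List.length_range, length_countProg, List.length_append,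
    List.length_cons, hL.lenSel, p8, p7, p6, p5, ntot, nin]
  omega

theorem outs_lt (hL : L.Good) (c : ℕ) : ∀ q ∈ L.outsOf c, q < L.wm := by
  rw [outsOf]; split_ifs
  · exact hL.o1_lt
  · exact hL.o2_lt

theorem base_add_le {c : ℕ} (hc : c < 2 * L.r) : L.base c + L.stride ≤ L.p2 := by
  rw [base, p2]
  have : (c + 1) * L.stride ≤ 2 * L.r * L.stride := Nat.mul_le_mul_right _ hc
  rw [Nat.add_mul] at this; omega

theorem relocVar_lt {N0 n d v : ℕ} {B : ℕ} (hN : N0 ≤ B) (hd : d + n ≤ B) (hv : v < N0 + n) :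
    relocVar N0 d v < B := by
  rw [relocVar]; split_ifs <;> omega

theorem voteStart_add {u t : ℕ} :
    L.voteStart u + t * L.wv = L.p2 + ((u / L.wv * L.r + t) * L.wv + u % L.wv) := by
  rw [voteStart, Nat.add_mul]; omega

theorem voteStart_lt {u t : ℕ} (hu : u < 2 * L.wv) (ht : t < L.r) :
    L.voteStart u + t * L.wv < L.p3 := by
  rw [voteStart_add, p3]
  have hw : 0 < L.wv := by omega
  have h1 : u / L.wv < 2 := Nat.div_lt_of_lt_mul (by rwa [mul_comm] at hu)
  have h2 := Nat.mod_lt u hw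
  have h3 : u / L.wv * L.r + t + 1 ≤ 2 * L.r := by
    have : u / L.wv * L.r ≤ 1 * L.r := Nat.mul_le_mul_right _ (by omega)
    omega
  have h4 := Nat.mul_le_mul_right L.wv h3
  rw [Nat.add_mul _ 1] at h4
  omega

theorem p_le : L.p1 ≤ L.p2 ∧ L.p2 ≤ L.p3 ∧ L.p3 ≤ L.p4 ∧ L.p4 ≤ L.p5 ∧ L.p5 ≤ L.p6 ∧
    L.p6 ≤ L.p7 ∧ L.p7 ≤ L.p8 :=
  ⟨Nat.le_add_right _ _, Nat.le_add_right _ _, Nat.le_add_right _ _, Nat.le_add_right _ _,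
    Nat.le_add_right _ _, Nat.le_add_right _ _, Nat.le_add_right _ _⟩

theorem fixed_lt : L.N0 + L.Wo = L.one ∧ L.one < L.p0 ∧ L.p0 ≤ L.p1 :=
  ⟨rfl, Nat.lt_succ_self _, Nat.le_add_right _ _⟩

theorem tableSize_add {j : ℕ} (hj : j ≤ L.r) : L.r * (L.r + 1) + j < L.tableSize := by
  rw [tableSize, Nat.add_mul _ 1]; omega

theorem table_le {u : ℕ} (hu : u < 2 * L.wv) : L.p3 + u * L.tableSize + L.tableSize ≤ L.p4 := by
  rw [p4]
  have h4 := Nat.mul_le_mul_right L.tableSize (show u + 1 ≤ 2 * L.wv by omega)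
  rw [Nat.add_mul _ 1] at h4
  omega

theorem wf_post (hL : L.Good) (hd : d + L.n ≤ L.p1) : WFProg L.p2 (L.post d i) := by
  obtain ⟨a1, a2, a3, a4, a5, a6, a7⟩ := p_le (L := L)
  obtain ⟨b1, b2, b3⟩ := fixed_lt (L := L)
  have hrel {B : ℕ} (hB : L.p1 ≤ B) (es : List Expr)
      (hes : ∀ e ∈ es, e ∈ L.sub1 ∨ e ∈ L.sub2 ∨ e ∈ L.sel ∨ e ∈ L.head) :
      WFProg B (es.map (relocE L.N0 d)) := by
    refine wfProg_of_forall fun e he t ht => ?_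
    obtain ⟨e', he', rfl⟩ := List.mem_map.1 he
    obtain ⟨t', ht', rfl⟩ := List.mem_map.1 ht
    have := hL.vars e' (hes e' he') t' ht'
    exact ⟨relocVar_lt (by omega) (by omega) this.1, relocVar_lt (by omega) (by omega) this.2⟩
  rw [wf_post_iff hL]
  refine ⟨?_, ?_, ?_, ?_, ?_, ?_, ?_, ?_, ?_⟩
  · rw [wfProg_flatMap_range fun c _ => outRow_length L c]
    intro c hc
    rw [outRow, wfProg_map_range]
    intro l hl t ht
    split_ifs at ht with h
    · have hm : (L.outsOf c).getD l 0 ∈ L.outsOf c := by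
        rw [List.getD_eq_getElem _ _ h]; exact List.getElem_mem _
      have h1 := outs_lt hL c _ hm
      have h2 := base_add_le hc
      simp only [List.mem_singleton] at ht
      rw [stride] at h2
      subst ht; simp only; omega
    · simp at ht
  · rw [wfProg_flatMap_range fun u _ => length_countProg _ _ _ _ _]
    intro u hu
    refine wf_countProg ?_ fun t ht => ?_
    · omega
    · have := voteStart_lt hu ht; omega
  · exact hrel (by omega) _ fun e he => by tauto
  · refine wf_countProg (by omega) fun t ht => ?_
    rw [p5]; omega
  · exact hrel (by omega) _ fun e he => by tauto
  · rw [wfProg_map_range]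
    intro u hu t ht
    obtain ⟨j, hj, ht⟩ := List.mem_flatMap.1 ht
    split_ifs at ht with h
    · have h1 := tableSize_add (L := L) (j := j) (by rw [List.mem_range] at hj; omega)
      have h2 := table_le hu
      simp only [List.mem_singleton] at ht
      subst ht; simp only; omega
    · simp at ht
  · rw [wfProg_map_range]
    intro k hk t ht
    rcases List.mem_cons.1 ht with rfl | ht
    · simp only; omega
    · split_ifs at ht with h
      · simp only [List.mem_singleton] at ht
        subst ht; simp only; omega
      · simp at ht
  · rw [wfProg_map_range]
    intro l hl t ht
    rw [goExpr] at ht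
    split_ifs at ht with h
    · simp only [List.mem_singleton] at ht
      subst ht; simp only [p7]; omega
    · simp at ht
  · have hk := hL.k_le
    have h6 : L.p6 = L.p5 + (L.n * (L.n + 1) + (L.n + 1)) := by rw [p6, Nat.add_mul _ 1, one_mul]
    refine ⟨by simp; omega, ?_⟩
    rw [wfProg_map_range]
    intro l hl t ht
    simp only [chainExpr, List.mem_cons, List.mem_append] at ht
    rcases ht with rfl | ht | ht
    · simp only; omega
    · split_ifs at ht
      · simp only [List.mem_singleton] at ht
        subst ht; simp only [p8]; omega
      · simp at ht
    · split_ifs at ht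
      · simp only [List.mem_singleton] at ht
        subst ht; simp only; omega
      · simp at ht

/-- The majority of the copies of a subroutine have the correct output `v`; the copies of the
first subroutine are numbered from `0` and those of the second one from `r`. -/
def Maj (L : Lay) (g v : ℕ) (φ : BasisState) : Prop :=
  open Classical in
  L.r < 2 * ((Finset.range L.r).filter fun t =>
    OutCorrect (L.base (g * L.r + t)) (L.outsOf (g * L.r + t)) L.wv v φ).card

/-- If the majority of the copies is correct, then the vote yields the bits of the value. -/
theorem vote_spec (hsat : Sat L.p2 (L.post d i) φ) (hL : L.Good) (h1 : φ (.work L.one) = true)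
    {g v l : ℕ} (hg : g < 2) (hl : l < L.wv) (hmaj : Maj L g v φ) :
    φ (.work (L.p6 + L.head.length + (g * L.wv + l))) = v.testBit l := by
  classical
  obtain ⟨s1, s2, -, -, -, s6, -, -, -⟩ := (sat_post hL).1 hsat
  have hu : g * L.wv + l < 2 * L.wv := by
    have : g * L.wv ≤ 1 * L.wv := Nat.mul_le_mul_right _ (by omega)
    omega
  set u := g * L.wv + l with hudef
  have hdiv : u / L.wv = g := by
    rw [hudef, mul_comm, Nat.mul_add_div (by omega), Nat.div_eq_of_lt hl, add_zero]
  have hmod : u % L.wv = l := by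
    rw [hudef, mul_comm, Nat.mul_add_mod, Nat.mod_eq_of_lt hl]
  have hob (t : ℕ) (ht : t < L.r) : φ (.work (L.voteStart u + t * L.wv))
      = outBit (L.base (g * L.r + t)) (L.outsOf (g * L.r + t)) l φ := by
    have hc : g * L.r + t < 2 * L.r := by
      have : g * L.r ≤ 1 * L.r := Nat.mul_le_mul_right _ (by omega)
      omega
    rw [sat_flatMap_range fun c _ => outRow_length L c] at s1
    have := s1 _ hc
    rw [outRow, sat_map_range] at this
    rw [voteStart_add, hdiv, hmod, ← add_assoc, this l hl, outBit]
    split_ifs <;> simp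
  set cnt := ((Finset.range L.r).filter fun t =>
    φ (.work (L.voteStart u + t * L.wv)) = true).card with hcnt
  have hcle : cnt ≤ L.r := (Finset.card_filter_le _ _).trans (by simp)
  rw [sat_map_range] at s6
  rw [s6 u hu, voteExpr, exprVal_flatMap_range (c := cnt) (P := fun j => L.r < 2 * j)]
  · have hbit : (L.r < 2 * cnt) ↔ v.testBit l = true := by
      rw [Maj] at hmaj
      constructor
      · intro h
        by_contra hv
        have hdisj : Disjoint ((Finset.range L.r).filter fun t =>
            φ (.work (L.voteStart u + t * L.wv)) = true) ((Finset.range L.r).filter fun t =>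
            OutCorrect (L.base (g * L.r + t)) (L.outsOf (g * L.r + t)) L.wv v φ) := by
          rw [Finset.disjoint_left]
          intro t ht ht'
          rw [Finset.mem_filter, Finset.mem_range] at ht ht'
          rw [hob t ht.1, ht'.2 l hl] at ht
          exact hv ht.2
        have := Finset.card_union_of_disjoint hdisj
        have hle := Finset.card_le_card (Finset.union_subset
          (Finset.filter_subset (fun t => φ (.work (L.voteStart u + t * L.wv)) = true)
            (Finset.range L.r))
          (Finset.filter_subset (fun t =>
            OutCorrect (L.base (g * L.r + t)) (L.outsOf (g * L.r + t)) L.wv v φ)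
            (Finset.range L.r)))
        rw [this, Finset.card_range] at hle
        omega
      · intro hv
        have : ((Finset.range L.r).filter fun t =>
            OutCorrect (L.base (g * L.r + t)) (L.outsOf (g * L.r + t)) L.wv v φ).card ≤ cnt := by
          refine Finset.card_le_card fun t ht => ?_
          rw [Finset.mem_filter, Finset.mem_range] at ht ⊢
          exact ⟨ht.1, by rw [hob t ht.1, ht.2 l hl, hv]⟩
        omega
    have : (L.r < 2 * cnt ∧ cnt < L.r + 1) ↔ v.testBit l = true := by
      rw [← hbit]; constructor
      · exact fun h => h.1
      · exact fun h => ⟨h, by omega⟩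
    rw [Bool.eq_iff_iff, decide_eq_true_eq]; exact this
  · intro j hj
    rw [sat_flatMap_range fun u _ => length_countProg _ _ _ _ _] at s2
    have s2u : Sat (L.p3 + u * L.tableSize) (countProg L.one (L.voteStart u) L.wv L.r
      (L.p3 + u * L.tableSize)) φ := s2 u hu
    have := countProg_spec s2u h1 (i := L.r) (j := j) le_rfl (by omega)
    rw [← hcnt] at this
    split_ifs with h
    · simp only [exprVal_cons, exprVal_nil, workBits_apply, Bool.and_self, Bool.xor_false]
      rw [this]
      simp [h]
    · simp [h]

/-- The entry `k` of the last row of the table tells whether the second part has `k` elements. -/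
theorem valid_spec (hsat : Sat L.p2 (L.post d i) φ) (hL : L.Good) (h1 : φ (.work L.one) = true)
    {input : List Bool} {X : Finset ℕ}
    (hev : ∀ e ∈ L.sel, exprVal (relocE L.N0 d e) (workBits φ) = evX L.N0 input X e) :
    φ (.work L.p8) = decide (((Finset.range L.n).filter fun t =>
      evX L.N0 input X (L.sel.getD t []) = true).card = L.k) := by
  obtain ⟨-, -, s3, s4, -, -, -, -, s9⟩ := (sat_post hL).1 hsat
  have h9 := s9.1
  simp only [exprVal_cons, exprVal_nil, workBits_apply, Bool.and_self, Bool.xor_false] at h9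
  rw [h9, countProg_spec s4 h1 le_rfl hL.k_le]
  have : ((Finset.range L.n).filter fun t => φ (.work (L.p4 + t * 1)) = true)
      = (Finset.range L.n).filter fun t => evX L.N0 input X (L.sel.getD t []) = true := by
    refine Finset.filter_congr fun t ht => ?_
    have ht' : t < L.sel.length := by rw [hL.lenSel]; exact Finset.mem_range.1 ht
    rw [mul_one, sat_list s3 (by simpa using ht'), List.getElem_map, hev _ (List.getElem_mem _),
      List.getD_eq_getElem _ _ ht']
  rw [this]

/-- The program evaluates the circuit that combines the values. -/
theorem wires_spec (hsat : Sat L.p2 (L.post d i) φ) (hL : L.Good) (h1 : φ (.work L.one) = true)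
    {inp : List Bool} (hlen : inp.length = L.nin)
    (hinp : ∀ x < L.nin, φ (.work (L.p6 + x)) = inp.getD x false) {l : ℕ} (hl : l < L.Wo) :
    φ (.work (L.p7 + l)) = (BoolCircuit.eval ⟨L.ga, L.go⟩ inp).getD l false := by
  obtain ⟨-, -, -, -, -, -, s7, s8, -⟩ := (sat_post hL).1 hsat
  rw [sat_map_range] at s7 s8
  have key : ∀ T ≤ L.ga.length, ∀ x < L.nin + T, φ (.work (L.p6 + x))
      = ((L.ga.take T).foldl
        (fun ws p => ws ++ [!(ws.getD p.1 false && ws.getD p.2 false)]) inp).getD x false := by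
    intro T hT
    induction T with
    | zero => simpa using hinp
    | succ T ih =>
      intro x hx
      have ih := ih (by omega)
      set ws := (L.ga.take T).foldl
        (fun ws p => ws ++ [!(ws.getD p.1 false && ws.getD p.2 false)]) inp with hws
      have hwl : ws.length = L.nin + T := by
        rw [hws, length_foldl_wires, hlen, List.length_take]; omega
      rw [List.take_succ_eq_append_getElem (by omega), List.foldl_append, ← hws, List.foldl_cons,
        List.foldl_nil]
      by_cases hxT : x < L.nin + T
      · rw [ih x hxT, List.getD_append _ _ _ _ (by omega)]
      · have hx' : x = L.nin + T := by omega
        subst hx'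
        rw [List.getD_append_right _ _ _ _ (by omega), hwl, Nat.sub_self, ← add_assoc, s7 T
            (by omega),
          gateExpr, List.getD_eq_getElem _ _ (show T < L.ga.length by omega)]
        set g := L.ga[T]
        simp only [List.getD_cons_zero, exprVal_cons, workBits_apply, h1, Bool.and_self]
        split_ifs with hg
        · simp only [exprVal_cons, exprVal_nil, workBits_apply, Bool.xor_false]
          rw [ih _ hg.1, ih _ hg.2, Bool.true_xor]
        · have : ws.getD g.1 false = false ∨ ws.getD g.2 false = false := by
            rcases not_and_or.1 hg with h | h
            · left; exact List.getD_eq_default _ _ (by omega)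
            · right; exact List.getD_eq_default _ _ (by omega)
          rw [exprVal_nil]
          rcases this with h | h <;> rw [h] <;> simp
  have hfull := key L.ga.length le_rfl
  rw [List.take_length] at hfull
  rw [s8 l hl, goExpr, BoolCircuit.eval, List.getD_eq_getElem _ _ (show l < L.go.length from hl),
    List.getD_eq_getElem _ _ (by simpa using (show l < L.go.length from hl)), List.getElem_map,
    BoolCircuit.wires]
  dsimp only
  split_ifs with h
  · simp only [exprVal_cons, exprVal_nil, workBits_apply, Bool.and_self, Bool.xor_false]
    exact hfull _ h
  · rw [exprVal_nil, List.getD_eq_default]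
    rw [length_foldl_wires, hlen]
    simpa [ntot] using h

/-- The last link of the chain is the conjunction of all tests. -/
theorem chain_spec (hsat : Sat L.p2 (L.post d i) φ) (hL : L.Good) :
    φ (.work (L.p8 + L.Wo)) = true ↔ φ (.work L.p8) = true ∧ ∀ l < L.Wo, i ≤ l →
      φ (.work (L.p7 + l)) = (decide (l ≠ i) && φ (.work (L.N0 + l))) := by
  obtain ⟨-, -, -, -, -, -, -, -, s9⟩ := (sat_post hL).1 hsat
  have s := s9.2
  rw [sat_map_range] at s
  have key : ∀ M ≤ L.Wo, (φ (.work (L.p8 + M)) = true ↔ φ (.work L.p8) = true ∧ ∀ l < M, i ≤ l →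
      φ (.work (L.p7 + l)) = (decide (l ≠ i) && φ (.work (L.N0 + l)))) := by
    intro M hM
    induction M with
    | zero => simp
    | succ M ih =>
      have hstep := s M (by omega)
      rw [show L.p8 + 1 + M = L.p8 + (M + 1) by omega] at hstep
      rw [hstep]
      have ih := ih (by omega)
      have hsplit : (∀ l < M + 1, i ≤ l →
          φ (.work (L.p7 + l)) = (decide (l ≠ i) && φ (.work (L.N0 + l)))) ↔
          (∀ l < M, i ≤ l → φ (.work (L.p7 + l)) = (decide (l ≠ i) && φ (.work (L.N0 + l)))) ∧
          (i ≤ M → φ (.work (L.p7 + M)) = (decide (M ≠ i) && φ (.work (L.N0 + M)))) := by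
        constructor
        · exact fun h => ⟨fun l hl => h l (by omega), h M (by omega)⟩
        · rintro ⟨h1, h2⟩ l hl
          rcases Nat.lt_succ_iff_lt_or_eq.1 hl with hl | rfl
          · exact h1 l hl
          · exact h2
      rw [hsplit, ← and_assoc, ← ih]
      simp only [chainExpr, exprVal_cons, exprVal_append, workBits_apply, Bool.and_self]
      by_cases h1 : i ≤ M
      · by_cases h2 : i < M
        · have h3 : M ≠ i := by omega
          simp only [h1, h2, if_true, exprVal_cons, exprVal_nil, workBits_apply]
          generalize φ (.work (L.p8 + M)) = acc
          generalize φ (.work (L.p7 + M)) = o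
          generalize φ (.work (L.N0 + M)) = y
          cases acc <;> cases o <;> cases y <;> simp [h3]
        · have h3 : M = i := by omega
          subst h3
          rw [if_pos le_rfl, if_neg h2]
          simp only [exprVal_cons, exprVal_nil, workBits_apply]
          generalize φ (.work (L.p8 + M)) = acc
          generalize φ (.work (L.p7 + M)) = o
          cases acc <;> cases o <;> simp
      · have h2 : ¬ i < M := by omega
        simp [h1, h2]
  exact key L.Wo le_rfl

/-- The value that the sets `M ∖ X` and `X` with the values `v1` and `v2` give. -/
def combine (L : Lay) (input : List Bool) (X : Finset ℕ) (v1 v2 : ℕ) : ℕ :=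
  bitsVal (BoolCircuit.eval ⟨L.ga, L.go⟩
    (L.head.map (evX L.N0 input X) ++ natBits L.wv v1 ++ natBits L.wv v2))

/-- The second part has the right size. -/
def Valid (L : Lay) (input : List Bool) (X : Finset ℕ) : Prop :=
  ((Finset.range L.n).filter fun t => evX L.N0 input X (L.sel.getD t []) = true).card = L.k

instance (input : List Bool) (X : Finset ℕ) : Decidable (L.Valid input X) := by
  unfold Valid; infer_instance

/-- The set `X` has the right size, and its value agrees with `ybit` in the places above `i` and has
a zero in place `i`. -/
def goodSet (L : Lay) (input : List Bool) (v1 v2 : Finset ℕ → ℕ) (ybit : ℕ → Bool) (i : ℕ)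
    (X : Finset ℕ) : Bool :=
  decide (L.Valid input X ∧ ∀ l < L.Wo, i ≤ l →
    (L.combine input X (v1 X) (v2 X)).testBit l = (decide (l ≠ i) && ybit l))

theorem length_natBits (w a : ℕ) : (natBits w a).length = w := by simp [natBits]

theorem getElem_natBits {w a l : ℕ} (hl : l < (natBits w a).length) :
    (natBits w a)[l] = a.testBit l := by simp [natBits]

/-- If the majority of the copies of both subroutines are correct, the evaluation is correct. -/
theorem post_spec (hsat : Sat L.p2 (L.post d i) φ) (hL : L.Good) (h1 : φ (.work L.one) = true)
    {input : List Bool} {X : Finset ℕ} {v1 v2 : Finset ℕ → ℕ}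
    (hev : ∀ e, e ∈ L.sub1 ∨ e ∈ L.sub2 ∨ e ∈ L.sel ∨ e ∈ L.head →
      exprVal (relocE L.N0 d e) (workBits φ) = evX L.N0 input X e)
    (hmaj : L.Valid input X → Maj L 0 (v1 X) φ ∧ Maj L 1 (v2 X) φ) :
    φ (.work (L.p8 + L.Wo))
      = L.goodSet input v1 v2 (fun l => φ (.work (L.N0 + l))) i X := by
  have hvalid := valid_spec hsat hL h1 (X := X) (input := input) fun e he => hev e (by tauto)
  rw [Bool.eq_iff_iff, chain_spec hsat hL, hvalid, goodSet, decide_eq_true_eq, decide_eq_true_eq]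
  refine and_congr_right fun hv => ?_
  have hv' : L.Valid input X := hv
  obtain ⟨m1, m2⟩ := hmaj hv'
  obtain ⟨-, -, -, -, s5, -, -, -, -⟩ := (sat_post hL).1 hsat
  set inp := L.head.map (evX L.N0 input X) ++ natBits L.wv (v1 X) ++ natBits L.wv (v2 X) with hinp
  have hlen : inp.length = L.nin := by
    simp only [hinp, List.length_append, List.length_map, length_natBits, nin]; omega
  have hx : ∀ x < L.nin, φ (.work (L.p6 + x)) = inp.getD x false := by
    intro x hx
    rw [List.getD_eq_getElem _ _ (by omega)]
    by_cases hx1 : x < L.head.length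
    · rw [sat_list s5 (by simpa using hx1)]
      simp only [hinp]
      rw [List.getElem_append_left (by simp; omega), List.getElem_append_left (by simpa using hx1),
        List.getElem_map, List.getElem_map, hev _ (by simp)]
    · by_cases hx2 : x < L.head.length + L.wv
      · have := vote_spec hsat hL h1 (g := 0) (l := x - L.head.length) (by norm_num) (by omega) m1
        rw [show L.p6 + L.head.length + (0 * L.wv + (x - L.head.length)) = L.p6 + x by
          omega] at this
        rw [this]
        simp only [hinp]
        rw [List.getElem_append_left (by simp [length_natBits]; omega),
          List.getElem_append_right (by simp; omega), getElem_natBits, List.length_map]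
      · rw [nin] at hx
        have := vote_spec hsat hL h1 (g := 1) (l := x - (L.head.length + L.wv)) (by norm_num)
          (by omega) m2
        rw [show L.p6 + L.head.length + (1 * L.wv + (x - (L.head.length + L.wv))) = L.p6 + x by
          omega] at this
        rw [this]
        simp only [hinp]
        rw [List.getElem_append_right (by simp [length_natBits]; omega), getElem_natBits]
        simp [length_natBits]
  have hbit (l : ℕ) (hl : l < L.Wo) : φ (.work (L.p7 + l))
      = (L.combine input X (v1 X) (v2 X)).testBit l := by
    rw [wires_spec hsat hL h1 hlen hx hl, combine, testBit_bitsVal]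
  constructor
  · intro h l hl hil
    rw [← hbit l hl]; exact h l hl hil
  · intro h l hl hil
    rw [hbit l hl]; exact h l hl hil

end Lay

/-! ### The oracle -/

theorem writes_subset_qubits (G : Gate) :
    G.writes ⊆ {x | (∃ q ∈ G.qubits, x = .work q) ∨ ∃ i j, x = .cell i j} := by
  intro x hx
  cases G with
  | phase q => exact absurd hx (by simp [Gate.writes])
  | phaseInv q => exact absurd hx (by simp [Gate.writes])
  | qread addr tgt =>
    obtain ⟨q, hq, rfl⟩ := hx
    exact Or.inl ⟨q, by simp [Gate.qubits, hq], rfl⟩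
  | qswap addr tgt =>
    rcases hx with ⟨q, hq, rfl⟩ | ⟨i, j, -, -, rfl⟩
    · exact Or.inl ⟨q, by simp [Gate.qubits, hq], rfl⟩
    · exact Or.inr ⟨i, j, rfl⟩
  | _ => exact Or.inl ⟨_, by simp [Gate.qubits], hx⟩

/-- The operations of a copy of a circuit use the qubits of the copy only. -/
theorem placeGates_ok {base wm s A w a wd : ℕ} {gs : List Gate} (hw : wd ≤ w)
    (haA : 0 < wd → a ≤ A) (hG : ∀ G ∈ gs, GateOK wm a wd G) :
    ∀ G ∈ placeGates base wm s A w gs,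
      (∀ q ∈ G.qubits, base ≤ q ∧ q < base + (wm + s + A + w)) ∧ G.qubits.Nodup ∧
        G.RegistersFit (A + s) w := by
  intro G' hG'
  obtain ⟨G, hmem, hG'⟩ := List.mem_flatMap.1 hG'
  obtain ⟨hlt, hnd, hfit⟩ := hG G hmem
  have key (addr tgt : List ℕ) (hlt : ∀ q ∈ addr ++ tgt, q < wm) (hnd : (addr ++ tgt).Nodup)
      (ha : addr.length = a) (ht : tgt.length = wd) (h0 : tgt.length ≠ 0) :
      (∀ q ∈ padAddr base wm s A addr ++ padTgt base wm s A w tgt,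
        base ≤ q ∧ q < base + (wm + s + A + w)) ∧
      (padAddr base wm s A addr ++ padTgt base wm s A w tgt).Nodup ∧
      (padAddr base wm s A addr).length = A + s ∧ (padTgt base wm s A w tgt).length = w := by
    refine ⟨fun q hq => ?_, nodup_pad hnd hlt, length_padAddr ?_, length_padTgt ?_⟩
    · rcases List.mem_append.1 hq with hq | hq
      · rcases mem_padAddr.1 hq with ⟨t, ht, rfl⟩ | ⟨l, hl, rfl⟩ | ⟨l, hl, rfl⟩
        · have := hlt t (by simp [ht]); omega
        · omega
        · omega
      · rcases mem_padTgt.1 hq with ⟨t, ht, rfl⟩ | ⟨l, hl, rfl⟩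
        · have := hlt t (by simp [ht]); omega
        · omega
    · rw [ha]; exact haA (by omega)
    · omega
  cases G with
  | qread addr tgt =>
    by_cases h0 : tgt.length = 0
    · simp only [placeGate, h0, if_true, List.not_mem_nil] at hG'
    · simp only [placeGate, h0, if_false, List.mem_singleton] at hG'
      subst hG'
      obtain ⟨h1, h2, h3⟩ := key addr tgt hlt hnd hfit.1 hfit.2 h0
      exact ⟨h1, h2, h3⟩
  | qswap addr tgt =>
    by_cases h0 : tgt.length = 0
    · simp only [placeGate, h0, if_true, List.not_mem_nil] at hG'
    · simp only [placeGate, h0, if_false, List.mem_singleton] at hG'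
      subst hG'
      obtain ⟨h1, h2, h3⟩ := key addr tgt hlt hnd hfit.1 hfit.2 h0
      exact ⟨h1, h2, h3⟩
  | _ =>
    simp only [placeGate, List.mem_singleton] at hG'
    subst hG'
    simp only [Gate.qubits, List.mem_cons, List.not_mem_nil, or_false, List.nodup_cons,
      List.nodup_nil, forall_eq_or_imp, forall_eq, not_or, not_false_eq_true, and_true,
      Gate.RegistersFit] at hlt hnd ⊢
    omega

theorem lt_progGates {es : List Expr} {p : ℕ} (h : WFProg p es) :
    ∀ G ∈ progGates p es, ∀ q ∈ G.qubits, q < p + es.length := by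
  induction es generalizing p with
  | nil => intro G hG; simp [progGates] at hG
  | cons e es ih =>
    intro G hG q hq
    rcases List.mem_append.1 hG with hG | hG
    · obtain ⟨t, ht, rfl⟩ := mem_assignGates hG
      have := h.1 t ht
      simp only [List.length_cons]
      split_ifs at hq
      · simp [Gate.qubits] at hq; omega
      · simp [Gate.qubits] at hq; omega
    · have := ih h.2 G hG q hq
      simp only [List.length_cons]; omega

theorem run_flatMap_range (g : ℕ → List Gate) (N : ℕ) :
    run ((List.range N).flatMap g) = seqOp (fun c => run (g c)) N := by
  induction N with
  | zero => rfl
  | succ N ih =>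
    refine LinearMap.ext fun ψ => ?_
    rw [List.range_succ, List.flatMap_append, run_append, ih]
    simp [seqOp]

namespace Lay

variable {L : Lay} {d i : ℕ}

/-- The parts of the machine that are used inside of an oracle call. -/
def scratch (L : Lay) : Set Qubit := {x | (∃ q, L.p1 ≤ q ∧ x = .work q) ∨ ∃ i j, x = .cell i j}

/-- The subroutines compute the values `v1 X` and `v2 X` of the parts given by `X`. -/
structure Correct (L : Lay) (input : List Bool) (v1 v2 : Finset ℕ → ℕ) : Prop where
  sub : ∀ X ⊆ Finset.range L.n, L.Valid input X → ∀ c < 2 * L.r, ∃ C : QCircuit, C.WellFormed ∧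
    C.gates = L.gatesOf c ∧ C.outs = L.outsOf c ∧
    C.Computes ((L.subOf c).map (evX L.N0 input X)) (if c < L.r then v1 X else v2 X) ∧
    C.work ≤ L.wm ∧ C.wordSize ≤ L.w ∧ (0 < C.wordSize → C.addrWidth ≤ L.A)

/-- The input is in place, and the scratch qubits are zero. -/
structure Ready (L : Lay) (input : List Bool) (b : BasisState) : Prop where
  inp : ∀ q < L.N0, b (.work q) = input.getD q false
  one : b (.work L.one) = true
  zero : ∀ q, L.p1 ≤ q → b (.work q) = false
  cells : ∀ i j, b (.cell i j) = false

theorem length_subOf (hL : L.Good) (c : ℕ) : (L.subOf c).length = L.N0 := by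
  rw [subOf]; split_ifs
  · exact hL.len1
  · exact hL.len2

theorem mem_subOf {c : ℕ} {e : Expr} (he : e ∈ L.subOf c) : e ∈ L.sub1 ∨ e ∈ L.sub2 := by
  rw [subOf] at he; split_ifs at he
  · exact Or.inl he
  · exact Or.inr he

theorem length_preCopy (hL : L.Good) (c : ℕ) : (L.preCopy d c).length = L.stride := by
  have := hL.N0_le
  simp only [preCopy, blanks, numExprs, stride, List.length_append, List.length_map,
    List.length_range, length_subOf hL]
  omega

theorem length_pre (hL : L.Good) : L.p1 + (L.pre d).length = L.p2 := by
  rw [pre, length_flatMap_range fun c _ => length_preCopy hL c, p2]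

theorem vars_relocE (hL : L.Good) {es : List Expr}
    (hes : ∀ e ∈ es, e ∈ L.sub1 ∨ e ∈ L.sub2 ∨ e ∈ L.sel ∨ e ∈ L.head) :
    ∀ e ∈ es.map (relocE L.N0 d), ∀ t ∈ e, (t.1 < L.N0 ∨ d ≤ t.1 ∧ t.1 < d + L.n) ∧
      (t.2 < L.N0 ∨ d ≤ t.2 ∧ t.2 < d + L.n) := by
  intro e he t ht
  obtain ⟨e', he', rfl⟩ := List.mem_map.1 he
  obtain ⟨t', ht', rfl⟩ := List.mem_map.1 ht
  obtain ⟨h1, h2⟩ := hL.vars e' (hes e' he') t' ht'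
  simp only [relocVar]
  constructor <;> split_ifs <;> omega

/-- The qubits that the computation of the oracle may involve. -/
def usable (L : Lay) (i d q : ℕ) : Prop :=
  (q < L.p0 ∧ q ≠ L.N0 + i) ∨ (d ≤ q ∧ q < d + L.n) ∨ L.p1 ≤ q

theorem vars_pre (hL : L.Good) : ∀ e ∈ L.pre d, ∀ t ∈ e,
    (t.1 < L.N0 ∨ t.1 = L.one ∨ d ≤ t.1 ∧ t.1 < d + L.n) ∧
      (t.2 < L.N0 ∨ t.2 = L.one ∨ d ≤ t.2 ∧ t.2 < d + L.n) := by
  intro e he t ht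
  obtain ⟨c, -, he⟩ := List.mem_flatMap.1 he
  simp only [preCopy, List.mem_append] at he
  rcases he with he | he | he | he
  · have := vars_relocE hL (fun e he => by have := mem_subOf he; tauto) e he t ht
    omega
  · obtain ⟨l, -, rfl⟩ := List.mem_map.1 he; simp at ht
  · obtain ⟨l, -, rfl⟩ := List.mem_map.1 he
    split_ifs at ht
    · simp only [List.mem_singleton] at ht
      subst ht
      exact ⟨Or.inr (Or.inl rfl), Or.inr (Or.inl rfl)⟩
    · simp at ht
  · obtain ⟨l, -, rfl⟩ := List.mem_map.1 he; simp at ht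

theorem wf_pre (hL : L.Good) (hd : d + L.n ≤ L.p1) : WFProg L.p1 (L.pre d) := by
  obtain ⟨b1, b2, b3⟩ := fixed_lt (L := L)
  refine wfProg_of_forall fun e he t ht => ?_
  have := vars_pre hL e he t ht
  omega

theorem evX_reloc {input : List Bool} {φ : BasisState}
    (hin : ∀ q < L.N0, φ (.work q) = input.getD q false) {e : Expr}
    (he : ∀ t ∈ e, t.1 < L.N0 + L.n ∧ t.2 < L.N0 + L.n) :
    exprVal (relocE L.N0 d e) (workBits φ) = evX L.N0 input (idxSet d L.n φ) e := by
  rw [exprVal_relocE, evX]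
  have key : ∀ v < L.N0 + L.n, workBits φ (relocVar L.N0 d v)
      = if v < L.N0 then input.getD v false else decide (v - L.N0 ∈ idxSet d L.n φ) := by
    intro v hv
    rw [relocVar, workBits_apply]
    split_ifs with h
    · exact hin v h
    · rw [Bool.eq_iff_iff, decide_eq_true_eq, mem_idxSet]
      exact ⟨fun h' => ⟨by omega, h'⟩, fun h' => h'.2⟩
  exact exprVal_congr fun t ht => ⟨key _ (he t ht).1, key _ (he t ht).2⟩

theorem idxSet_congr {d n : ℕ} {b b' : BasisState}
    (h : ∀ i < n, b (.work (d + i)) = b' (.work (d + i))) : idxSet d n b = idxSet d n b' := by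
  ext x
  rw [mem_idxSet, mem_idxSet]
  exact and_congr_right fun hx => by rw [h x hx]

/-- The effect of the first program of the oracle. -/
theorem pre_spec (hL : L.Good) {input : List Bool} {b : BasisState} (hb : L.Ready input b)
    (hd : d + L.n ≤ L.p1) :
    (∀ q, q < L.p1 ∨ L.p2 ≤ q → execProg L.p1 (L.pre d) b (.work q) = b (.work q)) ∧
    (∀ i j, execProg L.p1 (L.pre d) b (.cell i j) = false) ∧
    ∀ c < 2 * L.r,
      CopyReady (L.base c) L.wm L.s L.A L.w c (execProg L.p1 (L.pre d) b) ∧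
      ∀ q < L.wm, execProg L.p1 (L.pre d) b (.work (L.base c + q))
        = ((L.subOf c).map (evX L.N0 input (idxSet d L.n b))).getD q false := by
  have hlen := length_pre hL (d := d)
  obtain ⟨b1, b2, b3⟩ := fixed_lt (L := L)
  set φ := execProg L.p1 (L.pre d) b with hφ
  have h1 : ∀ q, q < L.p1 ∨ L.p2 ≤ q → φ (.work q) = b (.work q) := fun q hq =>
    execProg_of_lt fun q' h1 h2 => by
      intro h; cases h; omega
  have h2 : ∀ i j, φ (.cell i j) = false := fun i j => by
    rw [hφ, execProg_of_lt fun q' _ _ => by simp]; exact hb.cells i j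
  refine ⟨h1, h2, fun c hc => ?_⟩
  have hsat : Sat L.p1 (L.pre d) φ := sat_execProg (wf_pre hL hd) fun q hq _ => hb.zero q hq
  rw [pre, sat_flatMap_range fun c _ => length_preCopy hL c] at hsat
  have hs : Sat (L.base c) (L.preCopy d c) φ := hsat c hc
  rw [preCopy, sat_append, sat_append, sat_append] at hs
  simp only [List.length_map, blanks, numExprs, List.length_range, length_subOf hL] at hs
  have hN := hL.N0_le
  rw [show L.base c + L.N0 + (L.wm - L.N0) = L.base c + L.wm by omega] at hs
  obtain ⟨s1, s2, s3, s4⟩ := hs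
  rw [sat_map_range] at s2 s3 s4
  have hone : φ (.work L.one) = true := by rw [h1 _ (by omega)]; exact hb.one
  have hin : ∀ q < L.N0, φ (.work q) = input.getD q false := fun q hq => by
    rw [h1 _ (by omega)]; exact hb.inp q hq
  have hidx : idxSet d L.n φ = idxSet d L.n b := idxSet_congr fun i hi => h1 _ (by omega)
  refine ⟨⟨fun l hl => ?_, fun l hl => ?_, fun l hl => ?_, fun i j _ => h2 i j⟩, fun q hq => ?_⟩
  · rw [s3 l hl, Nat.testBit_eq_decide_div_mod_eq]
    split_ifs with h
    · simp [h, hone]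
    · simp [h]
  · rw [s4 l (by omega), exprVal_nil]
  · have := s4 (L.A + l) (by omega)
    rw [← add_assoc] at this
    rw [this, exprVal_nil]
  · by_cases hq' : q < L.N0
    · have hq'' : q < (L.subOf c).length := by rw [length_subOf hL]; exact hq'
      rw [sat_list s1 (by simpa using hq''), List.getD_eq_getElem _ _ (by simpa using hq''),
        List.getElem_map, List.getElem_map, evX_reloc hin, hidx]
      exact hL.vars _ (by have := mem_subOf (List.getElem_mem hq''); tauto)
    · rw [List.getD_eq_default _ _ (by simp [length_subOf hL]; omega)]
      have := s2 (q - L.N0) (by omega)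
      rw [show L.base c + L.N0 + (q - L.N0) = L.base c + q by omega] at this
      rw [this, exprVal_nil]

theorem copies_ok (hL : L.Good) : ∀ G ∈ L.copies,
    (∀ q ∈ G.qubits, L.p1 ≤ q ∧ q < L.p2) ∧ G.qubits.Nodup ∧ G.RegistersFit (L.A + L.s) L.w := by
  intro G hG
  obtain ⟨c, hc, hG⟩ := List.mem_flatMap.1 hG
  obtain ⟨a, wd, hwd, haA, hok⟩ := hL.g_ok c
  obtain ⟨h1, h2, h3⟩ := placeGates_ok hwd haA hok G hG
  refine ⟨fun q hq => ?_, h2, h3⟩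
  have h4 := h1 q hq
  have h5 := base_add_le (List.mem_range.1 hc)
  have h6 : L.p1 ≤ L.base c := Nat.le_add_right _ _
  rw [stride] at h5
  omega

theorem vars_post (hL : L.Good) (hi : i < L.Wo) : ∀ e ∈ L.post d i, ∀ t ∈ e,
    L.usable i d t.1 ∧ L.usable i d t.2 := by
  obtain ⟨a1, a2, a3, a4, a5, a6, a7⟩ := p_le (L := L)
  obtain ⟨b1, b2, b3⟩ := fixed_lt (L := L)
  have hbig : ∀ q, L.p1 ≤ q → L.usable i d q := fun q hq => Or.inr (Or.inr hq)
  have hlow : ∀ q, q < L.p0 → q ≠ L.N0 + i → L.usable i d q := fun q hq hq' => Or.inl ⟨hq, hq'⟩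
  have hrel (es : List Expr) (hes : ∀ e ∈ es, e ∈ L.sub1 ∨ e ∈ L.sub2 ∨ e ∈ L.sel ∨ e ∈ L.head) :
      ∀ e ∈ es.map (relocE L.N0 d), ∀ t ∈ e, L.usable i d t.1 ∧ L.usable i d t.2 := by
    intro e he t ht
    have := vars_relocE hL hes e he t ht
    unfold usable; omega
  intro e he t ht
  simp only [post, List.mem_append, List.mem_cons] at he
  rcases he with he | he | he | he | he | he | he | he | rfl | he
  · obtain ⟨c, hc, he⟩ := List.mem_flatMap.1 he
    obtain ⟨l, hl, rfl⟩ := List.mem_map.1 he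
    split_ifs at ht
    · simp only [List.mem_singleton] at ht; subst ht
      have : L.p1 ≤ L.base c := Nat.le_add_right _ _
      exact ⟨hbig _ (by simp only; omega), hbig _ (by simp only; omega)⟩
    · simp at ht
  · obtain ⟨u, hu, he⟩ := List.mem_flatMap.1 he
    refine vars_countProg (hlow _ (by omega) (by omega)) (fun t _ => hbig _ ?_)
        (fun q hq => hbig _ ?_) e he t ht
    · rw [voteStart]; omega
    · omega
  · exact hrel _ (fun e he => by tauto) e he t ht
  · exact vars_countProg (hlow _ (by omega) (by omega)) (fun t _ => hbig _ (by omega))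
      (fun q hq => hbig _ (by omega)) e he t ht
  · exact hrel _ (fun e he => by tauto) e he t ht
  · obtain ⟨u, hu, rfl⟩ := List.mem_map.1 he
    obtain ⟨j, hj, ht⟩ := List.mem_flatMap.1 ht
    split_ifs at ht
    · simp only [List.mem_singleton] at ht; subst ht
      exact ⟨hbig _ (by simp only; omega), hbig _ (by simp only; omega)⟩
    · simp at ht
  · obtain ⟨u, hu, rfl⟩ := List.mem_map.1 he
    rcases List.mem_cons.1 ht with rfl | ht
    · exact ⟨hlow _ (by simp only; omega) (by simp only; omega),
        hlow _ (by simp only; omega) (by simp only; omega)⟩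
    · split_ifs at ht
      · simp only [List.mem_singleton] at ht; subst ht
        exact ⟨hbig _ (by simp only; omega), hbig _ (by simp only; omega)⟩
      · simp at ht
  · obtain ⟨u, hu, rfl⟩ := List.mem_map.1 he
    rw [goExpr] at ht
    split_ifs at ht
    · simp only [List.mem_singleton] at ht; subst ht
      exact ⟨hbig _ (by simp only; omega), hbig _ (by simp only; omega)⟩
    · simp at ht
  · simp only [List.mem_singleton] at ht; subst ht
    exact ⟨hbig _ (by simp only; omega), hbig _ (by simp only; omega)⟩
  · obtain ⟨l, hl, rfl⟩ := List.mem_map.1 he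
    rw [List.mem_range] at hl
    simp only [chainExpr, List.mem_cons, List.mem_append] at ht
    rcases ht with rfl | ht | ht
    · exact ⟨hbig _ (by simp only; omega), hbig _ (by simp only; omega)⟩
    · split_ifs at ht
      · simp only [List.mem_singleton] at ht; subst ht
        exact ⟨hbig _ (by simp only; omega), hbig _ (by simp only; omega)⟩
      · simp at ht
    · split_ifs at ht
      · simp only [List.mem_singleton] at ht; subst ht
        exact ⟨hbig _ (by simp only; omega), hlow _ (by simp only; omega) (by simp only; omega)⟩
      · simp at ht

/-- The operations of the computation of the oracle are legal, they leave alone all flags, and they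
change scratch qubits only. -/
theorem oracleU_ok (hL : L.Good) (hi : i < L.Wo) (hd : d + L.n ≤ L.p1) : ∀ G ∈ L.oracleU d i,
    (∀ q ∈ G.qubits, L.usable i d q ∧ q < L.p8 + L.Wo + 1) ∧ G.qubits.Nodup ∧
      G.RegistersFit (L.A + L.s) L.w ∧ G.writes ⊆ L.scratch := by
  obtain ⟨a1, a2, a3, a4, a5, a6, a7⟩ := p_le (L := L)
  obtain ⟨b1, b2, b3⟩ := fixed_lt (L := L)
  have hl1 := length_pre hL (d := d)
  have hl2 := length_post hL (d := d) (i := i)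
  have hw1 := wf_pre hL hd
  have hw2 := wf_post hL hd (i := i)
  have hrange {p N : ℕ} (hp : L.p1 ≤ p) :
      {x : Qubit | ∃ q, p ≤ q ∧ q < N ∧ x = .work q} ⊆ L.scratch := by
    rintro x ⟨q, h1, h2, rfl⟩; exact Or.inl ⟨q, hp.trans h1, rfl⟩
  intro G hG
  simp only [oracleU, List.mem_append] at hG
  rcases hG with hG | hG | hG
  · refine ⟨?_, distinct_progGates hw1 G hG, registersFit_progGates _ _ G hG,
      (writes_progGates G hG).trans (hrange le_rfl)⟩
    refine qubits_progGates (P := fun q => L.usable i d q ∧ q < L.p8 + L.Wo + 1)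
        (fun e he t ht => ?_)
      (fun q h1 h2 => ⟨Or.inr (Or.inr h1), by omega⟩) G hG
    have := vars_pre hL e he t ht
    unfold usable; omega
  · obtain ⟨h1, h2, h3⟩ := copies_ok hL G hG
    refine ⟨fun q hq => ?_, h2, h3, (writes_subset_qubits G).trans ?_⟩
    · have := h1 q hq
      unfold usable; omega
    · rintro x (⟨q, hq, rfl⟩ | hx)
      · exact Or.inl ⟨q, (h1 q hq).1, rfl⟩
      · exact Or.inr hx
  · refine ⟨?_, distinct_progGates hw2 G hG, registersFit_progGates _ _ G hG,
      (writes_progGates G hG).trans (hrange a1)⟩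
    intro q hq
    refine ⟨qubits_progGates (P := fun q => L.usable i d q)
      (vars_post hL hi) (fun q h1 h2 => Or.inr (Or.inr (by omega))) G hG q hq, ?_⟩
    have := lt_progGates hw2 G hG q hq
    omega

end Lay

theorem prod_range_two_mul_ite {r g : ℕ} (hg : g < 2) (f : ℕ → ℝ) :
    ∏ c ∈ Finset.range (2 * r), (if g * r ≤ c ∧ c < g * r + r then f c else 1)
      = ∏ t ∈ Finset.range r, f (g * r + t) := by
  rw [two_mul, Finset.prod_range_add]
  obtain rfl | rfl : g = 0 ∨ g = 1 := by omega
  · rw [Finset.prod_congr (g := f) rfl fun c hc => by simp at hc; simp [hc],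
      Finset.prod_eq_one (s := Finset.range r) (f := fun x => if 0 * r ≤ r + x ∧ _ then _ else _)
        fun c _ => by simp]
    simp
  · rw [Finset.prod_eq_one fun c hc => by simp at hc; simp [hc], one_mul]
    exact Finset.prod_congr rfl fun c hc => by simp at hc; simp [hc]

theorem outBit_congr {base wm : ℕ} {outs : List ℕ} (h : ∀ q ∈ outs, q < wm) {b b' : BasisState}
    (hb : ∀ q < wm, b (.work (base + q)) = b' (.work (base + q))) (l : ℕ) :
    outBit base outs l b = outBit base outs l b' := by
  rw [outBit, outBit]
  split_ifs with hl
  · refine hb _ (h _ ?_)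
    rw [List.getD_eq_getElem _ _ hl]; exact List.getElem_mem hl
  · rfl

namespace Lay

variable {L : Lay} {d i : ℕ}

open Classical in
/-- The majority of the copies is wrong only with exponentially small probability. -/
theorem mass_not_maj (hL : L.Good) {input : List Bool} {v1 v2 : Finset ℕ → ℕ}
    (hC : L.Correct input v1 v2) {b : BasisState} (hb : L.Ready input b) (hd : d + L.n ≤ L.p1)
    (hvalid : L.Valid input (idxSet d L.n b)) {ρ : ℕ} (hr : L.r = 2 * ρ) {g : ℕ} (hg : g < 2) :
    mass {φ | ¬ Maj L g (if g = 0 then v1 (idxSet d L.n b) else v2 (idxSet d L.n b)) φ}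
      (run L.copies (Finsupp.single (execProg L.p1 (L.pre d) b) 1)) ≤ (8 / 9) ^ ρ := by
  obtain ⟨hp1, hp2, hp3⟩ := pre_spec hL hb hd
  set φ := execProg L.p1 (L.pre d) b with hφ
  set X := idxSet d L.n b with hX
  set v := if g = 0 then v1 X else v2 X with hvdef
  -- A copy has the weight `2` if it is wrong, and `1` otherwise. The mean of the weight is at most
  -- `4 / 3`, and the product of the weights is at least `2 ^ ρ` if the majority is wrong.
  set F : ℕ → BasisState → ℝ := fun c b' => if g * L.r ≤ c ∧ c < g * L.r + L.r then
    (if OutCorrect (L.base c) (L.outsOf c) L.wv v b' then 1 else 2) else 1 with hF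
  set W : ℕ → Set Qubit := fun c => copyQubits (L.base c) L.wm L.A c with hW
  have hbase (j c : ℕ) (hjc : j < c) : L.base j + L.stride ≤ L.base c := by
    have := Nat.mul_le_mul_right L.stride (show j + 1 ≤ c from hjc)
    rw [Nat.add_mul, one_mul] at this
    rw [base, base]; omega
  have hwork (c q : ℕ) (hq : L.base c ≤ q) (hq' : q < L.base c + L.stride) :
      ∀ j < c, Qubit.work q ∉ W j := by
    rintro j hj (⟨q', h1, h2, h3⟩ | ⟨_, _, _, h⟩)
    · have := hbase j c hj
      cases h3
      rw [stride] at *; omega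
    · cases h
  have hloc : ∀ c < 2 * L.r, ∀ b₁ ∈ {b₁ | ∀ q, (∀ j < c, q ∉ W j) → b₁ q = φ q},
      (∀ b', run (placeGates (L.base c) L.wm L.s L.A L.w (L.gatesOf c)) (Finsupp.single b₁ 1) b' ≠ 0
        → ∀ q ∉ W c, b' q = b₁ q) ∧
      wt (F c) (run (placeGates (L.base c) L.wm L.s L.A L.w (L.gatesOf c)) (Finsupp.single b₁ 1))
        ≤ if g * L.r ≤ c ∧ c < g * L.r + L.r then 4 / 3 else 1 := by
    intro c hc b₁ hb₁
    have hb₁' : ∀ q, (∀ j < c, q ∉ W j) → b₁ q = φ q := hb₁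
    obtain ⟨⟨r1, r2, r3, r4⟩, hin⟩ := hp3 c hc
    have hag (q : ℕ) (hq : q < L.stride) : b₁ (.work (L.base c + q)) = φ (.work (L.base c + q)) :=
      hb₁' _ (hwork c _ (by omega) (by omega))
    have hready : CopyReady (L.base c) L.wm L.s L.A L.w c b₁ := by
      refine ⟨fun l hl => ?_, fun l hl => ?_, fun l hl => ?_, fun i j hij => ?_⟩
      · rw [← r1 l hl, add_assoc]; exact hag _ (by rw [stride]; omega)
      · rw [← r2 l hl, add_assoc, add_assoc]; exact hag _ (by rw [stride]; omega)
      · rw [← r3 l hl, add_assoc, add_assoc, add_assoc]; exact hag _ (by rw [stride]; omega)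
      · rw [hb₁' _ ?_]
        · exact hp2 i j
        · rintro j' hj' (⟨_, _, _, h⟩ | ⟨i', j'', h1, h2⟩)
          · cases h
          · cases h2; omega
    obtain ⟨C, hwf, hg', ho, hcomp, hwm, hw, haA⟩ := hC.sub X (Finset.filter_subset _ _) hvalid c hc
    have hc2 : c < 2 ^ L.s := hc.trans_le hL.two_r_le
    have hres := wt_copy hwf hcomp hready hc2 hwm hw haA (fun q hq => by
      rw [hag q (by rw [stride]; omega)]; exact hin q hq) L.wv
    rw [hg', ho] at hres
    refine ⟨hres.1, ?_⟩
    by_cases hcg : g * L.r ≤ c ∧ c < g * L.r + L.r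
    · have hvc : (if c < L.r then v1 X else v2 X) = v := by
        rw [hvdef]
        obtain rfl | rfl : g = 0 ∨ g = 1 := by omega
        · rw [if_pos (by omega), if_pos rfl]
        · rw [if_neg (by omega), if_neg (by norm_num)]
      rw [hvc] at hres
      rw [if_pos hcg]
      simp only [hF, if_pos hcg]
      exact hres.2
    · rw [if_neg hcg]
      simp only [hF, if_neg hcg]
      rw [← norm_sq_eq_wt, norm_run, norm_single]
      · simp
      · obtain ⟨a, wd, hwd, haA', hok⟩ := hL.g_ok c
        exact fun G hG => (placeGates_ok hwd haA' hok G hG).2.1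
  have hprod := (wt_prod_le
    (fun c => run (placeGates (L.base c) L.wm L.s L.A L.w (L.gatesOf c))) W F
    (fun c => if g * L.r ≤ c ∧ c < g * L.r + L.r then 4 / 3 else 1) φ
    (fun c => {b₁ | ∀ q, (∀ j < c, q ∉ W j) → b₁ q = φ q}) (fun _ => rfl) (2 * L.r)
    (fun c j hjc hc => by
      rw [Set.disjoint_left]
      rintro x (⟨q, h1, h2, rfl⟩ | ⟨i, j', h1, rfl⟩)
      · rintro (⟨q', h3, h4, h5⟩ | ⟨_, _, _, h⟩)
        · cases h5
          have := hbase _ _ hjc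
          rw [stride] at this; omega
        · cases h
      · rintro (⟨_, _, _, h⟩ | ⟨i', j'', h3, h4⟩)
        · cases h
        · cases h4; omega)
    (fun c b' => by simp only [hF]; split_ifs <;> norm_num)
    (fun c hc b₁ b₂ h12 => by
      have : OutCorrect (L.base c) (L.outsOf c) L.wv v b₁
          ↔ OutCorrect (L.base c) (L.outsOf c) L.wv v b₂ := by
        refine forall_congr' fun l => imp_congr_right fun _ => ?_
        rw [outBit_congr (outs_lt hL c) fun q hq =>
          h12 _ (Or.inl ⟨_, Nat.le_add_right _ _, by omega, rfl⟩)]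
      simp only [hF, this])
    (fun c hc b₁ hb₁ => (hloc c hc b₁ hb₁).1)
    (fun c _ => by split_ifs <;> norm_num)
    (fun c hc b₁ hb₁ => (hloc c hc b₁ hb₁).2)).2
  rw [prod_range_two_mul_ite hg fun _ => (4 / 3 : ℝ), Finset.prod_const, Finset.card_range,
    ← run_flatMap_range] at hprod
  have hcop : run L.copies = run ((List.range (2 * L.r)).flatMap fun c =>
    placeGates (L.base c) L.wm L.s L.A L.w (L.gatesOf c)) := rfl
  rw [← hcop] at hprod
  set ψ := run L.copies (Finsupp.single φ 1) with hψ
  have hmark : mass {φ | ¬ Maj L g v φ} ψ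
      ≤ wt (fun b' => (1 / 2) ^ ρ * ∏ c ∈ Finset.range (2 * L.r), F c b') ψ := by
    refine wt_mono fun b' _ => ?_
    rw [prod_range_two_mul_ite hg fun c =>
      if OutCorrect (L.base c) (L.outsOf c) L.wv v b' then (1 : ℝ) else 2, Finset.prod_ite,
      Finset.prod_const_one, one_mul, Finset.prod_const]
    split_ifs with h
    · have h' : ¬ L.r < 2 * ((Finset.range L.r).filter fun t => OutCorrect (L.base (g * L.r + t))
          (L.outsOf (g * L.r + t)) L.wv v b').card := h
      have hcard := Finset.card_filter_add_card_filter_not (s := Finset.range L.r) fun t =>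
        OutCorrect (L.base (g * L.r + t)) (L.outsOf (g * L.r + t)) L.wv v b'
      rw [Finset.card_range] at hcard
      have hle : ρ ≤ ((Finset.range L.r).filter fun t => ¬ OutCorrect (L.base (g * L.r + t))
          (L.outsOf (g * L.r + t)) L.wv v b').card := by omega
      calc (1 : ℝ) = (1 / 2) ^ ρ * 2 ^ ρ := by rw [← mul_pow]; norm_num
        _ ≤ _ := mul_le_mul_of_nonneg_left (pow_le_pow_right₀ (by norm_num) hle) (by positivity)
    · positivity
  -- `(1 / 2) ^ ρ * (4 / 3) ^ (2 * ρ) = (8 / 9) ^ ρ`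
  refine hmark.trans ?_
  rw [wt_const_mul]
  refine (mul_le_mul_of_nonneg_left hprod (by positivity)).trans (le_of_eq ?_)
  rw [hr, pow_mul, ← mul_pow]
  norm_num

theorem goodSet_congr {input : List Bool} {v1 v2 : Finset ℕ → ℕ} {y y' : ℕ → Bool} {X : Finset ℕ}
    (h : ∀ l < L.Wo, i < l → y l = y' l) :
    L.goodSet input v1 v2 y i X = L.goodSet input v1 v2 y' i X := by
  rw [goodSet, goodSet, decide_eq_decide]
  refine and_congr_right fun _ => forall_congr' fun l => forall_congr' fun hl =>
    forall_congr' fun hil => ?_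
  rcases hil.eq_or_lt with rfl | hil
  · simp
  · rw [h l hl hil]

theorem maj_congr (hL : L.Good) {g v : ℕ} (hg : g < 2) {b b' : BasisState}
    (h : ∀ q < L.p2, b (.work q) = b' (.work q)) : Maj L g v b ↔ Maj L g v b' := by
  classical
  rw [Maj, Maj]
  have : ∀ t ∈ Finset.range L.r,
      (OutCorrect (L.base (g * L.r + t)) (L.outsOf (g * L.r + t)) L.wv v b ↔
        OutCorrect (L.base (g * L.r + t)) (L.outsOf (g * L.r + t)) L.wv v b') := by
    intro t ht
    rw [Finset.mem_range] at ht
    have hc : g * L.r + t < 2 * L.r := by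
      have : g * L.r ≤ 1 * L.r := Nat.mul_le_mul_right _ (by omega)
      omega
    have hle := base_add_le hc
    rw [stride] at hle
    refine forall_congr' fun l => imp_congr_right fun _ => ?_
    rw [outBit_congr (outs_lt hL _) fun q hq => h _ (by omega)]
  rw [Finset.filter_congr this]

open Classical in
/-- The oracle fails only with exponentially small probability. -/
theorem mass_oracleU (hL : L.Good) {input : List Bool} {v1 v2 : Finset ℕ → ℕ}
    (hC : L.Correct input v1 v2) {b : BasisState} (hb : L.Ready input b) (hd : d + L.n ≤ L.p1)
    {y : ℕ → Bool} (hy : ∀ l < L.Wo, i < l → y l = b (.work (L.N0 + l)))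
    {ρ : ℕ} (hr : L.r = 2 * ρ) :
    mass {c | c (.work (L.p8 + L.Wo)) ≠ L.goodSet input v1 v2 y i (idxSet d L.n b)}
      (run (L.oracleU d i) (Finsupp.single b 1)) ≤ 2 * (8 / 9) ^ ρ := by
  obtain ⟨hp1, hp2, hp3⟩ := pre_spec hL hb hd
  obtain ⟨a1, -⟩ := p_le (L := L)
  obtain ⟨b1, b2, b3⟩ := fixed_lt (L := L)
  set X := idxSet d L.n b with hX
  rw [oracleU, run_append, run_append, run_progGates (wf_pre hL hd)]
  have hm0 := fun hv => mass_not_maj hL hC hb hd hv hr (g := 0) (by norm_num)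
  have hm1 := fun hv => mass_not_maj hL hC hb hd hv hr (g := 1) (by norm_num)
  rw [← hX] at hm0 hm1
  set φ := execProg L.p1 (L.pre d) b with hφ
  set ψ := run L.copies (Finsupp.single φ 1) with hψ
  have hsupp : ∀ b', ψ b' ≠ 0 → ∀ q, q < L.p1 ∨ L.p2 ≤ q → b' (.work q) = b (.work q) := by
    intro b' hb' q hq
    have hl : Local {x | (∃ q, (L.p1 ≤ q ∧ q < L.p2) ∧ x = .work q) ∨ ∃ i j, x = .cell i j}
        (run L.copies) := local_run fun G hG => by
      refine (writes_subset_qubits G).trans ?_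
      rintro x (⟨q, hq, rfl⟩ | hx)
      · exact Or.inl ⟨q, (copies_ok hL G hG).1 q hq, rfl⟩
      · exact Or.inr hx
    rw [hl φ b' hb', hp1 q hq]
    rintro (⟨q', h1, h2⟩ | ⟨_, _, h⟩)
    · cases h2; omega
    · cases h
  have hwf := wf_post hL hd (i := i)
  have hloc : Local {x | ∃ q, L.p2 ≤ q ∧ q < L.p2 + (L.post d i).length ∧ x = .work q}
    (run (progGates L.p2 (L.post d i))) := local_run writes_progGates
  have htr : Transversal {x | ∃ q, L.p2 ≤ q ∧ q < L.p2 + (L.post d i).length ∧ x = .work q}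
      {b' | ∀ q, L.p2 ≤ q → b' (.work q) = false} := by
    intro c₁ h₁ c₂ h₂ h
    funext x
    by_cases hx : x ∈ {x | ∃ q, L.p2 ≤ q ∧ q < L.p2 + (L.post d i).length ∧ x = Qubit.work q}
    · obtain ⟨q, hq, -, rfl⟩ := hx
      rw [h₁ q hq, h₂ q hq]
    · exact h x hx
  rw [mass, wt_map hloc htr fun b' hb' q hq => by
    rw [hsupp b' hb' q (Or.inr hq)]; exact hb.zero q (a1.trans hq)]
  simp only [run_progGates hwf, wt_single, norm_one, one_pow, mul_one]
  have hspec : ∀ b', ψ b' ≠ 0 → (L.Valid input X → Maj L 0 (v1 X) b' ∧ Maj L 1 (v2 X) b') →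
      execProg L.p2 (L.post d i) b' (.work (L.p8 + L.Wo)) = L.goodSet input v1 v2 y i X := by
    intro b' hb' hmaj
    set χ := execProg L.p2 (L.post d i) b' with hχ
    have hlow : ∀ q < L.p2, χ (.work q) = b' (.work q) := fun q hq =>
      execProg_of_lt fun q' h1 h2 => by intro h; cases h; omega
    have hlow' : ∀ q < L.p1, χ (.work q) = b (.work q) := fun q hq => by
      rw [hlow q (by omega), hsupp b' hb' q (Or.inl hq)]
    have hsat : Sat L.p2 (L.post d i) χ := sat_execProg hwf fun q hq _ => by
      rw [hsupp b' hb' q (Or.inr hq)]; exact hb.zero q (a1.trans hq)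
    have hidx : idxSet d L.n χ = X := idxSet_congr fun t ht => hlow' _ (by omega)
    rw [post_spec hsat hL (input := input) (X := X) (v1 := v1) (v2 := v2)
      (by rw [hlow' _ (by omega)]; exact hb.one) (fun e he => ?_) (fun hv => ?_)]
    · refine goodSet_congr fun l hl hil => ?_
      rw [hy l hl hil]
      exact hlow' _ (by omega)
    · rw [← hidx]
      exact evX_reloc (fun q hq => by rw [hlow' _ (by omega)]; exact hb.inp q hq) (hL.vars e he)
    · rw [maj_congr hL (by norm_num) hlow, maj_congr hL (by norm_num) hlow]
      exact hmaj hv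
  -- an invalid splitting is rejected no matter what the subroutines return
  by_cases hv : L.Valid input X
  · have h0 := hm0 hv
    have h1 := hm1 hv
    rw [if_pos rfl] at h0
    rw [if_neg (by norm_num)] at h1
    have : 2 * (8 / 9 : ℝ) ^ ρ = (8 / 9) ^ ρ + (8 / 9) ^ ρ := by ring
    rw [this]
    refine le_trans ?_ (add_le_add h0 h1)
    refine le_trans ?_ (mass_union_le _ _ _)
    refine wt_mono fun b' hb' => ?_
    split_ifs with c1 c2
    · norm_num
    · exfalso
      refine c1 (hspec b' hb' fun _ => ?_)
      by_contra hcon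
      refine c2 ?_
      rcases not_and_or.1 hcon with h | h
      · exact Or.inl h
      · exact Or.inr h
    · norm_num
    · norm_num
  · refine (le_of_eq (wt_congr (G := fun _ => 0 * 0) fun b' hb' => ?_)).trans ?_
    · rw [if_neg (by simpa using hspec b' hb' fun h => absurd h hv), mul_zero]
    rw [wt_const_mul, zero_mul]
    positivity

/-- One call of the oracle acts, up to a small error, like the classical operation that adds to the
flag whether the set in the register is good. -/
theorem norm_oracle_sub_le (hL : L.Good) {input : List Bool} {v1 v2 : Finset ℕ → ℕ}
    (hC : L.Correct input v1 v2) {b : BasisState} (hb : L.Ready input b) {fl : ℕ}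
    (hfl : L.p0 ≤ fl) (hfl1 : fl < L.p1) (hfd : fl < d ∨ d + L.n ≤ fl) (hi : i < L.Wo)
        (hd : d + L.n ≤ L.p1)
    {y : ℕ → Bool} (hy : ∀ l < L.Wo, i < l → y l = b (.work (L.N0 + l)))
    {ρ : ℕ} (hr : L.r = 2 * ρ) :
    ‖run (L.oracle d i fl) (Finsupp.single b 1)
        - Finsupp.single (xorAt fl (L.goodSet input v1 v2 y i (idxSet d L.n b)) b) 1‖
      ≤ 2 * √(2 * (8 / 9) ^ ρ) := by
  obtain ⟨a1, a2, a3, a4, a5, a6, a7⟩ := p_le (L := L)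
  have hok := oracleU_ok hL hi hd (i := i)
  refine (norm_copyOut_sub_le (fun G hG => (hok G hG).2.1) (by omega) (fun G hG hq => ?_) b _).trans
    (mul_le_mul_of_nonneg_left (Real.sqrt_le_sqrt (mass_oracleU hL hC hb hd hy hr)) (by norm_num))
  have := ((hok G hG).1 fl hq).1
  unfold usable at this
  omega

end Lay

/-! ### The searches -/

/-- Approximation on basis states that can be told apart by the qubits that are not changed implies
approximation on their superpositions. -/
theorem approx_of_basis {g : List Gate} {I : QState →ₗ[ℂ] QState} {W : Set Qubit}
    {A B : Set BasisState} {ε : ℝ} (hd : Distinct g) (hW : ∀ G ∈ g, G.writes ⊆ W) (hI : Local W I)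
    (hA : Transversal W A) (hε : 0 ≤ ε)
    (h : ∀ b ∈ A, Supp B (I (Finsupp.single b 1)) ∧ ‖I (Finsupp.single b 1)‖ = 1 ∧
      ‖run g (Finsupp.single b 1) - I (Finsupp.single b 1)‖ ≤ ε) : Approx g I A B ε := by
  refine ⟨hd, fun ψ hψ => ⟨?_, ?_, ?_⟩⟩
  · rw [map_eq_sum]
    exact supp_sum fun b hb => (h b (hψ b (Finsupp.mem_support_iff.1 hb))).1.smul _
  · exact norm_map_eq hI hA hψ fun b hb => (h b hb).2.1
  · rw [← LinearMap.sub_apply]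
    refine norm_map_le ((local_run hW).sub hI) hA hψ hε fun b hb => ?_
    rw [LinearMap.sub_apply]
    exact (h b hb).2.2

theorem approx_seqOp {g : ℕ → List Gate} {I : ℕ → QState →ₗ[ℂ] QState} {A : ℕ → Set BasisState}
    {ε : ℝ} {N : ℕ} (h : ∀ c < N, Approx (g c) (I c) (A c) (A (c + 1)) ε) :
    Approx ((List.range N).flatMap g) (seqOp I N) (A 0) (A N) (N * ε) := by
  induction N with
  | zero =>
    refine ⟨fun G hG => by simp at hG, fun ψ hψ => ?_⟩
    simpa [seqOp] using hψ
  | succ N ih =>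
    have := (ih fun c hc => h c (by omega)).trans (h N (by omega))
    rw [List.range_succ, List.flatMap_append, List.flatMap_singleton]
    push_cast
    rw [add_mul, one_mul]
    exact this

/-- The basis states that agree with `b₀` outside of `W`. -/
def agreeOff (W : Set Qubit) (b₀ : BasisState) : Set BasisState := {b | ∀ q ∉ W, b q = b₀ q}

theorem transversal_agreeOff {V W : Set Qubit} (b₀ : BasisState) (h : Disjoint V W) :
    Transversal V (agreeOff W b₀) := by
  intro b₁ h₁ b₂ h₂ h'
  funext q
  by_cases hq : q ∈ V
  · have hq' := Set.disjoint_left.1 h hq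
    rw [h₁ q hq', h₂ q hq']
  · exact h' q hq

theorem mem_agreeOff_self (W : Set Qubit) (b₀ : BasisState) : b₀ ∈ agreeOff W b₀ := fun _ _ => rfl

theorem Local.supp_agreeOff {W : Set Qubit} {I : QState →ₗ[ℂ] QState} (h : Local W I)
    {b₀ : BasisState} {ψ : QState} (hψ : Supp (agreeOff W b₀) ψ) :
    Supp (agreeOff W b₀) (I ψ) := by
  intro b' hb'
  obtain ⟨b, hb, hbb⟩ := h.supp ψ hb'
  exact fun q hq => (hbb q hq).trans (hψ b hb q hq)

theorem approx_local {g : List Gate} {W : Set Qubit} (hd : Distinct g) (hW : ∀ G ∈ g, G.writes ⊆ W)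
    (b₀ : BasisState) : Approx g (run g) (agreeOff W b₀) (agreeOff W b₀) 0 :=
  Approx.exact hd fun _ hψ => (local_run hW).supp_agreeOff hψ

/-- Among `N * rep` repetitions each residue modulo `N` occurs `rep` times. -/
theorem prod_mod_ite {N rep t : ℕ} (ht : t < N) (x : ℝ) :
    ∏ c ∈ Finset.range (N * rep), (if c % N = t then x else 1) = x ^ rep := by
  induction rep with
  | zero => simp
  | succ rep ih =>
    rw [Nat.mul_succ, Finset.prod_range_add, ih, pow_succ]
    congr 1
    rw [Finset.prod_congr (g := fun c => if c = t then x else 1) rfl fun c hc => by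
      rw [Nat.mul_add_mod, Nat.mod_eq_of_lt (Finset.mem_range.1 hc)]]
    rw [Finset.prod_ite_eq' (Finset.range N) t fun _ => x, if_pos (Finset.mem_range.2 ht)]

namespace Lay

variable {L : Lay} {d i : ℕ}

/-- The operation is allowed in the circuit, does not involve the `i`-th bit of the minimum, and
changes qubits in `W` only. -/
def Legal (L : Lay) (i : ℕ) (W : Set Qubit) (G : Gate) : Prop :=
  (∀ q ∈ G.qubits, q < L.work ∧ q ≠ L.N0 + i) ∧ G.qubits.Nodup ∧ G.RegistersFit (L.A + L.s) L.w ∧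
      G.writes ⊆ W

theorem Legal.mono {W W' : Set Qubit} {G : Gate} (h : L.Legal i W G) (hW : W ⊆ W') :
    L.Legal i W' G :=
  ⟨h.1, h.2.1, h.2.2.1, h.2.2.2.trans hW⟩

theorem Legal.inv {W : Set Qubit} {G : Gate} (h : L.Legal i W G.inv) : L.Legal i W G := by
  obtain ⟨h1, h2, h3, h4⟩ := h
  rw [Gate.qubits_inv] at h1 h2
  rw [Gate.writes_inv] at h4
  refine ⟨h1, h2, ?_, h4⟩
  cases G <;> exact h3

theorem legal_invGates {W : Set Qubit} {gs : List Gate} (h : ∀ G ∈ gs, L.Legal i W G) :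
    ∀ G ∈ invGates gs, L.Legal i W G := fun _ hG => (h _ (mem_invGates.1 hG)).inv

theorem legal_append {W : Set Qubit} {gs hs : List Gate} (h : ∀ G ∈ gs, L.Legal i W G)
    (h' : ∀ G ∈ hs, L.Legal i W G) : ∀ G ∈ gs ++ hs, L.Legal i W G := fun G hG =>
  (List.mem_append.1 hG).elim (h G) (h' G)

theorem legal_copyOut {W : Set Qubit} {gs : List Gate} {f q : ℕ} (h : ∀ G ∈ gs, L.Legal i W G)
    (hf : f < L.work) (hfi : f ≠ L.N0 + i) (hq : q < L.work)
    (hqi : q ≠ L.N0 + i) (hfq : f ≠ q) (hW : .work q ∈ W) :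
    ∀ G ∈ copyOut gs f q, L.Legal i W G := by
  refine legal_append h fun G hG => ?_
  rcases List.mem_cons.1 hG with rfl | hG
  · refine ⟨?_, ?_, trivial, ?_⟩
    · intro x hx
      simp [Gate.qubits] at hx
      omega
    · simpa [Gate.qubits] using hfq
    · rintro x rfl
      exact hW
  · exact legal_invGates h G hG

theorem legal_phaseKick {W : Set Qubit} {gs : List Gate} {f : ℕ} (h : ∀ G ∈ gs, L.Legal i W G)
    (hf : f < L.work) (hfi : f ≠ L.N0 + i) : ∀ G ∈ phaseKick gs f, L.Legal i W G := by
  refine legal_append (legal_append h fun G hG => ?_) (legal_invGates h)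
  have : G = .phase f := by simpa [zGates] using hG
  subst this
  exact ⟨by simpa [Gate.qubits] using ⟨hf, hfi⟩, by simp [Gate.qubits], trivial, Set.empty_subset _⟩

theorem legal_hadGates {W : Set Qubit} (h : ∀ t < L.n, d + t < L.work ∧ d + t ≠ L.N0 + i)
    (hW : regQubits d L.n ⊆ W) : ∀ G ∈ hadGates d L.n, L.Legal i W G := by
  intro G hG
  have hw := writes_hadGates d L.n G hG
  have hn := distinct_hadGates d L.n G hG
  obtain ⟨t, ht, rfl⟩ := List.mem_map.1 hG
  have := h t (List.mem_range.1 ht)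
  exact ⟨by simpa [Gate.qubits] using this, hn, trivial, hw.trans hW⟩

theorem legal_progGates {W : Set Qubit} {p : ℕ} {es : List Expr} (h : WFProg p es)
    (hv : ∀ e ∈ es, ∀ t ∈ e, t.1 ≠ L.N0 + i ∧ t.2 ≠ L.N0 + i) (hi : L.N0 + i < p)
    (hp : p + es.length ≤ L.work) (hW : ∀ q, p ≤ q → .work q ∈ W) :
    ∀ G ∈ progGates p es, L.Legal i W G := fun G hG =>
  ⟨fun q hq => ⟨(lt_progGates h G hG q hq).trans_le hp,
    qubits_progGates (P := fun q => q ≠ L.N0 + i) hv (fun q h1 _ => by omega) G hG q hq⟩,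
        distinct_progGates h G hG,
    registersFit_progGates _ _ G hG, (writes_progGates G hG).trans <| by
      rintro x ⟨q, h1, -, rfl⟩; exact hW q h1⟩

/-- The qubits of a search register. -/
def regSet (L : Lay) (d : ℕ) : Set Qubit := regQubits d L.n ∪ {.work (d + L.n)}

theorem p1_add_lt_work : L.p1 + L.n < L.work ∧ L.p1 + L.Rn < L.work ∧ L.p8 + L.Wo + 1 < L.work := by
  obtain ⟨a1, a2, a3, a4, a5, a6, a7⟩ := p_le (L := L)
  rw [work]; omega

theorem legal_oracle (hL : L.Good) (hi : i < L.Wo) (hd0 : L.p0 ≤ d) (hd : d + L.n < L.p1) :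
    ∀ G ∈ L.oracle d i (d + L.n), L.Legal i (L.scratch ∪ {.work (d + L.n)}) G := by
  obtain ⟨w1, w2, w3⟩ := p1_add_lt_work (L := L)
  obtain ⟨a1, a2, a3, a4, a5, a6, a7⟩ := p_le (L := L)
  obtain ⟨b1, b2, b3⟩ := fixed_lt (L := L)
  refine legal_copyOut (fun G hG => ?_) (by omega) (by omega) (by omega) (by omega) (by omega)
    (Or.inr rfl)
  obtain ⟨h1, h2, h3, h4⟩ := oracleU_ok hL hi (d := d) (by omega) G hG
  refine ⟨fun q hq => ⟨(h1 q hq).2.trans w3, ?_⟩, h2, h3, h4.trans Set.subset_union_left⟩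
  have := (h1 q hq).1
  unfold usable at this
  omega

theorem wf_allZero_reg (hd : d + L.n < L.p1) : WFProg L.p1 (allZero L.one d 1 L.n L.p1) := by
  obtain ⟨b1, b2, b3⟩ := fixed_lt (L := L)
  exact wf_allZero (by omega) fun t ht => by omega

theorem legal_diffusion (hi : i < L.Wo) (hd0 : L.p0 ≤ d) (hd : d + L.n < L.p1) :
    ∀ G ∈ L.diffusion d, L.Legal i (L.scratch ∪ regQubits d L.n) G := by
  obtain ⟨w1, w2, w3⟩ := p1_add_lt_work (L := L)
  obtain ⟨b1, b2, b3⟩ := fixed_lt (L := L)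
  have hh : ∀ G ∈ hadGates d L.n, L.Legal i (L.scratch ∪ regQubits d L.n) G :=
    legal_hadGates (fun t ht => by omega) Set.subset_union_right
  refine legal_append (legal_invGates hh) (legal_append (legal_phaseKick ?_ w1 (by omega)) hh)
  exact legal_progGates (wf_allZero_reg hd)
    (vars_allZero (P := fun q => q ≠ L.N0 + i) (by omega) (fun t ht => by omega)
      fun q hq => by omega) (by omega) (by rw [length_allZero]; omega)
    fun q hq => Or.inl (Or.inl ⟨q, hq, rfl⟩)

theorem reg_add_lt {c : ℕ} (hc : c < L.Rn) : L.reg c + L.n < L.p1 := by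
  rw [reg, p1]
  have := Nat.mul_le_mul_right (L.n + 1) (show c + 1 ≤ L.Rn from hc)
  rw [Nat.add_mul] at this
  omega

theorem le_reg (c : ℕ) : L.p0 ≤ L.reg c := Nat.le_add_right _ _

theorem reg_lt_reg {c c' : ℕ} (h : c < c') : L.reg c + L.n < L.reg c' := by
  rw [reg, reg]
  have := Nat.mul_le_mul_right (L.n + 1) (show c + 1 ≤ c' from h)
  rw [Nat.add_mul] at this
  omega

theorem mem_regSet {x : Qubit} : x ∈ L.regSet d ↔ ∃ q, d ≤ q ∧ q ≤ d + L.n ∧ x = .work q := by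
  constructor
  · rintro (⟨t, ht, rfl⟩ | rfl)
    · exact ⟨_, by omega, by omega, rfl⟩
    · exact ⟨_, by omega, le_rfl, rfl⟩
  · rintro ⟨q, h1, h2, rfl⟩
    rcases h2.lt_or_eq with h | rfl
    · exact Or.inl ⟨q - d, by omega, by congr 1; omega⟩
    · exact Or.inr rfl

theorem legal_search (hL : L.Good) (hi : i < L.Wo) {c : ℕ} (hc : c < L.Rn) :
    ∀ G ∈ L.search i c, L.Legal i (L.scratch ∪ L.regSet (L.reg c)) G := by
  obtain ⟨w1, w2, w3⟩ := p1_add_lt_work (L := L)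
  have hd := reg_add_lt hc
  have hd0 := le_reg (L := L) c
  obtain ⟨b1, b2, b3⟩ := fixed_lt (L := L)
  have ho : ∀ G ∈ L.oracle (L.reg c) i (L.reg c + L.n),
      L.Legal i (L.scratch ∪ L.regSet (L.reg c)) G := fun G hG =>
    (legal_oracle hL hi hd0 hd G hG).mono
    (Set.union_subset_union_right _ Set.subset_union_right)
  have hdf : ∀ G ∈ L.diffusion (L.reg c), L.Legal i (L.scratch ∪ L.regSet (L.reg c)) G :=
    fun G hG => (legal_diffusion hi hd0 hd G hG).mono
      (Set.union_subset_union_right _ Set.subset_union_left)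
  refine legal_append (legal_hadGates (fun t ht => by omega)
    (Set.subset_union_left.trans Set.subset_union_right)) (legal_append (fun G hG => ?_) ho)
  obtain ⟨_, -, hG⟩ := List.mem_flatMap.1 hG
  exact legal_append (legal_phaseKick ho (by omega) (by omega)) hdf G hG

theorem disjoint_scratch_regSet (hd : d + L.n < L.p1) : Disjoint L.scratch (L.regSet d) := by
  rw [Set.disjoint_left]
  rintro x (⟨q, hq, rfl⟩ | ⟨i, j, rfl⟩) hx
  · obtain ⟨q', h1, h2, h3⟩ := mem_regSet.1 hx
    cases h3; omega
  · obtain ⟨q', h1, h2, h3⟩ := mem_regSet.1 hx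
    cases h3

theorem Ready.of_agreeOff {input : List Bool} {b₀ b : BasisState} (hb₀ : L.Ready input b₀)
    {W : Set Qubit} (hW : ∀ x ∈ W, ∃ q, L.p0 ≤ q ∧ q < L.p1 ∧ x = .work q)
    (hb : b ∈ agreeOff W b₀) : L.Ready input b := by
  obtain ⟨b1, b2, b3⟩ := fixed_lt (L := L)
  have hq (q : ℕ) (hq : q < L.p0 ∨ L.p1 ≤ q) : b (.work q) = b₀ (.work q) := hb _ fun hx => by
    obtain ⟨q', h1, h2, h3⟩ := hW _ hx
    cases h3; omega
  refine ⟨fun q h => ?_, ?_, fun q h => ?_, fun i j => ?_⟩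
  · rw [hq q (by omega)]; exact hb₀.inp q h
  · rw [hq _ (by omega)]; exact hb₀.one
  · rw [hq q (by omega)]; exact hb₀.zero q h
  · rw [hb _ fun hx => by obtain ⟨q', h1, h2, h3⟩ := hW _ hx; cases h3]; exact hb₀.cells i j

theorem regSet_range (hd0 : L.p0 ≤ d) (hd : d + L.n < L.p1) :
    ∀ x ∈ L.regSet d, ∃ q, L.p0 ≤ q ∧ q < L.p1 ∧ x = .work q := by
  intro x hx
  obtain ⟨q, h1, h2, rfl⟩ := mem_regSet.1 hx
  exact ⟨q, by omega, by omega, rfl⟩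

/-- The accuracy of an oracle call. -/
def oracleErr (ρ : ℕ) : ℝ := 2 * √(2 * (8 / 9) ^ ρ)

theorem oracleErr_nonneg (ρ : ℕ) : 0 ≤ oracleErr ρ := by rw [oracleErr]; positivity

section Search

variable {input : List Bool} {v1 v2 : Finset ℕ → ℕ} {b₀ : BasisState} {y : ℕ → Bool} {ρ : ℕ}

/-- The oracle computes whether the set in the register is good. -/
theorem approx_oracle (hL : L.Good) (hi : i < L.Wo) (hC : L.Correct input v1 v2)
    (hb₀ : L.Ready input b₀)
    (hd0 : L.p0 ≤ d) (hd : d + L.n < L.p1)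
    (hy : ∀ l < L.Wo, i < l → y l = b₀ (.work (L.N0 + l))) (hr : L.r = 2 * ρ) :
    Approx (L.oracle d i (d + L.n))
      (basisMap fun b => xorAt (d + L.n) (L.goodSet input v1 v2 y i (idxSet d L.n b)) b)
      (agreeOff (regQubits d L.n) b₀) (agreeOff (L.regSet d) b₀) (oracleErr ρ) := by
  obtain ⟨b1, b2, b3⟩ := fixed_lt (L := L)
  have hx : ∀ v b, ∀ q ≠ Qubit.work (d + L.n), xorAt (d + L.n) v b q = b q := fun v b q hq => by
    rw [xorAt, Function.update_of_ne hq]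
  refine approx_basisMap (W := L.scratch ∪ {.work (d + L.n)})
    (fun G hG => (legal_oracle hL hi hd0 hd G hG).2.1)
        (fun G hG => (legal_oracle hL hi hd0 hd G hG).2.2.2)
    (transversal_agreeOff _ ?_) (fun b q hq => hx _ _ _ fun h => hq (Or.inr h))
    (fun b hb q hq => ?_) (oracleErr_nonneg ρ) fun b hb => ?_
  · refine Set.disjoint_union_left.2
      ⟨(disjoint_scratch_regSet hd).mono_right Set.subset_union_left, ?_⟩
    rw [Set.disjoint_left]
    rintro x rfl ⟨t, ht, h⟩
    have := Qubit.work.inj h; omega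
  · rw [hx _ _ _ fun h => hq (Or.inr h)]
    exact hb q fun h => hq (Or.inl h)
  · refine norm_oracle_sub_le hL hC (hb₀.of_agreeOff (W := regQubits d L.n) (fun x hx =>
      regSet_range hd0 hd x (Or.inl hx)) hb) (by omega) hd (Or.inr le_rfl) hi hd.le
          (fun l hl hil => ?_) hr
    rw [hy l hl hil, hb]
    rintro ⟨t, ht, h⟩
    have := Qubit.work.inj h; omega

/-- The gates of `diffusion` implement `diffOp`. -/
theorem approx_diffusion (hb₀ : L.Ready input b₀) (hd0 : L.p0 ≤ d) (hd : d + L.n < L.p1) :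
    Approx (L.diffusion d) (diffOp d L.n) (agreeOff (regQubits d L.n) b₀)
      (agreeOff (regQubits d L.n) b₀) 0 := by
  obtain ⟨b1, b2, b3⟩ := fixed_lt (L := L)
  have hwf := wf_allZero_reg hd
  have h1 : Approx (progGates L.p1 (allZero L.one d 1 L.n L.p1))
      (basisMap (execProg L.p1 (allZero L.one d 1 L.n L.p1)))
      (agreeOff (regQubits d L.n) b₀) Set.univ 0 := by
    refine approx_basisMap (W := L.scratch) (distinct_progGates hwf)
      (fun G hG => (writes_progGates G hG).trans ?_)
      (transversal_agreeOff _ ((disjoint_scratch_regSet hd).mono_right Set.subset_union_left))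
      (fun b q hq => ?_) (fun _ _ => trivial) le_rfl fun b _ => ?_
    · rintro x ⟨q, hq, -, rfl⟩; exact Or.inl ⟨q, hq, rfl⟩
    · exact execProg_of_lt fun q' hq' _ h => hq (Or.inl ⟨q', hq', h⟩)
    · rw [run_progGates hwf, sub_self, norm_zero]
  have h2 := h1.phaseKick (f := L.p1 + L.n) (Q := idxZero d L.n) fun b hb => by
    have hready := hb₀.of_agreeOff (W := regQubits d L.n) (fun x hx =>
      regSet_range hd0 hd x (Or.inl hx)) hb
    have hlow : ∀ q < L.p1, execProg L.p1 (allZero L.one d 1 L.n L.p1) b (.work q) = b (.work q) :=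
      fun q hq => execProg_of_lt fun q' h1 h2 => by intro h; cases h; omega
    rw [Bool.eq_iff_iff, allZero_spec (sat_execProg hwf fun q hq _ => hready.zero q hq)
      (by rw [hlow _ (by omega)]; exact hready.one), idxZero, decide_eq_true_eq]
    rw [Finset.eq_empty_iff_forall_notMem]
    constructor
    · intro h t ht
      rw [mem_idxSet] at ht
      have := h t ht.1
      rw [mul_one, hlow _ (by omega), ht.2] at this
      cases this
    · intro h t ht
      rw [mul_one, hlow _ (by omega)]
      by_contra hne
      exact h t (mem_idxSet.2 ⟨ht, by simpa using hne⟩)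
  have hdist := distinct_hadGates d L.n
  have hw := writes_hadGates d L.n
  have := (approx_local hdist.inv (writes_invGates hw) b₀).trans
    (h2.trans (approx_local hdist hw b₀))
  exact this.mono le_rfl le_rfl (by norm_num)

/-- The test that a search looks for. -/
def goodAt (L : Lay) (input : List Bool) (v1 v2 : Finset ℕ → ℕ) (y : ℕ → Bool) (i d : ℕ)
    (b : BasisState) : Bool := L.goodSet input v1 v2 y i (idxSet d L.n b)

/-- A search makes at most `2 * 2 ^ h + 1` calls of the oracle, and their errors add up. -/
theorem approx_search_aux (hL : L.Good) (hi : i < L.Wo) (hC : L.Correct input v1 v2)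
    (hb₀ : L.Ready input b₀)
    {c : ℕ} (hc : c < L.Rn) (hfl : b₀ (.work (L.reg c + L.n)) = false)
    (hy : ∀ l < L.Wo, i < l → y l = b₀ (.work (L.N0 + l))) (hr : L.r = 2 * ρ) :
    Approx (L.search i c)
      (searchOp (L.reg c) L.n (L.reg c + L.n) (L.goodAt input v1 v2 y i (L.reg c))
        (iterCount (c % (L.h + 2))))
      (agreeOff (regQubits (L.reg c) L.n) b₀) (agreeOff (L.regSet (L.reg c)) b₀)
      ((2 * 2 ^ L.h + 1) * oracleErr ρ) := by
  have hd := reg_add_lt hc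
  have hd0 := le_reg (L := L) c
  have ho := approx_oracle hL hi hC hb₀ hd0 hd hy hr
  have hpk := ho.phaseKick (f := L.reg c + L.n)
    (Q := L.goodAt input v1 v2 y i (L.reg c)) fun b hb => by
      have : b (.work (L.reg c + L.n)) = false := by
        rw [hb _ ?_]
        · exact hfl
        · rintro ⟨t, ht, h⟩; have := Qubit.work.inj h; omega
      simp [xorAt, this, goodAt]
  have := (approx_local (distinct_hadGates (L.reg c) L.n) (writes_hadGates (L.reg c) L.n) b₀).trans
    (((hpk.trans (approx_diffusion hb₀ hd0 hd)).rep (iterCount (c % (L.h + 2)))).trans ho)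
  refine this.mono le_rfl le_rfl ?_
  have hj : (iterCount (c % (L.h + 2)) : ℝ) ≤ 2 ^ L.h := by
    have hlt : c % (L.h + 2) < L.h + 2 := Nat.mod_lt _ (by omega)
    rw [iterCount]
    split_ifs with h0
    · simp
    · push_cast
      exact pow_le_pow_right₀ (by norm_num) (by omega)
  have := mul_le_mul_of_nonneg_right hj (oracleErr_nonneg ρ)
  nlinarith [oracleErr_nonneg ρ]

/-- The qubits of the searches before the search number `c`. -/
def regsBefore (L : Lay) (c : ℕ) : Set Qubit := {x | ∃ j < c, x ∈ L.regSet (L.reg j)}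

/-- The input is in place, and everything else except for the bits of the minimum is zero. -/
structure Clean (L : Lay) (input : List Bool) (b : BasisState) : Prop extends L.Ready input b where
  regs : ∀ q, L.p0 ≤ q → b (.work q) = false

theorem regsBefore_range {c : ℕ} (hc : c ≤ L.Rn) :
    ∀ x ∈ L.regsBefore c, ∃ q, L.p0 ≤ q ∧ q < L.p1 ∧ x = .work q := by
  rintro x ⟨j, hj, hx⟩
  exact regSet_range (le_reg j) (reg_add_lt (by omega)) x hx

theorem disjoint_regsBefore (c : ℕ) : Disjoint (L.regSet (L.reg c)) (L.regsBefore c) := by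
  rw [Set.disjoint_left]
  rintro x hx ⟨j, hj, hx'⟩
  obtain ⟨q, h1, h2, rfl⟩ := mem_regSet.1 hx
  obtain ⟨q', h3, h4, h5⟩ := mem_regSet.1 hx'
  have := reg_lt_reg (L := L) hj
  cases h5; omega

theorem clean_facts (hb₀ : L.Clean input b₀) {c : ℕ} (hc : c < L.Rn) {b : BasisState}
    (hb : b ∈ agreeOff (L.regsBefore c) b₀) :
    L.Ready input b ∧ (∀ q, L.reg c ≤ q → q ≤ L.reg c + L.n → b (.work q) = false) ∧
      ∀ q < L.p0, b (.work q) = b₀ (.work q) := by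
  refine ⟨hb₀.toReady.of_agreeOff (regsBefore_range hc.le) hb, fun q h1 h2 => ?_, fun q hq => ?_⟩
  · rw [hb _ (Set.disjoint_left.1 (disjoint_regsBefore c) (mem_regSet.2 ⟨q, h1, h2, rfl⟩))]
    exact hb₀.regs q ((le_reg c).trans h1)
  · refine hb _ fun hx => ?_
    obtain ⟨q', h1, h2, h3⟩ := regsBefore_range hc.le _ hx
    cases h3; omega

/-- The ideal version of the search number `c`. -/
def idealSearch (L : Lay) (input : List Bool) (v1 v2 : Finset ℕ → ℕ) (y : ℕ → Bool) (i c : ℕ) :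
    QState →ₗ[ℂ] QState :=
  searchOp (L.reg c) L.n (L.reg c + L.n) (L.goodAt input v1 v2 y i (L.reg c))
    (iterCount (c % (L.h + 2)))

theorem approx_search (hL : L.Good) (hi : i < L.Wo) (hC : L.Correct input v1 v2)
    (hb₀ : L.Clean input b₀)
    {c : ℕ} (hc : c < L.Rn)
    (hy : ∀ l < L.Wo, i < l → y l = b₀ (.work (L.N0 + l))) (hr : L.r = 2 * ρ) :
    Approx (L.search i c) (L.idealSearch input v1 v2 y i c) (agreeOff (L.regsBefore c) b₀)
      (agreeOff (L.regsBefore (c + 1)) b₀) ((2 * 2 ^ L.h + 1) * oracleErr ρ) := by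
  have hleg := legal_search hL hi hc
  have hd := reg_add_lt hc
  refine approx_of_basis (W := L.scratch ∪ L.regSet (L.reg c)) (fun G hG => (hleg G hG).2.1)
    (fun G hG => (hleg G hG).2.2.2) (local_searchOp.mono Set.subset_union_right)
    (transversal_agreeOff _ (Set.disjoint_union_left.2 ⟨?_, disjoint_regsBefore c⟩))
    (by have := oracleErr_nonneg ρ; positivity) fun b hb => ?_
  · rw [Set.disjoint_left]
    rintro x hx hx'
    obtain ⟨q, h1, h2, rfl⟩ := regsBefore_range hc.le x hx'
    rcases hx with ⟨q', h3, h4⟩ | ⟨i, j, h⟩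
    · cases h4; omega
    · cases h
  · obtain ⟨hready, hz, hlow⟩ := clean_facts hb₀ hc hb
    have := approx_search_aux hL hi hC hready hc (hz _ (by omega) le_rfl) (y := y) (i := i)
      (fun l hl hil => by
        rw [hy l hl hil, hlow]
        rw [p0]; omega) hr
    obtain ⟨h1, h2, h3⟩ := this.2 (Finsupp.single b 1) (supp_single (mem_agreeOff_self _ b) 1)
    rw [norm_single, norm_one] at h2 h3
    rw [mul_one] at h3
    refine ⟨h1.mono fun b' hb' q hq => ?_, h2, h3⟩
    rw [hb' q fun h => hq ⟨c, by omega, h⟩]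
    exact hb q fun ⟨j, hj, h⟩ => hq ⟨j, by omega, h⟩

theorem approx_searches (hL : L.Good) (hi : i < L.Wo) (hC : L.Correct input v1 v2)
    (hb₀ : L.Clean input b₀)
    (hy : ∀ l < L.Wo, i < l → y l = b₀ (.work (L.N0 + l))) (hr : L.r = 2 * ρ) :
    Approx (L.searches i) (seqOp (L.idealSearch input v1 v2 y i) L.Rn)
      (agreeOff (L.regsBefore 0) b₀) (agreeOff (L.regsBefore L.Rn) b₀)
      (L.Rn * ((2 * 2 ^ L.h + 1) * oracleErr ρ)) :=
  approx_seqOp (A := fun c => agreeOff (L.regsBefore c) b₀) fun _ hc =>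
    approx_search hL hi hC hb₀ hc hy hr

theorem agreeOff_regsBefore (c : ℕ) : agreeOff (L.regsBefore c) b₀
    = {b | ∀ q, (∀ j < c, q ∉ L.regSet (L.reg j)) → b q = b₀ q} := by
  ext b
  refine forall_congr' fun q => imp_congr_left ?_
  simp [regsBefore]

theorem disjoint_regSet {j c : ℕ} (h : j < c) :
    Disjoint (L.regSet (L.reg j)) (L.regSet (L.reg c)) :=
  ((disjoint_regsBefore c).mono_right fun _ hx => ⟨j, h, hx⟩).symm

/-- If a sufficient fraction of the sets is good, then it is unlikely that all searches fail. -/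
theorem mass_searches_fail (hL : L.Good) (hi : i < L.Wo) (hC : L.Correct input v1 v2)
    (hb₀ : L.Clean input b₀)
    (hy : ∀ l < L.Wo, i < l → y l = b₀ (.work (L.N0 + l))) (hr : L.r = 2 * ρ) {m : ℕ}
    (hm : m ≤ 2 * L.h)
    (hgood : 2 ^ L.n ≤ 2 ^ m * ((Finset.range L.n).powerset.filter fun X =>
      L.goodSet input v1 v2 y i X = true).card) :
    mass {b | ∀ c < L.Rn, b (.work (L.reg c + L.n)) = false}
      (seqOp (L.idealSearch input v1 v2 y i) L.Rn (Finsupp.single b₀ 1)) ≤ (3 / 4) ^ L.rep := by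
  classical
  set K := ((Finset.range L.n).powerset.filter fun X => L.goodSet input v1 v2 y i X = true).card
    with hK
  have hKle : K ≤ 2 ^ L.n := (Finset.card_filter_le _ _).trans (by simp)
  set a : ℝ := K / 2 ^ L.n with ha
  have ha1 : a ≤ 1 := by
    rw [ha, div_le_one (by positivity)]
    exact_mod_cast hKle
  have ham : 1 ≤ a * 2 ^ m := by
    rw [ha, div_mul_eq_mul_div, le_div_iff₀ (by positivity), one_mul, mul_comm]
    exact_mod_cast hgood
  obtain ⟨t, ht, hamp⟩ := exists_iterCount ham ha1 hm
  -- only the searches with the number `iterCount t` of iterations are counted on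
  have hsearch : ∀ c < L.Rn, ∀ b ∈ {b | ∀ q, (∀ j < c, q ∉ L.regSet (L.reg j)) → b q = b₀ q},
      wt (fun b => if b (.work (L.reg c + L.n)) then 0 else 1)
        (L.idealSearch input v1 v2 y i c (Finsupp.single b 1))
        ≤ if c % (L.h + 2) = t then 3 / 4 else 1 := by
    intro c hc b hb
    rw [← agreeOff_regsBefore] at hb
    obtain ⟨hready, hz, hlow⟩ := clean_facts hb₀ hc hb
    split_ifs with hct
    · refine le_trans (le_of_eq ?_) hamp
      rw [idealSearch, hct]
      exact wt_searchOp (good := fun X => L.goodSet input v1 v2 y i X)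
        (fun t ht => hz _ (by omega) (by omega)) rfl
        (hz _ (by omega) le_rfl) (fun _ => rfl) ha (iterCount t)
    · have h1 := ((approx_search hL hi hC hb₀ hc hy hr).2 (Finsupp.single b 1)
        (supp_single hb 1)).2.1
      rw [norm_single, norm_one] at h1
      calc _ ≤ wt (fun _ => 1) (L.idealSearch input v1 v2 y i c (Finsupp.single b 1)) :=
            wt_mono fun b' _ => by split_ifs <;> norm_num
        _ = 1 := by rw [← norm_sq_eq_wt, h1, one_pow]
  have := (wt_prod_le (L.idealSearch input v1 v2 y i) (fun c => L.regSet (L.reg c))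
    (fun c b => if b (.work (L.reg c + L.n)) then 0 else 1)
    (fun c => if c % (L.h + 2) = t then 3 / 4 else 1) b₀
    (fun c => {b | ∀ q, (∀ j < c, q ∉ L.regSet (L.reg j)) → b q = b₀ q}) (fun _ => rfl) L.Rn
    (fun c j hj _ => disjoint_regSet hj) (fun c b => by split_ifs <;> norm_num)
    (fun c _ b b' h => by rw [h _ (Or.inr rfl)])
    (fun c _ b _ b' hb' q hq => local_searchOp b b' hb' q hq)
    (fun c _ => by split_ifs <;> norm_num) hsearch).2
  rw [Rn, prod_mod_ite (by omega)] at this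
  refine le_trans (wt_mono fun b _ => ?_) this
  split_ifs with h
  · rw [Finset.prod_eq_one fun c hc => by
      have := h c (Finset.mem_range.1 hc)
      simp [this]]
  · exact Finset.prod_nonneg fun c _ => by split_ifs <;> norm_num

/-- If no set is good, then all searches fail. -/
theorem supp_searches_fail (hb₀ : L.Clean input b₀)
    (hgood : ∀ X ⊆ Finset.range L.n, L.goodSet input v1 v2 y i X = false) :
    Supp {b | ∀ c < L.Rn, b (.work (L.reg c + L.n)) = false}
      (seqOp (L.idealSearch input v1 v2 y i) L.Rn (Finsupp.single b₀ 1)) := by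
  have hQ (d : ℕ) : L.goodAt input v1 v2 y i d = fun _ => false := by
    funext b; exact hgood _ (Finset.filter_subset _ _)
  have hphase : phaseOp (fun _ => false) = LinearMap.id := linearMap_ext fun b => by
    simp [phaseOp_single]
  -- as the phases are trivial, the flags are never changed
  have hloc (c : ℕ) : Local (regQubits (L.reg c) L.n) (L.idealSearch input v1 v2 y i c) := by
    have hh : Local (regQubits (L.reg c) L.n) (run (hadGates (L.reg c) L.n)) :=
      local_run (writes_hadGates _ _)
    have hi : Local (regQubits (L.reg c) L.n) (run (invGates (hadGates (L.reg c) L.n))) :=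
      local_run (writes_invGates (writes_hadGates _ _))
    have hit : Local (regQubits (L.reg c) L.n) (diffOp (L.reg c) L.n) :=
      hh.comp ((local_phaseOp _ _).comp hi)
    rw [idealSearch, hQ, searchOp, hphase, LinearMap.comp_id]
    refine Local.comp (local_basisMap fun b q _ => by rw [xorAt_false]) (Local.comp ?_ hh)
    induction iterCount (c % (L.h + 2)) with
    | zero => rw [pow_zero]; exact local_id _
    | succ j ih => rw [pow_succ]; exact ih.comp hit
  have := (wt_prod_le (L.idealSearch input v1 v2 y i) (fun c => regQubits (L.reg c) L.n)
    (fun _ _ => 0) (fun _ => 0) b₀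
    (fun c => {b | ∀ q, (∀ j < c, q ∉ regQubits (L.reg j) L.n) → b q = b₀ q}) (fun _ => rfl) L.Rn
    (fun c j hj _ => (disjoint_regSet hj).mono Set.subset_union_left Set.subset_union_left)
    (fun _ _ => le_rfl) (fun _ _ _ _ _ => rfl)
    (fun c _ b _ b' hb' q hq => hloc c b b' hb' q hq) (fun _ _ => le_rfl)
    fun c _ b _ => by simp [wt]).1
  refine this.mono fun b hb c hc => ?_
  rw [hb]
  · exact hb₀.regs _ ((le_reg c).trans (Nat.le_add_right _ _))
  · rintro j hj ⟨t, ht, h⟩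
    rcases lt_trichotomy j c with hjc | rfl | hjc
    · have := reg_lt_reg (L := L) hjc
      have := Qubit.work.inj h; omega
    · have := Qubit.work.inj h; omega
    · have := reg_lt_reg (L := L) hjc
      have := Qubit.work.inj h; omega

end Search

end Lay

/-! ### Correctness of the circuit -/

namespace Lay

variable {L : Lay} {i : ℕ}

theorem wf_flags : WFProg L.p1 (allZero L.one (L.p0 + L.n) (L.n + 1) L.Rn L.p1) := by
  obtain ⟨b1, b2, b3⟩ := fixed_lt (L := L)
  refine wf_allZero (by omega) fun t ht => ?_
  have := reg_add_lt ht
  rw [reg] at this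
  omega

theorem legal_bitU (hL : L.Good) (hi : i < L.Wo) : ∀ G ∈ L.bitU i, L.Legal i Set.univ G := by
  obtain ⟨w1, w2, w3⟩ := p1_add_lt_work (L := L)
  obtain ⟨b1, b2, b3⟩ := fixed_lt (L := L)
  refine legal_append (fun G hG => ?_) ?_
  · obtain ⟨c, hc, hG⟩ := List.mem_flatMap.1 hG
    exact (legal_search hL hi (List.mem_range.1 hc) G hG).mono (Set.subset_univ _)
  · exact legal_progGates wf_flags (vars_allZero (P := fun q => q ≠ L.N0 + i) (by omega)
      (fun t ht => by omega) fun q hq => by omega) (by omega) (by rw [length_allZero]; omega)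
      fun _ _ => Set.mem_univ _

/-- The accuracy of the computation of one bit of the minimum. -/
def bitErr (L : Lay) (ρ : ℕ) : ℝ :=
  2 * (√((3 / 4) ^ L.rep) + L.Rn * ((2 * 2 ^ L.h + 1) * oracleErr ρ))

section Bits

variable {input : List Bool} {v1 v2 : Finset ℕ → ℕ} {b₀ : BasisState} {y : ℕ → Bool} {ρ m : ℕ}

open Classical in
/-- One bit of the minimum is computed up to the error `bitErr`, which comprises the probability
that all searches fail although there are good sets, and the errors of all calls of the oracle. -/
theorem norm_bit_sub_le (hL : L.Good) (hi : i < L.Wo) (hC : L.Correct input v1 v2)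
    (hb₀ : L.Clean input b₀) (hy : ∀ l < L.Wo, i < l → y l = b₀ (.work (L.N0 + l)))
    (hr : L.r = 2 * ρ) (hm : m ≤ 2 * L.h) {v : Bool}
    (hv : (v = true ∧ ∀ X ⊆ Finset.range L.n, L.goodSet input v1 v2 y i X = false) ∨
      (v = false ∧ 2 ^ L.n ≤ 2 ^ m * ((Finset.range L.n).powerset.filter fun X =>
        L.goodSet input v1 v2 y i X = true).card)) :
    ‖run (L.bit i) (Finsupp.single b₀ 1) - Finsupp.single (xorAt (L.N0 + i) v b₀) 1‖
      ≤ L.bitErr ρ := by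
  obtain ⟨b1, b2, b3⟩ := fixed_lt (L := L)
  have hleg := legal_bitU hL hi
  refine (norm_copyOut_sub_le (fun G hG => (hleg G hG).2.1) (by omega)
    (fun G hG hq => ((hleg G hG).1 _ hq).2 rfl) b₀ v).trans ?_
  rw [bitErr]
  refine mul_le_mul_of_nonneg_left ?_ (by norm_num)
  have happ := (approx_searches hL hi hC hb₀ hy hr).2 (Finsupp.single b₀ 1)
    (supp_single (mem_agreeOff_self _ _) 1)
  rw [norm_single, norm_one, mul_one] at happ
  obtain ⟨hsupp, -, herr⟩ := happ
  have hfail := mass_searches_fail hL hi hC hb₀ hy hr hm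
  have hfail' := supp_searches_fail (v1 := v1) (v2 := v2) (y := y) (i := i) hb₀
  set ψ' := seqOp (L.idealSearch input v1 v2 y i) L.Rn (Finsupp.single b₀ 1) with hψ'
  set P := allZero L.one (L.p0 + L.n) (L.n + 1) L.Rn L.p1 with hP
  have hwf : WFProg L.p1 P := wf_flags
  rw [bitU, run_append]
  -- the first summand is the error of the ideal searches, the second one their distance to the
  -- actual ones
  refine (sqrt_mass_le _ _ (run (progGates L.p1 P) ψ')).trans (add_le_add ?_ ?_)
  · refine Real.sqrt_le_sqrt ?_
    have htr : Transversal L.scratch (agreeOff (L.regsBefore L.Rn) b₀) :=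
      transversal_agreeOff _ <| by
        rw [Set.disjoint_left]
        rintro x hx hx'
        obtain ⟨q, h1, h2, rfl⟩ := regsBefore_range le_rfl x hx'
        rcases hx with ⟨q', h3, h4⟩ | ⟨i, j, h⟩
        · cases h4; omega
        · cases h
    have hloc : Local L.scratch (run (progGates L.p1 P)) := local_run fun G hG =>
      (writes_progGates G hG).trans <| by
        rintro x ⟨q, h1, -, rfl⟩; exact Or.inl ⟨q, h1, rfl⟩
    rw [mass, wt_map hloc htr hsupp]
    simp only [run_progGates hwf, wt_single, norm_one, one_pow, mul_one]
    have hspec : ∀ b, ψ' b ≠ 0 → (execProg L.p1 P b (.work (L.p1 + L.Rn)) = true ↔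
        ∀ c < L.Rn, b (.work (L.reg c + L.n)) = false) := by
      intro b hb
      have hready := hb₀.toReady.of_agreeOff (regsBefore_range le_rfl) (hsupp b hb)
      have hlow : ∀ q < L.p1, execProg L.p1 P b (.work q) = b (.work q) :=
        fun q hq => execProg_of_lt fun q' h1 h2 => by intro h; cases h; omega
      rw [allZero_spec (sat_execProg hwf fun q hq _ => hready.zero q hq)
        (by rw [hlow _ (by omega)]; exact hready.one)]
      refine forall_congr' fun c => imp_congr_right fun hc => ?_
      have h1 := reg_add_lt hc
      have h2 : L.p0 + L.n + c * (L.n + 1) = L.reg c + L.n := by rw [reg]; omega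
      rw [h2, hlow _ h1]
    rcases hv with ⟨rfl, hno⟩ | ⟨rfl, hmany⟩
    · refine (le_of_eq (wt_congr (G := fun _ => 0 * 0) fun b hb => ?_)).trans ?_
      · rw [if_neg, mul_zero]
        have := (hspec b hb).2 (hfail' hno b hb)
        simpa using this
      · rw [wt_const_mul, zero_mul]; positivity
    · refine le_trans (wt_mono fun b hb => ?_) (hfail hmany)
      have := hspec b hb
      split_ifs with h1 h2 h2
      · norm_num
      · exfalso
        have h1' : execProg L.p1 P b (.work (L.p1 + L.Rn)) ≠ false := h1
        exact h2 (this.1 (by simpa using h1'))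
      · norm_num
      · norm_num
  · have hdist : Distinct (progGates L.p1 P) := distinct_progGates hwf
    rw [← map_sub, norm_run hdist]
    exact herr

end Bits

/-- The minimum of the values of the splittings given by the subsets `X` of `{0, …, n - 1}` is `y`,
and it is attained by at least a fraction of `2 ^ (-m)` of these subsets. -/
structure Solves (L : Lay) (input : List Bool) (v1 v2 : Finset ℕ → ℕ) (m y : ℕ) : Prop where
  len : input.length = L.N0
  le : ∀ X ⊆ Finset.range L.n, L.Valid input X → y ≤ L.combine input X (v1 X) (v2 X)
  count : 2 ^ L.n ≤ 2 ^ m * ((Finset.range L.n).powerset.filter fun X =>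
    L.Valid input X ∧ L.combine input X (v1 X) (v2 X) = y).card

theorem combine_lt (input : List Bool) (X : Finset ℕ) (a b : ℕ) :
    L.combine input X a b < 2 ^ L.Wo := by
  refine (bitsVal_lt _).trans_le (le_of_eq ?_)
  rw [BoolCircuit.eval, List.length_map]; rfl

theorem Solves.lt {input : List Bool} {v1 v2 : Finset ℕ → ℕ} {m y : ℕ}
    (h : L.Solves input v1 v2 m y) : y < 2 ^ L.Wo := by
  have h1 : 0 < ((Finset.range L.n).powerset.filter fun X =>
      L.Valid input X ∧ L.combine input X (v1 X) (v2 X) = y).card := by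
    by_contra hc
    have h2 := h.count
    rw [Nat.eq_zero_of_not_pos hc, mul_zero] at h2
    exact absurd h2 (by simp)
  obtain ⟨X, hX⟩ := Finset.card_pos.1 h1
  rw [← (Finset.mem_filter.1 hX).2.2]
  exact combine_lt _ _ _ _

/-- The `i`-th bit of the minimum is `0` if and only if there is a good set, and then there are many
good sets. -/
theorem Solves.bit {input : List Bool} {v1 v2 : Finset ℕ → ℕ} {m y : ℕ}
    (h : L.Solves input v1 v2 m y) (hi : i < L.Wo) :
    (y.testBit i = true ∧
      ∀ X ⊆ Finset.range L.n, L.goodSet input v1 v2 (fun l => y.testBit l) i X = false) ∨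
    (y.testBit i = false ∧ 2 ^ L.n ≤ 2 ^ m * ((Finset.range L.n).powerset.filter fun X =>
      L.goodSet input v1 v2 (fun l => y.testBit l) i X = true).card) := by
  cases hbit : y.testBit i with
  | true =>
    refine Or.inl ⟨rfl, fun X hX => ?_⟩
    rw [goodSet, decide_eq_false_iff_not]
    rintro ⟨hval, hall⟩
    refine absurd (h.le X hX hval) (not_le.2 ?_)
    refine Nat.lt_of_testBit i (by simpa using hall i hi le_rfl) hbit fun j hj => ?_
    by_cases hjW : j < L.Wo
    · rw [hall j hjW hj.le, decide_eq_true hj.ne', Bool.true_and]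
    · rw [Nat.testBit_lt_two_pow, Nat.testBit_lt_two_pow]
      · exact h.lt.trans_le (Nat.pow_le_pow_right (by norm_num) (by omega))
      · exact (combine_lt _ _ _ _).trans_le (Nat.pow_le_pow_right (by norm_num) (by omega))
  | false =>
    refine Or.inr ⟨rfl, h.count.trans (Nat.mul_le_mul_left _ (Finset.card_le_card fun X hX => ?_))⟩
    rw [Finset.mem_filter] at hX ⊢
    refine ⟨hX.1, ?_⟩
    rw [goodSet, decide_eq_true_eq]
    refine ⟨hX.2.1, fun l _ _ => ?_⟩
    rw [hX.2.2]
    by_cases hl : l = i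
    · simp [hl, hbit]
    · simp [hl]

/-- The state in which the bits of `y` from the `j`-th one on have been computed. -/
def stage (L : Lay) (input : List Bool) (y j : ℕ) : BasisState
  | .work q => if q < L.N0 then input.getD q false
      else if q < L.N0 + L.Wo then decide (L.N0 + j ≤ q) && y.testBit (q - L.N0)
      else decide (q = L.one)
  | .cell _ _ => false

theorem clean_stage (input : List Bool) (y j : ℕ) : L.Clean input (L.stage input y j) := by
  obtain ⟨b1, b2, b3⟩ := fixed_lt (L := L)
  have hreg : ∀ q, L.p0 ≤ q → L.stage input y j (.work q) = false := fun q hq => by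
    rw [stage, if_neg (by omega), if_neg (by omega)]
    exact decide_eq_false (by omega)
  refine ⟨⟨fun q hq => ?_, ?_, fun q hq => hreg q (b3.trans hq), fun i j => rfl⟩, hreg⟩
  · rw [stage, if_pos hq]
  · rw [stage, if_neg (by omega), if_neg (by omega)]
    exact decide_eq_true rfl

theorem xorAt_stage (input : List Bool) (y : ℕ) {j : ℕ} (hj : j < L.Wo) :
    xorAt (L.N0 + j) (y.testBit j) (L.stage input y (j + 1)) = L.stage input y j := by
  funext x
  cases x with
  | cell i j => simp [xorAt, stage]
  | work q =>
    by_cases hq : q = L.N0 + j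
    · subst hq
      simp [xorAt, stage, hj]
    · have : Qubit.work q ≠ .work (L.N0 + j) := fun h => hq (Qubit.work.inj h)
      rw [xorAt, Function.update_of_ne this, stage, stage]
      have : decide (L.N0 + (j + 1) ≤ q) = decide (L.N0 + j ≤ q) := by
        rw [decide_eq_decide]; omega
      rw [this]

/-- The errors in the computation of the bits of the minimum add up. -/
theorem norm_bits_sub_le (hL : L.Good) {input : List Bool} {v1 v2 : Finset ℕ → ℕ} {m y ρ : ℕ}
    (hC : L.Correct input v1 v2) (hs : L.Solves input v1 v2 m y) (hr : L.r = 2 * ρ)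
    (hm : m ≤ 2 * L.h) {t : ℕ} (ht : t ≤ L.Wo) :
    ‖run ((List.range t).flatMap fun t => L.bit (L.Wo - 1 - t))
        (Finsupp.single (L.stage input y L.Wo) 1)
      - Finsupp.single (L.stage input y (L.Wo - t)) 1‖ ≤ t * L.bitErr ρ := by
  induction t with
  | zero => simp
  | succ t ih =>
    have ih := ih (by omega)
    rw [List.range_succ, List.flatMap_append, List.flatMap_singleton, run_append]
    set i := L.Wo - 1 - t with hi
    have e1 : L.Wo - t = i + 1 := by omega
    have e2 : L.Wo - (t + 1) = i := by omega
    have hiW : i < L.Wo := by omega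
    rw [e1] at ih
    rw [e2]
    set ψ := run ((List.range t).flatMap fun t => L.bit (L.Wo - 1 - t))
      (Finsupp.single (L.stage input y L.Wo) 1)
    have hstep := norm_bit_sub_le hL hiW hC (clean_stage input y (i + 1))
      (y := fun l => y.testBit l) (fun l hl hil => by
        rw [stage, if_neg (by omega), if_pos (by omega), decide_eq_true (by omega), Bool.true_and,
          Nat.add_sub_cancel_left]) hr hm (hs.bit hiW)
    rw [xorAt_stage input y hiW] at hstep
    have hdist : Distinct (L.bit i) := distinct_copyOut (fun G hG => (legal_bitU hL hiW G hG).2.1)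
      (by obtain ⟨b1, b2, b3⟩ := fixed_lt (L := L); omega)
    have e : run (L.bit i) ψ - Finsupp.single (L.stage input y i) 1
        = run (L.bit i) (ψ - Finsupp.single (L.stage input y (i + 1)) 1)
          + (run (L.bit i) (Finsupp.single (L.stage input y (i + 1)) 1)
            - Finsupp.single (L.stage input y i) 1) := by
      rw [map_sub]; abel
    rw [e]
    refine (norm_add_le _ _).trans ?_
    rw [norm_run hdist]
    push_cast
    linarith

theorem prob_eq_mass (C : QCircuit) (input : List Bool) (y : ℕ) :
    C.prob input y = mass {b | bitsVal (C.outs.map fun q => b (.work q)) = y}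
      (C.finalState input) := by
  rw [QCircuit.prob, mass, wt]
  refine Finsupp.sum_congr fun b _ => ?_
  by_cases h : bitsVal (C.outs.map fun q => b (.work q)) = y <;> simp [h]

/-- The final state is at distance at most `1 / 2` from a basis state with the correct output, so
that the probability of a wrong output is at most `1 / 4`. -/
theorem circuit_computes (hL : L.Good) {input : List Bool} {v1 v2 : Finset ℕ → ℕ} {m y ρ : ℕ}
    (hC : L.Correct input v1 v2) (hs : L.Solves input v1 v2 m y) (hr : L.r = 2 * ρ)
    (hm : m ≤ 2 * L.h) (herr : L.Wo * L.bitErr ρ ≤ 1 / 2) : L.circuit.Computes input y := by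
  obtain ⟨w1, w2, w3⟩ := p1_add_lt_work (L := L)
  obtain ⟨b1, b2, b3⟩ := fixed_lt (L := L)
  refine ⟨?_, ?_⟩
  · rw [hs.len]; show L.N0 ≤ L.work; omega
  rw [prob_eq_mass]
  -- the first gate sets the qubit `one`
  have hfinal : L.circuit.finalState input
      = run ((List.range L.Wo).flatMap fun t => L.bit (L.Wo - 1 - t))
        (Finsupp.single (L.stage input y L.Wo) 1) := by
    rw [QCircuit.finalState, foldl_op_eq_run]
    show run L.gates _ = _
    rw [gates, run_cons]
    congr 1
    rw [Gate.op_single, Gate.onBasis]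
    congr 1
    funext x
    cases x with
    | cell i j => simp [initial, stage]
    | work q =>
      by_cases hq : q = L.one
      · subst hq
        rw [Function.update_self, initial, stage, List.getD_eq_default _ _ (by rw [hs.len]; omega),
          if_neg (by omega), if_neg (by omega)]
        simp
      · have hne : Qubit.work q ≠ .work L.one := fun h => hq (Qubit.work.inj h)
        rw [Function.update_of_ne hne, initial, stage]
        split_ifs with h1 h2
        · rfl
        · rw [List.getD_eq_default _ _ (by rw [hs.len]; omega), decide_eq_false (by omega),
            Bool.false_and]
        · rw [List.getD_eq_default _ _ (by rw [hs.len]; omega), decide_eq_false hq]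
  have hclose := norm_bits_sub_le hL hC hs hr hm le_rfl
  rw [← hfinal, Nat.sub_self] at hclose
  set ψ := L.circuit.finalState input with hψ
  set S : Set BasisState := {b | bitsVal (L.circuit.outs.map fun q => b (.work q)) = y} with hS
  have hnorm : ‖ψ‖ = 1 := by
    rw [hfinal, norm_run, norm_single, norm_one]
    intro G hG
    obtain ⟨t, ht, hG⟩ := List.mem_flatMap.1 hG
    rw [List.mem_range] at ht
    exact distinct_copyOut (fun G hG => (legal_bitU hL (by omega) G hG).2.1) (by omega) G hG
  have hmem : L.stage input y 0 ∈ S := by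
    show bitsVal (((List.range L.Wo).map (L.N0 + ·)).map _) = y
    refine bitsVal_eq_of_testBit (by simpa using hs.lt) fun l hl => ?_
    have hl' : l < L.Wo := by simpa using hl
    simp only [List.getElem_map, List.getElem_range, stage]
    rw [if_neg (by omega), if_pos (by omega), decide_eq_true (by omega), Bool.true_and,
      Nat.add_sub_cancel_left]
  have hzero : mass Sᶜ (Finsupp.single (L.stage input y 0) 1) = 0 := by
    rw [mass, wt_single, if_neg (by simpa using hmem), zero_mul]
  have hsq := sqrt_mass_le Sᶜ ψ (Finsupp.single (L.stage input y 0) 1)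
  rw [hzero, Real.sqrt_zero, zero_add] at hsq
  have hle : √(mass Sᶜ ψ) ≤ 1 / 2 := hsq.trans (hclose.trans herr)
  have hm4 : mass Sᶜ ψ ≤ 1 / 4 := by
    rw [Real.sqrt_le_left (by norm_num)] at hle
    linarith
  rw [mass_compl, hnorm] at hm4
  linarith

theorem circuit_wellFormed (hL : L.Good) : L.circuit.WellFormed := by
  obtain ⟨w1, w2, w3⟩ := p1_add_lt_work (L := L)
  obtain ⟨b1, b2, b3⟩ := fixed_lt (L := L)
  refine ⟨fun q hq => ?_, ?_, fun G hG => ?_⟩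
  · obtain ⟨l, hl, rfl⟩ := List.mem_map.1 hq
    rw [List.mem_range] at hl
    show L.N0 + l < L.work
    omega
  · exact List.nodup_range.map (add_right_injective _)
  · rcases List.mem_cons.1 hG with rfl | hG
    · refine ⟨fun q hq => ?_, by simp [Gate.qubits], trivial⟩
      simp [Gate.qubits] at hq
      show q < L.work
      omega
    · obtain ⟨t, ht, hG⟩ := List.mem_flatMap.1 hG
      rw [List.mem_range] at ht
      have hleg := legal_bitU hL (i := L.Wo - 1 - t) (by omega)
      have key : ∀ G, L.Legal (L.Wo - 1 - t) Set.univ G → (∀ q ∈ G.qubits, q < L.circuit.work) ∧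
          G.qubits.Nodup ∧ G.RegistersFit L.circuit.addrWidth L.circuit.wordSize :=
        fun G h => ⟨fun q hq => (h.1 q hq).1, h.2.1, h.2.2.1⟩
      rcases List.mem_append.1 hG with hG | hG
      · exact key G (hleg G hG)
      rcases List.mem_cons.1 hG with rfl | hG
      · refine ⟨fun q hq => ?_, ?_, trivial⟩
        · simp [Gate.qubits] at hq
          show q < L.work
          omega
        · simp [Gate.qubits]; omega
      · exact key G (legal_invGates hleg G hG)

theorem sqrt_pow_le {x : ℝ} (hx : 0 ≤ x) {k : ℕ} (h : x ^ k ≤ 1 / 2) (K : ℕ) :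
    √(x ^ (2 * k * K)) ≤ (1 / 2) ^ K := by
  have : x ^ (2 * k * K) = ((x ^ k) ^ K) ^ 2 := by
    rw [← pow_mul, ← pow_mul]; congr 1; ring
  rw [this, Real.sqrt_sq (by positivity)]
  exact pow_le_pow_left₀ (by positivity) h K

/-- The numbers of repetitions are large enough. The exponents `2 * 3` and `2 * 6` come from
`(3 / 4) ^ 3 ≤ 1 / 2` and `(8 / 9) ^ 6 ≤ 1 / 2`, together with the square root in the norms. -/
theorem err_le (hrep : L.rep = 2 * 3 * (L.Wo + 3)) {ρ : ℕ}
    (hρ : ρ = 2 * 6 * (L.Wo + L.Rn + L.h + 7)) : L.Wo * L.bitErr ρ ≤ 1 / 2 := by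
  have h1 : √((3 / 4 : ℝ) ^ L.rep) ≤ (1 / 2) ^ (L.Wo + 3) := by
    rw [hrep]; exact sqrt_pow_le (by norm_num) (by norm_num) _
  have h2 : oracleErr ρ ≤ 4 * (1 / 2) ^ (L.Wo + L.Rn + L.h + 7) := by
    have h3 : √((8 / 9 : ℝ) ^ ρ) ≤ (1 / 2) ^ (L.Wo + L.Rn + L.h + 7) := by
      rw [hρ]; exact sqrt_pow_le (by norm_num) (by norm_num) _
    have h4 : √(2 : ℝ) ≤ 2 := by
      rw [Real.sqrt_le_left (by norm_num)]; norm_num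
    rw [oracleErr, Real.sqrt_mul (by norm_num)]
    have := mul_le_mul h4 h3 (Real.sqrt_nonneg _) (by norm_num)
    linarith
  have hp (a : ℕ) : (a : ℝ) * (1 / 2) ^ a ≤ 1 := by
    rw [one_div, inv_pow, ← div_eq_mul_inv, div_le_one (by positivity)]
    exact_mod_cast Nat.lt_two_pow_self.le
  have hh : (2 * 2 ^ L.h + 1 : ℝ) * (1 / 2) ^ L.h ≤ 3 := by
    have e : (2 : ℝ) ^ L.h * (1 / 2) ^ L.h = 1 := by rw [← mul_pow]; norm_num
    have e2 : (1 / 2 : ℝ) ^ L.h ≤ 1 := pow_le_one₀ (by norm_num) (by norm_num)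
    nlinarith
  have hW := hp L.Wo
  have hR := hp L.Rn
  have hW0 : (0 : ℝ) ≤ L.Wo * (1 / 2) ^ L.Wo := by positivity
  have hR0 : (0 : ℝ) ≤ L.Rn * (1 / 2) ^ L.Rn := by positivity
  have hH0 : (0 : ℝ) ≤ (2 * 2 ^ L.h + 1 : ℝ) * (1 / 2) ^ L.h := by positivity
  -- the powers of `1 / 2` absorb the numbers of bits, searches and calls of the oracle
  calc L.Wo * L.bitErr ρ
      ≤ L.Wo * (2 * ((1 / 2) ^ (L.Wo + 3) + L.Rn * ((2 * 2 ^ L.h + 1) *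
          (4 * (1 / 2) ^ (L.Wo + L.Rn + L.h + 7))))) := by
        rw [bitErr]; gcongr
    _ = (L.Wo * (1 / 2) ^ L.Wo) * (1 / 4) + (L.Wo * (1 / 2) ^ L.Wo) * (L.Rn * (1 / 2) ^ L.Rn)
          * ((2 * 2 ^ L.h + 1) * (1 / 2) ^ L.h) * (1 / 16) := by
        simp only [pow_add]; ring
    _ ≤ 1 * (1 / 4) + 1 * 1 * 3 * (1 / 16) := by gcongr
    _ ≤ 1 / 2 := by norm_num

end Lay

/-! ### Uniformity -/

attribute [fun_prop] Primrec

section Basics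

variable {α β γ σ : Type*} [Primcodable α] [Primcodable β] [Primcodable γ] [Primcodable σ]

@[fun_prop] theorem primrec_id : Primrec fun a : α => a := Primrec.id

@[fun_prop] theorem primrec_const (x : σ) : Primrec fun _ : α => x := Primrec.const x

@[fun_prop] theorem primrec_comp {f : β → σ} {g : α → β} (hf : Primrec f) (hg : Primrec g) :
    Primrec fun a => f (g a) := hf.comp hg

@[fun_prop] theorem primrec_mk {f : α → β} {g : α → γ} (hf : Primrec f) (hg : Primrec g) :
    Primrec fun a => (f a, g a) := hf.pair hg

@[fun_prop] theorem primrec_fst {f : α → β × γ} (hf : Primrec f) : Primrec fun a => (f a).1 :=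
  Primrec.fst.comp hf

@[fun_prop] theorem primrec_snd {f : α → β × γ} (hf : Primrec f) : Primrec fun a => (f a).2 :=
  Primrec.snd.comp hf

@[fun_prop] theorem primrec_add {f g : α → ℕ} (hf : Primrec f) (hg : Primrec g) :
    Primrec fun a => f a + g a := Primrec.nat_add.comp hf hg

@[fun_prop] theorem primrec_sub {f g : α → ℕ} (hf : Primrec f) (hg : Primrec g) :
    Primrec fun a => f a - g a := Primrec.nat_sub.comp hf hg

@[fun_prop] theorem primrec_mul {f g : α → ℕ} (hf : Primrec f) (hg : Primrec g) :
    Primrec fun a => f a * g a := Primrec.nat_mul.comp hf hg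

@[fun_prop] theorem primrec_div {f g : α → ℕ} (hf : Primrec f) (hg : Primrec g) :
    Primrec fun a => f a / g a := Primrec.nat_div.comp hf hg

@[fun_prop] theorem primrec_mod {f g : α → ℕ} (hf : Primrec f) (hg : Primrec g) :
    Primrec fun a => f a % g a := Primrec.nat_mod.comp hf hg

@[fun_prop] theorem primrec_max {f g : α → ℕ} (hf : Primrec f) (hg : Primrec g) :
    Primrec fun a => max (f a) (g a) := Primrec.nat_max.comp hf hg

theorem primrec_rec {f : α → ℕ} {g : α → β} {h : α → ℕ × β → β} (hf : Primrec f) (hg : Primrec g)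
    (hh : Primrec fun p : α × (ℕ × β) => h p.1 p.2) :
    Primrec fun a => Nat.rec (motive := fun _ => β) (g a) (fun n x => h a (n, x)) (f a) :=
  Primrec.nat_rec' hf hg hh

@[fun_prop] theorem primrec_two_pow {f : α → ℕ} (hf : Primrec f) : Primrec fun a => 2 ^ f a := by
  have := primrec_rec (h := fun _ p => p.2 * 2) hf (primrec_const (α := α) 1) (by fun_prop)
  refine this.of_eq fun a => ?_
  induction f a with
  | zero => rfl
  | succ n ih => rw [pow_succ, ← ih]

@[fun_prop] theorem primrec_map {f : α → List β} {g : α → β → γ} (hf : Primrec f)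
    (hg : Primrec fun p : α × β => g p.1 p.2) : Primrec fun a => (f a).map (g a) :=
  Primrec.list_map hf hg

@[fun_prop] theorem primrec_flatMap {f : α → List β} {g : α → β → List γ} (hf : Primrec f)
    (hg : Primrec fun p : α × β => g p.1 p.2) : Primrec fun a => (f a).flatMap (g a) :=
  Primrec.list_flatMap hf hg

@[fun_prop] theorem primrec_range {f : α → ℕ} (hf : Primrec f) :
    Primrec fun a => List.range (f a) := Primrec.list_range.comp hf

@[fun_prop] theorem primrec_length {f : α → List β} (hf : Primrec f) :
    Primrec fun a => (f a).length := Primrec.list_length.comp hf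

@[fun_prop] theorem primrec_append {f g : α → List β} (hf : Primrec f) (hg : Primrec g) :
    Primrec fun a => f a ++ g a := Primrec.list_append.comp hf hg

@[fun_prop] theorem primrec_cons {f : α → β} {g : α → List β} (hf : Primrec f) (hg : Primrec g) :
    Primrec fun a => f a :: g a := Primrec.list_cons.comp hf hg

@[fun_prop] theorem primrec_reverse {f : α → List β} (hf : Primrec f) :
    Primrec fun a => (f a).reverse := Primrec.list_reverse.comp hf

@[fun_prop] theorem primrec_getD {f : α → List β} {g : α → ℕ} (hf : Primrec f) (hg : Primrec g)
    (d : β) : Primrec fun a => (f a).getD (g a) d := (Primrec.list_getD d).comp hf hg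

@[fun_prop] theorem primrec_decide_lt {f g : α → ℕ} (hf : Primrec f) (hg : Primrec g) :
    Primrec fun a => decide (f a < g a) := Primrec.nat_lt.decide.comp hf hg

@[fun_prop] theorem primrec_decide_le {f g : α → ℕ} (hf : Primrec f) (hg : Primrec g) :
    Primrec fun a => decide (f a ≤ g a) := Primrec.nat_le.decide.comp hf hg

@[fun_prop] theorem primrec_decide_eq {f g : α → ℕ} (hf : Primrec f) (hg : Primrec g) :
    Primrec fun a => decide (f a = g a) := Primrec.eq.decide.comp hf hg

@[fun_prop] theorem primrec_decide_and {p q : α → Prop} [DecidablePred p] [DecidablePred q]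
    (hp : Primrec fun a => decide (p a)) (hq : Primrec fun a => decide (q a)) :
    Primrec fun a => decide (p a ∧ q a) :=
  (Primrec.and.comp hp hq).of_eq fun a => by rw [Bool.decide_and]

@[fun_prop] theorem primrec_ite {c : α → Prop} [DecidablePred c] {f g : α → β}
    (hc : Primrec fun a => decide (c a)) (hf : Primrec f) (hg : Primrec g) :
    Primrec fun a => if c a then f a else g a :=
  (Primrec.cond hc hf hg).of_eq fun a => by rw [Bool.cond_decide]

end Basics

section Gates

variable {α : Type*} [Primcodable α]

/-- Gates as elements of a sum of types of registers. -/
def gateEquiv : Gate ≃ ℕ ⊕ ℕ ⊕ ℕ ⊕ ℕ ⊕ (ℕ × ℕ) ⊕ (ℕ × ℕ × ℕ) ⊕ (List ℕ × List ℕ) ⊕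
    (List ℕ × List ℕ) where
  toFun
    | .not q => .inl q
    | .had q => .inr (.inl q)
    | .phase q => .inr (.inr (.inl q))
    | .phaseInv q => .inr (.inr (.inr (.inl q)))
    | .cnot c t => .inr (.inr (.inr (.inr (.inl (c, t)))))
    | .toffoli c₁ c₂ t => .inr (.inr (.inr (.inr (.inr (.inl (c₁, c₂, t))))))
    | .qread addr tgt => .inr (.inr (.inr (.inr (.inr (.inr (.inl (addr, tgt)))))))
    | .qswap addr tgt => .inr (.inr (.inr (.inr (.inr (.inr (.inr (addr, tgt)))))))
  invFun
    | .inl q => .not q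
    | .inr (.inl q) => .had q
    | .inr (.inr (.inl q)) => .phase q
    | .inr (.inr (.inr (.inl q))) => .phaseInv q
    | .inr (.inr (.inr (.inr (.inl (c, t))))) => .cnot c t
    | .inr (.inr (.inr (.inr (.inr (.inl (c₁, c₂, t)))))) => .toffoli c₁ c₂ t
    | .inr (.inr (.inr (.inr (.inr (.inr (.inl (addr, tgt))))))) => .qread addr tgt
    | .inr (.inr (.inr (.inr (.inr (.inr (.inr (addr, tgt))))))) => .qswap addr tgt
  left_inv G := by cases G <;> rfl
  right_inv x := by rcases x with x | x | x | x | x | x | x | x <;> rfl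

instance : Primcodable Gate := Primcodable.ofEquiv _ gateEquiv

theorem primrec_sumElim {β γ σ : Type*} [Primcodable β] [Primcodable γ] [Primcodable σ]
    {f : β → σ} {g : γ → σ} (hf : Primrec f) (hg : Primrec g) : Primrec (Sum.elim f g) :=
  (Primrec.sumCasesOn Primrec.id (hf.comp Primrec.snd).to₂ (hg.comp Primrec.snd).to₂).of_eq
    fun x => by cases x <;> rfl

@[fun_prop] theorem primrec_code {f : α → Gate} (hf : Primrec f) :
    Primrec fun a => (f a).code := by
  refine Primrec.comp (f := Gate.code) ?_ hf
  have h7 : Primrec fun p : List ℕ × List ℕ => ((7, p.1, p.2) : ℕ × List ℕ × List ℕ) := by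
    fun_prop
  have h6 := primrec_sumElim (f := fun p : List ℕ × List ℕ => ((6, p.1, p.2) : ℕ × List ℕ × List ℕ))
    (by fun_prop) h7
  have h5 := primrec_sumElim
    (f := fun p : ℕ × ℕ × ℕ => ((5, [p.1, p.2.1, p.2.2], []) : ℕ × List ℕ × List ℕ)) (by fun_prop)
        h6
  have h4 := primrec_sumElim
    (f := fun p : ℕ × ℕ => ((4, [p.1, p.2], []) : ℕ × List ℕ × List ℕ)) (by fun_prop) h5
  have h3 := primrec_sumElim (f := fun q : ℕ => ((3, [q], []) : ℕ × List ℕ × List ℕ))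
    (by fun_prop) h4
  have h2 := primrec_sumElim (f := fun q : ℕ => ((2, [q], []) : ℕ × List ℕ × List ℕ))
    (by fun_prop) h3
  have h1 := primrec_sumElim (f := fun q : ℕ => ((1, [q], []) : ℕ × List ℕ × List ℕ))
    (by fun_prop) h2
  have h0 := primrec_sumElim (f := fun q : ℕ => ((0, [q], []) : ℕ × List ℕ × List ℕ))
    (by fun_prop) h1
  refine (h0.comp (Primrec.of_equiv (e := gateEquiv))).of_eq fun G => ?_
  cases G <;> rfl

section Constructors

variable {f g h : α → ℕ} {l l' : α → List ℕ}

open Primrec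

@[fun_prop] theorem primrec_not (hf : Primrec f) : Primrec fun a => Gate.not (f a) :=
  (of_equiv_symm (e := gateEquiv)).comp (sumInl.comp hf)

@[fun_prop] theorem primrec_had (hf : Primrec f) : Primrec fun a => Gate.had (f a) :=
  (of_equiv_symm (e := gateEquiv)).comp (sumInr.comp (sumInl.comp hf))

@[fun_prop] theorem primrec_phase (hf : Primrec f) : Primrec fun a => Gate.phase (f a) :=
  (of_equiv_symm (e := gateEquiv)).comp (sumInr.comp (sumInr.comp (sumInl.comp hf)))

@[fun_prop] theorem primrec_phaseInv (hf : Primrec f) : Primrec fun a => Gate.phaseInv (f a) :=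
  (of_equiv_symm (e := gateEquiv)).comp
    (sumInr.comp (sumInr.comp (sumInr.comp (sumInl.comp hf))))

@[fun_prop] theorem primrec_cnot (hf : Primrec f) (hg : Primrec g) :
    Primrec fun a => Gate.cnot (f a) (g a) :=
  (of_equiv_symm (e := gateEquiv)).comp
    (sumInr.comp (sumInr.comp (sumInr.comp (sumInr.comp (sumInl.comp (hf.pair hg))))))

@[fun_prop] theorem primrec_toffoli (hf : Primrec f) (hg : Primrec g) (hh : Primrec h) :
    Primrec fun a => Gate.toffoli (f a) (g a) (h a) :=
  (of_equiv_symm (e := gateEquiv)).comp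
    (sumInr.comp (sumInr.comp (sumInr.comp (sumInr.comp (sumInr.comp (sumInl.comp
      (hf.pair (hg.pair hh))))))))

@[fun_prop] theorem primrec_qread (hl : Primrec l) (hl' : Primrec l') :
    Primrec fun a => Gate.qread (l a) (l' a) :=
  (of_equiv_symm (e := gateEquiv)).comp
    (sumInr.comp (sumInr.comp (sumInr.comp (sumInr.comp (sumInr.comp (sumInr.comp (sumInl.comp
      (hl.pair hl'))))))))

@[fun_prop] theorem primrec_qswap (hl : Primrec l) (hl' : Primrec l') :
    Primrec fun a => Gate.qswap (l a) (l' a) :=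
  (of_equiv_symm (e := gateEquiv)).comp
    (sumInr.comp (sumInr.comp (sumInr.comp (sumInr.comp (sumInr.comp (sumInr.comp (sumInr.comp
      (hl.pair hl'))))))))

end Constructors

/-- The operation with a given description. -/
def gateOf (c : ℕ × List ℕ × List ℕ) : Gate :=
  if c.1 = 0 then .not (c.2.1.getD 0 0)
  else if c.1 = 1 then .had (c.2.1.getD 0 0)
  else if c.1 = 2 then .phase (c.2.1.getD 0 0)
  else if c.1 = 3 then .phaseInv (c.2.1.getD 0 0)
  else if c.1 = 4 then .cnot (c.2.1.getD 0 0) (c.2.1.getD 1 0)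
  else if c.1 = 5 then .toffoli (c.2.1.getD 0 0) (c.2.1.getD 1 0) (c.2.1.getD 2 0)
  else if c.1 = 6 then .qread c.2.1 c.2.2
  else .qswap c.2.1 c.2.2

theorem gateOf_code (G : Gate) : gateOf G.code = G := by cases G <;> simp [gateOf, Gate.code]

@[fun_prop] theorem primrec_gateOf {f : α → ℕ × List ℕ × List ℕ} (hf : Primrec f) :
    Primrec fun a => gateOf (f a) := by unfold gateOf; fun_prop

@[fun_prop] theorem primrec_inv {f : α → Gate} (hf : Primrec f) : Primrec fun a => (f a).inv := by
  have : Primrec fun a => gateOf (if (f a).code.1 = 2 then 3 else if (f a).code.1 = 3 then 2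
    else (f a).code.1, (f a).code.2.1, (f a).code.2.2) := by fun_prop
  refine this.of_eq fun a => ?_
  cases f a <;> simp [gateOf, Gate.code, Gate.inv]

@[fun_prop] theorem primrec_padAddr {base wm s A : α → ℕ} {l : α → List ℕ} (hb : Primrec base)
    (hwm : Primrec wm) (hs : Primrec s) (hA : Primrec A) (hl : Primrec l) :
    Primrec fun a => padAddr (base a) (wm a) (s a) (A a) (l a) := by unfold padAddr; fun_prop

@[fun_prop] theorem primrec_padTgt {base wm s A w : α → ℕ} {l : α → List ℕ} (hb : Primrec base)
    (hwm : Primrec wm) (hs : Primrec s) (hA : Primrec A) (hw : Primrec w) (hl : Primrec l) :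
    Primrec fun a => padTgt (base a) (wm a) (s a) (A a) (w a) (l a) := by unfold padTgt; fun_prop

@[fun_prop] theorem primrec_placeGates {base wm s A w : α → ℕ} {l : α → List Gate}
    (hb : Primrec base) (hwm : Primrec wm) (hs : Primrec s) (hA : Primrec A) (hw : Primrec w)
    (hl : Primrec l) :
    Primrec fun a => placeGates (base a) (wm a) (s a) (A a) (w a) (l a) := by
  unfold placeGates
  refine primrec_flatMap hl ?_
  have : Primrec fun p : α × Gate =>
      if p.2.code.1 = 6 then (if p.2.code.2.2.length = 0 then [] else
        [Gate.qread (padAddr (base p.1) (wm p.1) (s p.1) (A p.1) p.2.code.2.1)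
          (padTgt (base p.1) (wm p.1) (s p.1) (A p.1) (w p.1) p.2.code.2.2)])
      else if p.2.code.1 = 7 then (if p.2.code.2.2.length = 0 then [] else
        [Gate.qswap (padAddr (base p.1) (wm p.1) (s p.1) (A p.1) p.2.code.2.1)
          (padTgt (base p.1) (wm p.1) (s p.1) (A p.1) (w p.1) p.2.code.2.2)])
      else [gateOf (p.2.code.1, p.2.code.2.1.map (base p.1 + ·), p.2.code.2.2)] := by fun_prop
  refine this.of_eq fun p => ?_
  cases p.2 <;> simp [gateOf, Gate.code, placeGate]

@[fun_prop] theorem primrec_invGates {f : α → List Gate} (hf : Primrec f) :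
    Primrec fun a => invGates (f a) := by unfold invGates; fun_prop

@[fun_prop] theorem primrec_copyOut {f : α → List Gate} {g h : α → ℕ} (hf : Primrec f)
    (hg : Primrec g) (hh : Primrec h) : Primrec fun a => copyOut (f a) (g a) (h a) := by
  unfold copyOut; fun_prop

@[fun_prop] theorem primrec_phaseKick {f : α → List Gate} {g : α → ℕ} (hf : Primrec f)
    (hg : Primrec g) : Primrec fun a => phaseKick (f a) (g a) := by
  unfold phaseKick zGates; fun_prop

@[fun_prop] theorem primrec_repGates {f : α → List Gate} {g : α → ℕ} (hf : Primrec f)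
    (hg : Primrec g) : Primrec fun a => repGates (g a) (f a) := by unfold repGates; fun_prop

@[fun_prop] theorem primrec_hadGates {f g : α → ℕ} (hf : Primrec f)
    (hg : Primrec g) : Primrec fun a => hadGates (f a) (g a) := by unfold hadGates; fun_prop

@[fun_prop] theorem primrec_iterCount {f : α → ℕ} (hf : Primrec f) :
    Primrec fun a => iterCount (f a) := by unfold iterCount; fun_prop

/-- The gates of a program without recursion on the list of expressions. -/
theorem progGates_eq (p : ℕ) (es : List Expr) : progGates p es
    = (List.range es.length).flatMap fun i => assignGates (p + i) (es.getD i []) := by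
  induction es generalizing p with
  | nil => rfl
  | cons e es ih =>
    rw [progGates, ih, List.length_cons, List.range_succ_eq_map, List.flatMap_cons,
      List.flatMap_map]
    congr 1
    refine List.flatMap_congr fun i _ => ?_
    rw [List.getD_cons_succ, show p + 1 + i = p + Nat.succ i by omega]

@[fun_prop] theorem primrec_progGates {f : α → ℕ} {g : α → List Expr} (hf : Primrec f)
    (hg : Primrec g) : Primrec fun a => progGates (f a) (g a) := by
  simp only [progGates_eq, assignGates]; fun_prop

@[fun_prop] theorem primrec_relocE {f g : α → ℕ} {e : α → Expr} (hf : Primrec f)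
    (hg : Primrec g) (he : Primrec e) : Primrec fun a => relocE (f a) (g a) (e a) := by
  unfold relocE relocVar; fun_prop

@[fun_prop] theorem primrec_allZero {one start step N p : α → ℕ} (h₁ : Primrec one)
    (h₂ : Primrec start) (h₃ : Primrec step) (h₄ : Primrec N) (h₅ : Primrec p) :
    Primrec fun a => allZero (one a) (start a) (step a) (N a) (p a) := by
  unfold allZero; fun_prop

@[fun_prop] theorem primrec_countProg {one start step N p : α → ℕ} (h₁ : Primrec one)
    (h₂ : Primrec start) (h₃ : Primrec step) (h₄ : Primrec N) (h₅ : Primrec p) :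
    Primrec fun a => countProg (one a) (start a) (step a) (N a) (p a) := by
  unfold countProg countRow; fun_prop

end Gates

section Layouts

variable {α : Type*} [Primcodable α]

/-- A layout is a tuple of numbers, lists of expressions, and circuits. -/
def layEquiv : Lay ≃ (ℕ × ℕ × ℕ × ℕ × ℕ × ℕ) × (ℕ × ℕ × ℕ × ℕ × ℕ) ×
    (List Expr × List Expr × List Expr × List Expr) ×
    (List (ℕ × ℕ) × List ℕ × List Gate × List Gate × List ℕ × List ℕ) where
  toFun L := ((L.n, L.k, L.N0, L.wv, L.r, L.s), (L.wm, L.A, L.w, L.rep, L.h),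
    (L.sub1, L.sub2, L.sel, L.head), (L.ga, L.go, L.g1, L.g2, L.o1, L.o2))
  invFun p := ⟨p.1.1, p.1.2.1, p.1.2.2.1, p.1.2.2.2.1, p.1.2.2.2.2.1, p.1.2.2.2.2.2,
    p.2.1.1, p.2.1.2.1, p.2.1.2.2.1, p.2.1.2.2.2.1, p.2.1.2.2.2.2,
    p.2.2.1.1, p.2.2.1.2.1, p.2.2.1.2.2.1, p.2.2.1.2.2.2,
    p.2.2.2.1, p.2.2.2.2.1, p.2.2.2.2.2.1, p.2.2.2.2.2.2.1, p.2.2.2.2.2.2.2.1,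
    p.2.2.2.2.2.2.2.2⟩
  left_inv _ := rfl
  right_inv _ := rfl

instance : Primcodable Lay := Primcodable.ofEquiv _ layEquiv

theorem primrec_layEquiv {l : α → Lay} (hl : Primrec l) : Primrec fun a => layEquiv (l a) :=
  Primrec.of_equiv.comp hl

theorem primrec_layEquiv_symm {f : α → _} (hf : Primrec f) :
    Primrec fun a => layEquiv.symm (f a) := Primrec.of_equiv_symm.comp hf

namespace Lay

variable {l : α → Lay}

@[fun_prop] theorem primrec_n (hl : Primrec l) : Primrec fun a => (l a).n :=
  primrec_fst (primrec_fst (primrec_layEquiv hl))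

@[fun_prop] theorem primrec_k (hl : Primrec l) : Primrec fun a => (l a).k :=
  primrec_fst (primrec_snd (primrec_fst (primrec_layEquiv hl)))

@[fun_prop] theorem primrec_N0 (hl : Primrec l) : Primrec fun a => (l a).N0 :=
  primrec_fst (primrec_snd (primrec_snd (primrec_fst (primrec_layEquiv hl))))

@[fun_prop] theorem primrec_wv (hl : Primrec l) : Primrec fun a => (l a).wv :=
  primrec_fst (primrec_snd (primrec_snd (primrec_snd (primrec_fst (primrec_layEquiv hl)))))

@[fun_prop] theorem primrec_r (hl : Primrec l) : Primrec fun a => (l a).r :=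
  primrec_fst (primrec_snd
      (primrec_snd (primrec_snd (primrec_snd (primrec_fst (primrec_layEquiv hl))))))

@[fun_prop] theorem primrec_s (hl : Primrec l) : Primrec fun a => (l a).s :=
  primrec_snd (primrec_snd
      (primrec_snd (primrec_snd (primrec_snd (primrec_fst (primrec_layEquiv hl))))))

@[fun_prop] theorem primrec_wm (hl : Primrec l) : Primrec fun a => (l a).wm :=
  primrec_fst (primrec_fst (primrec_snd (primrec_layEquiv hl)))

@[fun_prop] theorem primrec_A (hl : Primrec l) : Primrec fun a => (l a).A :=
  primrec_fst (primrec_snd (primrec_fst (primrec_snd (primrec_layEquiv hl))))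

@[fun_prop] theorem primrec_w (hl : Primrec l) : Primrec fun a => (l a).w :=
  primrec_fst (primrec_snd (primrec_snd (primrec_fst (primrec_snd (primrec_layEquiv hl)))))

@[fun_prop] theorem primrec_rep (hl : Primrec l) : Primrec fun a => (l a).rep :=
  primrec_fst (primrec_snd
      (primrec_snd (primrec_snd (primrec_fst (primrec_snd (primrec_layEquiv hl))))))

@[fun_prop] theorem primrec_h (hl : Primrec l) : Primrec fun a => (l a).h :=
  primrec_snd (primrec_snd
      (primrec_snd (primrec_snd (primrec_fst (primrec_snd (primrec_layEquiv hl))))))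

@[fun_prop] theorem primrec_sub1 (hl : Primrec l) : Primrec fun a => (l a).sub1 :=
  primrec_fst (primrec_fst (primrec_snd (primrec_snd (primrec_layEquiv hl))))

@[fun_prop] theorem primrec_sub2 (hl : Primrec l) : Primrec fun a => (l a).sub2 :=
  primrec_fst (primrec_snd (primrec_fst (primrec_snd (primrec_snd (primrec_layEquiv hl)))))

@[fun_prop] theorem primrec_sel (hl : Primrec l) : Primrec fun a => (l a).sel :=
  primrec_fst (primrec_snd
      (primrec_snd (primrec_fst (primrec_snd (primrec_snd (primrec_layEquiv hl))))))

@[fun_prop] theorem primrec_head (hl : Primrec l) : Primrec fun a => (l a).head :=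
  primrec_snd (primrec_snd
      (primrec_snd (primrec_fst (primrec_snd (primrec_snd (primrec_layEquiv hl))))))

@[fun_prop] theorem primrec_ga (hl : Primrec l) : Primrec fun a => (l a).ga :=
  primrec_fst (primrec_snd (primrec_snd (primrec_snd (primrec_layEquiv hl))))

@[fun_prop] theorem primrec_go (hl : Primrec l) : Primrec fun a => (l a).go :=
  primrec_fst (primrec_snd (primrec_snd (primrec_snd (primrec_snd (primrec_layEquiv hl)))))

@[fun_prop] theorem primrec_g1 (hl : Primrec l) : Primrec fun a => (l a).g1 :=
  primrec_fst (primrec_snd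
      (primrec_snd (primrec_snd (primrec_snd (primrec_snd (primrec_layEquiv hl))))))

@[fun_prop] theorem primrec_g2 (hl : Primrec l) : Primrec fun a => (l a).g2 :=
  primrec_fst (primrec_snd
      (primrec_snd (primrec_snd (primrec_snd (primrec_snd (primrec_snd (primrec_layEquiv hl)))))))

@[fun_prop] theorem primrec_o1 (hl : Primrec l) : Primrec fun a => (l a).o1 :=
  primrec_fst (primrec_snd
      (primrec_snd (primrec_snd
          (primrec_snd (primrec_snd (primrec_snd (primrec_snd (primrec_layEquiv hl))))))))

@[fun_prop] theorem primrec_o2 (hl : Primrec l) : Primrec fun a => (l a).o2 :=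
  primrec_snd (primrec_snd
      (primrec_snd (primrec_snd
          (primrec_snd (primrec_snd (primrec_snd (primrec_snd (primrec_layEquiv hl))))))))

@[fun_prop] theorem primrec_Wo (hl : Primrec l) : Primrec fun a => (l a).Wo := by
  unfold Lay.Wo; fun_prop

@[fun_prop] theorem primrec_one (hl : Primrec l) : Primrec fun a => (l a).one := by
  unfold Lay.one; fun_prop

@[fun_prop] theorem primrec_p0 (hl : Primrec l) : Primrec fun a => (l a).p0 := by
  unfold Lay.p0; fun_prop

@[fun_prop] theorem primrec_Rn (hl : Primrec l) : Primrec fun a => (l a).Rn := by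
  unfold Lay.Rn; fun_prop

@[fun_prop] theorem primrec_reg {c : α → ℕ} (hl : Primrec l) (hc : Primrec c) :
    Primrec fun a => (l a).reg (c a) := by
  unfold Lay.reg; fun_prop

@[fun_prop] theorem primrec_p1 (hl : Primrec l) : Primrec fun a => (l a).p1 := by
  unfold Lay.p1; fun_prop

@[fun_prop] theorem primrec_stride (hl : Primrec l) : Primrec fun a => (l a).stride := by
  unfold Lay.stride; fun_prop

@[fun_prop] theorem primrec_base {c : α → ℕ} (hl : Primrec l) (hc : Primrec c) :
    Primrec fun a => (l a).base (c a) := by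
  unfold Lay.base; fun_prop

@[fun_prop] theorem primrec_p2 (hl : Primrec l) : Primrec fun a => (l a).p2 := by
  unfold Lay.p2; fun_prop

@[fun_prop] theorem primrec_subOf {c : α → ℕ} (hl : Primrec l) (hc : Primrec c) :
    Primrec fun a => (l a).subOf (c a) := by
  unfold Lay.subOf; fun_prop

@[fun_prop] theorem primrec_gatesOf {c : α → ℕ} (hl : Primrec l) (hc : Primrec c) :
    Primrec fun a => (l a).gatesOf (c a) := by
  unfold Lay.gatesOf; fun_prop

@[fun_prop] theorem primrec_outsOf {c : α → ℕ} (hl : Primrec l) (hc : Primrec c) :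
    Primrec fun a => (l a).outsOf (c a) := by
  unfold Lay.outsOf; fun_prop

@[fun_prop] theorem primrec_numExprs {c : α → ℕ} (hl : Primrec l) (hc : Primrec c) :
    Primrec fun a => (l a).numExprs (c a) := by
  unfold Lay.numExprs; fun_prop

@[fun_prop] theorem primrec_preCopy {d c : α → ℕ} (hl : Primrec l) (hd : Primrec d)
    (hc : Primrec c) :
    Primrec fun a => (l a).preCopy (d a) (c a) := by
  unfold Lay.preCopy blanks; fun_prop

@[fun_prop] theorem primrec_pre {d : α → ℕ} (hl : Primrec l) (hd : Primrec d) :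
    Primrec fun a => (l a).pre (d a) := by
  unfold Lay.pre; fun_prop

@[fun_prop] theorem primrec_copies (hl : Primrec l) : Primrec fun a => (l a).copies := by
  unfold Lay.copies; fun_prop

@[fun_prop] theorem primrec_outRow {c : α → ℕ} (hl : Primrec l) (hc : Primrec c) :
    Primrec fun a => (l a).outRow (c a) := by
  unfold Lay.outRow; fun_prop

@[fun_prop] theorem primrec_p3 (hl : Primrec l) : Primrec fun a => (l a).p3 := by
  unfold Lay.p3; fun_prop

@[fun_prop] theorem primrec_voteStart {u : α → ℕ} (hl : Primrec l) (hu : Primrec u) :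
    Primrec fun a => (l a).voteStart (u a) := by
  unfold Lay.voteStart; fun_prop

@[fun_prop] theorem primrec_tableSize (hl : Primrec l) : Primrec fun a => (l a).tableSize := by
  unfold Lay.tableSize; fun_prop

@[fun_prop] theorem primrec_p4 (hl : Primrec l) : Primrec fun a => (l a).p4 := by
  unfold Lay.p4; fun_prop

@[fun_prop] theorem primrec_p5 (hl : Primrec l) : Primrec fun a => (l a).p5 := by
  unfold Lay.p5; fun_prop

@[fun_prop] theorem primrec_p6 (hl : Primrec l) : Primrec fun a => (l a).p6 := by
  unfold Lay.p6; fun_prop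

@[fun_prop] theorem primrec_voteExpr {u : α → ℕ} (hl : Primrec l) (hu : Primrec u) :
    Primrec fun a => (l a).voteExpr (u a) := by
  unfold Lay.voteExpr; fun_prop

@[fun_prop] theorem primrec_nin (hl : Primrec l) : Primrec fun a => (l a).nin := by
  unfold Lay.nin; fun_prop

@[fun_prop] theorem primrec_gateExpr {t : α → ℕ} (hl : Primrec l) (ht : Primrec t) :
    Primrec fun a => (l a).gateExpr (t a) := by
  unfold Lay.gateExpr; fun_prop

@[fun_prop] theorem primrec_ntot (hl : Primrec l) : Primrec fun a => (l a).ntot := by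
  unfold Lay.ntot; fun_prop

@[fun_prop] theorem primrec_p7 (hl : Primrec l) : Primrec fun a => (l a).p7 := by
  unfold Lay.p7; fun_prop

@[fun_prop] theorem primrec_goExpr {t : α → ℕ} (hl : Primrec l) (ht : Primrec t) :
    Primrec fun a => (l a).goExpr (t a) := by
  unfold Lay.goExpr; fun_prop

@[fun_prop] theorem primrec_p8 (hl : Primrec l) : Primrec fun a => (l a).p8 := by
  unfold Lay.p8; fun_prop

@[fun_prop] theorem primrec_chainExpr {i t : α → ℕ} (hl : Primrec l) (hi : Primrec i)
    (ht : Primrec t) :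
    Primrec fun a => (l a).chainExpr (i a) (t a) := by
  unfold Lay.chainExpr; fun_prop

@[fun_prop] theorem primrec_post {d i : α → ℕ} (hl : Primrec l) (hd : Primrec d) (hi : Primrec i) :
    Primrec fun a => (l a).post (d a) (i a) := by
  unfold Lay.post; fun_prop

@[fun_prop] theorem primrec_oracleU {d i : α → ℕ} (hl : Primrec l) (hd : Primrec d)
    (hi : Primrec i) :
    Primrec fun a => (l a).oracleU (d a) (i a) := by
  unfold Lay.oracleU; fun_prop

@[fun_prop] theorem primrec_oracle {d i t : α → ℕ} (hl : Primrec l) (hd : Primrec d)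
    (hi : Primrec i) (ht : Primrec t) :
    Primrec fun a => (l a).oracle (d a) (i a) (t a) := by
  unfold Lay.oracle; fun_prop

@[fun_prop] theorem primrec_diffusion {d : α → ℕ} (hl : Primrec l) (hd : Primrec d) :
    Primrec fun a => (l a).diffusion (d a) := by
  unfold Lay.diffusion; fun_prop

@[fun_prop] theorem primrec_search {i c : α → ℕ} (hl : Primrec l) (hi : Primrec i)
    (hc : Primrec c) :
    Primrec fun a => (l a).search (i a) (c a) := by
  unfold Lay.search; fun_prop

@[fun_prop] theorem primrec_searches {i : α → ℕ} (hl : Primrec l) (hi : Primrec i) :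
    Primrec fun a => (l a).searches (i a) := by
  unfold Lay.searches; fun_prop

@[fun_prop] theorem primrec_bitU {i : α → ℕ} (hl : Primrec l) (hi : Primrec i) :
    Primrec fun a => (l a).bitU (i a) := by
  unfold Lay.bitU; fun_prop

@[fun_prop] theorem primrec_bit {i : α → ℕ} (hl : Primrec l) (hi : Primrec i) :
    Primrec fun a => (l a).bit (i a) := by
  unfold Lay.bit; fun_prop

@[fun_prop] theorem primrec_gates (hl : Primrec l) : Primrec fun a => (l a).gates := by
  unfold Lay.gates; fun_prop

@[fun_prop] theorem primrec_work (hl : Primrec l) : Primrec fun a => (l a).work := by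
  unfold Lay.work; fun_prop

/-- The circuit is a primitive recursive function of its parameters. -/
theorem primrec_circuit (hl : Primrec l) : Primrec fun a => (l a).circuit.code := by
  unfold Lay.circuit QCircuit.code; fun_prop

end Lay

end Layouts

/-! ### The size of the circuit -/

theorem length_flatMap_range_le {β : Type*} {N B : ℕ} {f : ℕ → List β}
    (h : ∀ i < N, (f i).length ≤ B) : ((List.range N).flatMap f).length ≤ N * B := by
  induction N with
  | zero => simp
  | succ N ih =>
    have h1 := ih fun i hi => h i (by omega)
    have h2 := h N (by omega)
    rw [List.range_succ, List.flatMap_append, List.length_append, Nat.succ_mul]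
    simpa using Nat.add_le_add h1 h2

theorem progCost_flatMap_range_le {N B : ℕ} {f : ℕ → List Expr}
    (h : ∀ i < N, progCost (f i) ≤ B) : progCost ((List.range N).flatMap f) ≤ N * B := by
  induction N with
  | zero => simp [progCost]
  | succ N ih =>
    have h1 := ih fun i hi => h i (by omega)
    have h2 := h N (by omega)
    rw [List.range_succ, List.flatMap_append, progCost_append, Nat.succ_mul]
    simpa using Nat.add_le_add h1 h2

theorem progCost_map_range_le {N B : ℕ} {f : ℕ → Expr} (h : ∀ i < N, (f i).length ≤ B) :
    progCost ((List.range N).map f) ≤ N * B := by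
  refine (progCost_le (B := B) fun e he => ?_).trans (by simp)
  obtain ⟨i, hi, rfl⟩ := List.mem_map.1 he
  exact h i (List.mem_range.1 hi)

theorem progCost_blanks (N : ℕ) : progCost (Lay.blanks N) = 0 := by
  exact Nat.le_zero.1 (progCost_map_range_le (N := N) (B := 0) (f := fun _ => []) (by simp))

theorem progCost_allZero_le (one start step N p : ℕ) :
    progCost (allZero one start step N p) ≤ 1 + N * 2 := by
  have := progCost_map_range_le (N := N) (B := 2)
    (f := fun t => [(p + t, p + t), (p + t, start + t * step)]) (by simp)
  change 1 + progCost _ ≤ _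
  omega

theorem progCost_countProg_le (one start step N p : ℕ) :
    progCost (countProg one start step N p) ≤ (N + 1) * ((N + 1) * 3) := by
  refine progCost_flatMap_range_le fun i _ => progCost_map_range_le fun j _ => ?_
  split_ifs <;> simp

theorem progCost_relocE_le {N0 d B : ℕ} {es : List Expr} (h : ∀ e ∈ es, e.length ≤ B) :
    progCost (es.map (relocE N0 d)) ≤ es.length * B := by
  refine (progCost_le (B := B) fun e he => ?_).trans (by simp)
  obtain ⟨e', he', rfl⟩ := List.mem_map.1 he
  simpa [relocE] using h e' he'

theorem length_invGates (gs : List Gate) : (invGates gs).length = gs.length := by simp [invGates]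

theorem length_copyOut (gs : List Gate) (f q : ℕ) :
    (copyOut gs f q).length = 2 * gs.length + 1 := by
  simp [copyOut, length_invGates]; omega

theorem length_phaseKick (gs : List Gate) (f : ℕ) :
    (phaseKick gs f).length = 2 * gs.length + 4 := by
  simp [phaseKick, zGates, length_invGates]; omega

theorem length_repGates (j : ℕ) (gs : List Gate) : (repGates j gs).length = j * gs.length := by
  simp [repGates]

theorem length_hadGates (d n : ℕ) : (hadGates d n).length = n := by simp [hadGates]

theorem length_placeGates_le (base wm s A w : ℕ) (gs : List Gate) :
    (placeGates base wm s A w gs).length ≤ gs.length := by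
  induction gs with
  | nil => simp [placeGates]
  | cons G gs ih =>
    have : (placeGate base wm s A w G).length ≤ 1 := by
      cases G <;> simp only [placeGate] <;> (try split_ifs) <;> simp
    simp only [placeGates, List.flatMap_cons, List.length_append, List.length_cons] at *
    omega

namespace Lay

/-- All parameters of the layout that do not depend on the space used by the subroutines are
bounded by `P`. -/
structure Small (L : Lay) (P : ℕ) : Prop where
  n : L.n + 1 ≤ P
  N0 : L.N0 ≤ P
  wv : L.wv ≤ P
  r : L.r + 1 ≤ P
  s : L.s ≤ P
  w : L.w ≤ P
  rep : L.rep ≤ P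
  h : L.h + 2 ≤ P
  head : L.head.length ≤ P
  ga : L.ga.length ≤ P
  go : L.Wo ≤ P
  expr : ∀ e, e ∈ L.sub1 ∨ e ∈ L.sub2 ∨ e ∈ L.sel ∨ e ∈ L.head → e.length ≤ P

variable {L : Lay} {P G : ℕ} {d i c : ℕ}

/-- The zero qubits of the copies cost no gates, so that the time does not depend on the space
that is used by the subroutines. -/
theorem progCost_pre_le (hL : L.Good) (hP : L.Small P) : progCost (L.pre d) ≤ 4 * P ^ 3 := by
  have h1 := hP.r
  have key : progCost (L.pre d) ≤ 2 * L.r * (P * P + P * 1) := by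
    refine progCost_flatMap_range_le fun c _ => ?_
    rw [preCopy, progCost_append, progCost_append, progCost_append, progCost_blanks,
      progCost_blanks, zero_add, add_zero]
    refine Nat.add_le_add ((progCost_relocE_le (B := P) fun e he => hP.expr e ?_).trans ?_)
      ((progCost_map_range_le (B := 1) fun l _ => ?_).trans (Nat.mul_le_mul_right _ hP.s))
    · have := mem_subOf he; tauto
    · rw [length_subOf hL]; exact Nat.mul_le_mul_right _ hP.N0
    · split_ifs <;> simp
  have h2 : 2 * L.r * (P * P + P * 1) ≤ 2 * P * (P * P + P * P) := by gcongr <;> omega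
  calc _ ≤ _ := key.trans h2
    _ = 4 * P ^ 3 := by ring

theorem length_copies_le (h1 : L.g1.length ≤ G) (h2 : L.g2.length ≤ G) :
    L.copies.length ≤ 2 * L.r * G := by
  refine length_flatMap_range_le fun c _ => (length_placeGates_le _ _ _ _ _ _).trans ?_
  rw [gatesOf]; split_ifs <;> assumption

theorem progCost_post_le (hL : L.Good) (hP : L.Small P) :
    progCost (L.post d i) ≤ 32 * P ^ 3 := by
  have hn := hP.n
  have hr := hP.r
  have hv := hP.wv
  have a1 : progCost ((List.range (2 * L.r)).flatMap L.outRow) ≤ 2 * L.r * (L.wv * 1) := by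
    refine progCost_flatMap_range_le fun c _ => progCost_map_range_le fun l _ => ?_
    split_ifs <;> simp
  have a2 : progCost ((List.range (2 * L.wv)).flatMap (fun u =>
      countProg L.one (L.voteStart u) L.wv L.r (L.p3 + u * L.tableSize)))
      ≤ 2 * L.wv * ((L.r + 1) * ((L.r + 1) * 3)) :=
    progCost_flatMap_range_le fun u _ => progCost_countProg_le _ _ _ _ _
  have a3 : progCost (L.sel.map (relocE L.N0 d)) ≤ L.n * P := by
    rw [← hL.lenSel]
    exact progCost_relocE_le fun e he => hP.expr e (by tauto)
  have a4 := progCost_countProg_le L.one L.p4 1 L.n L.p5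
  have a5 : progCost (L.head.map (relocE L.N0 d)) ≤ L.head.length * P :=
    progCost_relocE_le fun e he => hP.expr e (by tauto)
  have a6 : progCost ((List.range (2 * L.wv)).map L.voteExpr) ≤ 2 * L.wv * ((L.r + 1) * 1) :=
    progCost_map_range_le fun u _ => length_flatMap_range_le fun j _ => by split_ifs <;> simp
  have a7 : progCost ((List.range L.ga.length).map L.gateExpr) ≤ L.ga.length * 2 :=
    progCost_map_range_le fun t _ => by rw [gateExpr]; split_ifs <;> simp
  have a8 : progCost ((List.range L.Wo).map L.goExpr) ≤ L.Wo * 1 :=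
    progCost_map_range_le fun t _ => by rw [goExpr]; split_ifs <;> simp
  have a9 : progCost ((List.range L.Wo).map (L.chainExpr i)) ≤ L.Wo * 3 :=
    progCost_map_range_le fun t _ => by rw [chainExpr]; split_ifs <;> simp
  have b1 : 2 * L.r * (L.wv * 1) ≤ 2 * P * (P * 1) := by gcongr; omega
  have b2 : 2 * L.wv * ((L.r + 1) * ((L.r + 1) * 3)) ≤ 2 * P * (P * (P * 3)) := by gcongr
  have b3 : L.n * P ≤ P * P := by gcongr; omega
  have b4 : (L.n + 1) * ((L.n + 1) * 3) ≤ P * (P * 3) := by gcongr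
  have b5 : L.head.length * P ≤ P * P := by gcongr; exact hP.head
  have b6 : 2 * L.wv * ((L.r + 1) * 1) ≤ 2 * P * (P * 1) := by gcongr
  have b7 := hP.ga
  have b8 := hP.go
  have c1 : P ≤ P ^ 3 := Nat.le_self_pow (by norm_num) P
  have c2 : P ^ 2 ≤ P ^ 3 := Nat.pow_le_pow_right (by omega) (by norm_num)
  rw [post]
  simp only [progCost_append]
  have a10 : progCost ([(L.p5 + L.n * (L.n + 1) + L.k, L.p5 + L.n * (L.n + 1) + L.k)] ::
      (List.range L.Wo).map (L.chainExpr i))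
      = 1 + progCost ((List.range L.Wo).map (L.chainExpr i)) :=
    rfl
  rw [a10]
  linarith

theorem length_oracleU_le (hL : L.Good) (hP : L.Small P) (h1 : L.g1.length ≤ G)
    (h2 : L.g2.length ≤ G) : (L.oracleU d i).length ≤ 36 * (P ^ 3 * (G + 1)) := by
  have a1 := progCost_pre_le hL hP (d := d)
  have a2 := length_copies_le h1 h2
  have a3 := progCost_post_le hL hP (d := d) (i := i)
  have hr := hP.r
  have a4 : 2 * L.r * G ≤ 2 * P ^ 3 * G := by
    gcongr
    exact (show L.r ≤ P by omega).trans (Nat.le_self_pow (by norm_num) P)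
  rw [oracleU, List.length_append, List.length_append, length_progGates, length_progGates]
  ring_nf at *
  omega

/-- A search calls the oracle `2 * 2 ^ h + 1` times at most. -/
theorem length_search_le (hL : L.Good) (hP : L.Small P) (h1 : L.g1.length ≤ G)
    (h2 : L.g2.length ≤ G) :
    (L.search i c).length ≤ 300 * (2 ^ L.h * (P ^ 3 * (G + 1))) := by
  set Q := P ^ 3 * (G + 1) with hQ
  have hn := hP.n
  have hPQ : P ≤ Q := (Nat.le_self_pow (by norm_num) P).trans (Nat.le_mul_of_pos_right _ (by omega))
  have a1 := length_oracleU_le hL hP h1 h2 (d := L.reg c) (i := i)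
  rw [← hQ] at a1
  have a2 := progCost_allZero_le L.one (L.reg c) 1 L.n L.p1
  have a3 : (L.diffusion (L.reg c)).length ≤ 6 * L.n + 6 := by
    rw [diffusion]
    simp only [List.length_append, length_invGates, length_hadGates, length_phaseKick,
      length_progGates]
    omega
  have a4 : iterCount (c % (L.h + 2)) ≤ 2 ^ L.h := by
    have := Nat.mod_lt c (show 0 < L.h + 2 by omega)
    rw [iterCount]
    split_ifs
    · exact Nat.zero_le _
    · exact Nat.pow_le_pow_right (by norm_num) (by omega)
  have a5 : Q ≤ 2 ^ L.h * Q := Nat.le_mul_of_pos_left _ (by positivity)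
  rw [search]
  simp only [List.length_append, length_hadGates, length_repGates, length_phaseKick, oracle,
    length_copyOut]
  have a6 : iterCount (c % (L.h + 2)) *
      (2 * (2 * (L.oracleU (L.reg c) i).length + 1) + 4 + (L.diffusion (L.reg c)).length)
      ≤ 2 ^ L.h * (170 * Q) := Nat.mul_le_mul a4 (by omega)
  rw [show 2 ^ L.h * (170 * Q) = 170 * (2 ^ L.h * Q) by ring] at a6
  omega

/-- The number of gates is a polynomial factor times `2 ^ h`, the number of iterations of the
longest search, times the number of gates of the subroutines. -/
theorem time_circuit_le (hL : L.Good) (hP : L.Small P) (h1 : L.g1.length ≤ G)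
    (h2 : L.g2.length ≤ G) : L.circuit.time ≤ 700 * (P ^ 6 * (2 ^ L.h * (G + 1))) := by
  have hn := hP.n
  have hRn : L.Rn ≤ P ^ 2 := by
    rw [Rn, sq]; exact Nat.mul_le_mul hP.h hP.rep
  have a1 : ∀ i, (L.searches i).length ≤ L.Rn * (300 * (2 ^ L.h * (P ^ 3 * (G + 1)))) := fun i =>
    length_flatMap_range_le fun c _ => length_search_le hL hP h1 h2
  have a2 := progCost_allZero_le L.one (L.p0 + L.n) (L.n + 1) L.Rn L.p1
  have a3 : ∀ i, (L.bit i).length ≤ 607 * (P ^ 5 * (2 ^ L.h * (G + 1))) := by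
    intro i
    have e1 : L.Rn * (300 * (2 ^ L.h * (P ^ 3 * (G + 1))))
        ≤ P ^ 2 * (300 * (2 ^ L.h * (P ^ 3 * (G + 1)))) := Nat.mul_le_mul_right _ hRn
    rw [show P ^ 2 * (300 * (2 ^ L.h * (P ^ 3 * (G + 1)))) =
      300 * (P ^ 5 * (2 ^ L.h * (G + 1))) by ring] at e1
    have e2 : P ^ 2 ≤ P ^ 5 * (2 ^ L.h * (G + 1)) :=
      (Nat.pow_le_pow_right (by omega) (by norm_num)).trans
        (Nat.le_mul_of_pos_right _ (by positivity))
    have e3 := a1 i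
    have e4 : 1 ≤ P ^ 2 := Nat.one_le_pow _ _ (by omega)
    rw [bit, length_copyOut, bitU, List.length_append, length_progGates]
    omega
  have a4 : ((List.range L.Wo).flatMap fun t => L.bit (L.Wo - 1 - t)).length
      ≤ L.Wo * (607 * (P ^ 5 * (2 ^ L.h * (G + 1)))) := length_flatMap_range_le fun t _ => a3 _
  have a5 : L.Wo * (607 * (P ^ 5 * (2 ^ L.h * (G + 1))))
      ≤ P * (607 * (P ^ 5 * (2 ^ L.h * (G + 1)))) := Nat.mul_le_mul_right _ hP.go
  rw [show P * (607 * (P ^ 5 * (2 ^ L.h * (G + 1)))) = 607 * (P ^ 6 * (2 ^ L.h * (G + 1))) by ring]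
    at a5
  have a6 : 1 ≤ P ^ 6 * (2 ^ L.h * (G + 1)) := Nat.one_le_iff_ne_zero.2
    (by have : 0 < P := by omega
        positivity)
  change (Gate.not L.one :: _).length ≤ _
  rw [List.length_cons]
  omega

theorem work_le (hP : L.Small P) : L.work ≤ 2 * P * (L.wm + L.A + L.w) + 24 * P ^ 3 := by
  have hn := hP.n
  have hr := hP.r
  have hRn : L.Rn ≤ P * P := Nat.mul_le_mul hP.h hP.rep
  have a1 : L.Rn * (L.n + 1) ≤ (P * P) * P := Nat.mul_le_mul hRn hn
  have a2 : 2 * L.r * L.stride ≤ 2 * P * (L.wm + P + L.A + L.w) := by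
    rw [stride]
    gcongr
    · omega
    · exact hP.s
  have a3 : 2 * L.r * L.wv ≤ 2 * P * P := by gcongr; omega; exact hP.wv
  have a4 : 2 * L.wv * L.tableSize ≤ 2 * P * (P * P) := by
    rw [tableSize]; gcongr; exact hP.wv
  have a5 : (L.n + 1) * (L.n + 1) ≤ P * P := by gcongr
  have b1 := hP.N0
  have b2 := hP.go
  have b3 := hP.head
  have b4 := hP.ga
  have b5 := hP.wv
  have c1 : P ≤ P ^ 3 := Nat.le_self_pow (by norm_num) P
  have c2 : P ^ 2 ≤ P ^ 3 := Nat.pow_le_pow_right (by omega) (by norm_num)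
  simp only [work, p8, p7, p6, p5, p4, p3, p2, p1, p0, ntot, nin]
  ring_nf at *
  omega

/-- Only polynomially many copies of the subroutines are needed, so that the space grows by a
polynomial factor. -/
theorem space_circuit_le {Z : ℕ} (hP : L.Small P) (hs : 2 ^ L.s ≤ 4 * L.r + 1) (hwm : L.wm ≤ P * Z)
    (hA : 2 ^ L.A ≤ Z) : L.circuit.space ≤ 34 * (P ^ 3 * Z) := by
  have hn := hP.n
  have hr := hP.r
  have hZ : 1 ≤ Z := Nat.one_le_two_pow.trans hA
  have a1 := work_le hP
  have a2 : 2 * P * (L.wm + L.A + L.w) ≤ 2 * P * (P * Z + P * Z + P * Z) := by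
    gcongr
    · exact Nat.lt_two_pow_self.le.trans (hA.trans (Nat.le_mul_of_pos_left _ (by omega)))
    · exact hP.w.trans (Nat.le_mul_of_pos_right _ hZ)
  have a3 : 2 ^ (L.A + L.s) * L.w ≤ Z * (4 * P) * P := by
    rw [pow_add]
    gcongr
    · omega
    · exact hP.w
  have c2 : P ^ 2 * Z ≤ P ^ 3 * Z :=
    Nat.mul_le_mul_right _ (Nat.pow_le_pow_right (by omega) (by norm_num))
  have c3 : P ^ 3 ≤ P ^ 3 * Z := Nat.le_mul_of_pos_right _ hZ
  change L.work + 2 ^ (L.A + L.s) * L.w ≤ _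
  ring_nf at *
  omega

end Lay

/-! ### The fractalization step for problems that split into halves -/

/-- An exponent `s` such that `2 ^ s` is at least `N`, and not much larger. -/
def bitLen (N : ℕ) : ℕ :=
  Nat.rec (motive := fun _ => ℕ) 0 (fun j acc => if 2 ^ acc < j + 1 then acc + 1 else acc) N

theorem bitLen_spec (N : ℕ) : N ≤ 2 ^ bitLen N ∧ 2 ^ bitLen N ≤ 2 * N + 1 := by
  induction N with
  | zero => simp [bitLen]
  | succ j ih =>
    have e : bitLen (j + 1) = if 2 ^ bitLen j < j + 1 then bitLen j + 1 else bitLen j := rfl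
    rw [e]
    clear e
    generalize bitLen j = s at ih ⊢
    have hpos := Nat.one_le_two_pow (n := s)
    by_cases h : 2 ^ s < j + 1
    · rw [if_pos h, pow_succ]
      omega
    · rw [if_neg h]
      omega

@[fun_prop] theorem primrec_bitLen {α : Type*} [Primcodable α] {f : α → ℕ} (hf : Primrec f) :
    Primrec fun a => bitLen (f a) :=
  primrec_rec (h := fun _ p => if 2 ^ p.2 < p.1 + 1 then p.2 + 1 else p.2) hf (primrec_const 0)
    (by fun_prop)

/-- The expressions for the inputs of the two subroutines, for the indicators of the elements of the
second part, and for the input of the circuit that combines the values. -/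
abbrev Exprs := List Expr × List Expr × List Expr × List Expr

/-- Descriptions of Boolean circuits. -/
abbrev BoolCode := List (ℕ × ℕ) × List ℕ

/-- Descriptions of quantum circuits. -/
abbrev QCode := ℕ × ℕ × ℕ × List ℕ × List (ℕ × List ℕ × List ℕ)

/-- The address width of a circuit, or zero if the words are empty: then the QRAM takes no space,
and the address width is not bounded by the space of the circuit. -/
def effWidth (c : QCode) : ℕ := if c.2.2.1 = 0 then 0 else c.2.1

/-- The number of repetitions of the searches for values with `W` bits. -/
@[irreducible] def numRep (W : ℕ) : ℕ := 2 * 3 * (W + 3)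

/-- Half of the number of repetitions of the subroutines. -/
@[irreducible] def numVote (W h : ℕ) : ℕ := 2 * 6 * (W + (h + 2) * numRep W + h + 7)

section Primrec

variable {α : Type*} [Primcodable α] {f g : α → ℕ}

@[fun_prop] theorem primrec_numRep (hf : Primrec f) : Primrec fun a => numRep (f a) := by
  unfold numRep; fun_prop

@[fun_prop] theorem primrec_numVote (hf : Primrec f) (hg : Primrec g) :
    Primrec fun a => numVote (f a) (g a) := by
  unfold numVote; fun_prop

@[fun_prop] theorem primrec_effWidth {c : α → QCode} (hc : Primrec c) :
    Primrec fun a => effWidth (c a) := by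
  unfold effWidth; fun_prop

end Primrec

/-- The layout for the subproblems of size `m`, given the circuits for the two parts. -/
def mkLay (n m N0 wv : ℕ) (E : Exprs) (B : BoolCode) (c₁ c₂ : QCode) : Lay where
  n := n
  k := m / 2
  N0 := N0
  wv := wv
  r := 2 * numVote B.2.length ((m + 1) / 2)
  s := bitLen (2 * (2 * numVote B.2.length ((m + 1) / 2)))
  wm := max N0 (max c₁.1 c₂.1)
  A := max (effWidth c₁) (effWidth c₂)
  w := max c₁.2.2.1 c₂.2.2.1
  rep := numRep B.2.length
  h := (m + 1) / 2
  sub1 := E.1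
  sub2 := E.2.1
  sel := E.2.2.1
  head := E.2.2.2
  ga := B.1
  go := B.2
  g1 := c₁.2.2.2.2.map gateOf
  g2 := c₂.2.2.2.2.map gateOf
  o1 := c₁.2.2.2.1
  o2 := c₂.2.2.2.1

theorem primrec_mkLay : Primrec fun p : (ℕ × ℕ × ℕ × ℕ) × Exprs × BoolCode × QCode × QCode =>
    mkLay p.1.1 p.1.2.1 p.1.2.2.1 p.1.2.2.2 p.2.1 p.2.2.1 p.2.2.2.1 p.2.2.2.2 := by
  have : Primrec fun p : (ℕ × ℕ × ℕ × ℕ) × Exprs × BoolCode × QCode × QCode =>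
      layEquiv (mkLay p.1.1 p.1.2.1 p.1.2.2.1 p.1.2.2.2 p.2.1 p.2.2.1 p.2.2.2.1 p.2.2.2.2) := by
    simp only [layEquiv, mkLay, Equiv.coe_fn_mk]
    fun_prop
  exact (primrec_layEquiv_symm this).of_eq fun p => layEquiv.symm_apply_apply _

theorem primrec_mkLay_code :
    Primrec fun p : (ℕ × ℕ × ℕ × ℕ) × Exprs × BoolCode × QCode × QCode =>
      (mkLay p.1.1 p.1.2.1 p.1.2.2.1 p.1.2.2.2 p.2.1 p.2.2.1 p.2.2.2.1 p.2.2.2.2).circuit.code :=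
  Lay.primrec_circuit primrec_mkLay

/-- The inputs of subproblems of size `n` have length `N0 n`. A subset `X` of the ground set
selects a splitting of a subproblem of size `m`, which is valid if its second part has size
`m / 2`. The inputs of the two parts, and of the circuit that combines their values, are given by
expressions in the bits of the input and of `X`. -/
structure Halving (R : Task) where
  /-- the length of the input -/
  N0 : ℕ → ℕ
  /-- the number of bits of a value -/
  wv : ℕ → ℕ
  /-- the expressions for the inputs of the two parts, for the selected elements, and for the part
  of the input of `B` that precedes the two values -/
  E : ℕ → Exprs
  /-- the circuit that combines the values of the two parts -/
  B : ℕ → BoolCircuit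
  N0_computable : Computable N0
  wv_computable : Computable wv
  E_computable : Computable E
  B_uniform : UniformPolySize B
  N0_poly : PolyBounded N0
  wv_poly : PolyBounded wv
  head_poly : PolyBounded fun n => (E n).2.2.2.length
  len1 : ∀ n, (E n).1.length = N0 n
  len2 : ∀ n, (E n).2.1.length = N0 n
  lenSel : ∀ n, (E n).2.2.1.length = n
  expr : ∀ n e, e ∈ (E n).1 ∨ e ∈ (E n).2.1 ∨ e ∈ (E n).2.2.1 ∨ e ∈ (E n).2.2.2 →
    e.length ≤ 3 ∧ ∀ t ∈ e, t.1 < N0 n + n ∧ t.2 < N0 n + n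
  solves : ∀ n m input y, 2 ≤ m → m ≤ n → R n m input y → ∀ c₁ c₂ L,
    L = mkLay n m (N0 n) (wv n) (E n) (B n).code c₁ c₂ →
    ∃ v₁ v₂ : Finset ℕ → ℕ, L.Solves input v₁ v₂ m y ∧
      ∀ X ⊆ Finset.range n, L.Valid input X →
        R n (m - m / 2) ((E n).1.map (evX (N0 n) input X)) (v₁ X) ∧
        R n (m / 2) ((E n).2.1.map (evX (N0 n) input X)) (v₂ X)

section PolyBounded

variable {p q : ℕ → ℕ}

theorem PolyBounded.mono (hq : PolyBounded q) (h : ∀ n, p n ≤ q n) : PolyBounded p := by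
  obtain ⟨c, hc⟩ := hq
  exact ⟨c, fun n => (h n).trans (hc n)⟩

theorem polyBounded_const (c : ℕ) : PolyBounded fun _ => c :=
  ⟨c, fun n => Nat.le_mul_of_pos_right _ (by positivity)⟩

theorem polyBounded_self (c : ℕ) : PolyBounded fun n => c * (n + 1) ^ c := ⟨c, fun _ => le_rfl⟩

theorem polyBounded_id : PolyBounded fun n => n := ⟨1, fun n => by simp⟩

theorem PolyBounded.add (hp : PolyBounded p) (hq : PolyBounded q) :
    PolyBounded fun n => p n + q n := by
  obtain ⟨c, hc⟩ := hp
  obtain ⟨d, hd⟩ := hq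
  refine ⟨c + d, fun n => ?_⟩
  have h1 : (n + 1) ^ c ≤ (n + 1) ^ (c + d) := Nat.pow_le_pow_right (by omega) (by omega)
  have h2 : (n + 1) ^ d ≤ (n + 1) ^ (c + d) := Nat.pow_le_pow_right (by omega) (by omega)
  rw [Nat.add_mul]
  exact Nat.add_le_add ((hc n).trans (Nat.mul_le_mul_left _ h1))
    ((hd n).trans (Nat.mul_le_mul_left _ h2))

theorem PolyBounded.mul (hp : PolyBounded p) (hq : PolyBounded q) :
    PolyBounded fun n => p n * q n := by
  obtain ⟨c, hc⟩ := hp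
  obtain ⟨d, hd⟩ := hq
  refine ⟨c * d + c + d, fun n => ?_⟩
  calc p n * q n ≤ (c * (n + 1) ^ c) * (d * (n + 1) ^ d) := Nat.mul_le_mul (hc n) (hd n)
    _ = (c * d) * (n + 1) ^ (c + d) := by ring
    _ ≤ _ := Nat.mul_le_mul (by omega) (Nat.pow_le_pow_right (by omega) (by omega))

theorem PolyBounded.pow (hp : PolyBounded p) (k : ℕ) : PolyBounded fun n => p n ^ k := by
  induction k with
  | zero => simpa using polyBounded_const 1
  | succ k ih => simpa only [pow_succ] using ih.mul hp

end PolyBounded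

namespace Halving

variable {R : Task} (H : Halving R) (C : ℕ → ℕ → QCircuit)

/-- The layout for the subproblems of size `m`, given the circuits for the smaller subproblems. -/
def lay (n m : ℕ) : Lay :=
  mkLay n m (H.N0 n) (H.wv n) (H.E n) (H.B n).code (C n (m - m / 2)).code (C n (m / 2)).code

/-- The circuits of one fractalization step. -/
def step (n m : ℕ) : QCircuit := if m ≤ 1 then C n m else (H.lay C n m).circuit

theorem computable_step (hC : Computable₂ fun n m => (C n m).code) :
    Computable₂ fun n m => (H.step C n m).code := by
  have hn : Computable fun p : ℕ × ℕ => p.1 := Computable.fst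
  have h1 : Computable fun p : ℕ × ℕ => (C p.1 (p.2 - p.2 / 2)).code :=
    hC.comp hn (Primrec.to_comp (by fun_prop : Primrec fun p : ℕ × ℕ => p.2 - p.2 / 2))
  have h2 : Computable fun p : ℕ × ℕ => (C p.1 (p.2 / 2)).code :=
    hC.comp hn (Primrec.to_comp (by fun_prop : Primrec fun p : ℕ × ℕ => p.2 / 2))
  have h3 : Computable fun p : ℕ × ℕ => (H.lay C p.1 p.2).circuit.code :=
    (primrec_mkLay_code.to_comp.comp
        ((hn.pair (Computable.snd.pair
            ((H.N0_computable.comp hn).pair (H.wv_computable.comp hn)))).pair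
        ((H.E_computable.comp hn).pair ((H.B_uniform.1.comp hn).pair (h1.pair h2))))).of_eq
        fun _ => rfl
  have h4 : Computable fun p : ℕ × ℕ => decide (p.2 ≤ 1) :=
    Primrec.to_comp (by fun_prop)
  refine (Computable.cond h4 hC h3).of_eq fun p => ?_
  change _ = QCircuit.code (if p.2 ≤ 1 then C p.1 p.2 else (H.lay C p.1 p.2).circuit)
  rw [Bool.cond_decide]
  split_ifs <;> rfl

variable {C} {n m : ℕ}

theorem map_gateOf_code (C : QCircuit) : C.code.2.2.2.2.map gateOf = C.gates := by
  have e : gateOf ∘ Gate.code = id := funext gateOf_code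
  simp [QCircuit.code, e]

theorem lay_g1 : (H.lay C n m).g1 = (C n (m - m / 2)).gates := map_gateOf_code _

theorem lay_g2 : (H.lay C n m).g2 = (C n (m / 2)).gates := map_gateOf_code _

theorem lay_o1 : (H.lay C n m).o1 = (C n (m - m / 2)).outs := rfl

theorem lay_o2 : (H.lay C n m).o2 = (C n (m / 2)).outs := rfl

theorem lay_wm : (H.lay C n m).wm = max (H.N0 n) (max (C n (m - m / 2)).work (C n (m / 2)).work) :=
  rfl

theorem lay_w : (H.lay C n m).w = max (C n (m - m / 2)).wordSize (C n (m / 2)).wordSize := rfl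

theorem effWidth_code (C : QCircuit) (h : 0 < C.wordSize) : effWidth C.code = C.addrWidth := by
  rw [effWidth, if_neg (show C.code.2.2.1 ≠ 0 from h.ne')]; rfl

/-- A QRAM with nonempty words takes at least as much space as it has words. -/
theorem two_pow_effWidth_le (C : QCircuit) : 2 ^ effWidth C.code ≤ C.space + 1 := by
  rcases Nat.eq_zero_or_pos C.wordSize with h | h
  · rw [effWidth, if_pos (show C.code.2.2.1 = 0 from h)]; omega
  · rw [effWidth_code C h, QCircuit.space]
    have := Nat.le_mul_of_pos_right (2 ^ C.addrWidth) h
    omega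

/-- The subroutine for one of the parts fits into the space that is reserved for it. -/
theorem fits_lay (c : ℕ) : ∃ k, (k = m - m / 2 ∨ k = m / 2) ∧
    (C n k).gates = (H.lay C n m).gatesOf c ∧ (C n k).outs = (H.lay C n m).outsOf c ∧
    (C n k).work ≤ (H.lay C n m).wm ∧ (C n k).wordSize ≤ (H.lay C n m).w ∧
    (0 < (C n k).wordSize → (C n k).addrWidth ≤ (H.lay C n m).A) ∧
    k = if c < (H.lay C n m).r then m - m / 2 else m / 2 := by
  rw [Lay.gatesOf, Lay.outsOf, lay_g1, lay_g2, lay_o1, lay_o2, lay_wm, lay_w]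
  split_ifs
  · refine ⟨_, Or.inl rfl, rfl, rfl, ?_, le_max_left _ _, fun h => ?_, rfl⟩
    · exact (le_max_left _ _).trans (le_max_right _ _)
    · rw [← effWidth_code _ h]; exact le_max_left _ _
  · refine ⟨_, Or.inr rfl, rfl, rfl, ?_, le_max_right _ _, fun h => ?_, rfl⟩
    · exact (le_max_right _ _).trans (le_max_right _ _)
    · rw [← effWidth_code _ h]; exact le_max_right _ _

theorem good_lay (hm : 2 ≤ m) (hmn : m ≤ n) (hC : ∀ k, 1 ≤ k → k ≤ n → (C n k).WellFormed) :
    (H.lay C n m).Good where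
  len1 := H.len1 n
  len2 := H.len2 n
  lenSel := H.lenSel n
  vars e he := (H.expr n e he).2
  N0_le := le_max_left _ _
  k_le := show m / 2 ≤ n by omega
  two_r_le := (bitLen_spec _).1
  o1_lt q hq := ((hC (m - m / 2) (by omega) (by omega)).1 q hq).trans_le
    ((le_max_left _ _).trans (le_max_right _ _))
  o2_lt q hq := ((hC (m / 2) (by omega) (by omega)).1 q hq).trans_le
    ((le_max_right _ _).trans (le_max_right _ _))
  g_ok c := by
    obtain ⟨k, hk, h1, -, h2, h3, h4, -⟩ := H.fits_lay (C := C) (n := n) (m := m) c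
    refine ⟨(C n k).addrWidth, (C n k).wordSize, h3, h4, fun G hG => ?_⟩
    rw [← h1] at hG
    exact GateOK.mono ((hC k (by omega) (by omega)).2.2 G hG) h2

/-- The circuits of one step solve the subproblems of size `m` if the given circuits solve the
smaller ones. -/
theorem computes_lay (hm : 2 ≤ m) (hmn : m ≤ n) (hC : ∀ k, 1 ≤ k → k ≤ n → (C n k).WellFormed)
    (hR : ∀ k, 1 ≤ k → k ≤ n → ∀ input y, R n k input y → (C n k).Computes input y)
    {input : List Bool} {y : ℕ} (h : R n m input y) : (H.lay C n m).circuit.Computes input y := by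
  obtain ⟨v₁, v₂, hs, hsub⟩ := H.solves n m input y hm hmn h _ _ _ rfl
  refine Lay.circuit_computes (H.good_lay hm hmn hC) (v1 := v₁) (v2 := v₂) ⟨fun X hX hv c _ => ?_⟩
    hs (ρ := numVote (H.B n).outs.length ((m + 1) / 2)) rfl
    (show m ≤ 2 * ((m + 1) / 2) by omega) (Lay.err_le ?_ ?_)
  rotate_left
  -- the numbers of repetitions are the ones that `Lay.err_le` asks for
  · exact numRep.eq_1 _
  · exact numVote.eq_1 _ _
  obtain ⟨k, hk, h1, h2, h3, h4, h5, h6⟩ := H.fits_lay (C := C) (n := n) (m := m) c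
  refine ⟨C n k, hC k (by omega) (by omega), h1, h2, hR k (by omega) (by omega) _ _ ?_, h3, h4, h5⟩
  obtain ⟨e1, e2⟩ := hsub X hX hv
  rw [Lay.subOf, h6]
  split_ifs
  · exact e1
  · exact e2

/-- A polynomial bound for the parameters of the layouts. -/
theorem exists_small (hw : ∃ c, ∀ n k, 1 ≤ k → k ≤ n → (C n k).wordSize ≤ c * (n + 1) ^ c) :
    ∃ P : ℕ → ℕ, PolyBounded P ∧
      ∀ n m, 2 ≤ m → m ≤ n → (H.lay C n m).Small (P n) := by
  obtain ⟨c, hc⟩ := hw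
  set q : ℕ → ℕ := fun n => H.N0 n + H.wv n + (H.E n).2.2.2.length + (H.B n).size +
    c * (n + 1) ^ c + n + 10 with hq
  -- `numRep` is linear in `q`, and `numVote` is quadratic
  refine ⟨fun n => 1000 * q n ^ 2, ?_, fun n m hm hmn => ?_⟩
  · refine (polyBounded_const _).mul (PolyBounded.pow ?_ 2)
    exact (((((H.N0_poly.add H.wv_poly).add H.head_poly).add H.B_uniform.2).add
      (polyBounded_self c)).add polyBounded_id).add (polyBounded_const _)
  show (H.lay C n m).Small (1000 * q n ^ 2)
  have hqn : q n = H.N0 n + H.wv n + (H.E n).2.2.2.length + (H.B n).size +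
    c * (n + 1) ^ c + n + 10 := rfl
  have hsz : (H.B n).size = (H.B n).gates.length + (H.B n).outs.length := rfl
  have h1 := hc n (m - m / 2) (by omega) (by omega)
  have h2 := hc n (m / 2) (by omega) (by omega)
  have hqq : 10 * q n ≤ q n ^ 2 := by rw [sq]; exact Nat.mul_le_mul_right _ (by omega)
  have hh : ((m + 1) / 2 + 2) * numRep (H.B n).outs.length ≤ q n * (6 * q n) :=
    Nat.mul_le_mul (by omega) (by rw [numRep]; omega)
  have hr : numVote (H.B n).outs.length ((m + 1) / 2) ≤ 80 * q n ^ 2 := by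
    rw [numVote]
    rw [show q n * (6 * q n) = 6 * q n ^ 2 by ring] at hh
    omega
  have hs := (bitLen_spec (2 * (2 * numVote (H.B n).outs.length ((m + 1) / 2)))).2
  have hs' := (bitLen (2 * (2 * numVote (H.B n).outs.length ((m + 1) / 2)))).lt_two_pow_self
  constructor
  · show n + 1 ≤ _; omega
  · show H.N0 n ≤ _; omega
  · show H.wv n ≤ _; omega
  · show 2 * numVote (H.B n).outs.length ((m + 1) / 2) + 1 ≤ _; omega
  · show bitLen (2 * (2 * numVote (H.B n).outs.length ((m + 1) / 2))) ≤ _; omega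
  · rw [lay_w]; omega
  · show numRep (H.B n).outs.length ≤ _; rw [numRep]; omega
  · show (m + 1) / 2 + 2 ≤ _; omega
  · show (H.E n).2.2.2.length ≤ _; omega
  · show (H.B n).gates.length ≤ _; omega
  · show (H.B n).outs.length ≤ _; omega
  · intro e he
    have := (H.expr n e he).1
    omega

/-- A subproblem of size `m` has parts of size at most `(m + 1) / 2`, so that a base is replaced
by its square root, up to a constant factor. -/
theorem pow_half_le {x : ℝ} (hx : 1 ≤ x) (m : ℕ) :
    x ^ ((m + 1) / 2) ≤ √x * √x ^ m := by
  have h1 : 1 ≤ √x := by rwa [Real.one_le_sqrt]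
  calc x ^ ((m + 1) / 2) = √x ^ (2 * ((m + 1) / 2)) := by
        rw [pow_mul, Real.sq_sqrt (by linarith)]
    _ ≤ √x ^ (m + 1) := pow_le_pow_right₀ h1 (by omega)
    _ = √x * √x ^ m := by ring

theorem hasTradeoff_of_polyBounded {T S : ℝ} (hT : 0 ≤ T) (hS : 0 ≤ S) {C : ℕ → ℕ → QCircuit}
    (hC : Computable₂ fun n m => (C n m).code) {F : ℕ → ℕ} (hF : PolyBounded F)
    (h : ∀ n m, 1 ≤ m → m ≤ n → (C n m).WellFormed ∧ (C n m).wordSize ≤ F n ∧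
      ((C n m).time : ℝ) ≤ F n * T ^ m ∧ ((C n m).space : ℝ) ≤ F n * S ^ m ∧
      ∀ input y, R n m input y → (C n m).Computes input y) : HasTradeoff R T S := by
  obtain ⟨c, hc⟩ := hF
  refine ⟨C, hC, c, fun n m hm hmn => ?_⟩
  obtain ⟨h1, h2, h3, h4, h5⟩ := h n m hm hmn
  have hc' : (F n : ℝ) ≤ c * ((n : ℝ) + 1) ^ c := by exact_mod_cast hc n
  exact ⟨h1, h2.trans (hc n), h3.trans (by gcongr), h4.trans (by gcongr), h5⟩

/-- One step of fractalization: a subproblem of size `m` is solved by a quantum search over its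
splittings into two halves, which are solved by the given circuits. -/
theorem hasTradeoff_step (H : Halving R) {T S : ℝ} (hT : 1 ≤ T) (hS : 1 ≤ S)
    (h : HasTradeoff R T S) :
    HasTradeoff R (√(2 * T)) (√S) := by
  obtain ⟨C, hcomp, c, hC⟩ := h
  obtain ⟨P, hP, hsmall⟩ := H.exists_small (C := C) ⟨c, fun n k h1 h2 => (hC n k h1 h2).2.1⟩
  -- the constant factor that is lost if `m` is odd
  obtain ⟨K, hK⟩ := exists_nat_ge (max (√(2 * T)) (√S))
  have hKT : √(2 * T) ≤ K := (le_max_left _ _).trans hK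
  have hKS : √S ≤ K := (le_max_right _ _).trans hK
  set D : ℕ → ℕ := fun n => c * (n + 1) ^ c with hD
  have hDp : PolyBounded D := polyBounded_self c
  have hDc (n : ℕ) : (D n : ℝ) = c * ((n : ℝ) + 1) ^ c := by simp [hD]
  refine hasTradeoff_of_polyBounded (Real.sqrt_nonneg _) (Real.sqrt_nonneg _)
    (H.computable_step C hcomp)
    (F := fun n => D n + D n * K + P n + 700 * P n ^ 6 * (D n + 1) * K +
      34 * P n ^ 3 * (2 * D n + 1) * K) ?_ fun n m hm hmn => ?_
  · exact (((hDp.add (hDp.mul (polyBounded_const K))).add hP).add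
      ((((polyBounded_const 700).mul (hP.pow 6)).mul (hDp.add (polyBounded_const 1))).mul
        (polyBounded_const K))).add
      ((((polyBounded_const 34).mul (hP.pow 3)).mul
        (((polyBounded_const 2).mul hDp).add (polyBounded_const 1))).mul (polyBounded_const K))
  have hT0 : 0 ≤ √(2 * T) ^ m := by positivity
  have hS0 : 0 ≤ √S ^ m := by positivity
  push_cast
  rcases Nat.lt_or_ge 1 m with hm2 | hm1
  · have hwf : ∀ k, 1 ≤ k → k ≤ n → (C n k).WellFormed := fun k h1 h2 => (hC n k h1 h2).1
    have hgood := H.good_lay hm2 hmn hwf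
    have hsm := hsmall n m hm2 hmn
    rw [step, if_neg (by omega)]
    have hhalf : m - m / 2 = (m + 1) / 2 := by omega
    obtain ⟨-, -, t1, s1, -⟩ := hC n (m - m / 2) (by omega) (by omega)
    obtain ⟨-, -, t2, s2, -⟩ := hC n (m / 2) (by omega) (by omega)
    rw [← hDc, hhalf] at t1 s1
    rw [← hDc] at t2 s2
    have hle : m / 2 ≤ (m + 1) / 2 := by omega
    have t2' := t2.trans (mul_le_mul_of_nonneg_left (pow_le_pow_right₀ hT hle) (by positivity))
    have s2' := s2.trans (mul_le_mul_of_nonneg_left (pow_le_pow_right₀ hS hle) (by positivity))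
    rw [← hhalf] at t1 s1
    refine ⟨Lay.circuit_wellFormed hgood, ?_, ?_, ?_, fun input y hy =>
      H.computes_lay hm2 hmn hwf (fun k h1 h2 => (hC n k h1 h2).2.2.2.2) hy⟩
    · exact hsm.w.trans (by omega)
    · set G := max (C n (m - m / 2)).time (C n (m / 2)).time with hG
      have hGr : (G : ℝ) ≤ D n * T ^ ((m + 1) / 2) := by
        rw [hG, Nat.cast_max]; exact max_le (by rwa [← hhalf]) t2'
      have hb := Lay.time_circuit_le (G := G) hgood hsm (by rw [lay_g1]; exact le_max_left _ _)
        (by rw [lay_g2]; exact le_max_right _ _)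
      have hh : (H.lay C n m).h = (m + 1) / 2 := rfl
      rw [hh] at hb
      have hb' : ((H.lay C n m).circuit.time : ℝ) ≤
          700 * ((P n : ℝ) ^ 6 * (2 ^ ((m + 1) / 2) * (G + 1))) := by exact_mod_cast hb
      have hT1 : 1 ≤ T ^ ((m + 1) / 2) := one_le_pow₀ hT
      -- `2 ^ ((m + 1) / 2)` comes from the search, and `T ^ ((m + 1) / 2)` from the parts
      have hp := pow_half_le (x := 2 * T) (by linarith) m
      rw [mul_pow] at hp
      calc _ ≤ _ := hb'
        _ ≤ 700 * ((P n : ℝ) ^ 6 *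
            (2 ^ ((m + 1) / 2) * (D n * T ^ ((m + 1) / 2) + T ^ ((m + 1) / 2)))) := by gcongr
        _ = 700 * (P n : ℝ) ^ 6 * (D n + 1) * (2 ^ ((m + 1) / 2) * T ^ ((m + 1) / 2)) := by ring
        _ ≤ 700 * (P n : ℝ) ^ 6 * (D n + 1) * (K * √(2 * T) ^ m) :=
            mul_le_mul_of_nonneg_left (hp.trans (by gcongr)) (by positivity)
        _ = 700 * (P n : ℝ) ^ 6 * (D n + 1) * K * √(2 * T) ^ m := by ring
        _ ≤ _ := mul_le_mul_of_nonneg_right (by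
            have : 0 ≤ (D n : ℝ) + D n * K + P n + 34 * P n ^ 3 * (2 * D n + 1) * K := by positivity
            linarith) hT0
    · set Z := (C n (m - m / 2)).space + (C n (m / 2)).space + 1 with hZ
      have hS1 : 1 ≤ S ^ ((m + 1) / 2) := one_le_pow₀ hS
      have hZr : (Z : ℝ) ≤ (2 * D n + 1) * S ^ ((m + 1) / 2) := by
        rw [hZ]; push_cast; rw [hhalf] at s1 ⊢; linarith
      have hPpos : 1 ≤ P n := by have := hsm.n; omega
      have hw1 : (C n (m - m / 2)).work ≤ (C n (m - m / 2)).space := Nat.le_add_right _ _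
      have hw2 : (C n (m / 2)).work ≤ (C n (m / 2)).space := Nat.le_add_right _ _
      have hb := Lay.space_circuit_le (Z := Z) hsm ((bitLen_spec _).2.trans (by
          show 2 * (2 * (2 * numVote _ _)) + 1 ≤ 4 * (2 * numVote _ _) + 1
          exact le_of_eq (by ring)))
        (by
          rw [lay_wm]
          refine max_le (hsm.N0.trans (Nat.le_mul_of_pos_right _ (by omega))) ?_
          exact (show _ ≤ Z by omega).trans (Nat.le_mul_of_pos_left _ hPpos))
        (by
          have e1 := two_pow_effWidth_le (C n (m - m / 2))
          have e2 := two_pow_effWidth_le (C n (m / 2))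
          show 2 ^ max (effWidth (C n (m - m / 2)).code) (effWidth (C n (m / 2)).code) ≤ Z
          rcases max_choice (effWidth (C n (m - m / 2)).code) (effWidth (C n (m / 2)).code)
            with e | e <;> rw [e] <;> omega)
      have hb' : ((H.lay C n m).circuit.space : ℝ) ≤ 34 * ((P n : ℝ) ^ 3 * Z) := by
        exact_mod_cast hb
      have hp := pow_half_le hS m
      calc _ ≤ _ := hb'
        _ ≤ 34 * ((P n : ℝ) ^ 3 * ((2 * D n + 1) * (K * √S ^ m))) := by
            gcongr; exact hZr.trans (by gcongr; exact hp.trans (by gcongr))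
        _ = 34 * (P n : ℝ) ^ 3 * (2 * D n + 1) * K * √S ^ m := by ring
        _ ≤ _ := mul_le_mul_of_nonneg_right (by
            have : 0 ≤ (D n : ℝ) + D n * K + P n + 700 * P n ^ 6 * (D n + 1) * K := by positivity
            linarith) hS0
  -- a subproblem of size `1` cannot be split, and the given circuit is kept
  · obtain rfl : m = 1 := by omega
    obtain ⟨h1, h2, h3, h4, h5⟩ := hC n 1 hm hmn
    rw [← hDc] at h3 h4
    rw [step, if_pos le_rfl]
    have eT := pow_half_le (x := 2 * T) (by linarith) 1
    have eS := pow_half_le hS 1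
    norm_num at eT eS
    have hD' : (0 : ℝ) ≤ D n := by positivity
    refine ⟨h1, h2.trans (by simp only [hD]; omega), h3.trans ?_, h4.trans ?_, h5⟩
    · rw [pow_one, pow_one]
      calc (D n : ℝ) * T ≤ D n * (K * √(2 * T)) := by
            gcongr
            have : √(2 * T) * √(2 * T) ≤ K * √(2 * T) := by gcongr
            rw [Real.mul_self_sqrt (by linarith)] at this
            linarith
        _ = D n * K * √(2 * T) := by ring
        _ ≤ _ := mul_le_mul_of_nonneg_right (by
            have : 0 ≤ (D n : ℝ) + P n + 700 * P n ^ 6 * (D n + 1) * K +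
              34 * P n ^ 3 * (2 * D n + 1) * K := by positivity
            linarith) (Real.sqrt_nonneg _)
    · rw [pow_one, pow_one]
      calc (D n : ℝ) * S ≤ D n * (K * √S) := by
            gcongr
            have : √S * √S ≤ K * √S := by gcongr
            rwa [Real.mul_self_sqrt (by linarith)] at this
        _ = D n * K * √S := by ring
        _ ≤ _ := mul_le_mul_of_nonneg_right (by
            have : 0 ≤ (D n : ℝ) + P n + 700 * P n ^ 6 * (D n + 1) * K +
              34 * P n ^ 3 * (2 * D n + 1) * K := by positivity
            linarith) (Real.sqrt_nonneg _)

end Halving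

/-! ### Divide & conquer problems and permutation problems split into halves -/

/-- The elements of `M` that are selected by `X`. -/
def pick {n : ℕ} (X : Finset ℕ) (M : Finset (Fin n)) : Finset (Fin n) :=
  M.filter fun i => (i : ℕ) ∈ X

theorem pick_subset {n : ℕ} (X : Finset ℕ) (M : Finset (Fin n)) : pick X M ⊆ M :=
  Finset.filter_subset _ _

theorem mem_pick {n : ℕ} {X : Finset ℕ} {M : Finset (Fin n)} {i : Fin n} :
    i ∈ pick X M ↔ i ∈ M ∧ (i : ℕ) ∈ X := Finset.mem_filter

/-- A fraction of `2 ^ (-m)` of all sets select the same elements of `M`. -/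
theorem two_pow_le_card_pick {n : ℕ} {M A : Finset (Fin n)} (hA : A ⊆ M) {P : Finset ℕ → Prop}
    [DecidablePred P] (hP : ∀ X ⊆ Finset.range n, pick X M = A → P X) :
    2 ^ n ≤ 2 ^ M.card * ((Finset.range n).powerset.filter P).card := by
  classical
  have hle : M.card ≤ n := by simpa using M.card_le_univ
  have hcard : (Mᶜ).powerset.card = 2 ^ (n - M.card) := by
    rw [Finset.card_powerset, Finset.card_compl, Fintype.card_fin]
  -- the elements outside of `M` can be chosen freely
  have hinj : (Mᶜ).powerset.card ≤ ((Finset.range n).powerset.filter P).card := by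
    refine Finset.card_le_card_of_injOn (fun Z => (Z ∪ A).map Fin.valEmbedding) (fun Z hZ => ?_) ?_
    · rw [Finset.mem_coe, Finset.mem_powerset] at hZ
      have hsub : (Z ∪ A).map Fin.valEmbedding ⊆ Finset.range n := by
        intro i hi
        obtain ⟨j, -, rfl⟩ := Finset.mem_map.1 hi
        exact Finset.mem_range.2 j.2
      refine Finset.mem_coe.2 (Finset.mem_filter.2 ⟨Finset.mem_powerset.2 hsub, hP _ hsub ?_⟩)
      ext i
      rw [mem_pick, ← Fin.valEmbedding_apply, Finset.mem_map', Finset.mem_union]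
      refine ⟨fun h => h.2.resolve_left fun hi => Finset.mem_compl.1 (hZ hi) h.1,
        fun h => ⟨hA h, Or.inr h⟩⟩
    · intro Z hZ Z' hZ' h
      rw [Finset.mem_coe, Finset.mem_powerset] at hZ hZ'
      have h' := Finset.map_injective _ h
      have hsd {W : Finset (Fin n)} (hW : W ⊆ Mᶜ) : (W ∪ A) \ A = W := by
        rw [Finset.union_sdiff_right, Finset.sdiff_eq_self_iff_disjoint]
        exact Finset.disjoint_left.2 fun i hi hiA => Finset.mem_compl.1 (hW hi) (hA hiA)
      rw [← hsd hZ, ← hsd hZ', h']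
  calc 2 ^ n = 2 ^ M.card * 2 ^ (n - M.card) := by rw [← pow_add]; congr 1; omega
    _ ≤ _ := Nat.mul_le_mul_left _ (hcard ▸ hinj)

/-- A recurrence for the value `y` as a minimum over the subsets of size `k` of a set `M` of size
`m` is solved by the search over all sets. -/
theorem Lay.solves_of_isLeast {L : Lay} {input : List Bool} {v₁ v₂ : Finset ℕ → ℕ} {y : ℕ}
    (hlen : input.length = L.N0) {M : Finset (Fin L.n)} {val : Finset (Fin L.n) → ℕ}
    (hsel : ∀ X (i : Fin L.n), evX L.N0 input X (L.sel.getD i []) = decide (i ∈ pick X M))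
    (hval : ∀ X, (pick X M).card = L.k → L.combine input X (v₁ X) (v₂ X) = val (pick X M))
    (hy : IsLeast {v | ∃ A ⊆ M, A.card = L.k ∧ v = val A} y) :
    L.Solves input v₁ v₂ M.card y ∧ ∀ X, L.Valid input X ↔ (pick X M).card = L.k := by
  have hvalid (X : Finset ℕ) : L.Valid input X ↔ (pick X M).card = L.k := by
    rw [Lay.Valid]
    have : (Finset.range L.n).filter (fun t => evX L.N0 input X (L.sel.getD t []) = true)
        = (pick X M).map Fin.valEmbedding := by
      ext t
      simp only [Finset.mem_filter, Finset.mem_range, Finset.mem_map, Fin.valEmbedding_apply]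
      constructor
      · rintro ⟨ht, h⟩
        exact ⟨⟨t, ht⟩, by simpa using (hsel X ⟨t, ht⟩).symm.trans h, rfl⟩
      · rintro ⟨i, hi, rfl⟩
        exact ⟨i.2, by rw [hsel]; simpa using hi⟩
    rw [this, Finset.card_map]
  refine ⟨⟨hlen, fun X _ hX => ?_, ?_⟩, hvalid⟩
  · rw [hvalid] at hX
    rw [hval X hX]
    exact hy.2 ⟨_, pick_subset _ _, hX, rfl⟩
  · obtain ⟨A, hAM, hA, rfl⟩ := hy.1
    refine two_pow_le_card_pick hAM fun X _ hX => ?_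
    rw [hvalid, hX]
    exact ⟨hA, by rw [hval X (by rw [hX, hA]), hX]⟩

section Expressions

variable {n N0 p : ℕ} {input x : List Bool} {X : Finset ℕ}

/-- The characteristic vector of `S` starts at place `p` of the input. -/
def HasSet (input : List Bool) (p : ℕ) (S : Finset (Fin n)) : Prop :=
  ∀ i : Fin n, input.getD (p + i) false = decide (i ∈ S)

theorem length_setBits (S : Finset (Fin n)) : (setBits S).length = n := by simp [setBits]

theorem hasSet_append (S : Finset (Fin n)) (rest : List Bool) (hx : x.length = p) :
    HasSet (x ++ (setBits S ++ rest)) p S := by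
  intro i
  rw [List.getD_append_right _ _ _ _ (by omega), hx, Nat.add_sub_cancel_left,
    List.getD_append _ _ _ _ (by rw [length_setBits]; exact i.2), List.getD_eq_getElem _ _
    (by rw [length_setBits]; exact i.2)]
  simp [setBits]

/-- The bits of the instance. -/
def copyExprs (l : ℕ) : List Expr := (List.range l).map fun i => [(i, i)]

theorem map_copyExprs {l : ℕ} (hx : x.length = l) (hl : l ≤ N0) (rest : List Bool) :
    (copyExprs l).map (evX N0 (x ++ rest) X) = x := by
  refine List.ext_getElem (by simp [copyExprs, hx]) fun i hi hi' => ?_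
  simp only [copyExprs, List.map_map, List.getElem_map, List.getElem_range, Function.comp_apply,
      evX,
    exprVal_cons, exprVal_nil, if_pos (show i < N0 by omega), Bool.and_self, Bool.xor_false]
  rw [List.getD_append _ _ _ _ hi', List.getD_eq_getElem _ _ hi']

theorem map_evX_eq_setBits {e : ℕ → Expr} {S : Finset (Fin n)}
    (h : ∀ i : Fin n, evX N0 input X (e i) = decide (i ∈ S)) :
    ((List.range n).map e).map (evX N0 input X) = setBits S := by
  refine List.ext_getElem (by simp [setBits]) fun i hi hi' => ?_
  rw [length_setBits] at hi'
  simpa [setBits] using h ⟨i, hi'⟩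

/-- The indicator of an element of the set that is given in the input at place `p`. -/
def inSet (p i : ℕ) : Expr := [(p + i, p + i)]

/-- The indicator of a selected element of the set that is given in the input at place `p`. -/
def inPick (N0 p i : ℕ) : Expr := [(p + i, N0 + i)]

theorem evX_append (e e' : Expr) :
    evX N0 input X (e ++ e') = xor (evX N0 input X e) (evX N0 input X e') := by
  simp only [evX, exprVal_append]

theorem evX_inSet {S : Finset (Fin n)} (hS : HasSet input p S) (hp : p + n ≤ N0) (i : Fin n) :
    evX N0 input X (inSet p i) = decide (i ∈ S) := by
  have := hS i
  simp only [inSet, evX, exprVal_cons, exprVal_nil, if_pos (show p + (i : ℕ) < N0 by omega), this,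
    Bool.and_self, Bool.xor_false]

theorem evX_inPick {S : Finset (Fin n)} (hS : HasSet input p S) (hp : p + n ≤ N0) (i : Fin n) :
    evX N0 input X (inPick N0 p i) = decide (i ∈ pick X S) := by
  have := hS i
  simp only [inPick, evX, exprVal_cons, exprVal_nil, if_pos (show p + (i : ℕ) < N0 by omega), this,
    if_neg (show ¬ N0 + (i : ℕ) < N0 by omega), Nat.add_sub_cancel_left, Bool.xor_false, mem_pick,
    Bool.decide_and]

/-- The indicator of an element of a set that is not selected. -/
theorem evX_rest {S : Finset (Fin n)} (hS : HasSet input p S) (hp : p + n ≤ N0) (i : Fin n) :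
    evX N0 input X (inSet p i ++ inPick N0 p i) = decide (i ∈ S \ pick X S) := by
  rw [evX_append, evX_inSet hS hp, evX_inPick hS hp]
  by_cases h1 : i ∈ S <;> by_cases h2 : (i : ℕ) ∈ X <;> simp [mem_pick, h1, h2]

theorem xor_decide_eq_union {S S' : Finset (Fin n)} (h : Disjoint S S') (i : Fin n) :
    xor (decide (i ∈ S)) (decide (i ∈ S')) = decide (i ∈ S ∪ S') := by
  by_cases h1 : i ∈ S
  · simp [h1, Finset.disjoint_left.1 h h1]
  · simp [h1]

section Primrec

variable {α : Type*} [Primcodable α] {f g h : α → ℕ}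

@[fun_prop] theorem primrec_copyExprs (hf : Primrec f) : Primrec fun a => copyExprs (f a) := by
  unfold copyExprs; fun_prop

@[fun_prop] theorem primrec_inSet (hf : Primrec f) (hg : Primrec g) :
    Primrec fun a => inSet (f a) (g a) := by unfold inSet; fun_prop

@[fun_prop] theorem primrec_inPick (hf : Primrec f) (hg : Primrec g) (hh : Primrec h) :
    Primrec fun a => inPick (f a) (g a) (h a) := by unfold inPick; fun_prop

end Primrec

end Expressions

namespace DivideConquerProblem

/-- The input consists of an instance and a set `S`. The second part consists of the selected
elements of `S`. -/
def exprs (l n : ℕ) : Exprs :=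
  (copyExprs l ++ (List.range n).map fun i => inSet l i ++ inPick (l + n) l i,
    copyExprs l ++ (List.range n).map (inPick (l + n) l),
    (List.range n).map (inPick (l + n) l),
    copyExprs l ++ ((List.range n).map fun i => inSet l i ++ inPick (l + n) l i) ++
      (List.range n).map (inPick (l + n) l))

/-- The recurrence with `k = m / 2` splits a set of size `m` into parts of sizes `m - m / 2` and
`m / 2`. -/
theorem exists_halving (D : DivideConquerProblem) : Nonempty (Halving D.task) := by
  obtain ⟨B, hB, hg⟩ := D.g_poly
  refine ⟨{
    N0 := fun n => D.inputLen n + n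
    wv := D.width
    E := fun n => exprs (D.inputLen n) n
    B := B
    N0_computable := Primrec.nat_add.to_comp.comp D.inputLen_computable Computable.id
    wv_computable := D.width_computable
    E_computable := ?_
    B_uniform := hB
    N0_poly := D.inputLen_poly.add polyBounded_id
    wv_poly := D.width_poly
    head_poly := ?_
    len1 := fun n => by simp [exprs, copyExprs]
    len2 := fun n => by simp [exprs, copyExprs]
    lenSel := fun n => by simp [exprs]
    expr := ?_
    solves := ?_ }⟩
  · have : Primrec fun p : ℕ × ℕ => exprs p.1 p.2 := by unfold exprs; fun_prop
    exact this.to_comp.comp (D.inputLen_computable.pair Computable.id)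
  · refine ((D.inputLen_poly.add polyBounded_id).add polyBounded_id).mono fun n => ?_
    simp [exprs, copyExprs, add_assoc]
  · intro n e he
    simp only [exprs, copyExprs, List.mem_append, List.mem_map, List.mem_range] at he
    have : (∃ i < D.inputLen n, [(i, i)] = e) ∨ (∃ i < n, inSet (D.inputLen n) i ++
        inPick (D.inputLen n + n) (D.inputLen n) i = e) ∨
        ∃ i < n, inPick (D.inputLen n + n) (D.inputLen n) i = e := by
      rcases he with (h | h) | (h | h) | h | (h | h) | h <;>
        first | exact .inl h | exact .inr (.inl h) | exact .inr (.inr h)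
    rcases this with ⟨i, hi, rfl⟩ | ⟨i, hi, rfl⟩ | ⟨i, hi, rfl⟩ <;> simp [inSet, inPick] <;> omega
  · rintro n m input y hm hmn ⟨x, S, hx, hS, rfl, rfl⟩ c₁ c₂ L hL
    have hlen := D.length_eq n x hx
    have hset : HasSet (x ++ setBits S) (D.inputLen n) S := by
      simpa using hasSet_append S [] hlen
    have hxs (X : Finset ℕ) : (copyExprs (D.inputLen n)).map
        (evX (D.inputLen n + n) (x ++ setBits S) X) = x := map_copyExprs hlen (by omega) _
    have hX (X : Finset ℕ) : ((List.range n).map (inPick (D.inputLen n + n) (D.inputLen n))).map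
        (evX (D.inputLen n + n) (x ++ setBits S) X) = setBits (pick X S) :=
      map_evX_eq_setBits fun i => evX_inPick hset le_rfl i
    have hY (X : Finset ℕ) : ((List.range n).map fun i => inSet (D.inputLen n) i ++
        inPick (D.inputLen n + n) (D.inputLen n) i).map
        (evX (D.inputLen n + n) (x ++ setBits S) X) = setBits (S \ pick X S) :=
      map_evX_eq_setBits fun i => evX_rest hset le_rfl i
    have hsel (X : Finset ℕ) (i : Fin n) : evX (D.inputLen n + n) (x ++ setBits S) X
        ((exprs (D.inputLen n) n).2.2.1.getD i []) = decide (i ∈ pick X S) := by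
      rw [← evX_inPick hset le_rfl i]
      simp [exprs]
    subst hL
    have key := Lay.solves_of_isLeast
      (L := mkLay n m (D.inputLen n + n) (D.width n) (exprs (D.inputLen n) n) (B n).code c₁ c₂)
      (input := x ++ setBits S) (M := S)
      (v₁ := fun X => D.f n x (S \ pick X S)) (v₂ := fun X => D.f n x (pick X S))
      (val := fun A => D.g n x (S \ A) A (D.f n x (S \ A)) (D.f n x A))
      (by simp [hlen, length_setBits, mkLay]) (fun X i => ?_) (fun X _ => ?_)
      (D.recurrence n x S (m / 2) hx (by omega) (by omega))
    · refine ⟨_, _, hS ▸ key.1, fun X _ hv => ?_⟩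
      rw [key.2] at hv
      have hk : (pick X S).card = m / 2 := hv
      constructor
      · refine ⟨x, S \ pick X S, hx, ?_, ?_, rfl⟩
        · rw [Finset.card_sdiff_of_subset (pick_subset _ _), hS, hk]
        · simp only [exprs, List.map_append, hxs, hY]
      · exact ⟨x, pick X S, hx, hk, by simp only [exprs, List.map_append, hxs, hX], rfl⟩
    · exact hsel X i
    · refine Eq.trans ?_ (hg n x (S \ pick X S) (pick X S) _ _ hx Finset.sdiff_disjoint
        (D.f_lt n x _ hx) (D.f_lt n x _ hx))
      simp only [Lay.combine, mkLay, exprs, List.map_append, hxs, hX, hY]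
      rfl

end DivideConquerProblem

namespace PermutationProblem

/-- The input consists of an instance and of a partition `L`, `M`, `R`. The second part consists of
the selected elements of `M`. -/
def exprs (l n : ℕ) : Exprs :=
  (copyExprs l ++ (List.range n).map (inSet l) ++
      ((List.range n).map fun i => inSet (l + n) i ++ inPick (l + n + n + n) (l + n) i) ++
      (List.range n).map fun i => inPick (l + n + n + n) (l + n) i ++ inSet (l + n + n) i,
    copyExprs l ++ ((List.range n).map fun i =>
        inSet l i ++ (inSet (l + n) i ++ inPick (l + n + n + n) (l + n) i)) ++
      (List.range n).map (inPick (l + n + n + n) (l + n)) ++ (List.range n).map (inSet (l + n + n)),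
    (List.range n).map (inPick (l + n + n + n) (l + n)),
    copyExprs l ++ (List.range n).map (inSet l) ++
      ((List.range n).map fun i => inSet (l + n) i ++ inPick (l + n + n + n) (l + n) i) ++
      (List.range n).map (inPick (l + n + n + n) (l + n)) ++ (List.range n).map (inSet (l + n + n)))

theorem primrec_exprs : Primrec fun p : ℕ × ℕ => exprs p.1 p.2 := by
  have h0 : Primrec fun p : ℕ × ℕ => copyExprs p.1 := by fun_prop
  have h1 : Primrec fun p : ℕ × ℕ => (List.range p.2).map (inSet p.1) := by fun_prop
  have h2 : Primrec fun p : ℕ × ℕ => (List.range p.2).map fun i =>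
      inSet (p.1 + p.2) i ++ inPick (p.1 + p.2 + p.2 + p.2) (p.1 + p.2) i := by fun_prop
  have h3 : Primrec fun p : ℕ × ℕ => (List.range p.2).map fun i =>
      inPick (p.1 + p.2 + p.2 + p.2) (p.1 + p.2) i ++ inSet (p.1 + p.2 + p.2) i := by fun_prop
  have h4 : Primrec fun p : ℕ × ℕ => (List.range p.2).map fun i => inSet p.1 i ++
      (inSet (p.1 + p.2) i ++ inPick (p.1 + p.2 + p.2 + p.2) (p.1 + p.2) i) := by fun_prop
  have h5 : Primrec fun p : ℕ × ℕ =>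
      (List.range p.2).map (inPick (p.1 + p.2 + p.2 + p.2) (p.1 + p.2)) := by fun_prop
  have h6 : Primrec fun p : ℕ × ℕ => (List.range p.2).map (inSet (p.1 + p.2 + p.2)) := by fun_prop
  exact primrec_mk (primrec_append (primrec_append (primrec_append h0 h1) h2) h3)
    (primrec_mk (primrec_append (primrec_append (primrec_append h0 h4) h5) h6)
      (primrec_mk h5 (primrec_append (primrec_append (primrec_append (primrec_append h0 h1) h2) h5)
        h6)))

theorem computable_exprs {l : ℕ → ℕ} (hl : Computable l) : Computable fun n => exprs (l n) n :=
  Computable.comp (f := fun p : ℕ × ℕ => exprs p.1 p.2) (g := fun n => (l n, n))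
    primrec_exprs.to_comp (hl.pair Computable.id)

theorem isPartition_first {n : ℕ} {L M R A : Finset (Fin n)} (h : IsPartition L M R) (hA : A ⊆ M) :
    IsPartition L (M \ A) (A ∪ R) := by
  obtain ⟨h1, h2, h3, h4⟩ := h
  refine ⟨h1.mono_right Finset.sdiff_subset,
    Finset.disjoint_union_right.2 ⟨h1.mono_right hA, h2⟩,
    Finset.disjoint_union_right.2 ⟨Finset.sdiff_disjoint, h3.mono_left Finset.sdiff_subset⟩, ?_⟩
  rw [← h4, Finset.union_assoc, ← Finset.union_assoc (M \ A), Finset.sdiff_union_of_subset hA,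
    Finset.union_assoc]

theorem isPartition_second {n : ℕ} {L M R A : Finset (Fin n)} (h : IsPartition L M R)
    (hA : A ⊆ M) : IsPartition (L ∪ M \ A) A R := by
  obtain ⟨h1, h2, h3, h4⟩ := h
  refine ⟨Finset.disjoint_union_left.2 ⟨h1.mono_right hA, Finset.sdiff_disjoint⟩,
    Finset.disjoint_union_left.2 ⟨h2, h3.mono_left Finset.sdiff_subset⟩, h3.mono_left hA, ?_⟩
  rw [← h4, Finset.union_assoc L, Finset.sdiff_union_of_subset hA]

/-- The recurrence in terms of the second part. -/
theorem recurrence_second (P : PermutationProblem) {n : ℕ} {x : List Bool} {L M R : Finset (Fin n)}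
    {k : ℕ} (hx : P.valid n x) (h : IsPartition L M R) (hk : 1 ≤ k) (hkM : k < M.card) :
    IsLeast {v | ∃ A ⊆ M, A.card = k ∧ v = P.g n x L (M \ A) A R (P.f n x L (M \ A) (A ∪ R))
      (P.f n x (L ∪ M \ A) A R)} (P.f n x L M R) := by
  have := P.recurrence n x L M R (M.card - k) hx h (by omega) (by omega)
  convert this using 1
  ext v
  constructor
  · rintro ⟨A, hA, hc, rfl⟩
    refine ⟨M \ A, Finset.sdiff_subset, by rw [Finset.card_sdiff_of_subset hA, hc], ?_⟩
    rw [Finset.sdiff_sdiff_eq_self hA]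
  · rintro ⟨X, hX, hc, rfl⟩
    refine ⟨M \ X, Finset.sdiff_subset, by rw [Finset.card_sdiff_of_subset hX, hc]; omega, ?_⟩
    rw [Finset.sdiff_sdiff_eq_self hX]

/-- The recurrence splits a set `M` of size `m` into a first part of size `m - m / 2` and a second
part of size `m / 2`. -/
theorem exists_halving (P : PermutationProblem) : Nonempty (Halving P.task) := by
  obtain ⟨B, hB, hg⟩ := P.g_poly
  have hN : Primrec fun p : ℕ × ℕ => p.1 + p.2 + p.2 + p.2 := by fun_prop
  refine ⟨{
    N0 := fun n => P.inputLen n + n + n + n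
    wv := P.width
    E := fun n => exprs (P.inputLen n) n
    B := B
    N0_computable := hN.to_comp.comp (P.inputLen_computable.pair Computable.id)
    wv_computable := P.width_computable
    E_computable := computable_exprs P.inputLen_computable
    B_uniform := hB
    N0_poly := ((P.inputLen_poly.add polyBounded_id).add polyBounded_id).add polyBounded_id
    wv_poly := P.width_poly
    head_poly := ?_
    len1 := fun n => by simp [exprs, copyExprs, add_assoc]
    len2 := fun n => by simp [exprs, copyExprs, add_assoc]
    lenSel := fun n => by simp [exprs]
    expr := ?_
    solves := ?_ }⟩
  · refine ((((P.inputLen_poly.add polyBounded_id).add polyBounded_id).add polyBounded_id).add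
      polyBounded_id).mono fun n => ?_
    simp [exprs, copyExprs, add_assoc]
  · intro n e he
    generalize P.inputLen n = l at he ⊢
    simp only [exprs, List.mem_append] at he
    have hcopy (h : e ∈ copyExprs l) :
        e.length ≤ 3 ∧ ∀ t ∈ e, t.1 < l + n + n + n + n ∧ t.2 < l + n + n + n + n := by
      obtain ⟨i, hi, rfl⟩ := List.mem_map.1 h
      rw [List.mem_range] at hi
      simp; omega
    have hmap {f : ℕ → Expr} (hf : ∀ i < n, (f i).length ≤ 3 ∧
        ∀ t ∈ f i, t.1 < l + n + n + n + n ∧ t.2 < l + n + n + n + n)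
        (h : e ∈ (List.range n).map f) :
        e.length ≤ 3 ∧ ∀ t ∈ e, t.1 < l + n + n + n + n ∧ t.2 < l + n + n + n + n := by
      obtain ⟨i, hi, rfl⟩ := List.mem_map.1 h
      exact hf i (List.mem_range.1 hi)
    rcases he with (((h | h) | h) | h) | (((h | h) | h) | h) | h | (((h | h) | h) | h) | h <;>
      first
      | exact hcopy h
      | refine hmap (fun i hi => ?_) h
        simp [inSet, inPick]
        try omega
  · rintro n m input y hm hmn ⟨x, L, M, R, hx, hpart, hM, rfl, rfl⟩ c₁ c₂ lay hlay
    have hlen := P.length_eq n x hx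
    set l := P.inputLen n with hl
    set input := x ++ setBits L ++ setBits M ++ setBits R with hinput
    have hsetL : HasSet input l L := by
      simpa [hinput] using hasSet_append L (setBits M ++ setBits R) hlen
    have hsetM : HasSet input (l + n) M := by
      simpa [hinput] using hasSet_append (x := x ++ setBits L) M (setBits R)
        (by rw [List.length_append, hlen, length_setBits])
    have hsetR : HasSet input (l + n + n) R := by
      simpa [hinput] using hasSet_append (x := x ++ setBits L ++ setBits M) R []
        (by simp only [List.length_append, hlen, length_setBits])
    have hxs (X : Finset ℕ) : (copyExprs l).map (evX (l + n + n + n) input X) = x := by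
      simpa [hinput] using map_copyExprs (X := X) (N0 := l + n + n + n) hlen (by omega)
        (setBits L ++ (setBits M ++ setBits R))
    have eL (X : Finset ℕ) (i : Fin n) := evX_inSet (N0 := l + n + n + n) (X := X) hsetL
      (by omega) i
    have eR (X : Finset ℕ) (i : Fin n) := evX_inSet (N0 := l + n + n + n) (X := X) hsetR
      (by omega) i
    have eA (X : Finset ℕ) (i : Fin n) :=
      evX_inPick (N0 := l + n + n + n) (X := X) hsetM (by omega) i
    have eB (X : Finset ℕ) (i : Fin n) :=
      evX_rest (N0 := l + n + n + n) (X := X) hsetM (by omega) i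
    obtain ⟨d1, d2, d3, -⟩ := id hpart
    have hL (X : Finset ℕ) : ((List.range n).map (inSet l)).map (evX (l + n + n + n) input X)
        = setBits L := map_evX_eq_setBits (eL X)
    have hR (X : Finset ℕ) : ((List.range n).map (inSet (l + n + n))).map
        (evX (l + n + n + n) input X) = setBits R := map_evX_eq_setBits (eR X)
    have hA (X : Finset ℕ) : ((List.range n).map (inPick (l + n + n + n) (l + n))).map
        (evX (l + n + n + n) input X) = setBits (pick X M) := map_evX_eq_setBits (eA X)
    have hB' (X : Finset ℕ) : ((List.range n).map fun i => inSet (l + n) i ++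
        inPick (l + n + n + n) (l + n) i).map (evX (l + n + n + n) input X)
        = setBits (M \ pick X M) := map_evX_eq_setBits (eB X)
    have hAR (X : Finset ℕ) : ((List.range n).map fun i => inPick (l + n + n + n) (l + n) i ++
        inSet (l + n + n) i).map (evX (l + n + n + n) input X) = setBits (pick X M ∪ R) :=
      map_evX_eq_setBits fun i => by
        rw [evX_append, eA, eR, xor_decide_eq_union (d3.mono_left (pick_subset _ _))]
    have hLB (X : Finset ℕ) : ((List.range n).map fun i => inSet l i ++ (inSet (l + n) i ++
        inPick (l + n + n + n) (l + n) i)).map (evX (l + n + n + n) input X)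
        = setBits (L ∪ M \ pick X M) :=
      map_evX_eq_setBits fun i => by
        rw [evX_append, eL, eB, xor_decide_eq_union (d1.mono_right Finset.sdiff_subset)]
    have hsel (X : Finset ℕ) (i : Fin n) : evX (l + n + n + n) input X
        ((exprs l n).2.2.1.getD i []) = decide (i ∈ pick X M) := by
      rw [← eA X i]
      simp [exprs]
    have p1 (X : Finset ℕ) := isPartition_first hpart (pick_subset X M)
    have p2 (X : Finset ℕ) := isPartition_second hpart (pick_subset X M)
    have hrec := P.recurrence_second hx hpart (k := m / 2) (by omega) (by omega)
    subst hlay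
    have key := Lay.solves_of_isLeast
      (L := mkLay n m (l + n + n + n) (P.width n) (exprs l n) (B n).code c₁ c₂)
      (input := input) (M := M)
      (v₁ := fun X => P.f n x L (M \ pick X M) (pick X M ∪ R))
      (v₂ := fun X => P.f n x (L ∪ M \ pick X M) (pick X M) R)
      (val := fun A => P.g n x L (M \ A) A R (P.f n x L (M \ A) (A ∪ R))
        (P.f n x (L ∪ M \ A) A R))
      (by simp [hinput, hlen, length_setBits, mkLay, add_assoc]) (fun X i => ?_) (fun X _ => ?_)
      hrec
    · refine ⟨_, _, hM ▸ key.1, fun X _ hv => ?_⟩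
      rw [key.2] at hv
      have hk : (pick X M).card = m / 2 := hv
      constructor
      · refine ⟨x, _, _, _, hx, p1 X, ?_, ?_, rfl⟩
        · rw [Finset.card_sdiff_of_subset (pick_subset _ _), hM, hk]
        · simp only [exprs, List.map_append, hxs, hL, hB', hAR]
      · refine ⟨x, _, _, _, hx, p2 X, hk, ?_, rfl⟩
        simp only [exprs, List.map_append, hxs, hLB, hA, hR]
    · exact hsel X i
    · refine Eq.trans ?_ (hg n x L (M \ pick X M) (pick X M) R _ _ hx Finset.sdiff_disjoint
        (by rwa [Finset.sdiff_union_of_subset (pick_subset _ _)]) (P.f_lt n x _ _ _ hx (p1 X))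
        (P.f_lt n x _ _ _ hx (p2 X)))
      simp only [Lay.combine, mkLay, exprs, List.map_append, hxs, hL, hB', hA, hR]
      rfl

end PermutationProblem

/-! ### Iteration -/

theorem one_le_fractalize {p : ℝ × ℝ} (h : 1 ≤ p.1 ∧ 1 ≤ p.2) :
    1 ≤ (fractalize p).1 ∧ 1 ≤ (fractalize p).2 := by
  constructor
  · exact Real.one_le_sqrt.2 (by linarith [h.1])
  · exact Real.one_le_sqrt.2 h.2

theorem Halving.hasTradeoff_iterate {R : Task} (H : Halving R) {T S : ℝ} (hT : 1 ≤ T)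
    (hS : 1 ≤ S) (h : HasTradeoff R T S) (k : ℕ) :
    HasTradeoff R (fractalize^[k] (T, S)).1 (fractalize^[k] (T, S)).2 := by
  suffices (1 ≤ (fractalize^[k] (T, S)).1 ∧ 1 ≤ (fractalize^[k] (T, S)).2) ∧
      HasTradeoff R (fractalize^[k] (T, S)).1 (fractalize^[k] (T, S)).2 from this.2
  induction k with
  | zero => exact ⟨⟨hT, hS⟩, h⟩
  | succ k ih =>
    rw [Function.iterate_succ_apply']
    exact ⟨one_le_fractalize ih.1, H.hasTradeoff_step ih.1.1 ih.1.2 ih.2⟩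

/-- The curve `T = 2 / S ^ c` is invariant under fractalization. -/
theorem fractalize_curve {c : ℝ} {p : ℝ × ℝ} (hp : 1 ≤ p.2) (h : p.1 = 2 / p.2 ^ c) :
    (fractalize p).1 = 2 / (fractalize p).2 ^ c := by
  have hp0 : 0 ≤ p.2 := by linarith
  simp only [fractalize]
  rw [h, Real.sqrt_eq_rpow p.2, ← Real.rpow_mul hp0, mul_comm (1 / 2) c, Real.rpow_mul hp0,
    ← Real.sqrt_eq_rpow, ← mul_div_assoc, Real.sqrt_div (by norm_num),
    Real.sqrt_mul_self (by norm_num)]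

/-- The exponent is the logarithm of `2 / T` to the base `S`. For `S = 1` the curve is the point
`T = 2`. -/
theorem exists_curve {T S : ℝ} (hT : 1 ≤ T) (hS : 1 ≤ S) (h : S = 1 → T = 2) :
    ∃ c : ℝ, T = 2 / S ^ c := by
  rcases hS.eq_or_lt with rfl | hS
  · exact ⟨0, by simp [h rfl]⟩
  · refine ⟨Real.logb S (2 / T), ?_⟩
    rw [Real.rpow_logb (by linarith) hS.ne' (by positivity)]
    field_simp

theorem exists_curve_iterate {T S : ℝ} (hT : 1 ≤ T) (hS : 1 ≤ S) (h : S = 1 → T = 2) :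
    ∃ c : ℝ, ∀ k : ℕ, (fractalize^[k] (T, S)).1 = 2 / (fractalize^[k] (T, S)).2 ^ c := by
  obtain ⟨c, hc⟩ := exists_curve hT hS h
  refine ⟨c, fun k => ?_⟩
  suffices (1 ≤ (fractalize^[k] (T, S)).1 ∧ 1 ≤ (fractalize^[k] (T, S)).2) ∧
      (fractalize^[k] (T, S)).1 = 2 / (fractalize^[k] (T, S)).2 ^ c from this.2
  induction k with
  | zero => exact ⟨⟨hT, hS⟩, hc⟩
  | succ k ih =>
    rw [Function.iterate_succ_apply']
    exact ⟨one_le_fractalize ih.1, fractalize_curve ih.1.2 ih.2⟩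

end Fract

end

theorem mainTheorem6 (R : Fract.Task)
    (hR : (∃ D : Fract.DivideConquerProblem, R = D.task) ∨
      (∃ P : Fract.PermutationProblem, R = P.task))
    (T S : ℝ) (hT : 1 ≤ T) (hS : 1 ≤ S) (h : Fract.HasTradeoff R T S) :
    Fract.HasTradeoff R (Real.sqrt (2 * T)) (Real.sqrt S) ∧
    (∀ k : ℕ, Fract.HasTradeoff R (Fract.fractalize^[k] (T, S)).1
      (Fract.fractalize^[k] (T, S)).2) ∧
    ((S = 1 → T = 2) →
      ∃ c : ℝ, ∀ k : ℕ,
        (Fract.fractalize^[k] (T, S)).1 = 2 / (Fract.fractalize^[k] (T, S)).2 ^ c) := by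
  obtain ⟨H⟩ : Nonempty (Fract.Halving R) := by
    rcases hR with ⟨D, rfl⟩ | ⟨P, rfl⟩
    · exact D.exists_halving
    · exact P.exists_halving
  exact ⟨H.hasTradeoff_step hT hS h, H.hasTradeoff_iterate hT hS h,
    Fract.exists_curve_iterate hT hS⟩
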